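/- **Setting.** Let $d,k,p\ge 1$. Let $\mathcal D$ be a probability distribution of examples $z=(x,y)\in\mathbb R^d\times\mathcal Y$ with $\|x\|_2=1$ and $x_d=\tfrac12$ almost surely. Let $L:\mathbb R^k\times\mathcal Y\to\mathbb R$ be a (measurable) loss such that for every $y$ the function $L(\cdot,y)$ is non-negative, convex, $1$-Lipschitz and $1$-smooth (differentiable with $1$-Lipschitz gradient), and $\mathbb E_{\mathcal D}L(0,y)<\infty$. *Complexity.* Let $C^\star$ be a sufficiently large absolute constant. For a smooth $\phi:\mathbb R\to\mathbb R$ with $\phi(z)=\sum_{i\ge0}c_iz^i$ for $|z|\le 1$, and $\varepsilon\in(0,1)$, $R\ge 0$, put $$\mathfrak C_{\mathfrak s}(\phi,R)=C^\star\sum_{i\ge0}(i+1)^{1.75}R^i|c_i|,\qquad \mathfrak C_\varepsilon(\phi,R)=\sum_{i\ge0}\Big((C^\star R)^i+\Big(\tfrac{\sqrt{\log(1/\varepsilon)}}{\sqrt i}\,C^\star R\Big)^i\Big)|c_i|$$ (the second power is $1$ for $i=0$). *Concept class.* For thresholds $\mathfrak c_{\mathfrak s}\ge1$ and $\mathfrak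 c_\varepsilon\ge0$, let $\mathcal C$ be the set of all $F^*=(f_1^*,\dots,f_k^*):\mathbb R^d\to\mathbb R^k$ with $f^*_r(x)=\sum_{i=1}^{q}a^*_{r,i}\,\phi_i(\langle w^*_{1,i},x\rangle)\,\langle w^*_{2,i},x\rangle$, where $q\le p$, $\|w^*_{1,i}\|_2=\|w^*_{2,i}\|_2=1$, $|a^*_{r,i}|\le1$, and each $\phi_i$ is as above with $\mathfrak C_{\mathfrak s}(\phi_i,1)\le\mathfrak c_{\mathfrak s}$ and $\mathfrak C_\varepsilon(\phi_i,1)\le\mathfrak c_\varepsilon$. Let $\mathsf{OPT}=\inf_{F^*\in\mathcal C}\mathbb E_{(x,y)\sim\mathcal D}L(F^*(x),y)$. *Learner.* The learner is $F(x;W)=(f_1,\dots,f_k)$ with $f_r(x;W)=\sum_{i=1}^m a^{(0)}_{r,i}\,\mathrm{ReLU}(\langle w_i,x\rangle+b^{(0)}_i)$, $W=(w_1,\dots,w_m)$. All entries of $W^{(0)},b^{(0)}$ are i.i.d. $\mathcal N(0,1/m)$ and, independently, all entries of $a^{(0)}$ are i.i.d. $\mathcal N(0,\varepsilon_a^2)$;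 $a^{(0)},b^{(0)}$ are never changed. Given a training set $\mathcal Z$ of $N$ i.i.d. samples from $\mathcal D$, un-normalized stochastic SAM starts at $W_0=0$ and in each step $t$ draws $(x,y)$ uniformly and independently from $\mathcal Z$ and sets $$W_{t+1/2}=W_t+\rho\,\nabla_W L(F(x;W^{(0)}+W_t),y),\qquad W_{t+1}=W_t-\eta\,\nabla_W L(F(x;W^{(0)}+W_{t+1/2}),y),$$ where gradients are computed by the chain rule with $\mathrm{ReLU}'(s)=\mathbb 1[s\ge0]$. $\mathbb E_{\rm SAM}$ is the expectation over these draws. *Conventions.* $v=\widetilde\Theta(u)$ means $u/(A(\log m)^A)\le v\le A(\log m)^A u$, and $N\ge\widetilde\Omega(N_0)$ means $N\ge A(\log m)^A N_0$, with $A$ a constant. "With high probability" means with probability at least $1-e^{-c\log^2 m}$. Here $c>0$ is arbitrary; the polynomials below and $A$ depend only on $c$ and $C^\star$. **Theorem.** For every $\varepsilon\in\big(0,\frac1{pk\,\mathfrak c_{\mathfrak s}}\big)$ there are $M_0=\mathrm{poly}(\mathfrak c_\varepsilon,1/\varepsilon)$ and $N_0=\mathrm{poly}(\mathfrak c_{\mathfrak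 s},1/\varepsilon)$ such that for every $m\ge M_0$ there are choices $$\varepsilon_a=\varepsilon/\widetilde\Theta(1)\in(0,1],\quad \eta=\widetilde\Theta\Big(\frac1{\varepsilon km}\Big),\quad\rho=\widetilde\Theta\Big(\frac1{\varepsilon^3km^3}\Big),\quad T=\widetilde\Theta\Big(\frac{\mathfrak c_{\mathfrak s}^2\,k^3p^2}{\varepsilon^2}\Big)\in\mathbb N,$$ depending only on $k,p,\mathfrak c_{\mathfrak s},\mathfrak c_\varepsilon,\varepsilon,m$ (and $c,C^\star$), such that for every $N\ge\widetilde\Omega(N_0)$, $N\ge 1$, and all $d,\mathcal Y,\mathcal D,L$ as above, with high probability over the random initialization the bound $$\mathbb E_{\rm SAM}\Big[\frac1T\sum_{t=0}^{T-1}\mathbb E_{(x,y)\sim\mathcal D}L\big(F(x;W^{(0)}+W_t),y\big)\Big]\le\mathsf{OPT}+\varepsilon$$ holds both with high probability over the training set $\mathcal Z$ and in expectation over $\mathcal Z$ (that is, with $\mathbb E_{\mathcal Z}\mathbb E_{\rm SAM}$ in place of $\mathbb E_{\rm SAM}$). -/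

import Mathlib

open MeasureTheory ProbabilityTheory
open scoped ContDiff NNReal ENNReal

noncomputable section

namespace SAMGen

/-! ### Complexity of smooth activation functions -/

/-- The coefficients `c i` of `φ z = ∑ i, c i * z ^ i`. -/
def taylorCoeff (φ : ℝ → ℝ) (i : ℕ) : ℝ := iteratedDeriv i φ 0 / (Nat.factorial i : ℝ)

/-- Infinite-order smooth functions: smooth and equal to their power series on `[-1, 1]`, the
only range in which a target network evaluates them. -/
def InfSmooth (φ : ℝ → ℝ) : Prop :=
  ContDiff ℝ ∞ φ ∧ ∀ z : ℝ, |z| ≤ 1 → HasSum (fun i : ℕ => taylorCoeff φ i * z ^ i) (φ z)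

/-- Sample complexity `C* ∑ i, (i + 1) ^ 1.75 R ^ i |c i|`. -/
def sampleComplexity (Cstar : ℝ) (φ : ℝ → ℝ) (R : ℝ) : ℝ≥0∞ :=
  ENNReal.ofReal Cstar *
    ∑' i : ℕ, ENNReal.ofReal (((i : ℝ) + 1) ^ (1.75 : ℝ) * R ^ i * |taylorCoeff φ i|)

/-- Network complexity
`∑ i, ((C* R) ^ i + (√(log (1 / ε)) / √i * C* R) ^ i) |c i|`
(the second power is `1` for `i = 0`). -/
def networkComplexity (Cstar ε : ℝ) (φ : ℝ → ℝ) (R : ℝ) : ℝ≥0∞ :=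
  ∑' i : ℕ, ENNReal.ofReal
    (((Cstar * R) ^ i + (√(Real.log (1 / ε)) / √(i : ℝ) * (Cstar * R)) ^ i) * |taylorCoeff φ i|)

/-! ### Data, loss, target networks -/

/-- The input space; its dimension is `d + 1`, so that there is a last coordinate. -/
abbrev Input (d : ℕ) := EuclideanSpace ℝ (Fin (d + 1))

abbrev Output (k : ℕ) := EuclideanSpace ℝ (Fin k)

/-- Every input has norm `1` and last coordinate `1 / 2`. -/
def NormalizedInputs {d : ℕ} {Y : Type*} [MeasurableSpace Y] (D : Measure (Input d × Y)) : Prop :=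
  ∀ᵐ z ∂D, ‖z.1‖ = 1 ∧ z.1 (Fin.last d) = 1 / 2

/-- Non-negative, and convex, `1`-Lipschitz and `1`-smooth in the first argument. -/
structure GoodLoss {k : ℕ} {Y : Type*} (L : Output k → Y → ℝ) : Prop where
  nonneg : ∀ u y, 0 ≤ L u y
  convex : ∀ y, ConvexOn ℝ Set.univ (fun u => L u y)
  lipschitz : ∀ y, LipschitzWith 1 (fun u => L u y)
  differentiable : ∀ y, Differentiable ℝ (fun u => L u y)
  smooth : ∀ y, LipschitzWith 1 (gradient (fun u => L u y))

/-- Population risk `E_{(x, y) ∼ D} L(F(x), y)`. -/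
def risk {d k : ℕ} {Y : Type*} [MeasurableSpace Y] (D : Measure (Input d × Y))
    (L : Output k → Y → ℝ) (F : Input d → Output k) : ℝ :=
  ∫ z, L (F z.1) z.2 ∂D

/-- `f*_r(x) = ∑ i, a*_{r,i} φ_i(⟨w*_{1,i}, x⟩) ⟨w*_{2,i}, x⟩`. -/
def targetNet {d k q : ℕ} (φ : Fin q → ℝ → ℝ) (w₁ w₂ : Fin q → Input d)
    (a : Fin k → Fin q → ℝ) (x : Input d) : Output k :=
  WithLp.toLp 2 fun r => ∑ i, a r i * φ i (inner ℝ (w₁ i) x) * inner ℝ (w₂ i) x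

/-- All target networks with at most `p` terms whose activation functions have sample complexity
at most `cs` and network complexity (at accuracy `ε`) at most `cn`. -/
def conceptClass (d k p : ℕ) (Cstar ε cs cn : ℝ) : Set (Input d → Output k) :=
  {F | ∃ q ≤ p, ∃ (φ : Fin q → ℝ → ℝ) (w₁ w₂ : Fin q → Input d) (a : Fin k → Fin q → ℝ),
    (∀ i, InfSmooth (φ i)) ∧
    (∀ i, sampleComplexity Cstar (φ i) 1 ≤ ENNReal.ofReal cs) ∧
    (∀ i, networkComplexity Cstar ε (φ i) 1 ≤ ENNReal.ofReal cn) ∧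
    (∀ i, ‖w₁ i‖ = 1) ∧ (∀ i, ‖w₂ i‖ = 1) ∧ (∀ r i, |a r i| ≤ 1) ∧
    F = targetNet φ w₁ w₂ a}

/-- The best population risk in the concept class. -/
def OPT {d k : ℕ} {Y : Type*} [MeasurableSpace Y] (D : Measure (Input d × Y))
    (L : Output k → Y → ℝ) (p : ℕ) (Cstar ε cs cn : ℝ) : ℝ :=
  sInf (risk D L '' conceptClass d k p Cstar ε cs cn)

/-! ### Learner network and its initialization -/

/-- First-layer weights `W = (w_1, …, w_m)`. -/
abbrev Weights (m d : ℕ) := Fin m → Input d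

/-- Entries of the initial values `(W⁽⁰⁾, b⁽⁰⁾, a⁽⁰⁾)`. -/
abbrev InitSpace (m d k : ℕ) :=
  (Fin m → Fin (d + 1) → ℝ) × (Fin m → ℝ) × (Fin k → Fin m → ℝ)

/-- All entries are independent, those of `W⁽⁰⁾` and `b⁽⁰⁾` with law `N(0, 1/m)` and those of
`a⁽⁰⁾` with law `N(0, εa²)`. -/
def initMeasure (m d k : ℕ) (εa : ℝ) : Measure (InitSpace m d k) :=
  (Measure.pi fun _ => Measure.pi fun _ => gaussianReal 0 (1 / (m : ℝ≥0))).prod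
    ((Measure.pi fun _ => gaussianReal 0 (1 / (m : ℝ≥0))).prod
      (Measure.pi fun _ => Measure.pi fun _ => gaussianReal 0 (εa.toNNReal ^ 2)))

variable {m d k : ℕ}

def initW (θ : InitSpace m d k) : Weights m d := fun i => WithLp.toLp 2 (θ.1 i)

def initB (θ : InitSpace m d k) (i : Fin m) : ℝ := θ.2.1 i

def initA (θ : InitSpace m d k) (r : Fin k) (i : Fin m) : ℝ := θ.2.2 r i

/-- `f_r(x; W) = ∑ i, a⁽⁰⁾_{r,i} ReLU(⟨w_i, x⟩ + b⁽⁰⁾_i)`. -/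
def learner (θ : InitSpace m d k) (W : Weights m d) (x : Input d) : Output k :=
  WithLp.toLp 2 fun r => ∑ i, initA θ r i * max (inner ℝ (W i) x + initB θ i) 0

/-- The gradient of `W ↦ L(F(x; W), y)` given by the chain rule, with the usual convention
`ReLU'(s) = 1[s ≥ 0]`. -/
def lossGrad {Y : Type*} (L : Output k → Y → ℝ) (θ : InitSpace m d k) (z : Input d × Y)
    (W : Weights m d) : Weights m d :=
  fun i =>
    if 0 ≤ inner ℝ (W i) z.1 + initB θ i then
      (∑ r, gradient (fun u => L u z.2) (learner θ W z.1) r * initA θ r i) • z.1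
    else 0

/-! ### Stochastic SAM -/

/-- One step `W_{t+1} = W_t - η ∇L(F(x; W⁽⁰⁾ + W_{t+1/2}), y)` of un-normalized SAM, where
`W_{t+1/2} = W_t + ρ ∇L(F(x; W⁽⁰⁾ + W_t), y)`. -/
def samStep {Y : Type*} (L : Output k → Y → ℝ) (η ρ : ℝ) (θ : InitSpace m d k)
    (z : Input d × Y) (W : Weights m d) : Weights m d :=
  W - η • lossGrad L θ z (initW θ + (W + ρ • lossGrad L θ z (initW θ + W)))

/-- The iterate `W_t` (for `t ≤ T`, starting from `W_0 = 0`) when the example `z s` is used in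
step `s`. -/
def samIterate {Y : Type*} (L : Output k → Y → ℝ) (η ρ : ℝ) (θ : InitSpace m d k) {T : ℕ}
    (z : Fin T → Input d × Y) : ℕ → Weights m d
  | 0 => 0
  | t + 1 =>
    if h : t < T then samStep L η ρ θ (z ⟨t, h⟩) (samIterate L η ρ θ z t)
    else samIterate L η ρ θ z t

/-- `E_SAM[(1/T) ∑_{t<T} E_{(x,y)∼D} L(F(x; W⁽⁰⁾ + W_t), y)]` for given initialization and
training set `Z`; in each step the example is drawn uniformly and independently from `Z`. -/
def samAverageRisk {Y : Type*} [MeasurableSpace Y] (D : Measure (Input d × Y))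
    (L : Output k → Y → ℝ) (η ρ : ℝ) (T : ℕ) (θ : InitSpace m d k) {N : ℕ}
    (Z : Fin N → Input d × Y) : ℝ :=
  (∑ s : Fin T → Fin N,
    (∑ t ∈ Finset.range T,
      risk D L (learner θ (initW θ + samIterate L η ρ θ (fun j => Z (s j)) t))) / (T : ℝ))
    / (N : ℝ) ^ T

/-- `v = Θ̃(u)` with a hidden factor `A (log m)^A`. -/
def TildeTheta (A m : ℕ) (v u : ℝ) : Prop :=
  u / (A * Real.log m ^ A) ≤ v ∧ v ≤ A * Real.log m ^ A * u

end SAMGen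

end

open SAMGen

/-! The weights stay so close to their initialization that almost no ReLU gate changes, so SAM acts
like online convex optimization for the linear model `linNet` whose gates are frozen at
initialization. Three ingredients are combined.

(1) A good comparator. For a unit input `x`, a unit target direction `w₁` and a standard Gaussian
hidden weight `w`, write `⟨w₁, w⟩ = ⟨w₁, x⟩ g + t` with `g = ⟨x, w⟩` and `t` independent of `g`.
Averaging `He i` over `t` gives `⟨w₁, x⟩ ^ i * He i g`. Integrating this over the open gate `g + b ≥
0` and against a suitable function of the bias `b` leaves exactly `⟨w₁, x⟩ ^ i`
(`integral_monomial`). Hence an activation function is, up to a small error, an average over random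
gates of a feature `h (⟨w₁, w⟩) b` (`exists_representation`). The second moment of `h` is governed
by the sample complexity, its supremum after a cutoff by the network complexity. The supremum only
enters concentration over the neurons and the norms of single neurons, hence the width. The second
moment bounds the squared norm of the comparator, hence the number of steps and of samples. This is
why there are two complexities. Moving each neuron along `w₂` by a multiple of its feature, with the
sign of its output weight, turns `linNet` into an empirical mean with expectation close to the
target (`integral_comparatorTerm`).

(2) Regret. Convexity of the loss and the frozen gates give the inequality of online gradient
descent for one SAM step (`samStep_dist_le`). The ascent step shifts the output by at most `m * ρ *
α ^ 2`, and freezing only costs for neurons with pre-activation within `τ` of zero; by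
anti-concentration these are roughly a fraction `√m * τ` of all. Since each step of an idealized run
sees a fresh example, the regret bound is already a bound on the population risk
(`integral_pathRisk_le`), and no uniform convergence is needed.

(3) From fresh examples to a training set. The number `T` of steps does not grow with `m` except
logarithmically, and `N` is much larger than `T ^ 4`. So `T` draws from the training set are
distinct outside a fraction `T ^ 2 / N` of the cases, and distinct draws are independent samples of
`D` (`integral_resampleMean_le`). One training example occurs in a fraction at most `T / N` of the
draw sequences, so McDiarmid's inequality upgrades the mean to high probability
(`resampleMean_tail`).

The random output of the initial network is treated with the smoothness of the loss: the loss is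
expanded to second order at the target output (`risk_comparator_le`). The linear term pairs the
initial output with a gradient of norm at most one, so it costs `εa` times logarithms. The quadratic
term costs `εa ^ 2 * k` times logarithms, which is affordable because `k * ε ≤ 1`. What remains is a
union bound over six bad events (`initMeasure_not_goodInit_le`) and arithmetic with the parameters
(`ParamBounds`). -/

namespace SAMGen

/-! ### Concentration for product measures -/

section Concentration

variable {Ω : Type*} [MeasurableSpace Ω]

/-- Hoeffding's inequality for a sum over the coordinates of a product measure. -/
lemma hoeffding_pi {m : ℕ} (μ : Measure Ω) [IsProbabilityMeasure μ] {g : Ω → ℝ}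
    (hg : Measurable g) {M : ℝ} (hM : 0 < M) (hgM : ∀ w, |g w| ≤ M) {s : ℝ} (hs : 0 ≤ s) :
    (Measure.pi fun _ : Fin m => μ).real {n | m * (∫ w, g w ∂μ) + m * s ≤ ∑ i, g (n i)}
      ≤ Real.exp (-(m * s ^ 2) / (2 * M ^ 2)) := by
  rcases Nat.eq_zero_or_pos m with rfl | hm
  · simp
  have hm' : (0 : ℝ) < m := by exact_mod_cast hm
  have hind : iIndepFun (fun (i : Fin m) (n : Fin m → Ω) => g (n i) - ∫ w, g w ∂μ)
      (Measure.pi fun _ : Fin m => μ) :=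
    iIndepFun_pi (X := fun _ w => g w - ∫ w, g w ∂μ) fun _ => (hg.sub_const _).aemeasurable
  have hsub0 : HasSubgaussianMGF (fun w => g w - ∫ w, g w ∂μ) ((‖M - (-M)‖₊ / 2) ^ 2) μ :=
    hasSubgaussianMGF_of_mem_Icc hg.aemeasurable
      (Filter.Eventually.of_forall fun w => abs_le.1 (hgM w))
  have hsub : ∀ i ∈ (Finset.univ : Finset (Fin m)),
      HasSubgaussianMGF (fun n : Fin m → Ω => g (n i) - ∫ w, g w ∂μ) ((‖M - (-M)‖₊ / 2) ^ 2)
      (Measure.pi fun _ : Fin m => μ) := by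
    intro i _
    have hmp := measurePreserving_eval (fun _ : Fin m => μ) i
    have := HasSubgaussianMGF.of_map (μ := Measure.pi fun _ : Fin m => μ)
      (Y := Function.eval i) (X := fun w => g w - ∫ w, g w ∂μ)
      (c := (‖M - (-M)‖₊ / 2) ^ 2) hmp.measurable.aemeasurable (by rw [hmp.map_eq]; exact hsub0)
    exact this
  have h := HasSubgaussianMGF.measure_sum_ge_le_of_iIndepFun hind hsub
    (ε := m * s) (by positivity)
  have hset : {n : Fin m → Ω | m * (∫ w, g w ∂μ) + m * s ≤ ∑ i, g (n i)} =
      {n | m * s ≤ ∑ i, (g (n i) - ∫ w, g w ∂μ)} := by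
    ext n
    simp only [Set.mem_ofPred_eq, Finset.sum_sub_distrib, Finset.sum_const, Finset.card_univ,
      Fintype.card_fin, nsmul_eq_mul]
    constructor <;> intro h <;> linarith
  rw [hset]
  refine h.trans (Real.exp_le_exp.2 (le_of_eq ?_))
  simp only [Finset.sum_const, Finset.card_univ, Fintype.card_fin, nsmul_eq_mul]
  push_cast
  rw [Real.norm_eq_abs, abs_of_pos (by linarith)]
  field_simp
  ring

/-- Moment generating function bound for functions with bounded differences. -/
lemma boundedDifferences_mgf (D : Measure Ω) [IsProbabilityMeasure D] {c : ℝ} (hc : 0 ≤ c) (t : ℝ) :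
    ∀ (n : ℕ) (f : (Fin n → Ω) → ℝ), Measurable f → (∃ B, ∀ Z, |f Z| ≤ B) →
      (∀ Z j z, |f (Function.update Z j z) - f Z| ≤ c) →
      ∫ Z, Real.exp (t * (f Z - ∫ Z', f Z' ∂(Measure.pi fun _ => D)))
        ∂(Measure.pi fun _ => D) ≤ Real.exp (n * c ^ 2 * t ^ 2 / 2) := by
  intro n
  induction n with
  | zero =>
    intro f _ _ _
    have h : ∀ Z : Fin 0 → Ω, f Z = f default := fun Z => congrArg f (Subsingleton.elim _ _)
    simp [h]
  | succ n ih =>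
    intro f hf ⟨B, hB⟩ hd
    set π := Measure.pi fun _ : Fin n => D
    have hmp := (measurePreserving_piFinSuccAbove (fun _ : Fin (n + 1) => D) 0).symm
    have hcons : ∀ q : Ω × (Fin n → Ω),
        (MeasurableEquiv.piFinSuccAbove (fun _ : Fin (n + 1) => Ω) 0).symm q
          = Fin.cons q.1 q.2 := by
      intro q
      exact congrFun (Fin.insertNth_zero' q.1 (q.2 : Fin n → Ω)) |> fun h => funext h
    set F : Ω × (Fin n → Ω) → ℝ := fun q => f (Fin.cons q.1 q.2) with hF
    have hFm : Measurable F := by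
      have := hf.comp (MeasurableEquiv.piFinSuccAbove (fun _ : Fin (n + 1) => Ω) 0).symm.measurable
      simpa only [hF, Function.comp_def, hcons] using this
    have hint : ∀ G : (Fin (n + 1) → Ω) → ℝ,
        ∫ Z, G Z ∂(Measure.pi fun _ => D) = ∫ q, G (Fin.cons q.1 q.2) ∂(D.prod π) := by
      intro G
      rw [← hmp.integral_comp' (g := G)]
      simp only [hcons]
      rfl
    have hFB : ∀ q, |F q| ≤ B := fun q => hB _
    set g : Ω → ℝ := fun z => ∫ Z, F (z, Z) ∂π with hg
    have hgm : Measurable g :=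
      (hFm.stronglyMeasurable.integral_prod_right' (ν := π)).measurable
    have hFi : Integrable F (D.prod π) :=
      Integrable.of_bound hFm.aestronglyMeasurable B (Filter.Eventually.of_forall hFB)
    have hsec : ∀ z, Integrable (fun Z => F (z, Z)) π := fun z =>
      Integrable.of_bound (hFm.comp measurable_prodMk_left).aestronglyMeasurable B
        (Filter.Eventually.of_forall fun Z => hFB _)
    have hgB : ∀ z, |g z| ≤ B := fun z => by
      have := norm_integral_le_of_norm_le_const (μ := π) (f := fun Z => F (z, Z)) (C := B)
        (Filter.Eventually.of_forall fun Z => hFB _)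
      simpa using this
    have hmean : ∫ Z, f Z ∂(Measure.pi fun _ => D) = ∫ z, g z ∂D := by
      rw [hint f, ← integral_prod F hFi]
    have hgd : ∀ z z', |g z - g z'| ≤ c := by
      intro z z'
      rw [hg]
      simp only
      rw [← integral_sub (hsec z) (hsec z')]
      have := norm_integral_le_of_norm_le_const (μ := π)
        (f := fun Z => F (z, Z) - F (z', Z)) (C := c)
        (Filter.Eventually.of_forall fun Z => by
          have h := hd (Fin.cons z' Z) 0 z
          simpa [hF, Fin.update_cons_zero] using h)
      simpa using this
    have hsecmgf : ∀ z, ∫ Z, Real.exp (t * (F (z, Z) - g z)) ∂π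
        ≤ Real.exp (n * c ^ 2 * t ^ 2 / 2) := by
      intro z
      refine ih (fun Z => F (z, Z)) (hFm.comp measurable_prodMk_left) ⟨B, fun Z => hFB _⟩ ?_
      intro Z j w
      have h := hd (Fin.cons z Z) j.succ w
      simp only [hF]
      rw [Fin.cons_update]
      exact h
    -- Anchoring at one point `z₀` places `g` in an interval of length `2 * c`, hence variance proxy
    -- `c ^ 2`. The sharp constant would need length `c`; the loss is harmless.
    have hgsub : HasSubgaussianMGF (fun z => g z - ∫ z, g z ∂D) (c.toNNReal ^ 2) D := by
      obtain ⟨z₀⟩ : Nonempty Ω := nonempty_of_isProbabilityMeasure D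
      have h := hasSubgaussianMGF_of_mem_Icc (μ := D) (X := g) (a := g z₀ - c) (b := g z₀ + c)
        hgm.aemeasurable (Filter.Eventually.of_forall fun z => by
          have := abs_le.1 (hgd z z₀)
          constructor <;> linarith)
      convert h using 2
      apply NNReal.coe_injective
      rw [Real.coe_toNNReal _ hc]
      push_cast
      rw [Real.norm_eq_abs, abs_of_nonneg (by linarith)]
      ring
    have hgmgf := hgsub.mgf_le t
    rw [mgf] at hgmgf
    rw [hint, hmean]
    have hexpm : Measurable fun q : Ω × (Fin n → Ω) =>
        Real.exp (t * (F q - ∫ z, g z ∂D)) := by fun_prop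
    have hexpi : Integrable (fun q : Ω × (Fin n → Ω) =>
        Real.exp (t * (F q - ∫ z, g z ∂D))) (D.prod π) := by
      refine Integrable.of_bound hexpm.aestronglyMeasurable
        (Real.exp (|t| * (B + |∫ z, g z ∂D|))) (Filter.Eventually.of_forall fun q => ?_)
      rw [Real.norm_eq_abs, Real.abs_exp]
      refine Real.exp_le_exp.2 ((le_abs_self _).trans ?_)
      rw [abs_mul]
      gcongr
      exact (abs_sub _ _).trans (by gcongr; exact hFB q)
    have e1 : ∫ q, Real.exp (t * (f (Fin.cons q.1 q.2) - ∫ z, g z ∂D)) ∂(D.prod π)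
        = ∫ z, Real.exp (t * (g z - ∫ z, g z ∂D)) *
            ∫ Z, Real.exp (t * (F (z, Z) - g z)) ∂π ∂D := by
      rw [show (fun q : Ω × (Fin n → Ω) =>
        Real.exp (t * (f (Fin.cons q.1 q.2) - ∫ z, g z ∂D))) =
        fun q => Real.exp (t * (F q - ∫ z, g z ∂D)) from rfl]
      rw [integral_prod _ hexpi]
      refine integral_congr_ae (Filter.Eventually.of_forall fun z => ?_)
      simp only
      rw [← integral_const_mul]
      refine integral_congr_ae (Filter.Eventually.of_forall fun Z => ?_)
      simp only
      rw [← Real.exp_add]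
      congr 1; ring
    rw [e1]
    calc _ ≤ ∫ z, Real.exp (t * (g z - ∫ z, g z ∂D)) * Real.exp (n * c ^ 2 * t ^ 2 / 2) ∂D := by
          refine integral_mono_of_nonneg (Filter.Eventually.of_forall fun z => ?_)
            ((hgsub.integrable_exp_mul t).mul_const _) (Filter.Eventually.of_forall fun z => ?_)
          · exact mul_nonneg (Real.exp_nonneg _) (integral_nonneg fun _ => Real.exp_nonneg _)
          · exact mul_le_mul_of_nonneg_left (hsecmgf z) (Real.exp_nonneg _)
      _ = (∫ z, Real.exp (t * (g z - ∫ z, g z ∂D)) ∂D) * Real.exp (n * c ^ 2 * t ^ 2 / 2) :=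
          integral_mul_const _ _
      _ ≤ Real.exp ((c.toNNReal ^ 2 : ℝ≥0) * t ^ 2 / 2) * Real.exp (n * c ^ 2 * t ^ 2 / 2) := by
          gcongr
      _ = _ := by
          rw [← Real.exp_add]
          congr 1
          push_cast
          rw [Real.coe_toNNReal _ hc]
          ring

/-- McDiarmid's inequality. -/
lemma mcdiarmid (D : Measure Ω) [IsProbabilityMeasure D] {n : ℕ} {c : ℝ} (hc : 0 ≤ c)
    {f : (Fin n → Ω) → ℝ} (hf : Measurable f) {B : ℝ} (hB : ∀ Z, |f Z| ≤ B)
    (hd : ∀ Z j z, |f (Function.update Z j z) - f Z| ≤ c) {s : ℝ} (hs : 0 ≤ s) :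
    (Measure.pi fun _ : Fin n => D).real {Z | (∫ Z', f Z' ∂(Measure.pi fun _ => D)) + s ≤ f Z}
      ≤ Real.exp (-s ^ 2 / (2 * (n * c ^ 2))) := by
  set I := ∫ Z', f Z' ∂(Measure.pi fun _ : Fin n => D)
  have hsub : HasSubgaussianMGF (fun Z => f Z - I) (n * c.toNNReal ^ 2)
      (Measure.pi fun _ : Fin n => D) := by
    refine ⟨fun t => ?_, fun t => ?_⟩
    · refine Integrable.of_bound (by fun_prop) (Real.exp (|t| * (B + |I|)))
        (Filter.Eventually.of_forall fun q => ?_)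
      rw [Real.norm_eq_abs, Real.abs_exp]
      refine Real.exp_le_exp.2 ((le_abs_self _).trans ?_)
      rw [abs_mul]
      gcongr
      exact (abs_sub _ _).trans (by gcongr; exact hB q)
    · refine (boundedDifferences_mgf D hc t n f hf ⟨B, hB⟩ hd).trans (le_of_eq ?_)
      push_cast
      rw [Real.coe_toNNReal _ hc]
  have h := hsub.measure_ge_le hs
  have hset : {Z : Fin n → Ω | I + s ≤ f Z} = {Z | s ≤ f Z - I} := by
    ext Z; simp only [Set.mem_ofPred_eq]; constructor <;> intro h <;> linarith
  rw [hset]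
  refine h.trans (le_of_eq ?_)
  push_cast
  rw [Real.coe_toNNReal _ hc]

/-- Resampling one coordinate preserves a product measure. -/
lemma measurePreserving_update {ι : Type*} [Fintype ι] [DecidableEq ι] (D : Measure Ω)
    [IsProbabilityMeasure D] (j : ι) :
    MeasurePreserving (fun q : (ι → Ω) × Ω => Function.update q.1 j q.2)
      ((Measure.pi fun _ : ι => D).prod D) (Measure.pi fun _ : ι => D) := by
  have hmeas : Measurable fun q : (ι → Ω) × Ω => Function.update q.1 j q.2 := by
    refine measurable_pi_lambda _ fun i => ?_
    by_cases h : i = j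
    · subst h; simpa using measurable_snd
    · simp only [Function.update_of_ne h]; fun_prop
  refine ⟨hmeas, (Measure.pi_eq fun s hs => ?_).symm⟩
  rw [Measure.map_apply hmeas (MeasurableSet.univ_pi hs)]
  -- The preimage of a box is again a box, with side `j` freed in the old sample and imposed on the
  -- new coordinate.
  have : (fun q : (ι → Ω) × Ω => Function.update q.1 j q.2) ⁻¹' (Set.univ.pi s) =
      (Set.univ.pi (Function.update s j Set.univ)) ×ˢ (s j) := by
    ext ⟨Z, z⟩
    simp only [Set.mem_preimage, Set.mem_pi, Set.mem_univ, true_implies, Set.mem_prod]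
    constructor
    · intro h
      refine ⟨fun i => ?_, by simpa using h j⟩
      by_cases hi : i = j
      · subst hi; simp
      · simpa [Function.update_of_ne hi] using h i
    · rintro ⟨h1, h2⟩ i
      by_cases hi : i = j
      · subst hi; simpa using h2
      · simpa [Function.update_of_ne hi] using h1 i
  rw [this, Measure.prod_prod, Measure.pi_pi,
    ← Finset.mul_prod_erase _ _ (Finset.mem_univ j),
    ← Finset.mul_prod_erase _ (fun i => D (s i)) (Finset.mem_univ j), mul_comm]
  simp only [Function.update_self, measure_univ, one_mul]
  congr 1
  refine Finset.prod_congr rfl fun i hi => ?_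
  rw [Function.update_of_ne (Finset.ne_of_mem_erase hi)]

/-- Selecting distinct coordinates of a product measure gives a product measure. -/
lemma measurePreserving_comp_injective {ι κ : Type*} [Fintype ι] [Fintype κ] (D : Measure Ω)
    [IsProbabilityMeasure D] {σ : κ → ι} (hσ : Function.Injective σ) :
    MeasurePreserving (fun (Z : ι → Ω) (j : κ) => Z (σ j))
      (Measure.pi fun _ : ι => D) (Measure.pi fun _ : κ => D) := by
  have hm : Measurable fun (Z : ι → Ω) (j : κ) => Z (σ j) := by fun_prop
  refine ⟨hm, ?_⟩
  have hind : iIndepFun (fun (i : ι) (Z : ι → Ω) => Z i) (Measure.pi fun _ : ι => D) :=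
    iIndepFun_pi (X := fun _ w => w) fun _ => aemeasurable_id
  have h := (iIndepFun_iff_map_fun_eq_pi_map (μ := Measure.pi fun _ : ι => D)
    (f := fun (j : κ) (Z : ι → Ω) => Z (σ j))
    (fun j => (measurable_pi_apply _).aemeasurable)).1 (hind.precomp hσ)
  rw [h]
  congr 1
  ext1 j
  exact (measurePreserving_eval (fun _ : ι => D) (σ j)).map_eq

end Concentration

/-! ### Counting draws with replacement -/

/-- All but a `T ^ 2 / N` fraction of the sequences of `T` draws from `N` items are injective. -/
lemma card_not_injective_le (T N : ℕ) (hN : 0 < N) :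
    ((Finset.univ.filter fun s : Fin T → Fin N => ¬ Function.Injective s).card : ℝ)
      ≤ (T : ℝ) ^ 2 / N * (N : ℝ) ^ T := by
  have hN' : (0 : ℝ) < N := by exact_mod_cast hN
  have hinj : ((Finset.univ.filter fun s : Fin T → Fin N => Function.Injective s).card)
      = N.descFactorial T := by
    rw [← Fintype.card_subtype, Fintype.card_congr (Equiv.subtypeInjectiveEquivEmbedding _ _),
      Fintype.card_embedding_eq]
    simp
  have hsum : ((Finset.univ.filter fun s : Fin T → Fin N => Function.Injective s).card : ℝ)
      + ((Finset.univ.filter fun s : Fin T → Fin N => ¬ Function.Injective s).card : ℝ)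
      = (N : ℝ) ^ T := by
    rw [← Nat.cast_add, Finset.card_filter_add_card_filter_not]
    simp
  rw [hinj] at hsum
  by_cases hT : T ≤ N
  · have h1 : ((N + 1 - T : ℕ) : ℝ) ^ T ≤ N.descFactorial T := by
      exact_mod_cast Nat.pow_sub_le_descFactorial N T
    have h2 : (N : ℝ) ^ T * (1 - (T : ℝ) ^ 2 / N) ≤ ((N + 1 - T : ℕ) : ℝ) ^ T := by
      have hb : 1 + (T : ℝ) * (-((T : ℝ) / N)) ≤ (1 + -((T : ℝ) / N)) ^ T := by
        apply one_add_mul_le_pow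
        have : (T : ℝ) / N ≤ 1 := by
          rw [div_le_one hN']; exact_mod_cast hT
        linarith
      calc (N : ℝ) ^ T * (1 - (T : ℝ) ^ 2 / N)
          = (N : ℝ) ^ T * (1 + (T : ℝ) * (-((T : ℝ) / N))) := by ring
        _ ≤ (N : ℝ) ^ T * (1 + -((T : ℝ) / N)) ^ T := by gcongr
        _ = ((N : ℝ) - T) ^ T := by
            rw [← mul_pow]; congr 1; field_simp; ring
        _ ≤ ((N + 1 - T : ℕ) : ℝ) ^ T := by
            have h0 : (T : ℝ) ≤ N := by exact_mod_cast hT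
            rw [Nat.cast_sub (by omega)]
            push_cast
            gcongr
            linarith
    nlinarith
  · push Not at hT
    have : (1 : ℝ) ≤ (T : ℝ) ^ 2 / N := by
      rw [le_div_iff₀ hN']
      have h1 : (N : ℝ) ≤ T := by exact_mod_cast hT.le
      have h2 : (1 : ℝ) ≤ T := by exact_mod_cast (by omega : 1 ≤ T)
      nlinarith
    have h0 : (0 : ℝ) ≤ (N.descFactorial T : ℝ) := by positivity
    have h3 : (0 : ℝ) < (N : ℝ) ^ T := by positivity
    nlinarith

/-- At most a `T / N` fraction of the sequences of `T` draws from `N` items contain a given item. -/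
lemma card_hit_le (T N : ℕ) (j : Fin N) :
    ((Finset.univ.filter fun s : Fin T → Fin N => ∃ t, s t = j).card : ℝ)
      ≤ (T : ℝ) / N * (N : ℝ) ^ T := by
  have hN : 0 < N := j.pos
  have hN' : (0 : ℝ) < N := by exact_mod_cast hN
  have h1 : (Finset.univ.filter fun s : Fin T → Fin N => ∃ t, s t = j) ⊆
      Finset.univ.biUnion fun t : Fin T =>
        Fintype.piFinset fun i : Fin T => if i = t then {j} else Finset.univ := by
    intro s hs
    simp only [Finset.mem_filter, Finset.mem_univ, true_and] at hs
    obtain ⟨t, ht⟩ := hs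
    simp only [Finset.mem_biUnion, Finset.mem_univ, true_and, Fintype.mem_piFinset]
    refine ⟨t, fun i => ?_⟩
    by_cases hi : i = t
    · subst hi; simp [ht]
    · simp [hi]
  have h2 : ∀ t : Fin T, ((Fintype.piFinset fun i : Fin T =>
      if i = t then ({j} : Finset (Fin N)) else Finset.univ).card : ℝ) = (N : ℝ) ^ T / N := by
    intro t
    rw [Fintype.card_piFinset, ← Finset.mul_prod_erase _ _ (Finset.mem_univ t)]
    have : ∏ i ∈ Finset.univ.erase t,
        (if i = t then ({j} : Finset (Fin N)) else Finset.univ).card = N ^ (T - 1) := by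
      rw [Finset.prod_congr rfl (g := fun _ => N) fun i hi => by
        simp [Finset.ne_of_mem_erase hi]]
      simp
    rw [this]
    simp only [if_true, Finset.card_singleton, one_mul, Nat.cast_pow]
    have hT : T = (T - 1) + 1 := by have := t.pos; omega
    rw [eq_div_iff hN'.ne', ← pow_succ, ← hT]
  calc ((Finset.univ.filter fun s : Fin T → Fin N => ∃ t, s t = j).card : ℝ)
      ≤ ∑ t : Fin T, ((Fintype.piFinset fun i : Fin T =>
        if i = t then ({j} : Finset (Fin N)) else Finset.univ).card : ℝ) := by
        exact_mod_cast (Finset.card_le_card h1).trans Finset.card_biUnion_le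
    _ = (T : ℝ) / N * (N : ℝ) ^ T := by
        simp only [h2, Finset.sum_const, Finset.card_univ, Fintype.card_fin, nsmul_eq_mul]
        ring

end SAMGen

namespace SAMGen

noncomputable section

/-! ### Hermite polynomials and Gaussian integrals -/

/-- The probabilists' Hermite polynomial with real coefficients. -/
def hermiteR (n : ℕ) : Polynomial ℝ := (Polynomial.hermite n).map (Int.castRingHom ℝ)

open Polynomial in
lemma hermiteR_zero : hermiteR 0 = 1 := by simp [hermiteR]

open Polynomial in
lemma hermiteR_succ (n : ℕ) :
    hermiteR (n + 1) = X * hermiteR n - derivative (hermiteR n) := by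
  simp [hermiteR, Polynomial.hermite_succ, Polynomial.derivative_map]

open Polynomial in
lemma derivative_hermiteR_succ (n : ℕ) :
    derivative (hermiteR (n + 1)) = ((n : ℝ[X]) + 1) * hermiteR n := by
  induction n with
  | zero => simp [hermiteR_succ, hermiteR_zero]
  | succ n ih =>
    rw [hermiteR_succ (n + 1), derivative_sub, derivative_mul, ih, derivative_mul]
    simp only [derivative_X, one_mul, derivative_add, derivative_natCast, derivative_one,
      add_zero, zero_mul, zero_add]
    rw [hermiteR_succ n]
    push_cast
    ring

/-- Value of the Hermite polynomial. -/
def He (n : ℕ) (x : ℝ) : ℝ := (hermiteR n).eval x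

lemma He_zero (x : ℝ) : He 0 x = 1 := by simp [He, hermiteR_zero]

lemma He_one (x : ℝ) : He 1 x = x := by simp [He, hermiteR_succ, hermiteR_zero]

lemma hasDerivAt_He_succ (n : ℕ) (x : ℝ) : HasDerivAt (He (n + 1)) ((n + 1) * He n x) x := by
  have := (hermiteR (n + 1)).hasDerivAt x
  rw [derivative_hermiteR_succ] at this
  simp only [Polynomial.eval_mul, Polynomial.eval_add, Polynomial.eval_natCast,
    Polynomial.eval_one] at this
  exact this

lemma He_add_two (n : ℕ) (x : ℝ) : He (n + 2) x = x * He (n + 1) x - (n + 1) * He n x := by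
  unfold He
  rw [hermiteR_succ (n + 1), derivative_hermiteR_succ]
  simp

lemma continuous_He (n : ℕ) : Continuous (He n) := (hermiteR n).continuous

lemma measurable_He (n : ℕ) : Measurable (He n) := (continuous_He n).measurable

/-- Induction on the three-term recurrence: with `s = √(n + 2)` it suffices that `|x| * (|x| + s) +
(n + 1) ≤ (|x| + s) ^ 2`. The shift by `√n` is of the right order, since it will be cancelled by the
factor `1 / √(n!)` of the bias filter. -/
lemma abs_He_le (n : ℕ) (x : ℝ) : |He n x| ≤ (|x| + √n) ^ n := by
  induction n using Nat.strong_induction_on with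
  | _ n ih =>
    match n, ih with
    | 0, _ => simp [He_zero]
    | 1, _ => simp [He_one]
    | n + 2, ih =>
      set s := √((n + 2 : ℕ) : ℝ) with hs
      have hs0 : 0 ≤ s := Real.sqrt_nonneg _
      have hs2 : s * s = n + 2 := by
        rw [hs, Real.mul_self_sqrt (by positivity)]; push_cast; ring
      have h1 := ih (n + 1) (by omega)
      have h0 := ih n (by omega)
      have l1 : √((n + 1 : ℕ) : ℝ) ≤ s := Real.sqrt_le_sqrt (by push_cast; linarith)
      have l0 : √(n : ℝ) ≤ s := Real.sqrt_le_sqrt (by push_cast; linarith)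
      have hx := abs_nonneg x
      rw [He_add_two]
      calc |x * He (n + 1) x - (n + 1) * He n x|
          ≤ |x| * |He (n + 1) x| + (n + 1) * |He n x| := by
            refine (abs_sub _ _).trans ?_
            rw [abs_mul, abs_mul, abs_of_pos (by positivity : (0 : ℝ) < n + 1)]
        _ ≤ |x| * (|x| + s) ^ (n + 1) + (n + 1) * (|x| + s) ^ n := by
            gcongr
            · exact h1.trans (by gcongr)
            · exact h0.trans (by gcongr)
        _ = (|x| + s) ^ n * (|x| * (|x| + s) + (n + 1)) := by ring
        _ ≤ (|x| + s) ^ n * (|x| + s) ^ 2 := by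
            gcongr
            nlinarith
        _ = _ := by ring

lemma integrable_eval_gaussianReal (p : Polynomial ℝ) (v : ℝ≥0) :
    Integrable (fun x => p.eval x) (gaussianReal 0 v) := by
  induction p using Polynomial.induction_on' with
  | add p q hp hq => simp only [Polynomial.eval_add]; exact hp.add hq
  | monomial n a =>
    simp only [Polynomial.eval_monomial]
    have h := (memLp_id_gaussianReal' (μ := 0) (v := v) (n : ℝ≥0∞) (by simp)).integrable_norm_pow'
    refine Integrable.const_mul ?_ a
    refine (integrable_norm_iff (by fun_prop)).1 ?_
    simpa using h

lemma hasDerivAt_gaussianPDFReal {v : ℝ≥0} (hv : v ≠ 0) (x : ℝ) :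
    HasDerivAt (gaussianPDFReal 0 v) (-(x / v) * gaussianPDFReal 0 v x) x := by
  have hv' : (v : ℝ) ≠ 0 := by exact_mod_cast hv
  have h : HasDerivAt (fun x : ℝ => (√(2 * Real.pi * v))⁻¹ * Real.exp (-(x - 0) ^ 2 / (2 * v)))
      ((√(2 * Real.pi * v))⁻¹ * (Real.exp (-(x - 0) ^ 2 / (2 * v)) * (-(x / v)))) x := by
    refine HasDerivAt.const_mul _ (HasDerivAt.exp ?_)
    have h1 : HasDerivAt (fun x : ℝ => -(x - 0) ^ 2 / (2 * v))
        (-(2 * (x - 0) ^ 1 * 1) / (2 * v)) x := by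
      have := ((((hasDerivAt_id x).sub_const 0).pow 2).neg).div_const (2 * (v : ℝ))
      simpa using this
    convert h1 using 1
    field_simp
    ring
  have e : gaussianPDFReal 0 v =
      fun x : ℝ => (√(2 * Real.pi * v))⁻¹ * Real.exp (-(x - 0) ^ 2 / (2 * v)) := by
    rw [gaussianPDFReal_def]
  rw [e]
  convert h using 1
  ring

lemma integrable_eval_mul_gaussianPDFReal (p : Polynomial ℝ) {v : ℝ≥0} (hv : v ≠ 0) :
    Integrable (fun x => p.eval x * gaussianPDFReal 0 v x) := by
  have h := integrable_eval_gaussianReal p v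
  rw [gaussianReal_of_var_ne_zero _ hv] at h
  rw [integrable_withDensity_iff (measurable_gaussianPDF 0 v)
    (Filter.Eventually.of_forall fun _ => gaussianPDF_lt_top)] at h
  simpa [toReal_gaussianPDF] using h

/-- Gaussian integration by parts. -/
lemma integral_mul_eval_gaussianReal (p : Polynomial ℝ) (v : ℝ≥0) :
    ∫ x, x * p.eval x ∂(gaussianReal 0 v)
      = v * ∫ x, (Polynomial.derivative p).eval x ∂(gaussianReal 0 v) := by
  by_cases hv : v = 0
  · subst hv; simp [gaussianReal_zero_var]
  have hv' : (v : ℝ) ≠ 0 := by exact_mod_cast hv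
  rw [integral_gaussianReal_eq_integral_smul hv, integral_gaussianReal_eq_integral_smul hv]
  simp only [smul_eq_mul]
  have h := integral_mul_deriv_eq_deriv_mul_of_integrable
    (u := fun x => p.eval x) (v := gaussianPDFReal 0 v)
    (u' := fun x => (Polynomial.derivative p).eval x)
    (v' := fun x => -(x / v) * gaussianPDFReal 0 v x)
    (fun x _ => p.hasDerivAt x) (fun x _ => hasDerivAt_gaussianPDFReal hv x)
    (by
      have h := (integrable_eval_mul_gaussianPDFReal (Polynomial.X * p) hv).const_mul (-(1 / v : ℝ))
      refine h.congr (Filter.Eventually.of_forall fun x => ?_)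
      simp only [Polynomial.eval_mul, Polynomial.eval_X, Pi.mul_apply]
      ring)
    (integrable_eval_mul_gaussianPDFReal _ hv) (integrable_eval_mul_gaussianPDFReal p hv)
  have e1 : ∫ x, p.eval x * (-(x / v) * gaussianPDFReal 0 v x)
      = -(1 / v : ℝ) * ∫ x, gaussianPDFReal 0 v x * (x * p.eval x) := by
    rw [← integral_const_mul]
    congr 1; ext x; ring
  have e2 : ∫ x, gaussianPDFReal 0 v x * (Polynomial.derivative p).eval x
      = ∫ x, (Polynomial.derivative p).eval x * gaussianPDFReal 0 v x := by
    congr 1; ext x; ring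
  rw [e2]
  rw [e1] at h
  generalize (∫ x, gaussianPDFReal 0 v x * (x * p.eval x)) = I at *
  field_simp at h
  linarith

/-- Action of the Ornstein–Uhlenbeck semigroup on Hermite polynomials. -/
lemma integral_He_add (x : ℝ) {v : ℝ≥0} (hv : (v : ℝ) = 1 - x ^ 2) (n : ℕ) (g : ℝ) :
    ∫ b, He n (x * g + b) ∂(gaussianReal 0 v) = x ^ n * He n g := by
  have hpoly : ∀ n b, He n (x * g + b) =
      ((hermiteR n).comp (Polynomial.C (x * g) + Polynomial.X)).eval b := by
    intro n b; simp [He, Polynomial.eval_comp]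
  have hint : ∀ n, Integrable (fun b => He n (x * g + b)) (gaussianReal 0 v) := by
    intro n
    simp only [hpoly]
    exact integrable_eval_gaussianReal _ v
  have hstein : ∀ n, ∫ b, b * He (n + 1) (x * g + b) ∂(gaussianReal 0 v)
      = v * ((n + 1) * ∫ b, He n (x * g + b) ∂(gaussianReal 0 v)) := by
    intro n
    simp only [hpoly]
    rw [integral_mul_eval_gaussianReal, ← integral_const_mul ((n : ℝ) + 1)]
    congr 2
    ext b
    rw [Polynomial.derivative_comp, derivative_hermiteR_succ]
    simp [Polynomial.eval_comp]
  have hbint : ∀ n, Integrable (fun b => b * He n (x * g + b)) (gaussianReal 0 v) := by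
    intro n
    have := integrable_eval_gaussianReal
      (Polynomial.X * (hermiteR n).comp (Polynomial.C (x * g) + Polynomial.X)) v
    simpa [hpoly] using this
  induction n using Nat.strong_induction_on with
  | _ n ih =>
    match n, ih with
    | 0, _ => simp [He_zero]
    | 1, _ =>
      simp only [He_one]
      rw [integral_add (integrable_const _) (by
        simpa using integrable_eval_gaussianReal Polynomial.X v)]
      simp [integral_id_gaussianReal]
    | n + 2, ih =>
      have h1 := ih (n + 1) (by omega)
      have h0 := ih n (by omega)
      -- By `hstein` the summand with the factor `b` contributes `(n + 1) * v`, so the lower-order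
      -- coefficient becomes `(n + 1) * (v - 1) = -(n + 1) * x ^ 2`. This is the Hermite recurrence
      -- for `g` multiplied by `x ^ (n + 2)`.
      have e : ∀ b, He (n + 2) (x * g + b) = x * g * He (n + 1) (x * g + b)
          + b * He (n + 1) (x * g + b) - (n + 1) * He n (x * g + b) := by
        intro b; rw [He_add_two]; ring
      simp only [e]
      have hadd : Integrable (fun b => x * g * He (n + 1) (x * g + b)
          + b * He (n + 1) (x * g + b)) (gaussianReal 0 v) :=
        ((hint (n + 1)).const_mul _).add (hbint (n + 1))
      rw [integral_sub hadd ((hint n).const_mul _),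
        integral_add ((hint (n + 1)).const_mul _) (hbint (n + 1)), integral_const_mul,
        integral_const_mul, hstein, h1, h0, He_add_two, hv]
      ring

/-- Write one factor as `He (n + 1) = x * He n - (He n)'` and integrate by parts: the terms with
`(He n)'` cancel, and `He n * (He (n + 1))' = (n + 1) * (He n) ^ 2` remains. -/
lemma integral_He_sq (n : ℕ) : ∫ x, He n x ^ 2 ∂(gaussianReal 0 1) = n.factorial := by
  induction n with
  | zero => simp [He_zero]
  | succ n ih =>
    have h := integral_mul_eval_gaussianReal (hermiteR n * hermiteR (n + 1)) 1
    have e : ∀ x, He (n + 1) x ^ 2 = x * (hermiteR n * hermiteR (n + 1)).eval x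
        - (Polynomial.derivative (hermiteR n) * hermiteR (n + 1)).eval x := by
      intro x
      have : He (n + 1) x = x * He n x - (Polynomial.derivative (hermiteR n)).eval x := by
        simp [He, hermiteR_succ]
      rw [sq]
      nth_rewrite 1 [this]
      simp only [Polynomial.eval_mul, He]
      ring
    simp only [e]
    have hX : Integrable (fun x => x * (hermiteR n * hermiteR (n + 1)).eval x)
        (gaussianReal 0 1) := by
      have := integrable_eval_gaussianReal (Polynomial.X * (hermiteR n * hermiteR (n + 1))) 1
      exact this.congr (Filter.Eventually.of_forall fun x => by simp [Polynomial.eval_mul])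
    rw [integral_sub hX
      (integrable_eval_gaussianReal _ 1), h, Polynomial.derivative_mul, NNReal.coe_one, one_mul]
    simp only [Polynomial.eval_add]
    rw [integral_add (integrable_eval_gaussianReal _ 1) (integrable_eval_gaussianReal _ 1),
      add_sub_cancel_left, derivative_hermiteR_succ, Nat.factorial_succ]
    push_cast
    rw [← ih, ← integral_const_mul]
    congr 1
    ext x
    simp [He]
    ring

lemma integrable_He_sq (n : ℕ) : Integrable (fun x => He n x ^ 2) (gaussianReal 0 1) := by
  have := integrable_eval_gaussianReal (hermiteR n ^ 2) 1
  simpa [He] using this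

/-- Gaussian tail integral of a Hermite polynomial. -/
lemma integral_indicator_He_succ (n : ℕ) (b : ℝ) :
    ∫ g, (if 0 ≤ g + b then He (n + 1) g else 0) ∂(gaussianReal 0 1)
      = He n (-b) * gaussianPDFReal 0 1 b := by
  -- `He (n + 1)` times the Gaussian density is an exact derivative, so the tail integral is a
  -- boundary value.
  have hF : ∀ x, HasDerivAt (fun x => -(He n x * gaussianPDFReal 0 1 x))
      (He (n + 1) x * gaussianPDFReal 0 1 x) x := by
    intro x
    have h := ((hermiteR n).hasDerivAt x).mul (hasDerivAt_gaussianPDFReal one_ne_zero x)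
    have h2 := h.neg
    refine h2.congr_deriv ?_
    have : He (n + 1) x = x * He n x - (Polynomial.derivative (hermiteR n)).eval x := by
      simp [He, hermiteR_succ]
    rw [this]
    simp [He]
    ring
  have hint := (integrable_eval_mul_gaussianPDFReal (hermiteR (n + 1)) (one_ne_zero (α := ℝ≥0)))
  have hintF := (integrable_eval_mul_gaussianPDFReal (hermiteR n) (one_ne_zero (α := ℝ≥0))).neg
  have hlim := tendsto_zero_of_hasDerivAt_of_integrableOn_Ioi (a := -b) (fun x _ => hF x)
    hint.integrableOn hintF.integrableOn
  have h := integral_Ioi_of_hasDerivAt_of_tendsto (hF (-b)).continuousAt.continuousWithinAt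
    (fun x _ => hF x) hint.integrableOn hlim
  rw [integral_gaussianReal_eq_integral_smul one_ne_zero]
  have e : (fun g => gaussianPDFReal 0 1 g • (if 0 ≤ g + b then He (n + 1) g else 0))
      = (Set.Ici (-b)).indicator fun g => He (n + 1) g * gaussianPDFReal 0 1 g := by
    ext g
    by_cases hg : 0 ≤ g + b
    · rw [Set.indicator_of_mem (by simp only [Set.mem_Ici]; linarith)]
      simp [hg, mul_comm]
    · rw [Set.indicator_of_notMem (by simp only [Set.mem_Ici]; linarith)]
      simp [hg]
  rw [e, integral_indicator measurableSet_Ici, integral_Ici_eq_integral_Ioi, h]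
  simp [gaussianPDFReal]

end

end SAMGen

namespace SAMGen

noncomputable section

/-! ### Lower bounds for Hermite polynomials near the origin -/

/-- At the origin the recurrence makes `|He (2 * l) 0|` the double factorial `(2 * l - 1)!!`, whose
square misses `(2 * l)!` only by a factor linear in `l`. -/
lemma He_even_zero_sq (l : ℕ) : ((2 * l).factorial : ℝ) ≤ (2 * l + 1) * He (2 * l) 0 ^ 2 := by
  induction l with
  | zero => simp [He_zero]
  | succ l ih =>
    have h : He (2 * (l + 1)) 0 = -(2 * l + 1) * He (2 * l) 0 := by
      rw [show 2 * (l + 1) = 2 * l + 2 by ring, He_add_two]; push_cast; ring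
    rw [h, show 2 * (l + 1) = (2 * l + 1) + 1 by ring, Nat.factorial_succ, Nat.factorial_succ]
    push_cast
    set A := He (2 * l) 0 ^ 2
    have hA : 0 ≤ A := sq_nonneg _
    have hl : (0 : ℝ) ≤ l := by positivity
    have e : (-(2 * (l : ℝ) + 1) * He (2 * l) 0) ^ 2 = (2 * l + 1) ^ 2 * A := by
      rw [mul_pow, neg_sq]
    rw [e]
    calc (2 * (l : ℝ) + 1 + 1) * ((2 * l + 1) * ((2 * l).factorial : ℝ))
        ≤ (2 * (l : ℝ) + 1 + 1) * ((2 * l + 1) * ((2 * l + 1) * A)) := by gcongr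
      _ ≤ (2 * ((l : ℝ) + 1) + 1) * ((2 * l + 1) ^ 2 * A) := by
        have : 0 ≤ (2 * (l : ℝ) + 1) ^ 2 * A := by positivity
        nlinarith

lemma He_odd_zero (l : ℕ) : He (2 * l + 1) 0 = 0 := by
  induction l with
  | zero => simp [He_one]
  | succ l ih =>
    rw [show 2 * (l + 1) + 1 = (2 * l + 1) + 2 by ring, He_add_two, ih]; ring

/-- Derivative of the Hermite polynomial. -/
def HeD (n : ℕ) (x : ℝ) : ℝ := (Polynomial.derivative (hermiteR n)).eval x

lemma hasDerivAt_He (n : ℕ) (x : ℝ) : HasDerivAt (He n) (HeD n x) x := (hermiteR n).hasDerivAt x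

lemma HeD_succ (n : ℕ) (x : ℝ) : HeD (n + 1) x = (n + 1) * He n x := by
  simp [HeD, derivative_hermiteR_succ, He]

/-- The Hermite differential equation. -/
lemma hasDerivAt_HeD (n : ℕ) (x : ℝ) : HasDerivAt (HeD n) (x * HeD n x - n * He n x) x := by
  have h := (Polynomial.derivative (hermiteR n)).hasDerivAt x
  refine h.congr_deriv ?_
  have h1 := derivative_hermiteR_succ n
  rw [hermiteR_succ, Polynomial.derivative_sub, Polynomial.derivative_mul] at h1
  have h2 := congrArg (Polynomial.eval x) h1
  simp at h2
  simp only [HeD, He]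
  linarith

/-- A Sturm-type energy. By the Hermite equation, `exp (-y ^ 2) * (He' ^ 2 + n * He ^ 2)` has
derivative `-2 * y * exp (-y ^ 2) * n * He ^ 2`, so it decreases on the positive half-line. -/
lemma He_energy_le (n : ℕ) {y : ℝ} (hy : 0 ≤ y) :
    HeD n y ^ 2 + n * He n y ^ 2 ≤ Real.exp (y ^ 2) * (HeD n 0 ^ 2 + n * He n 0 ^ 2) := by
  set E : ℝ → ℝ := fun y => Real.exp (-y ^ 2) * (HeD n y ^ 2 + n * He n y ^ 2) with hE
  have hd : ∀ y, HasDerivAt E (-(2 * y * Real.exp (-y ^ 2) * (n * He n y ^ 2))) y := by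
    intro y
    have h1 : HasDerivAt (fun y : ℝ => Real.exp (-y ^ 2)) (Real.exp (-y ^ 2) * (-(2 * y))) y := by
      have h0 : HasDerivAt (fun y : ℝ => -y ^ 2) (-(2 * y)) y := by
        exact ((hasDerivAt_pow 2 y).neg).congr_deriv (by simp)
      exact h0.exp
    have h2 := ((hasDerivAt_HeD n y).pow 2).add (((hasDerivAt_He n y).pow 2).const_mul (n : ℝ))
    refine (h1.mul h2).congr_deriv ?_
    simp
    ring
  have hanti : AntitoneOn E (Set.Ici 0) := by
    refine antitoneOn_of_deriv_nonpos (convex_Ici 0)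
      (fun y _ => (hd y).continuousAt.continuousWithinAt)
      (fun y _ => (hd y).differentiableAt.differentiableWithinAt) fun y hy => ?_
    rw [(hd y).deriv]
    simp only [interior_Ici, Set.mem_Ioi] at hy
    have : 0 ≤ 2 * y * Real.exp (-y ^ 2) * (n * He n y ^ 2) := by positivity
    linarith
  have h := hanti (Set.mem_Ici.2 le_rfl) (Set.mem_Ici.2 hy) hy
  simp only [hE] at h
  rw [show -(0 : ℝ) ^ 2 = 0 by norm_num, Real.exp_zero, one_mul] at h
  calc HeD n y ^ 2 + n * He n y ^ 2
      = Real.exp (y ^ 2) * (Real.exp (-y ^ 2) * (HeD n y ^ 2 + n * He n y ^ 2)) := by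
        rw [← mul_assoc, ← Real.exp_add]; simp
    _ ≤ _ := by gcongr

/-- Even Hermite polynomials are of constant size and sign near `0`. -/
lemma He_even_ge (l : ℕ) {y : ℝ} (hy : 0 ≤ y) (hy1 : y * √(2 * l + 1) ≤ 1 / 4) :
    He (2 * l) 0 ^ 2 / 2 ≤ He (2 * l) 0 * He (2 * l) y := by
  have hs1 : 1 ≤ √(2 * (l : ℝ) + 1) := by
    rw [Real.one_le_sqrt]; have : (0 : ℝ) ≤ l := by positivity
    linarith
  have hyq : y ≤ 1 / 4 := by nlinarith
  set A := He (2 * l) 0 with hA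
  have hD0 : HeD (2 * l) 0 = 0 := by
    rcases l with _ | l
    · simp [HeD, hermiteR_zero]
    · rw [show 2 * (l + 1) = (2 * l + 1) + 1 by ring, HeD_succ, He_odd_zero, mul_zero]
  -- The derivative vanishes at `0`, so the initial energy is `2 * l * A ^ 2`; on this short
  -- interval `exp (t ^ 2) ≤ 4`. Hence `He` moves by at most `|A| / 2`.
  have hbound : ∀ t ∈ Set.Icc 0 y, |HeD (2 * l) t| ≤ 2 * √(2 * l + 1) * |A| := by
    intro t ht
    have h := He_energy_le (2 * l) ht.1
    rw [hD0] at h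
    have hexp : Real.exp (t ^ 2) ≤ 4 := by
      have h1 : t ^ 2 ≤ 1 := by nlinarith [ht.1, ht.2]
      have h2 := Real.exp_one_lt_d9
      have h3 := Real.exp_le_exp.2 h1
      linarith
    apply abs_le_of_sq_le_sq _ (by positivity)
    rw [mul_pow, mul_pow, Real.sq_sqrt (by positivity), sq_abs]
    have h4 : 0 ≤ ((2 * l : ℕ) : ℝ) * He (2 * l) t ^ 2 := by positivity
    have h5 : 0 ≤ (2 * (l : ℝ)) * A ^ 2 := by positivity
    have h6 : 0 ≤ A ^ 2 := sq_nonneg _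
    push_cast at h h4
    nlinarith
  have hmv : |He (2 * l) y - A| ≤ 2 * √(2 * l + 1) * |A| * (y - 0) := by
    have := (convex_Icc 0 y).norm_image_sub_le_of_norm_hasDerivWithin_le
      (f := He (2 * l)) (f' := HeD (2 * l)) (C := 2 * √(2 * l + 1) * |A|)
      (x := 0) (y := y) (fun t _ => (hasDerivAt_He _ t).hasDerivWithinAt) hbound
      ⟨le_rfl, hy⟩ ⟨hy, le_rfl⟩
    simpa [Real.norm_eq_abs, abs_of_nonneg hy] using this
  have hmv2 : |He (2 * l) y - A| ≤ |A| / 2 := by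
    refine hmv.trans ?_
    have := abs_nonneg A
    nlinarith
  have h7 : |A * (He (2 * l) y - A)| ≤ |A| * (|A| / 2) := by
    rw [abs_mul]; gcongr
  have h8 := (abs_le.1 h7).1
  have h9 : |A| * |A| = A ^ 2 := by rw [← sq, sq_abs]
  nlinarith

/-- Odd Hermite polynomials grow linearly near `0`. -/
lemma He_odd_ge (l : ℕ) {y : ℝ} (hy : 0 ≤ y) (hy1 : y * √(2 * l + 1) ≤ 1 / 4) :
    (2 * l + 1) * He (2 * l) 0 ^ 2 / 2 * y ≤ He (2 * l) 0 * He (2 * l + 1) y := by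
  set A := He (2 * l) 0 with hA
  -- The derivative of the odd polynomial is `2 * l + 1` times the even one, which is bounded below
  -- by `He_even_ge`; thus `f` is increasing from `f 0 = 0`.
  set f : ℝ → ℝ := fun t => A * He (2 * l + 1) t - (2 * l + 1) * A ^ 2 / 2 * t with hf
  have hd : ∀ t, HasDerivAt f ((2 * l + 1) * (A * He (2 * l) t - A ^ 2 / 2)) t := by
    intro t
    have h := ((hasDerivAt_He_succ (2 * l) t).const_mul A).sub
      ((hasDerivAt_id t).const_mul ((2 * l + 1) * A ^ 2 / 2))
    refine h.congr_deriv ?_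
    push_cast
    ring
  have hmono : MonotoneOn f (Set.Icc 0 y) := by
    refine monotoneOn_of_deriv_nonneg (convex_Icc 0 y)
      (fun t _ => (hd t).continuousAt.continuousWithinAt)
      (fun t _ => (hd t).differentiableAt.differentiableWithinAt) fun t ht => ?_
    rw [(hd t).deriv]
    rw [interior_Icc] at ht
    have := He_even_ge l ht.1.le (le_trans (by gcongr; exact ht.2.le) hy1)
    exact mul_nonneg (by positivity) (by linarith)
  have h := hmono ⟨le_rfl, hy⟩ ⟨hy, le_rfl⟩ hy
  simp only [hf, He_odd_zero, mul_zero, sub_zero] at h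
  linarith

/-! ### Bias filters -/

/-- Width of the window of biases used to detect the monomial of degree `n + 1`. -/
def biasWidth (n : ℕ) : ℝ := 1 / (4 * √(n + 1))

lemma biasWidth_pos (n : ℕ) : 0 < biasWidth n := by unfold biasWidth; positivity

lemma biasWidth_le (n : ℕ) : biasWidth n ≤ 1 / 4 := by
  unfold biasWidth
  have : 1 ≤ √((n : ℝ) + 1) := by
    rw [Real.one_le_sqrt]; have : (0 : ℝ) ≤ n := by positivity
    linarith
  gcongr
  linarith

/-- The response of the window to the Hermite polynomial of degree `n`. -/
def biasMass (n : ℕ) : ℝ :=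
  ∫ b, (if -biasWidth n ≤ b ∧ b ≤ 0 then He n (-b) * gaussianPDFReal 0 1 b else 0)
    ∂(gaussianReal 0 1)

/-- Substitute `b = -y`. The density appears squared: one factor comes from the tail integral of the
Hermite polynomial, the other from the law of the bias. -/
lemma biasMass_eq (n : ℕ) :
    biasMass n = ∫ y in (0 : ℝ)..biasWidth n, He n y * gaussianPDFReal 0 1 y ^ 2 := by
  have hw := (biasWidth_pos n).le
  rw [biasMass, integral_gaussianReal_eq_integral_smul one_ne_zero,
    intervalIntegral.integral_of_le hw, ← integral_Icc_eq_integral_Ioc,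
    ← integral_indicator measurableSet_Icc, ← integral_neg_eq_self]
  congr 1
  ext y
  have hpdf : gaussianPDFReal 0 1 (-y) = gaussianPDFReal 0 1 y := by simp [gaussianPDFReal]
  by_cases hy : y ∈ Set.Icc 0 (biasWidth n)
  · rw [Set.indicator_of_mem hy, if_pos ⟨by linarith [hy.2], by linarith [hy.1]⟩, hpdf]
    simp; ring
  · rw [Set.indicator_of_notMem hy, if_neg]
    · simp
    · rintro ⟨h1, h2⟩
      exact hy ⟨by linarith, by linarith⟩

lemma gaussianPDFReal_ge {y : ℝ} (h0 : 0 ≤ y) (h1 : y ≤ 1 / 4) :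
    1 / 4 ≤ gaussianPDFReal 0 1 y := by
  have hp : √(2 * Real.pi * (1 : ℝ≥0)) ≤ 8 / 3 := by
    rw [Real.sqrt_le_left (by norm_num)]
    have := Real.pi_lt_d2
    push_cast; linarith
  have hp0 : 0 < √(2 * Real.pi * (1 : ℝ≥0)) := by
    apply Real.sqrt_pos.2; have := Real.pi_pos; push_cast; linarith
  have he : 15 / 16 ≤ Real.exp (-(y - 0) ^ 2 / (2 * (1 : ℝ≥0))) := by
    have := Real.add_one_le_exp (-(y - 0) ^ 2 / (2 * ((1 : ℝ≥0) : ℝ)))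
    refine le_trans ?_ this
    push_cast
    nlinarith
  rw [gaussianPDFReal]
  calc (1 / 4 : ℝ) ≤ (8 / 3)⁻¹ * (15 / 16) := by norm_num
    _ ≤ _ := by gcongr

lemma continuous_gaussianPDFReal : Continuous (gaussianPDFReal 0 1) := by
  rw [gaussianPDFReal_def]; fun_prop

/-- Since the filter is the inverse of this mass, the bound prevents the filter from being large. On
the window `He n` keeps one sign: with `A = He (2 * l) 0` it is at least `|A| / 2` in absolute value
in even degree and at least `(2 * l + 1) * |A| * y / 2` in odd degree, while the squared density is
at least `1 / 16`. Integrate over the window, whose squared width is `1 / (16 * (n + 1))`, and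
insert `(2 * l)! ≤ (2 * l + 1) * A ^ 2`. Multiplying by `A` and squaring avoids tracking the sign of
`A`. -/
lemma factorial_le_biasMass_sq (n : ℕ) :
    (n.factorial : ℝ) ≤ (1024 * (n + 1) * biasMass n) ^ 2 := by
  have hw := biasWidth_pos n
  have hw4 := biasWidth_le n
  have hn1 : (0 : ℝ) < √(n + 1) := by positivity
  have hwn : biasWidth n * √(n + 1) = 1 / 4 := by
    unfold biasWidth; field_simp
  have hwsq : biasWidth n ^ 2 = 1 / (16 * (n + 1)) := by
    unfold biasWidth
    rw [div_pow, mul_pow, Real.sq_sqrt (by positivity)]; norm_num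
  rw [biasMass_eq]
  have hcont : ∀ c : ℝ, Continuous fun y => c * (He n y * gaussianPDFReal 0 1 y ^ 2) := fun c =>
    continuous_const.mul ((continuous_He n).mul (continuous_gaussianPDFReal.pow 2))
  have hpdf2 : ∀ y ∈ Set.Icc 0 (biasWidth n), 1 / 16 ≤ gaussianPDFReal 0 1 y ^ 2 := by
    intro y hy
    have := gaussianPDFReal_ge hy.1 (hy.2.trans hw4)
    nlinarith
  obtain ⟨l, hl | hl⟩ := Nat.even_or_odd' n
  · subst hl
    set A := He (2 * l) 0 with hA
    have hfac := He_even_zero_sq l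
    rw [← hA] at hfac
    have hn : ((2 * l : ℕ) : ℝ) = 2 * l := by push_cast; ring
    have hlow : A ^ 2 / 32 * biasWidth (2 * l) ≤
        A * ∫ y in (0 : ℝ)..biasWidth (2 * l), He (2 * l) y * gaussianPDFReal 0 1 y ^ 2 := by
      rw [← intervalIntegral.integral_const_mul]
      have := intervalIntegral.integral_mono_on (μ := volume) (a := 0) (b := biasWidth (2 * l)) hw.le
        (f := fun _ => A ^ 2 / 32)
        (g := fun y => A * (He (2 * l) y * gaussianPDFReal 0 1 y ^ 2))
        (continuous_const.intervalIntegrable _ _) ((hcont A).intervalIntegrable _ _) (fun y hy => by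
          have h1 := He_even_ge l hy.1 (by
            rw [hn] at hwn; rw [← hwn]; gcongr; exact hy.2)
          have h2 := hpdf2 y hy
          rw [← hA] at h1
          have h3 : 0 ≤ A ^ 2 / 2 := by positivity
          calc A ^ 2 / 32 = A ^ 2 / 2 * (1 / 16) := by ring
            _ ≤ (A * He (2 * l) y) * gaussianPDFReal 0 1 y ^ 2 := by gcongr; linarith
            _ = _ := by ring)
      rw [intervalIntegral.integral_const, sub_zero, smul_eq_mul] at this
      linarith
    set I := ∫ y in (0 : ℝ)..biasWidth (2 * l), He (2 * l) y * gaussianPDFReal 0 1 y ^ 2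
    have hA0 : 0 < A ^ 2 := by
      have h1 : (0 : ℝ) < (2 * l).factorial := by positivity
      have : (0 : ℝ) < 2 * l + 1 := by positivity
      by_contra h
      have h2 : A ^ 2 = 0 := le_antisymm (not_lt.1 h) (sq_nonneg _)
      rw [h2] at hfac; linarith
    -- square the lower bound and cancel
    have hsq : (A ^ 2 / 32 * biasWidth (2 * l)) ^ 2 ≤ (A * I) ^ 2 := by
      gcongr
    have h3 : A ^ 2 / 1024 * biasWidth (2 * l) ^ 2 ≤ I ^ 2 := by
      have : A ^ 2 * (A ^ 2 / 1024 * biasWidth (2 * l) ^ 2) ≤ A ^ 2 * I ^ 2 := by nlinarith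
      exact le_of_mul_le_mul_left this hA0
    rw [hwsq, hn] at h3
    rw [hn]
    have hl0 : (0 : ℝ) ≤ l := by positivity
    calc ((2 * l).factorial : ℝ) ≤ (2 * l + 1) * A ^ 2 := hfac
      _ = 16384 * (2 * l + 1) ^ 2 * (A ^ 2 / 1024 * (1 / (16 * (2 * l + 1)))) := by
          field_simp; ring
      _ ≤ 16384 * (2 * l + 1) ^ 2 * I ^ 2 := by gcongr
      _ ≤ _ := by
        have : 0 ≤ (2 * (l : ℝ) + 1) ^ 2 * I ^ 2 := by positivity
        nlinarith
  · subst hl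
    set A := He (2 * l) 0 with hA
    have hfac := He_even_zero_sq l
    rw [← hA] at hfac
    have hn : ((2 * l + 1 : ℕ) : ℝ) = 2 * l + 1 := by push_cast; ring
    set c : ℝ := (2 * l + 1) * A ^ 2 / 32 with hc
    have hlow : c * (biasWidth (2 * l + 1) ^ 2 / 2) ≤
        A * ∫ y in (0 : ℝ)..biasWidth (2 * l + 1),
          He (2 * l + 1) y * gaussianPDFReal 0 1 y ^ 2 := by
      rw [← intervalIntegral.integral_const_mul]
      have := intervalIntegral.integral_mono_on (μ := volume) (a := 0) (b := biasWidth (2 * l + 1)) hw.le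
        (f := fun y => c * y)
        (g := fun y => A * (He (2 * l + 1) y * gaussianPDFReal 0 1 y ^ 2))
        ((continuous_const.mul continuous_id).intervalIntegrable _ _)
        ((hcont A).intervalIntegrable _ _) (fun y hy => by
          have h1 := He_odd_ge l hy.1 (by
            rw [hn] at hwn; rw [← hwn]
            have : √(2 * (l : ℝ) + 1) ≤ √(2 * l + 1 + 1) := Real.sqrt_le_sqrt (by linarith)
            exact mul_le_mul hy.2 this (Real.sqrt_nonneg _) hw.le)
          have h2 := hpdf2 y hy
          rw [← hA] at h1
          have h3 : 0 ≤ (2 * l + 1) * A ^ 2 / 2 * y := mul_nonneg (by positivity) hy.1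
          calc c * y = (2 * l + 1) * A ^ 2 / 2 * y * (1 / 16) := by rw [hc]; ring
            _ ≤ (A * He (2 * l + 1) y) * gaussianPDFReal 0 1 y ^ 2 := by gcongr; linarith
            _ = _ := by ring)
      rw [intervalIntegral.integral_const_mul, integral_id] at this
      simpa using this
    set I := ∫ y in (0 : ℝ)..biasWidth (2 * l + 1),
      He (2 * l + 1) y * gaussianPDFReal 0 1 y ^ 2
    have hA0 : 0 < A ^ 2 := by
      have h1 : (0 : ℝ) < (2 * l).factorial := by positivity
      have : (0 : ℝ) < 2 * l + 1 := by positivity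
      by_contra h
      have h2 : A ^ 2 = 0 := le_antisymm (not_lt.1 h) (sq_nonneg _)
      rw [h2] at hfac; linarith
    rw [hwsq, hn] at hlow
    have hl0 : (0 : ℝ) ≤ l := by positivity
    have hsq : (c * (1 / (16 * (2 * l + 1 + 1)) / 2)) ^ 2 ≤ (A * I) ^ 2 := by
      gcongr
    have h3 : (2 * l + 1) ^ 2 * A ^ 2 / (1024 * (2 * l + 1 + 1)) ^ 2 ≤ I ^ 2 := by
      refine le_of_mul_le_mul_left (le_trans (le_of_eq ?_) (hsq.trans (le_of_eq ?_))) hA0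
      · rw [hc]; field_simp; ring
      · ring
    rw [hn, Nat.factorial_succ]
    push_cast
    calc (2 * (l : ℝ) + 1) * ((2 * l).factorial : ℝ)
        ≤ (2 * (l : ℝ) + 1) * ((2 * l + 1) * A ^ 2) := by gcongr
      _ = (1024 * (2 * l + 1 + 1)) ^ 2 *
          ((2 * l + 1) ^ 2 * A ^ 2 / (1024 * (2 * l + 1 + 1)) ^ 2) := by
          field_simp
      _ ≤ (1024 * (2 * l + 1 + 1)) ^ 2 * I ^ 2 := by gcongr
      _ = _ := by ring

lemma biasMass_ne_zero (n : ℕ) : biasMass n ≠ 0 := by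
  have h := factorial_le_biasMass_sq n
  have hf : (0 : ℝ) < n.factorial := by positivity
  intro h0
  rw [h0, mul_zero, zero_pow two_ne_zero] at h
  linarith

/-- The bias filter of degree `i`: together with the Hermite polynomial of degree `i` it
represents the monomial of degree `i`. -/
def biasFilter : ℕ → ℝ → ℝ
  | 0, _ => 2
  | n + 1, b => if -biasWidth n ≤ b ∧ b ≤ 0 then (biasMass n)⁻¹ else 0

lemma measurable_biasFilter (i : ℕ) : Measurable (biasFilter i) := by
  cases i with
  | zero => exact measurable_const
  | succ n =>
    exact Measurable.ite (measurableSet_Icc (a := -biasWidth n) (b := 0)) measurable_const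
      measurable_const

/-- The normalization matches `∫ (He i) ^ 2 = i!`. The polynomial loss `(i + 1) ^ 3` is below the
square of the weight `(i + 1) ^ 1.75` of the sample complexity. -/
lemma biasFilter_sq_le (i : ℕ) (b : ℝ) :
    (i.factorial : ℝ) * biasFilter i b ^ 2 ≤ (1024 : ℝ) ^ 2 * (i + 1) ^ 3 := by
  cases i with
  | zero => simp [biasFilter]; norm_num
  | succ n =>
    have h := factorial_le_biasMass_sq n
    have hne := biasMass_ne_zero n
    simp only [biasFilter]
    split_ifs
    · rw [Nat.factorial_succ]
      push_cast
      rw [inv_pow, ← div_eq_mul_inv, div_le_iff₀ (by positivity)]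
      calc ((n : ℝ) + 1) * n.factorial ≤ (n + 1) * (1024 * (n + 1) * biasMass n) ^ 2 := by gcongr
        _ = 1024 ^ 2 * (n + 1) ^ 3 * biasMass n ^ 2 := by ring
        _ ≤ _ := by gcongr; linarith
    · simp; positivity

lemma abs_biasFilter_le (i : ℕ) (b : ℝ) :
    |biasFilter i b| ≤ 1024 * (i + 1) ^ 2 / √(i.factorial) := by
  have h := biasFilter_sq_le i b
  have hf : (0 : ℝ) < √(i.factorial) := by positivity
  rw [le_div_iff₀ hf, ← abs_of_pos hf, ← abs_mul]
  apply abs_le_of_sq_le_sq _ (by positivity)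
  rw [mul_pow, Real.sq_sqrt (by positivity), mul_comm]
  refine h.trans ?_
  have : (1 : ℝ) ≤ i + 1 := by have : (0 : ℝ) ≤ i := by positivity
                               linarith
  calc (1024 : ℝ) ^ 2 * (i + 1) ^ 3 ≤ (1024 : ℝ) ^ 2 * (i + 1) ^ 4 := by
        gcongr
        · norm_num
    _ = _ := by ring

lemma integral_gaussian_halfspace (b : ℝ) :
    ∫ g, (if 0 ≤ g + b then (1 : ℝ) else 0) ∂(gaussianReal 0 1)
      = (gaussianReal 0 1).real (Set.Ici (-b)) := by
  rw [← integral_indicator_one measurableSet_Ici]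
  congr 1; ext g
  by_cases h : 0 ≤ g + b
  · rw [Set.indicator_of_mem (by simp only [Set.mem_Ici]; linarith)]; simp [h]
  · rw [Set.indicator_of_notMem (by simp only [Set.mem_Ici]; linarith)]; simp [h]

/-- A half-space of the plane has Gaussian measure one half. -/
lemma integral_integral_halfspace :
    ∫ b, ∫ g, (if 0 ≤ g + b then (1 : ℝ) else 0) ∂(gaussianReal 0 1) ∂(gaussianReal 0 1)
      = 1 / 2 := by
  have hanti : (gaussianReal 0 1).map (fun x : ℝ => -x) = gaussianReal 0 1 := by
    simpa using gaussianReal_map_neg (μ := 0) (v := 1)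
  have : NullSingletonClass (gaussianReal 0 1) := nullSingletonClass_gaussianReal one_ne_zero
  set G : ℝ → ℝ := fun b => (gaussianReal 0 1).real (Set.Ici (-b)) with hG
  have hGm : Measurable G := by
    have : Monotone G := by
      intro a b hab
      exact measureReal_mono (Set.Ici_subset_Ici.2 (by linarith))
    exact this.measurable
  -- By symmetry of the Gaussian the half-lines for `b` and `-b` have complementary masses, so `G`
  -- averages to one half.
  have hsym : ∀ b, G b + G (-b) = 1 := by
    intro b
    simp only [hG, neg_neg]
    have h1 : (gaussianReal 0 1).real (Set.Ici (-b)) = (gaussianReal 0 1).real (Set.Iio b) := by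
      conv_lhs => rw [← hanti]
      rw [map_measureReal_apply measurable_neg measurableSet_Ici]
      have : (fun x : ℝ => -x) ⁻¹' Set.Ici (-b) = Set.Iic b := by
        ext x; simp
      rw [this]
      exact measureReal_congr Iio_ae_eq_Iic.symm
    rw [h1, ← measureReal_union (by
      rw [Set.disjoint_left]; intro x h1 h2; simp at h1 h2; linarith) measurableSet_Ici,
      Set.Iio_union_Ici, probReal_univ]
  have hGi : Integrable G (gaussianReal 0 1) :=
    Integrable.of_bound hGm.aestronglyMeasurable 1 (Filter.Eventually.of_forall fun b => by
      rw [Real.norm_eq_abs, abs_of_nonneg measureReal_nonneg]; exact measureReal_le_one)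
  have hneg : ∫ b, G (-b) ∂(gaussianReal 0 1) = ∫ b, G b ∂(gaussianReal 0 1) := by
    conv_rhs => rw [← hanti]
    rw [integral_map measurable_neg.aemeasurable hGm.aestronglyMeasurable]
  have hsum : ∫ b, G b ∂(gaussianReal 0 1) + ∫ b, G (-b) ∂(gaussianReal 0 1) = 1 := by
    have hmp : MeasurePreserving (fun x : ℝ => -x) (gaussianReal 0 1) (gaussianReal 0 1) :=
      ⟨measurable_neg, hanti⟩
    have hGn : Integrable (fun b => G (-b)) (gaussianReal 0 1) :=
      hmp.integrable_comp_of_integrable hGi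
    rw [← integral_add hGi hGn]
    simp [hsym]
  simp only [integral_gaussian_halfspace]
  change ∫ b, G b ∂(gaussianReal 0 1) = 1 / 2
  linarith

/-- Indicator representation of monomials. -/
lemma integral_monomial (x : ℝ) {v : ℝ≥0} (hv : (v : ℝ) = 1 - x ^ 2) (i : ℕ) :
    ∫ b, ∫ g, ∫ t, (if 0 ≤ g + b then He i (x * g + t) * biasFilter i b else 0)
      ∂(gaussianReal 0 v) ∂(gaussianReal 0 1) ∂(gaussianReal 0 1) = x ^ i := by
  have e1 : ∀ b g, ∫ t, (if 0 ≤ g + b then He i (x * g + t) * biasFilter i b else 0)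
      ∂(gaussianReal 0 v) = x ^ i * (biasFilter i b * (if 0 ≤ g + b then He i g else 0)) := by
    intro b g
    split_ifs
    · rw [integral_mul_const, integral_He_add x hv]; ring
    · simp
  simp only [e1, integral_const_mul]
  cases i with
  -- Degree zero is not covered by the tail formula; there the open gate itself has mean `1 / 2`,
  -- compensated by the constant filter `2`.
  | zero =>
    simp only [biasFilter, He_zero, integral_const_mul, integral_integral_halfspace]
    norm_num
  | succ n =>
    simp only [integral_indicator_He_succ]
    have hne := biasMass_ne_zero n
    have e2 : ∀ b, biasFilter (n + 1) b * (He n (-b) * gaussianPDFReal 0 1 b) =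
        (biasMass n)⁻¹ *
          (if -biasWidth n ≤ b ∧ b ≤ 0 then He n (-b) * gaussianPDFReal 0 1 b else 0) := by
      intro b
      simp only [biasFilter]
      split_ifs <;> simp
    simp only [e2, integral_const_mul]
    rw [← biasMass, inv_mul_cancel₀ hne, mul_one]

end

end SAMGen

namespace SAMGen

noncomputable section

/-! ### Representing smooth functions by random indicators -/

/-- The joint law of bias, projection on the input, and the independent remainder. -/
def projLaw (v : ℝ≥0) : Measure (ℝ × ℝ × ℝ) :=
  (gaussianReal 0 1).prod ((gaussianReal 0 1).prod (gaussianReal 0 v))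

lemma map_add_gaussian (x : ℝ) {v : ℝ≥0} (hv : (v : ℝ) = 1 - x ^ 2) :
    ((gaussianReal 0 1).prod (gaussianReal 0 v)).map (fun q : ℝ × ℝ => x * q.1 + q.2)
      = gaussianReal 0 1 := by
  have h1 : ((gaussianReal 0 1).prod (gaussianReal 0 v)).map (fun q : ℝ × ℝ => x * q.1)
      = gaussianReal 0 (NNReal.mk (x ^ 2) (sq_nonneg x)) := by
    have : (fun q : ℝ × ℝ => x * q.1) = (fun y => x * y) ∘ Prod.fst := rfl
    rw [this, ← Measure.map_map (by fun_prop) measurable_fst, Measure.map_fst_prod]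
    simp [gaussianReal_map_const_mul]
  have h2 : ((gaussianReal 0 1).prod (gaussianReal 0 v)).map (fun q : ℝ × ℝ => q.2)
      = gaussianReal 0 v := by
    rw [Measure.map_snd_prod]; simp
  have hind : IndepFun (fun q : ℝ × ℝ => x * q.1) (fun q : ℝ × ℝ => q.2)
      ((gaussianReal 0 1).prod (gaussianReal 0 v)) :=
    indepFun_prod (X := fun y : ℝ => x * y) (Y := fun y : ℝ => y) (by fun_prop) (by fun_prop)
  have := gaussianReal_add_gaussianReal_of_indepFun hind h1 h2
  rw [show (fun q : ℝ × ℝ => x * q.1 + q.2) =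
    (fun q : ℝ × ℝ => x * q.1) + (fun q : ℝ × ℝ => q.2) from rfl, this]
  congr 1
  · simp
  · apply NNReal.coe_injective
    push_cast
    rw [hv]
    ring

/-- The finite Hermite expansion with coefficients `c`. -/
def hermiteSum (c : ℕ → ℝ) (n : ℕ) (u b : ℝ) : ℝ :=
  ∑ i ∈ Finset.range n, c i * (He i u * biasFilter i b)

/-- The Hermite expansion cut off at level `B`. -/
def hermiteCut (c : ℕ → ℝ) (n : ℕ) (B : ℝ) (u b : ℝ) : ℝ :=
  if |u| ≤ B then hermiteSum c n u b else 0

lemma measurable_hermiteSum (c : ℕ → ℝ) (n : ℕ) :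
    Measurable (Function.uncurry (hermiteSum c n)) := by
  unfold hermiteSum Function.uncurry
  refine Finset.measurable_sum _ fun i _ => ?_
  exact (((measurable_He i).comp measurable_fst).mul
    ((measurable_biasFilter i).comp measurable_snd)).const_mul _

lemma measurable_hermiteCut (c : ℕ → ℝ) (n : ℕ) (B : ℝ) :
    Measurable (Function.uncurry (hermiteCut c n B)) := by
  have : Function.uncurry (hermiteCut c n B) = fun q : ℝ × ℝ =>
      if |q.1| ≤ B then Function.uncurry (hermiteSum c n) q else 0 := rfl
  rw [this]
  exact Measurable.ite (measurableSet_le (by fun_prop) measurable_const)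
    (measurable_hermiteSum c n) measurable_const

lemma hermiteSum_sq_integrable (c : ℕ → ℝ) (n : ℕ) (b : ℝ) :
    Integrable (fun u => hermiteSum c n u b ^ 2) (gaussianReal 0 1) := by
  have h := integrable_eval_gaussianReal
    ((∑ i ∈ Finset.range n, Polynomial.C (c i * biasFilter i b) * hermiteR i) ^ 2) 1
  refine h.congr (Filter.Eventually.of_forall fun u => ?_)
  simp only [Polynomial.eval_pow, Polynomial.eval_finsetSum, Polynomial.eval_mul,
    Polynomial.eval_C, hermiteSum, He]
  congr 1
  exact Finset.sum_congr rfl fun i _ => by ring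

/-- Second moment of the Hermite expansion. -/
lemma integral_hermiteSum_sq_le (c : ℕ → ℝ) (n : ℕ) (b : ℝ) :
    ∫ u, hermiteSum c n u b ^ 2 ∂(gaussianReal 0 1)
      ≤ (1024 * ∑ i ∈ Finset.range n, ((i : ℝ) + 1) ^ (1.75 : ℝ) * |c i|) ^ 2 := by
  set s : ℕ → ℝ := fun i => 1024 * ((i : ℝ) + 1) ^ (1.75 : ℝ) with hs
  have hs0 : ∀ i, 0 < s i := fun i => by simp only [hs]; positivity
  have hs2 : ∀ i : ℕ, (1024 : ℝ) ^ 2 * (((i : ℕ) : ℝ) + 1) ^ 3 ≤ s i ^ 2 := by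
    intro i
    simp only [hs, mul_pow]
    gcongr
    rw [← Real.rpow_natCast, ← Real.rpow_natCast, ← Real.rpow_mul (by positivity)]
    apply Real.rpow_le_rpow_of_exponent_le
    · have : (0 : ℝ) ≤ i := by positivity
      linarith
    · norm_num
  set Q := ∑ i ∈ Finset.range n, |c i| * s i with hQ
  have hQ' : 1024 * ∑ i ∈ Finset.range n, ((i : ℝ) + 1) ^ (1.75 : ℝ) * |c i| = Q := by
    rw [hQ, Finset.mul_sum]
    exact Finset.sum_congr rfl fun i _ => by simp only [hs]; ring
  have hQ0 : 0 ≤ Q := Finset.sum_nonneg fun i _ => mul_nonneg (abs_nonneg _) (hs0 i).le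
  rw [hQ']
  -- Cauchy–Schwarz with weights `|c i| * s i`. After integration each square contributes `i!`,
  -- which the filter cancels, and the result is the full square of `Q`; orthogonality of the
  -- Hermite polynomials is not needed.
  have hpt : ∀ u, hermiteSum c n u b ^ 2 ≤
      Q * ∑ i ∈ Finset.range n, |c i| * s i / (i.factorial : ℝ) * He i u ^ 2 := by
    intro u
    have h1 := Finset.sum_sq_le_sum_mul_sum_of_sq_le_mul (Finset.range n)
      (r := fun i => c i * (He i u * biasFilter i b)) (f := fun i => |c i| * s i)
      (g := fun i => |c i| / s i * (He i u * biasFilter i b) ^ 2)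
      (fun i _ => mul_nonneg (abs_nonneg _) (hs0 i).le)
      (fun i _ => mul_nonneg (div_nonneg (abs_nonneg _) (hs0 i).le) (sq_nonneg _))
      (fun i _ => by
        have := (hs0 i).ne'
        rw [mul_pow, ← sq_abs (c i)]
        field_simp
        exact le_rfl)
    refine h1.trans (mul_le_mul_of_nonneg_left (Finset.sum_le_sum fun i _ => ?_) hQ0)
    have hf : (0 : ℝ) < i.factorial := by positivity
    have hb : biasFilter i b ^ 2 ≤ s i ^ 2 / i.factorial := by
      rw [le_div_iff₀ hf, mul_comm]
      exact (biasFilter_sq_le i b).trans (hs2 i)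
    calc |c i| / s i * (He i u * biasFilter i b) ^ 2
        = |c i| / s i * He i u ^ 2 * biasFilter i b ^ 2 := by ring
      _ ≤ |c i| / s i * He i u ^ 2 * (s i ^ 2 / i.factorial) := by
          have := (hs0 i).le
          gcongr
      _ = _ := by
          have := (hs0 i).ne'
          field_simp
  have hint : Integrable (fun u => Q * ∑ i ∈ Finset.range n,
      |c i| * s i / (i.factorial : ℝ) * He i u ^ 2) (gaussianReal 0 1) :=
    (integrable_finsetSum _ fun i _ => (integrable_He_sq i).const_mul _).const_mul _
  calc ∫ u, hermiteSum c n u b ^ 2 ∂(gaussianReal 0 1)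
      ≤ ∫ u, Q * ∑ i ∈ Finset.range n, |c i| * s i / (i.factorial : ℝ) * He i u ^ 2
          ∂(gaussianReal 0 1) :=
        integral_mono (hermiteSum_sq_integrable c n b) hint hpt
    _ = Q ^ 2 := by
        rw [integral_const_mul, integral_finsetSum _ fun i _ => (integrable_He_sq i).const_mul _]
        simp only [integral_const_mul, integral_He_sq]
        rw [sq]
        congr 1
        refine Finset.sum_congr rfl fun i _ => ?_
        have hf : (i.factorial : ℝ) ≠ 0 := by positivity
        field_simp

/-- The factor `√i ^ i` of the Hermite bound is absorbed by `√(i!)` up to `2 ^ i`, since `i ^ i ≤ e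
^ i * i!`. For `i ≥ 1` the base is at most `2 * max (4 * √l) (7 * √i)`, and `(i + 1) ^ 2 ≤ 4 ^ i`.
Only geometric factors remain, `112 ^ i` for the part with `√i` and `64 ^ i` for the part with `√l`,
which is what the constant `C` in the network complexity is for. -/
lemma hermite_term_le {l C : ℝ} (hC : 1024 ≤ C) (i : ℕ) :
    (4 * √l + 6 + √i) ^ i * (1024 * (i + 1) ^ 2 / √(i.factorial))
      ≤ 1024 * ((C * 1) ^ i + (√l / √i * (C * 1)) ^ i) := by
  rcases Nat.eq_zero_or_pos i with rfl | hi
  · norm_num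
  have hi' : (1 : ℝ) ≤ i := by exact_mod_cast hi
  have hsi : 1 ≤ √(i : ℝ) := Real.one_le_sqrt.2 hi'
  have hsl := Real.sqrt_nonneg l
  have hfac : √(i : ℝ) ^ i / √(i.factorial) ≤ 2 ^ i := by
    have hf : (0 : ℝ) < i.factorial := by positivity
    rw [div_le_iff₀ (by positivity)]
    have h1 := Real.pow_div_factorial_le_exp (i : ℝ) (by positivity) i
    have h2 : Real.exp (i : ℝ) ≤ 4 ^ i := by
      have : Real.exp (i : ℝ) = Real.exp 1 ^ i := by rw [← Real.exp_nat_mul]; simp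
      rw [this]
      have := Real.exp_one_lt_d9
      gcongr
      linarith
    have h3 : (i : ℝ) ^ i ≤ 4 ^ i * i.factorial := by
      rw [div_le_iff₀ hf] at h1
      exact h1.trans (by gcongr)
    refine le_of_sq_le_sq ?_ (by positivity)
    rw [mul_pow, Real.sq_sqrt hf.le, ← pow_mul, mul_comm i 2, pow_mul, Real.sq_sqrt (by positivity),
      ← pow_mul, mul_comm i 2, pow_mul]
    norm_num
    exact h3
  have hpoly : ((i : ℝ) + 1) ^ 2 ≤ 4 ^ i := by
    have h : ((i : ℝ) + 1) ≤ 2 ^ i := by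
      have := Nat.lt_two_pow_self (n := i)
      exact_mod_cast this
    calc ((i : ℝ) + 1) ^ 2 ≤ (2 ^ i) ^ 2 := by gcongr
      _ = 4 ^ i := by rw [← pow_mul, mul_comm, pow_mul]; norm_num
  have hbase : (4 * √l + 6 + √i) ^ i ≤ 2 ^ i * ((4 * √l) ^ i + (7 * √i) ^ i) := by
    have h1 : 4 * √l + 6 + √i ≤ 2 * max (4 * √l) (7 * √i) := by
      have := le_max_left (4 * √l) (7 * √i)
      have := le_max_right (4 * √l) (7 * √i)
      linarith
    calc (4 * √l + 6 + √i) ^ i ≤ (2 * max (4 * √l) (7 * √i)) ^ i := by gcongr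
      _ = 2 ^ i * (max (4 * √l) (7 * √i)) ^ i := mul_pow _ _ _
      _ ≤ _ := by
        gcongr
        rcases max_choice (4 * √l) (7 * √(i : ℝ)) with h | h <;> rw [h]
        · have : 0 ≤ (7 * √(i : ℝ)) ^ i := by positivity
          linarith
        · have : 0 ≤ (4 * √l) ^ i := by positivity
          linarith
  have hsi0 : 0 < √(i : ℝ) ^ i := by positivity
  calc (4 * √l + 6 + √i) ^ i * (1024 * (i + 1) ^ 2 / √(i.factorial))
      ≤ (2 ^ i * ((4 * √l) ^ i + (7 * √i) ^ i)) * (1024 * 4 ^ i / √(i.factorial)) := by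
        gcongr
    _ = 1024 * (2 ^ i * 4 ^ i) * ((4 * √l / √i) ^ i + 7 ^ i) * (√i ^ i / √(i.factorial)) := by
        rw [div_pow, mul_pow 7]
        field_simp
    _ ≤ 1024 * (2 ^ i * 4 ^ i) * ((4 * √l / √i) ^ i + 7 ^ i) * 2 ^ i := by gcongr
    _ = 1024 * (112 ^ i + (√l / √i * 64) ^ i) := by
        have e1 : (112 : ℝ) ^ i = 2 ^ i * 4 ^ i * 2 ^ i * 7 ^ i := by
          rw [← mul_pow, ← mul_pow, ← mul_pow]; norm_num
        have e2 : (√l / √i * 64) ^ i = 2 ^ i * 4 ^ i * 2 ^ i * (4 * √l / √i) ^ i := by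
          rw [← mul_pow, ← mul_pow, ← mul_pow]; congr 1; ring
        rw [e1, e2]; ring
    _ ≤ _ := by
        gcongr <;> linarith

lemma abs_hermiteCut_le {l C : ℝ} (hC : 1024 ≤ C) (c : ℕ → ℝ) (n : ℕ)
    (u b : ℝ) :
    |hermiteCut c n (4 * √l + 6) u b| ≤
      1024 * ∑ i ∈ Finset.range n, ((C * 1) ^ i + (√l / √i * (C * 1)) ^ i) * |c i| := by
  have hsl := Real.sqrt_nonneg l
  have h0 : 0 ≤ 1024 * ∑ i ∈ Finset.range n, ((C * 1) ^ i + (√l / √i * (C * 1)) ^ i) * |c i| := by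
    have : 0 ≤ C * 1 := by linarith
    positivity
  unfold hermiteCut
  split_ifs with h
  · rw [Finset.mul_sum]
    refine (Finset.abs_sum_le_sum_abs _ _).trans (Finset.sum_le_sum fun i _ => ?_)
    rw [abs_mul, abs_mul]
    have h1 : |He i u| ≤ (4 * √l + 6 + √i) ^ i := (abs_He_le i u).trans (by gcongr)
    calc |c i| * (|He i u| * |biasFilter i b|)
        ≤ |c i| * ((4 * √l + 6 + √i) ^ i * (1024 * (i + 1) ^ 2 / √(i.factorial))) := by
          gcongr
          exact abs_biasFilter_le i b
      _ ≤ |c i| * (1024 * ((C * 1) ^ i + (√l / √i * (C * 1)) ^ i)) := by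
          gcongr ?_ * ?_
          exact hermite_term_le hC i
      _ = _ := by ring
  · simpa using h0

lemma gaussian_abs_tail (B : ℝ) (hB : 0 ≤ B) :
    (gaussianReal 0 1).real {u | B < |u|} ≤ 2 * Real.exp (-B ^ 2 / 2) := by
  have hsub : HasSubgaussianMGF (fun x : ℝ => x) 1 (gaussianReal 0 1) := by
    refine ⟨fun t => integrable_exp_mul_gaussianReal t, fun t => ?_⟩
    rw [mgf_fun_id_gaussianReal]
    simp
  have h1 := hsub.measure_ge_le hB
  have h2 := hsub.neg.measure_ge_le hB
  have hss : {u : ℝ | B < |u|} ⊆ {u | B ≤ u} ∪ {u | B ≤ (-fun x : ℝ => x) u} := by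
    intro u hu
    simp only [Set.mem_ofPred_eq] at hu
    rcases lt_abs.1 hu with h | h
    · left; exact h.le
    · right; exact h.le
  refine (measureReal_mono hss).trans ((measureReal_union_le _ _).trans ?_)
  simp only [NNReal.coe_one, mul_one] at h1 h2
  linarith

/-- Integral of the Hermite expansion over a random half-space. -/
lemma integral_hermiteSum (c : ℕ → ℝ) (n : ℕ) {x : ℝ} {v : ℝ≥0} (hv : (v : ℝ) = 1 - x ^ 2) :
    Integrable (fun q : ℝ × ℝ × ℝ => if 0 ≤ q.2.1 + q.1 then
        hermiteSum c n (x * q.2.1 + q.2.2) q.1 else 0) (projLaw v) ∧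
    ∫ q, (if 0 ≤ q.2.1 + q.1 then hermiteSum c n (x * q.2.1 + q.2.2) q.1 else 0) ∂(projLaw v)
      = ∑ i ∈ Finset.range n, c i * x ^ i := by
  set f : ℕ → ℝ × ℝ × ℝ → ℝ := fun i q =>
    if 0 ≤ q.2.1 + q.1 then He i (x * q.2.1 + q.2.2) * biasFilter i q.1 else 0 with hf
  have hset : MeasurableSet {q : ℝ × ℝ × ℝ | 0 ≤ q.2.1 + q.1} :=
    measurableSet_le measurable_const (by fun_prop)
  have hfm : ∀ i, Measurable (f i) := fun i =>
    Measurable.ite hset (((measurable_He i).comp (by fun_prop)).mul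
      ((measurable_biasFilter i).comp measurable_fst)) measurable_const
  have hmpu : MeasurePreserving (fun q : ℝ × ℝ × ℝ => x * q.2.1 + q.2.2) (projLaw v)
      (gaussianReal 0 1) := by
    refine ⟨by fun_prop, ?_⟩
    have : (fun q : ℝ × ℝ × ℝ => x * q.2.1 + q.2.2) =
        (fun q : ℝ × ℝ => x * q.1 + q.2) ∘ Prod.snd := rfl
    rw [this, ← Measure.map_map (by fun_prop) measurable_snd, projLaw, Measure.map_snd_prod]
    simp [map_add_gaussian x hv]
  have hfi : ∀ i, Integrable (f i) (projLaw v) := by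
    intro i
    have hHe : Integrable (He i) (gaussianReal 0 1) := integrable_eval_gaussianReal (hermiteR i) 1
    have h1 : Integrable (fun q : ℝ × ℝ × ℝ => He i (x * q.2.1 + q.2.2)) (projLaw v) :=
      hmpu.integrable_comp_of_integrable hHe
    refine Integrable.mono' (h1.norm.mul_const (1024 * (i + 1) ^ 2 / √(i.factorial)))
      (hfm i).aestronglyMeasurable (Filter.Eventually.of_forall fun q => ?_)
    simp only [hf]
    split_ifs
    · rw [norm_mul]
      gcongr
      exact abs_biasFilter_le i _
    · simp; positivity
  have hfint : ∀ i, ∫ q, f i q ∂(projLaw v) = x ^ i := by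
    intro i
    have h := hfi i
    rw [projLaw] at h ⊢
    rw [integral_prod _ h, ← integral_monomial x hv i]
    have h2 := h.prod_right_ae
    refine integral_congr_ae ?_
    filter_upwards [h2] with b hb
    rw [integral_prod _ hb]
  have heq : (fun q : ℝ × ℝ × ℝ => if 0 ≤ q.2.1 + q.1 then
        hermiteSum c n (x * q.2.1 + q.2.2) q.1 else 0)
      = fun q => ∑ i ∈ Finset.range n, c i * f i q := by
    ext q
    simp only [hf, hermiteSum]
    split_ifs <;> simp
  rw [heq]
  refine ⟨integrable_finsetSum _ fun i _ => (hfi i).const_mul _, ?_⟩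
  rw [integral_finsetSum _ fun i _ => (hfi i).const_mul _]
  simp only [integral_const_mul, hfint]

/-- The cutoff discards `|S|` on `|u| > B`, and there `|S| ≤ lam / 2 * S ^ 2 + 1 / (2 * lam)`. The
first part is controlled by the second moment and the second by the Gaussian tail. Both bounds are
uniform in the bias, because the projection is standard Gaussian and independent of it. -/
lemma hermiteCut_bias {c : ℕ → ℝ} {n : ℕ} {x : ℝ} {v : ℝ≥0} (hv : (v : ℝ) = 1 - x ^ 2) {B lam Q : ℝ}
    (hB : 0 ≤ B) (hlam : 0 < lam)
    (hQ : ∀ b, ∫ u, hermiteSum c n u b ^ 2 ∂(gaussianReal 0 1) ≤ Q) :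
    |∫ q, (if 0 ≤ q.2.1 + q.1 then hermiteCut c n B (x * q.2.1 + q.2.2) q.1 else 0) ∂(projLaw v)
      - ∑ i ∈ Finset.range n, c i * x ^ i| ≤ lam / 2 * Q + Real.exp (-B ^ 2 / 2) / lam := by
  obtain ⟨hI, hval⟩ := integral_hermiteSum c n hv
  set F : ℝ × ℝ × ℝ → ℝ := fun q =>
    if 0 ≤ q.2.1 + q.1 then hermiteSum c n (x * q.2.1 + q.2.2) q.1 else 0 with hF
  set G : ℝ × ℝ × ℝ → ℝ := fun q =>
    if 0 ≤ q.2.1 + q.1 then hermiteCut c n B (x * q.2.1 + q.2.2) q.1 else 0 with hG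
  have hset : MeasurableSet {q : ℝ × ℝ × ℝ | 0 ≤ q.2.1 + q.1} :=
    measurableSet_le measurable_const (by fun_prop)
  have hGm : Measurable G := Measurable.ite hset
    ((measurable_hermiteCut c n B).comp (g := Function.uncurry (hermiteCut c n B))
      (f := fun q : ℝ × ℝ × ℝ => (x * q.2.1 + q.2.2, q.1)) (by fun_prop)) measurable_const
  have hGF : ∀ q, ‖G q‖ ≤ ‖F q‖ := by
    intro q
    simp only [hG, hF, hermiteCut]
    split_ifs <;> simp
  have hGi : Integrable G (projLaw v) := hI.mono hGm.aestronglyMeasurable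
    (Filter.Eventually.of_forall hGF)
  set w : ℝ → ℝ → ℝ := fun b u => lam / 2 * hermiteSum c n u b ^ 2
    + 1 / (2 * lam) * ({u : ℝ | B < |u|}.indicator 1 u) with hw
  have htm : MeasurableSet {u : ℝ | B < |u|} := measurableSet_lt measurable_const (by fun_prop)
  have hpt : ∀ q, ‖G q - F q‖ ≤ w q.1 (x * q.2.1 + q.2.2) := by
    intro q
    simp only [hG, hF, hw, hermiteCut]
    set a := hermiteSum c n (x * q.2.1 + q.2.2) q.1
    have hnn : 0 ≤ lam / 2 * a ^ 2 + 1 / (2 * lam) *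
        ({u : ℝ | B < |u|}.indicator 1 (x * q.2.1 + q.2.2)) := by
      have : (0 : ℝ) ≤ {u : ℝ | B < |u|}.indicator 1 (x * q.2.1 + q.2.2) :=
        Set.indicator_nonneg (fun _ _ => by simp) _
      positivity
    split_ifs with h1 h2
    · simpa using hnn
    · rw [Set.indicator_of_mem (by simpa using h2)]
      simp only [zero_sub, norm_neg, Real.norm_eq_abs, Pi.one_apply, mul_one]
      have : 0 ≤ (lam * |a| - 1) ^ 2 := sq_nonneg _
      have e : lam / 2 * a ^ 2 + 1 / (2 * lam) = (lam ^ 2 * |a| ^ 2 + 1) / (2 * lam) := by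
        rw [sq_abs]; field_simp
      rw [e, le_div_iff₀ (by positivity)]
      nlinarith
    · simpa using hnn
  have hmpu : ∀ b : ℝ, MeasurePreserving (fun q : ℝ × ℝ => x * q.1 + q.2)
      ((gaussianReal 0 1).prod (gaussianReal 0 v)) (gaussianReal 0 1) := fun _ =>
    ⟨by fun_prop, map_add_gaussian x hv⟩
  have hwi : ∀ b, Integrable (w b) (gaussianReal 0 1) := fun b =>
    ((hermiteSum_sq_integrable c n b).const_mul _).add
      (((integrable_const (1 : ℝ)).indicator htm).const_mul _)
  have hwint : ∀ b, ∫ u, w b u ∂(gaussianReal 0 1) ≤ lam / 2 * Q + Real.exp (-B ^ 2 / 2) / lam := by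
    intro b
    simp only [hw]
    have hind : Integrable (fun u : ℝ => 1 / (2 * lam) * ({u : ℝ | B < |u|}.indicator 1 u))
      (gaussianReal 0 1) := ((integrable_const (1 : ℝ)).indicator htm).const_mul _
    rw [integral_add ((hermiteSum_sq_integrable c n b).const_mul _)
      hind, integral_const_mul,
      integral_const_mul, integral_indicator_one htm]
    have h1 := hQ b
    have h2 := gaussian_abs_tail B hB
    have e : Real.exp (-B ^ 2 / 2) / lam = 1 / (2 * lam) * (2 * Real.exp (-B ^ 2 / 2)) := by
      field_simp
    rw [e]
    gcongr
  have hdi : Integrable (fun q => ‖G q - F q‖) (projLaw v) := (hGi.sub hI).norm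
  have hd : Integrable (fun q => ‖G q - F q‖)
      ((gaussianReal 0 1).prod ((gaussianReal 0 1).prod (gaussianReal 0 v))) := hdi
  rw [← hval, ← integral_sub hGi hI]
  rw [← Real.norm_eq_abs]
  refine (norm_integral_le_integral_norm _).trans ?_
  change ∫ q, ‖G q - F q‖ ∂((gaussianReal 0 1).prod ((gaussianReal 0 1).prod (gaussianReal 0 v)))
    ≤ _
  rw [integral_prod _ hd]
  calc ∫ b, ∫ q, ‖G (b, q) - F (b, q)‖ ∂((gaussianReal 0 1).prod (gaussianReal 0 v))
        ∂(gaussianReal 0 1)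
      ≤ ∫ b, (lam / 2 * Q + Real.exp (-B ^ 2 / 2) / lam) ∂(gaussianReal 0 1) := by
        refine integral_mono_of_nonneg (Filter.Eventually.of_forall fun b =>
          integral_nonneg fun q => norm_nonneg _) (integrable_const _)
          (Filter.Eventually.of_forall fun b => ?_)
        refine le_trans ?_ (hwint b)
        have hmap : ∫ u, w b u ∂(gaussianReal 0 1) = ∫ q : ℝ × ℝ, w b (x * q.1 + q.2)
            ∂((gaussianReal 0 1).prod (gaussianReal 0 v)) := by
          conv_lhs => rw [← map_add_gaussian x hv]
          exact integral_map (by fun_prop) (by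
            rw [map_add_gaussian x hv]; exact (hwi b).aestronglyMeasurable)
        rw [hmap]
        refine integral_mono_of_nonneg (Filter.Eventually.of_forall fun q => norm_nonneg _)
          ((hmpu b).integrable_comp_of_integrable (hwi b))
          (Filter.Eventually.of_forall fun q => hpt (b, q))
    _ = _ := by simp

/-- A function of small complexity is represented, up to a small error, by a bounded
function of a random projection and a random bias, integrated over random half-spaces. -/
lemma exists_representation {Cstar ε cs cn : ℝ} (hC : 1024 ≤ Cstar) (hε : 0 < ε)
    (hε1 : ε < 1) (hcs : 1 ≤ cs) (hcsε : cs ≤ 1 / ε) (hcn : 0 ≤ cn) {φ : ℝ → ℝ}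
    (hφ : InfSmooth φ) (hs : sampleComplexity Cstar φ 1 ≤ ENNReal.ofReal cs)
    (hn : networkComplexity Cstar ε φ 1 ≤ ENNReal.ofReal cn) :
    ∃ h : ℝ → ℝ → ℝ, Measurable (Function.uncurry h) ∧ (∀ u b, |h u b| ≤ 1024 * cn) ∧
      (∀ b, ∫ u, h u b ^ 2 ∂(gaussianReal 0 1) ≤ cs ^ 2) ∧
      ∀ (x : ℝ) (v : ℝ≥0), |x| ≤ 1 → (v : ℝ) = 1 - x ^ 2 →
        |∫ q, (if 0 ≤ q.2.1 + q.1 then h (x * q.2.1 + q.2.2) q.1 else 0) ∂(projLaw v) - φ x|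
          ≤ ε ^ 2 / 1000 := by
  set c := taylorCoeff φ with hc
  set l := Real.log (1 / ε) with hl
  have hl0 : 0 ≤ l := Real.log_nonneg (by rw [le_div_iff₀ hε]; linarith)
  -- partial sums
  have hsum_s : ∀ n, ∑ i ∈ Finset.range n, ((i : ℝ) + 1) ^ (1.75 : ℝ) * |c i| ≤ cs / Cstar := by
    intro n
    have h1 : ENNReal.ofReal Cstar *
        ENNReal.ofReal (∑ i ∈ Finset.range n, ((i : ℝ) + 1) ^ (1.75 : ℝ) * |c i|)
        ≤ ENNReal.ofReal cs := by
      refine le_trans ?_ hs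
      rw [sampleComplexity, ENNReal.ofReal_sum_of_nonneg (fun i _ => by positivity)]
      gcongr
      simp only [one_pow, mul_one]
      exact ENNReal.sum_le_tsum _
    rw [← ENNReal.ofReal_mul (by linarith), ENNReal.ofReal_le_ofReal_iff (by linarith)] at h1
    rw [le_div_iff₀ (by linarith), mul_comm]
    exact h1
  have hsum_n : ∀ n, ∑ i ∈ Finset.range n,
      ((Cstar * 1) ^ i + (√l / √i * (Cstar * 1)) ^ i) * |c i| ≤ cn := by
    intro n
    have h1 : ENNReal.ofReal (∑ i ∈ Finset.range n,
        ((Cstar * 1) ^ i + (√l / √i * (Cstar * 1)) ^ i) * |c i|) ≤ ENNReal.ofReal cn := by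
      refine le_trans ?_ hn
      rw [networkComplexity, ENNReal.ofReal_sum_of_nonneg (fun i _ => by
        have : 0 ≤ Cstar * 1 := by linarith
        positivity)]
      exact ENNReal.sum_le_tsum _
    rwa [ENNReal.ofReal_le_ofReal_iff hcn] at h1
  have hsummable : Summable fun i => |c i| := by
    refine summable_of_sum_range_le (c := cs / Cstar) (fun i => abs_nonneg _) fun n => ?_
    refine le_trans (Finset.sum_le_sum fun i _ => ?_) (hsum_s n)
    have : (1 : ℝ) ≤ ((i : ℝ) + 1) ^ (1.75 : ℝ) :=
      Real.one_le_rpow (by have : (0 : ℝ) ≤ i := by positivity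
                           linarith) (by norm_num)
    have h0 := abs_nonneg (c i)
    nlinarith
  -- The degree `n` may be arbitrarily large: every bound below is a partial sum of a complexity and
  -- does not see it.
  obtain ⟨n, hn⟩ : ∃ n, ∑' i, |c (i + n)| ≤ ε ^ 2 / 2000 := by
    have h := tendsto_sum_nat_add fun i => |c i|
    have := h.eventually (ge_mem_nhds (by positivity : (0 : ℝ) < ε ^ 2 / 2000))
    exact this.exists
  have hQ : ∀ b, ∫ u, hermiteSum c n u b ^ 2 ∂(gaussianReal 0 1) ≤ cs ^ 2 := by
    intro b
    refine (integral_hermiteSum_sq_le c n b).trans ?_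
    have h0 : 0 ≤ ∑ i ∈ Finset.range n, ((i : ℝ) + 1) ^ (1.75 : ℝ) * |c i| := by positivity
    gcongr
    calc 1024 * ∑ i ∈ Finset.range n, ((i : ℝ) + 1) ^ (1.75 : ℝ) * |c i|
        ≤ Cstar * (cs / Cstar) := by gcongr; exact hsum_s n
      _ = cs := by field_simp
  refine ⟨hermiteCut c n (4 * √l + 6), measurable_hermiteCut _ _ _, fun u b => ?_, fun b => ?_,
    fun x v hx hv => ?_⟩
  · refine (abs_hermiteCut_le hC c n u b).trans ?_
    gcongr
    exact hsum_n n
  · refine le_trans (integral_mono_of_nonneg (Filter.Eventually.of_forall fun u => sq_nonneg _)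
      (hermiteSum_sq_integrable c n b) (Filter.Eventually.of_forall fun u => ?_)) (hQ b)
    simp only [hermiteCut]
    split_ifs
    · exact le_rfl
    · simp only [ne_eq, OfNat.ofNat_ne_zero, not_false_eq_true, zero_pow]; exact sq_nonneg _
  -- Since `cs ≤ 1 / ε`, a weight `lam` of order `ε ^ 4` makes the moment term of order `ε ^ 2`. The
  -- tail then has to be of order `ε ^ 6`, which the cutoff `4 * √l + 6` provides: half its square
  -- exceeds `6 * l + 16`.
  · have hbias := hermiteCut_bias (c := c) (n := n) hv (B := 4 * √l + 6) (lam := ε ^ 4 / 2000)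
      (Q := cs ^ 2) (by positivity) (by positivity) hQ
    have htail : |∑ i ∈ Finset.range n, c i * x ^ i - φ x| ≤ ε ^ 2 / 2000 := by
      have hsx := hφ.2 x hx
      have h1 := hsx.summable.sum_add_tsum_nat_add n
      rw [hsx.tsum_eq] at h1
      have h2 : ∑ i ∈ Finset.range n, c i * x ^ i - φ x = -∑' i, c (i + n) * x ^ (i + n) := by
        rw [← h1]; simp [hc]
      rw [h2, abs_neg]
      have hs2 : Summable fun i => |c (i + n)| := (summable_nat_add_iff n).2 hsummable
      refine le_trans ?_ hn
      have hle : ∀ i, ‖c (i + n) * x ^ (i + n)‖ ≤ |c (i + n)| := by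
        intro i
        rw [norm_mul, norm_pow, Real.norm_eq_abs, Real.norm_eq_abs]
        have := pow_le_one₀ (n := i + n) (abs_nonneg x) hx
        have h0 := abs_nonneg (c (i + n))
        nlinarith
      exact tsum_of_norm_bounded hs2.hasSum hle
    have hnum : ε ^ 4 / 2000 / 2 * cs ^ 2 + Real.exp (-(4 * √l + 6) ^ 2 / 2) / (ε ^ 4 / 2000)
        ≤ ε ^ 2 / 2000 := by
      have h1 : ε ^ 4 / 2000 / 2 * cs ^ 2 ≤ ε ^ 2 / 4000 := by
        have : (ε * cs) ^ 2 ≤ 1 := by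
          rw [le_div_iff₀ hε, mul_comm] at hcsε
          exact pow_le_one₀ (by positivity) hcsε
        have h2 : 0 ≤ ε ^ 2 := sq_nonneg _
        nlinarith
      have h2 : Real.exp (-(4 * √l + 6) ^ 2 / 2) ≤ ε ^ 6 * (1 / 8000000) := by
        have hsl := Real.sqrt_nonneg l
        have hsq := Real.mul_self_sqrt hl0
        have h3 : -(4 * √l + 6) ^ 2 / 2 ≤ -(6 * l) + -16 := by nlinarith
        refine (Real.exp_le_exp.2 h3).trans ?_
        rw [Real.exp_add]
        have e1 : Real.exp (-(6 * l)) = ε ^ 6 := by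
          have : -(6 * l) = Real.log (ε ^ 6) := by
            rw [hl, Real.log_pow, one_div, Real.log_inv]; push_cast; ring
          rw [this, Real.exp_log (by positivity)]
        have e2 : Real.exp (-16) ≤ 1 / 8000000 := by
          rw [Real.exp_neg, ← one_div]
          apply one_div_le_one_div_of_le (by norm_num)
          have : Real.exp 16 = Real.exp 1 ^ 16 := by rw [← Real.exp_nat_mul]; norm_num
          rw [this]
          have h9 := Real.exp_one_gt_d9
          calc (8000000 : ℝ) ≤ 2.71 ^ 16 := by norm_num
            _ ≤ Real.exp 1 ^ 16 := by gcongr; linarith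
        rw [e1]
        gcongr
      have h3 : Real.exp (-(4 * √l + 6) ^ 2 / 2) / (ε ^ 4 / 2000) ≤ ε ^ 2 / 4000 := by
        rw [div_le_iff₀ (by positivity)]
        refine h2.trans (le_of_eq ?_)
        ring
      linarith
    have := abs_sub_le (∫ q, (if 0 ≤ q.2.1 + q.1 then
      hermiteCut c n (4 * √l + 6) (x * q.2.1 + q.2.2) q.1 else 0) ∂(projLaw v))
      (∑ i ∈ Finset.range n, c i * x ^ i) (φ x)
    linarith

end

end SAMGen

namespace SAMGen

noncomputable section

/-! ### Consequences of the assumptions on the loss -/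

section Loss

variable {E : Type*} [NormedAddCommGroup E] [InnerProductSpace ℝ E] [CompleteSpace E]

lemma hasDerivAt_comp_line {f : E → ℝ} (hf : Differentiable ℝ f) (u n : E) (t : ℝ) :
    HasDerivAt (fun t : ℝ => f (u + t • n)) (inner ℝ (gradient f (u + t • n)) n) t := by
  have h1 : HasDerivAt (fun t : ℝ => u + t • n) n t := by
    simpa using ((hasDerivAt_id t).smul_const n).const_add u
  have h2 := (hf (u + t • n)).hasGradientAt.hasFDerivAt
  have h3 := h2.comp_hasDerivAt t h1
  exact h3.congr_deriv (by simp)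

lemma gradient_inner_le_sub {f : E → ℝ} (hf : Differentiable ℝ f) (hc : ConvexOn ℝ Set.univ f)
    (u v : E) : inner ℝ (gradient f u) (v - u) ≤ f v - f u := by
  have hp : ConvexOn ℝ Set.univ (fun t : ℝ => f (u + t • (v - u))) := by
    have h := hc.comp_affineMap (AffineMap.lineMap u v : ℝ →ᵃ[ℝ] E)
    have e : f ∘ (AffineMap.lineMap u v : ℝ →ᵃ[ℝ] E) = fun t : ℝ => f (u + t • (v - u)) := by
      ext t; simp [AffineMap.lineMap_apply, add_comm]
    rw [e] at h
    simpa using h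
  have h := hp.le_slope_of_hasDerivAt (x := 0) (y := 1) (Set.mem_univ _) (Set.mem_univ _)
    one_pos (hasDerivAt_comp_line hf u (v - u) 0)
  simpa [slope_def_field] using h

lemma norm_gradient_le_one {f : E → ℝ} (hl : LipschitzWith 1 f) (u : E) : ‖gradient f u‖ ≤ 1 := by
  have h := norm_fderiv_le_of_lipschitz ℝ hl (x₀ := u)
  rw [← toDual_gradient, LinearIsometryEquiv.norm_map] at h
  simpa using h

/-- In the application `F` is the output at the current weights, `F'` the output after the ascent
step, where the gradient is taken, and `G`, `Gs` are the linearized outputs at the current weights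
and at the comparator. Convexity is used at `F'`. The distance from `F'` to `F` is paid twice, once
in the pairing and once in the value of `f`; the distance from `F` to `G` is paid once. -/
lemma inner_gradient_sub_ge {f : E → ℝ} (hf : Differentiable ℝ f) (hc : ConvexOn ℝ Set.univ f)
    (hl : LipschitzWith 1 f) (F F' G Gs : E) :
    f F - f Gs - 2 * ‖F' - F‖ - ‖F - G‖ ≤ inner ℝ (gradient f F') (G - Gs) := by
  have hDn := norm_gradient_le_one hl F'
  have h0 := gradient_inner_le_sub hf hc F' Gs
  have h1 : inner ℝ (gradient f F') (F' - F) ≤ ‖F' - F‖ := by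
    refine (real_inner_le_norm _ _).trans ?_
    have := norm_nonneg (F' - F); nlinarith
  have h2 : inner ℝ (gradient f F') (F - G) ≤ ‖F - G‖ := by
    refine (real_inner_le_norm _ _).trans ?_
    have := norm_nonneg (F - G); nlinarith
  have h3 : f F - f F' ≤ ‖F' - F‖ := by
    have := hl.norm_sub_le F F'
    rw [NNReal.coe_one, one_mul, norm_sub_rev F F'] at this
    exact (le_abs_self _).trans this
  have e : G - Gs = -(Gs - F') - (F' - F) - (F - G) := by abel
  rw [e, inner_sub_right, inner_sub_right, inner_neg_right]
  linarith

/-- The descent lemma. -/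
lemma le_of_lipschitz_gradient {f : E → ℝ} (hf : Differentiable ℝ f)
    (hs : LipschitzWith 1 (gradient f)) (u n : E) :
    f (u + n) ≤ f u + inner ℝ (gradient f u) n + ‖n‖ ^ 2 / 2 := by
  set g : ℝ → ℝ := fun t => f (u + t • n) - t * inner ℝ (gradient f u) n - t ^ 2 / 2 * ‖n‖ ^ 2
    with hg
  have hd : ∀ t, HasDerivAt g (inner ℝ (gradient f (u + t • n)) n - inner ℝ (gradient f u) n
      - t * ‖n‖ ^ 2) t := by
    intro t
    have h := ((hasDerivAt_comp_line hf u n t).sub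
      ((hasDerivAt_id t).mul_const (inner ℝ (gradient f u) n))).sub
      (((hasDerivAt_pow 2 t).div_const 2).mul_const (‖n‖ ^ 2))
    exact h.congr_deriv (by simp)
  have hanti : AntitoneOn g (Set.Ici 0) := by
    refine antitoneOn_of_deriv_nonpos (convex_Ici 0)
      (fun t _ => (hd t).continuousAt.continuousWithinAt)
      (fun t _ => (hd t).differentiableAt.differentiableWithinAt) fun t ht => ?_
    rw [(hd t).deriv]
    simp only [interior_Ici, Set.mem_Ioi] at ht
    rw [← inner_sub_left]
    have h1 := real_inner_le_norm (gradient f (u + t • n) - gradient f u) n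
    have h2 : ‖gradient f (u + t • n) - gradient f u‖ ≤ t * ‖n‖ := by
      have := hs.norm_sub_le (u + t • n) u
      simpa [norm_smul, abs_of_pos ht] using this
    have h3 := norm_nonneg n
    nlinarith
  have h := hanti (Set.mem_Ici.2 le_rfl) (Set.mem_Ici.2 zero_le_one) zero_le_one
  simp only [hg, one_smul, zero_smul, add_zero] at h
  linarith

end Loss

/-! ### Freezing the activation pattern, and the one-step inequality -/

section Network

variable {m d k : ℕ} {Y : Type*}

/-- The output weights of a neuron. -/
def outWeight (θ : InitSpace m d k) (i : Fin m) : Output k := WithLp.toLp 2 fun r => initA θ r i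

/-- The pre-activation of a neuron at initialization. -/
def preact (θ : InitSpace m d k) (i : Fin m) (x : Input d) : ℝ :=
  inner ℝ (initW θ i) x + initB θ i

/-- The network with the activation pattern frozen at initialization. -/
def linNet (θ : InitSpace m d k) (V : Weights m d) (x : Input d) : Output k :=
  ∑ i, (if 0 ≤ preact θ i x then inner ℝ (V i) x else 0) • outWeight θ i

/-- Whether a pre-activation is within `τ` of changing sign. -/
def nearZero (θ : InitSpace m d k) (τ : ℝ) (i : Fin m) (x : Input d) : ℝ :=
  if |preact θ i x| ≤ τ then 1 else 0

lemma nearZero_nonneg (θ : InitSpace m d k) (τ : ℝ) (i : Fin m) (x : Input d) :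
    0 ≤ nearZero θ τ i x := by unfold nearZero; split_ifs <;> norm_num

lemma learner_eq_sum (θ : InitSpace m d k) (W : Weights m d) (x : Input d) :
    learner θ W x = ∑ i, max (inner ℝ (W i) x + initB θ i) 0 • outWeight θ i := by
  ext r
  simp [learner, outWeight, mul_comm]

lemma lossGrad_eq (L : Output k → Y → ℝ) (θ : InitSpace m d k) (z : Input d × Y)
    (W : Weights m d) (i : Fin m) :
    lossGrad L θ z W i = if 0 ≤ inner ℝ (W i) z.1 + initB θ i then
      (inner ℝ (gradient (fun u => L u z.2) (learner θ W z.1)) (outWeight θ i)) • z.1 else 0 := by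
  unfold lossGrad
  congr 2
  rw [PiLp.inner_apply]
  simp [outWeight, mul_comm]

lemma norm_lossGrad_le {L : Output k → Y → ℝ} (hL : GoodLoss L) (θ : InitSpace m d k)
    {z : Input d × Y} (hz : ‖z.1‖ = 1) (W : Weights m d) (i : Fin m) :
    ‖lossGrad L θ z W i‖ ≤ ‖outWeight θ i‖ := by
  rw [lossGrad_eq]
  split_ifs
  · rw [norm_smul, hz, mul_one]
    refine (norm_inner_le_norm _ _).trans ?_
    have := norm_gradient_le_one (hL.lipschitz z.2) (learner θ W z.1)
    have h2 := norm_nonneg (outWeight θ i)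
    nlinarith
  · simp

lemma norm_learner_sub_le (θ : InitSpace m d k) (W W' : Weights m d) {x : Input d}
    (hx : ‖x‖ = 1) :
    ‖learner θ W x - learner θ W' x‖ ≤ ∑ i, ‖outWeight θ i‖ * ‖W i - W' i‖ := by
  rw [learner_eq_sum, learner_eq_sum, ← Finset.sum_sub_distrib]
  refine (norm_sum_le _ _).trans (Finset.sum_le_sum fun i _ => ?_)
  rw [← sub_smul, norm_smul, mul_comm]
  gcongr
  refine (abs_max_sub_max_le_abs _ _ _).trans ?_
  rw [add_sub_add_right_eq_sub, ← inner_sub_left]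
  refine (abs_real_inner_le_norm _ _).trans ?_
  rw [hx, mul_one]

lemma gate_eq_of_lt {s t τ : ℝ} (ht : |t| ≤ τ) (hs : τ < |s|) : 0 ≤ s + t ↔ 0 ≤ s := by
  have h := abs_le.1 ht
  rcases lt_abs.1 hs with h1 | h1
  · constructor <;> intro _ <;> linarith
  · constructor <;> intro h2 <;> linarith

/-- A neuron whose initial pre-activation exceeds `τ` in absolute value keeps its gate, so it is
exactly linear in the displacement and contributes no error. Any other neuron contributes at most
the size `τ` of its shift times its output weight. -/
lemma norm_learner_sub_linNet_le (θ : InitSpace m d k) (V : Weights m d) {x : Input d}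
    (hx : ‖x‖ = 1) {α τ : ℝ} (hα : ∀ i, ‖outWeight θ i‖ ≤ α) (hV : ∀ i, ‖V i‖ ≤ τ) :
    ‖learner θ (initW θ + V) x - (learner θ (initW θ) x + linNet θ V x)‖
      ≤ α * τ * ∑ i, nearZero θ τ i x := by
  rw [learner_eq_sum, learner_eq_sum, linNet, ← Finset.sum_add_distrib, ← Finset.sum_sub_distrib,
    Finset.mul_sum]
  refine (norm_sum_le _ _).trans (Finset.sum_le_sum fun i _ => ?_)
  rw [← add_smul, ← sub_smul, norm_smul, mul_comm α τ, mul_right_comm]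
  have hα0 : 0 ≤ α := (norm_nonneg _).trans (hα i)
  refine mul_le_mul ?_ (hα i) (norm_nonneg _) (mul_nonneg ((norm_nonneg _).trans (hV i))
    (nearZero_nonneg _ _ _ _))
  have ht : |inner ℝ (V i) x| ≤ τ := by
    refine (abs_real_inner_le_norm _ _).trans ?_
    rw [hx, mul_one]; exact hV i
  rw [Pi.add_apply, inner_add_left, add_right_comm]
  change |max (preact θ i x + inner ℝ (V i) x) 0 - (max (preact θ i x) 0 + _)| ≤ _
  unfold nearZero
  set s := preact θ i x
  set t := inner ℝ (V i) x
  have h := abs_le.1 ht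
  split_ifs with h1 h2 h2
  · rw [max_eq_left h1]
    rcases le_total 0 (s + t) with h3 | h3
    · rw [max_eq_left h3]; simp; linarith
    · rw [max_eq_right h3, abs_le]; constructor <;> linarith
  · have := (gate_eq_of_lt ht (not_le.1 h2)).2 h1
    rw [max_eq_left h1, max_eq_left this]; simp
  · push Not at h1
    rw [max_eq_right h1.le]
    rcases le_total 0 (s + t) with h3 | h3
    · rw [max_eq_left h3, abs_le]; constructor <;> linarith
    · rw [max_eq_right h3]; simp; linarith
  · have h3 : ¬ 0 ≤ s + t := fun h3 => h1 ((gate_eq_of_lt ht (not_le.1 h2)).1 h3)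
    push Not at h1 h3
    rw [max_eq_right h1.le, max_eq_right h3.le]; simp

/-- The pairing of the gradient at a nearby point with a displacement, compared with the
linearized network. -/
lemma sum_inner_lossGrad_ge {L : Output k → Y → ℝ} (hL : GoodLoss L) (θ : InitSpace m d k)
    {x : Input d} {y : Y} (hz : ‖x‖ = 1) {α τ τs : ℝ}
    (hα : ∀ i, ‖outWeight θ i‖ ≤ α) {V V' Vs : Weights m d} (hVτ : ∀ i, ‖V i‖ ≤ τ)
    (hV'τ : ∀ i, ‖V' i‖ ≤ τ) (hVs : ∀ i, ‖Vs i‖ ≤ τs) :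
    inner ℝ (gradient (fun u => L u y) (learner θ (initW θ + V') x))
        (linNet θ V x - linNet θ Vs x) - α * (τ + τs) * ∑ i, nearZero θ τ i x
      ≤ ∑ i, inner ℝ (lossGrad L θ (x, y) (initW θ + V') i) (V i - Vs i) := by
  have hDn := norm_gradient_le_one (hL.lipschitz y) (learner θ (initW θ + V') x)
  have hgi' : ∀ i, inner ℝ (lossGrad L θ (x, y) (initW θ + V') i) (V i - Vs i) =
      if 0 ≤ preact θ i x + inner ℝ (V' i) x then
        inner ℝ (gradient (fun u => L u y) (learner θ (initW θ + V') x)) (outWeight θ i)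
          * inner ℝ (V i - Vs i) x else 0 := by
    intro i
    rw [lossGrad_eq]
    have : inner ℝ ((initW θ + V') i) x + initB θ i = preact θ i x + inner ℝ (V' i) x := by
      rw [preact, Pi.add_apply, inner_add_left]; ring
    simp only [this]
    split_ifs
    · rw [real_inner_smul_left, real_inner_comm x]
    · simp
  generalize gradient (fun u => L u y) (learner θ (initW θ + V') x) = D at *
  have e : inner ℝ D (linNet θ V x - linNet θ Vs x) = ∑ i,
      (if 0 ≤ preact θ i x then inner ℝ D (outWeight θ i) * inner ℝ (V i - Vs i) x else 0) := by
    rw [linNet, linNet, ← Finset.sum_sub_distrib, inner_sum]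
    refine Finset.sum_congr rfl fun i _ => ?_
    rw [← sub_smul, inner_smul_right]
    split_ifs
    · rw [inner_sub_left]; ring
    · simp
  rw [e, Finset.mul_sum, ← Finset.sum_sub_distrib]
  refine Finset.sum_le_sum fun i _ => ?_
  have hgi := hgi' i
  have hb : |inner ℝ D (outWeight θ i) * inner ℝ (V i - Vs i) x| ≤ α * (τ + τs) := by
    rw [abs_mul]
    have h1 : |inner ℝ D (outWeight θ i)| ≤ α := by
      refine (abs_real_inner_le_norm _ _).trans ?_
      have := hα i; have := norm_nonneg (outWeight θ i)
      nlinarith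
    have h2 : |inner ℝ (V i - Vs i) x| ≤ τ + τs := by
      refine (abs_real_inner_le_norm _ _).trans ?_
      rw [hz, mul_one]
      exact (norm_sub_le _ _).trans (add_le_add (hVτ i) (hVs i))
    exact mul_le_mul h1 h2 (abs_nonneg _) ((abs_nonneg _).trans h1)
  rw [hgi]
  set q := inner ℝ D (outWeight θ i) * inner ℝ (V i - Vs i) x
  have hq := abs_le.1 hb
  have ht : |inner ℝ (V' i) x| ≤ τ := by
    refine (abs_real_inner_le_norm _ _).trans ?_
    rw [hz, mul_one]; exact hV'τ i
  unfold nearZero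
  by_cases hn : |preact θ i x| ≤ τ
  · rw [if_pos hn, mul_one]
    split_ifs <;> linarith
  · have := gate_eq_of_lt ht (not_le.1 hn)
    rw [if_neg hn, mul_zero, sub_zero]
    simp only [this]
    exact le_rfl

lemma sum_norm_sub_smul_sq_le {η α : ℝ} {V Vs g : Weights m d} (hg : ∀ i, ‖g i‖ ≤ α) :
    ∑ i, ‖(V - η • g) i - Vs i‖ ^ 2 ≤
      ∑ i, ‖V i - Vs i‖ ^ 2 - 2 * η * ∑ i, inner ℝ (g i) (V i - Vs i) + η ^ 2 * (m * α ^ 2) := by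
  have hexp : ∑ i, ‖(V - η • g) i - Vs i‖ ^ 2 =
      ∑ i, ‖V i - Vs i‖ ^ 2 - 2 * η * ∑ i, inner ℝ (g i) (V i - Vs i)
        + η ^ 2 * ∑ i, ‖g i‖ ^ 2 := by
    rw [Finset.mul_sum, Finset.mul_sum, ← Finset.sum_sub_distrib, ← Finset.sum_add_distrib]
    refine Finset.sum_congr rfl fun i _ => ?_
    have e : (V - η • g) i - Vs i = (V i - Vs i) - η • g i := by
      rw [Pi.sub_apply, Pi.smul_apply]; abel
    rw [e, norm_sub_sq_real, inner_smul_right, real_inner_comm, norm_smul, mul_pow,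
      Real.norm_eq_abs, sq_abs]
    ring
  have hgsum : ∑ i, ‖g i‖ ^ 2 ≤ m * α ^ 2 := by
    calc ∑ i, ‖g i‖ ^ 2 ≤ ∑ _i : Fin m, α ^ 2 := by
          refine Finset.sum_le_sum fun i _ => ?_
          have := hg i
          gcongr
      _ = _ := by simp
  rw [hexp]
  have h3 : η ^ 2 * ∑ i, ‖g i‖ ^ 2 ≤ η ^ 2 * (m * α ^ 2) := by gcongr
  linarith

/-- One step of SAM decreases the distance to any reference point in proportion to the excess
loss, up to the error of freezing the activation pattern. -/
lemma samStep_dist_le {L : Output k → Y → ℝ} (hL : GoodLoss L) (θ : InitSpace m d k)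
    {z : Input d × Y} (hz : ‖z.1‖ = 1) {η ρ α τ τs : ℝ} (hη : 0 ≤ η) (hρ : 0 ≤ ρ)
    (hα0 : 0 ≤ α) (hα : ∀ i, ‖outWeight θ i‖ ≤ α) {V Vs : Weights m d}
    (hV : ∀ i, ‖V i‖ + ρ * α ≤ τ) (hVs : ∀ i, ‖Vs i‖ ≤ τs) :
    ∑ i, ‖samStep L η ρ θ z V i - Vs i‖ ^ 2 ≤ ∑ i, ‖V i - Vs i‖ ^ 2
      - 2 * η * (L (learner θ (initW θ + V) z.1) z.2
          - L (learner θ (initW θ) z.1 + linNet θ Vs z.1) z.2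
          - (2 * (m * ρ * α ^ 2) + α * (2 * τ + τs) * ∑ i, nearZero θ τ i z.1))
      + η ^ 2 * (m * α ^ 2) := by
  obtain ⟨x, y⟩ := z
  obtain ⟨g₀, hg₀⟩ : ∃ g₀, g₀ = lossGrad L θ (x, y) (initW θ + V) := ⟨_, rfl⟩
  obtain ⟨V', hV'⟩ : ∃ V', V' = V + ρ • g₀ := ⟨_, rfl⟩
  have hstep : samStep L η ρ θ (x, y) V = V - η • lossGrad L θ (x, y) (initW θ + V') := by
    rw [hV', hg₀, samStep]
  have hVτ : ∀ i, ‖V i‖ ≤ τ := fun i => by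
    have := hV i; have : 0 ≤ ρ * α := by positivity
    linarith
  have hg₀n : ∀ i, ‖g₀ i‖ ≤ α := fun i => by
    rw [hg₀]; exact (norm_lossGrad_le hL θ hz _ i).trans (hα i)
  have hgn : ∀ i, ‖lossGrad L θ (x, y) (initW θ + V') i‖ ≤ α := fun i =>
    (norm_lossGrad_le hL θ hz _ i).trans (hα i)
  have hdiff : ∀ i, ‖(initW θ + V') i - (initW θ + V) i‖ ≤ ρ * α := fun i => by
    have e : (initW θ + V') i - (initW θ + V) i = ρ • g₀ i := by
      rw [hV', Pi.add_apply, Pi.add_apply, Pi.add_apply, Pi.smul_apply]; abel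
    rw [e, norm_smul, Real.norm_eq_abs, abs_of_nonneg hρ]
    exact mul_le_mul_of_nonneg_left (hg₀n i) hρ
  have hV'τ : ∀ i, ‖V' i‖ ≤ τ := fun i => by
    refine le_trans ?_ (hV i)
    rw [hV', Pi.add_apply, Pi.smul_apply]
    refine (norm_add_le _ _).trans ?_
    rw [norm_smul, Real.norm_eq_abs, abs_of_nonneg hρ]
    exact add_le_add le_rfl (mul_le_mul_of_nonneg_left (hg₀n i) hρ)
  -- This is where the SAM perturbation enters the loss comparison: the ascent step moves each
  -- neuron by at most `ρ * α`, and ReLU is Lipschitz.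
  have hFF' : ‖learner θ (initW θ + V') x - learner θ (initW θ + V) x‖ ≤ m * ρ * α ^ 2 := by
    refine (norm_learner_sub_le θ _ _ hz).trans ?_
    calc ∑ i, ‖outWeight θ i‖ * ‖(initW θ + V') i - (initW θ + V) i‖
        ≤ ∑ _i : Fin m, α * (ρ * α) := Finset.sum_le_sum fun i _ =>
          mul_le_mul (hα i) (hdiff i) (norm_nonneg _) hα0
      _ = _ := by simp; ring
  have hFG := norm_learner_sub_linNet_le θ V hz hα hVτ
  have hinner := sum_inner_lossGrad_ge (y := y) hL θ hz hα hVτ hV'τ hVs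
  have hlin := inner_gradient_sub_ge (hL.differentiable y) (hL.convex y) (hL.lipschitz y)
    (learner θ (initW θ + V) x) (learner θ (initW θ + V') x)
    (learner θ (initW θ) x + linNet θ V x) (learner θ (initW θ) x + linNet θ Vs x)
  rw [add_sub_add_left_eq_sub] at hlin
  rw [hstep]
  refine (sum_norm_sub_smul_sq_le hgn).trans ?_
  -- The factor `2 * τ + τs` collects `τ` from linearizing the network at `V` and `τ + τs` from
  -- gates in the gradient at `V'` that differ from the frozen ones.
  have h1 : L (learner θ (initW θ + V) x) y - L (learner θ (initW θ) x + linNet θ Vs x) y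
      - (2 * (m * ρ * α ^ 2) + α * (2 * τ + τs) * ∑ i, nearZero θ τ i x)
      ≤ ∑ i, inner ℝ (lossGrad L θ (x, y) (initW θ + V') i) (V i - Vs i) := by
    linarith
  have h2 := mul_le_mul_of_nonneg_left h1 (by positivity : 0 ≤ 2 * η)
  linarith

lemma norm_samStep_sub_le {L : Output k → Y → ℝ} (hL : GoodLoss L) (θ : InitSpace m d k)
    {z : Input d × Y} (hz : ‖z.1‖ = 1) {η ρ α : ℝ} (hη : 0 ≤ η)
    (hα : ∀ i, ‖outWeight θ i‖ ≤ α) (V : Weights m d) (i : Fin m) :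
    ‖samStep L η ρ θ z V i‖ ≤ ‖V i‖ + η * α := by
  unfold samStep
  rw [Pi.sub_apply, Pi.smul_apply]
  refine (norm_sub_le _ _).trans ?_
  rw [norm_smul, Real.norm_eq_abs, abs_of_nonneg hη]
  gcongr
  exact (norm_lossGrad_le hL θ hz _ i).trans (hα i)

/-! ### Measurability -/

variable [MeasurableSpace Y]

/-- Each partial derivative is a pointwise limit of the difference quotients with increments `1 / (n
+ 1)`, and these are jointly measurable in the output and the label. -/
lemma measurable_gradient {L : Output k → Y → ℝ} (hL : GoodLoss L)
    (hm : Measurable (Function.uncurry L)) :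
    Measurable fun q : Output k × Y => gradient (fun u => L u q.2) q.1 := by
  have hcoord : ∀ r : Fin k, Measurable fun q : Output k × Y =>
      gradient (fun u => L u q.2) q.1 r := by
    intro r
    set e : Output k := EuclideanSpace.single r (1 : ℝ) with he
    have hlim : ∀ q : Output k × Y, Filter.Tendsto
        (fun n : ℕ => ((n : ℝ) + 1) * (L (q.1 + ((n : ℝ) + 1)⁻¹ • e) q.2 - L q.1 q.2))
        Filter.atTop (nhds (gradient (fun u => L u q.2) q.1 r)) := by
      intro q
      have h := hasDerivAt_comp_line (hL.differentiable q.2) q.1 e 0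
      rw [hasDerivAt_iff_tendsto_slope_zero] at h
      have hseq : Filter.Tendsto (fun n : ℕ => ((n : ℝ) + 1)⁻¹) Filter.atTop
          (nhdsWithin 0 {0}ᶜ) := by
        refine tendsto_nhdsWithin_iff.2 ⟨?_, Filter.Eventually.of_forall fun n => ?_⟩
        · have := tendsto_one_div_add_atTop_nhds_zero_nat (𝕜 := ℝ)
          simpa using this
        · simp only [Set.mem_compl_iff, Set.mem_singleton_iff]; positivity
      have h2 := h.comp hseq
      have e1 : inner ℝ (gradient (fun u => L u q.2) (q.1 + (0 : ℝ) • e)) e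
          = gradient (fun u => L u q.2) q.1 r := by
        rw [zero_smul, add_zero, he, EuclideanSpace.inner_single_right, one_mul]
        rfl
      rw [e1] at h2
      refine h2.congr fun n => ?_
      simp
    refine measurable_of_tendsto_metrizable (f := fun (n : ℕ) (q : Output k × Y) =>
      ((n : ℝ) + 1) * (L (q.1 + ((n : ℝ) + 1)⁻¹ • e) q.2 - L q.1 q.2)) (fun n => ?_)
      (tendsto_pi_nhds.2 hlim)
    refine Measurable.const_mul (Measurable.sub ?_ ?_) _
    · exact hm.comp (f := fun q : Output k × Y => (q.1 + ((n : ℝ) + 1)⁻¹ • e, q.2))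
        ((measurable_fst.add_const _).prodMk measurable_snd)
    · exact hm
  have : (fun q : Output k × Y => gradient (fun u => L u q.2) q.1) =
      fun q => WithLp.toLp 2 fun r => gradient (fun u => L u q.2) q.1 r := by
    ext q r; rfl
  rw [this]
  exact (WithLp.measurable_toLp 2 _).comp (measurable_pi_lambda _ hcoord)

lemma measurable_learner (θ : InitSpace m d k) :
    Measurable fun q : Weights m d × Input d => learner θ q.1 q.2 := by
  simp only [learner_eq_sum]
  refine Finset.measurable_sum _ fun i _ => Measurable.smul_const ?_ _
  have : Continuous fun q : Weights m d × Input d =>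
      max (inner ℝ (q.1 i) q.2 + initB θ i) 0 := by fun_prop
  exact this.measurable

lemma measurable_lossGrad {L : Output k → Y → ℝ} (hL : GoodLoss L)
    (hm : Measurable (Function.uncurry L)) (θ : InitSpace m d k) :
    Measurable fun q : (Input d × Y) × Weights m d => lossGrad L θ q.1 q.2 := by
  refine measurable_pi_lambda _ fun i => ?_
  simp only [lossGrad_eq]
  have hin : Measurable fun q : (Input d × Y) × Weights m d => learner θ q.2 q.1.1 :=
    (measurable_learner θ).comp (f := fun q : (Input d × Y) × Weights m d => (q.2, q.1.1))
      (measurable_snd.prodMk (measurable_fst.comp measurable_fst))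
  have hgr : Measurable fun q : (Input d × Y) × Weights m d =>
      gradient (fun u => L u q.1.2) (learner θ q.2 q.1.1) :=
    (measurable_gradient hL hm).comp
      (f := fun q : (Input d × Y) × Weights m d => (learner θ q.2 q.1.1, q.1.2))
      (hin.prodMk (measurable_snd.comp measurable_fst))
  refine Measurable.ite ?_ ?_ measurable_const
  · refine measurableSet_le measurable_const (Measurable.add_const ?_ _)
    have : Measurable fun q : (Input d × Y) × Weights m d => q.2 i := by fun_prop
    exact this.inner (measurable_fst.comp measurable_fst)
  · have h := (hgr.inner (𝕜 := ℝ) (measurable_const (a := outWeight θ i))).smul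
      (measurable_fst.comp (measurable_fst (α := Input d × Y) (β := Weights m d)))
    exact h

lemma measurable_samStep {L : Output k → Y → ℝ} (hL : GoodLoss L)
    (hm : Measurable (Function.uncurry L)) (η ρ : ℝ) (θ : InitSpace m d k) :
    Measurable fun q : (Input d × Y) × Weights m d => samStep L η ρ θ q.1 q.2 := by
  unfold samStep
  have h1 : Measurable fun q : (Input d × Y) × Weights m d =>
      lossGrad L θ q.1 (initW θ + q.2) :=
    (measurable_lossGrad hL hm θ).comp
      (f := fun q : (Input d × Y) × Weights m d => (q.1, initW θ + q.2))
      (measurable_fst.prodMk (measurable_snd.const_add _))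
  refine measurable_snd.sub (Measurable.fun_const_smul ?_ _)
  exact (measurable_lossGrad hL hm θ).comp
    (f := fun q : (Input d × Y) × Weights m d =>
      (q.1, initW θ + (q.2 + ρ • lossGrad L θ q.1 (initW θ + q.2))))
    (measurable_fst.prodMk ((measurable_snd.add (h1.fun_const_smul _)).const_add _))

end Network

end

end SAMGen

namespace SAMGen

noncomputable section

/-! ### Online regret of a stochastic iteration -/

section Online

variable {Ω S : Type*}

/-- The state after `t` steps when `z s` drives step `s`. -/
def iterates (step : Ω → S → S) (s₀ : S) {T : ℕ} (z : Fin T → Ω) : ℕ → S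
  | 0 => s₀
  | t + 1 => if h : t < T then step (z ⟨t, h⟩) (iterates step s₀ z t) else iterates step s₀ z t

lemma measurable_iterates [MeasurableSpace Ω] [MeasurableSpace S] {step : Ω → S → S} (hstep : Measurable fun q : Ω × S => step q.1 q.2)
    (s₀ : S) {T : ℕ} (t : ℕ) : Measurable fun z : Fin T → Ω => iterates step s₀ z t := by
  induction t with
  | zero => exact measurable_const
  | succ t ih =>
    by_cases h : t < T
    · simp only [iterates, h, dite_true]
      exact hstep.comp ((measurable_pi_apply _).prodMk ih)
    · simpa only [iterates, h, dite_false] using ih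

/-- The state before a step does not depend on the example used in that step: this is the
independence behind the online-to-batch argument. -/
lemma iterates_update (step : Ω → S → S) (s₀ : S) {T : ℕ} (z : Fin T → Ω) (j : Fin T) (w : Ω)
    (t : ℕ) (ht : t ≤ j) :
    iterates step s₀ (Function.update z j w) t = iterates step s₀ z t := by
  induction t with
  | zero => rfl
  | succ t ih =>
    have h : t < T := by omega
    have hj : (⟨t, h⟩ : Fin T) ≠ j := by
      intro e; rw [← e] at ht; simp at ht
    simp only [iterates, h, dite_true]
    rw [ih (by omega), Function.update_of_ne hj]

lemma iterates_invariant {step : Ω → S → S} {s₀ : S} {Inv : ℕ → S → Prop} (h0 : Inv 0 s₀)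
    (hI : ∀ t s z, Inv t s → Inv (t + 1) (step z s)) {T : ℕ} (z : Fin T → Ω) (t : ℕ)
    (ht : t ≤ T) : Inv t (iterates step s₀ z t) := by
  induction t with
  | zero => exact h0
  | succ t ih =>
    have h : t < T := by omega
    simp only [iterates, h, dite_true]
    exact hI _ _ _ (ih (by omega))

lemma integrable_of_abs_le {α : Type*} [MeasurableSpace α] (μ : Measure α) [IsFiniteMeasure μ]
    {f : α → ℝ} (hf : Measurable f) {C : ℝ} (hC : ∀ x, |f x| ≤ C) : Integrable f μ :=
  Integrable.of_bound hf.aestronglyMeasurable C (Filter.Eventually.of_forall fun x => by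
    rw [Real.norm_eq_abs]; exact hC x)

/-- Online-to-batch conversion: a potential that decreases in expectation bounds the average
value of the iterates on fresh samples. -/
lemma integral_sum_iterates_le [MeasurableSpace Ω] [MeasurableSpace S] (D : Measure Ω) [IsProbabilityMeasure D] {step : Ω → S → S}
    (hstep : Measurable fun q : Ω × S => step q.1 q.2) {s₀ : S} {Inv : ℕ → S → Prop}
    (h0 : Inv 0 s₀) (hI : ∀ t s z, Inv t s → Inv (t + 1) (step z s)) {Ψ r : S → ℝ}
    (hΨm : Measurable Ψ) (hrm : Measurable r) (hΨ0 : ∀ s, 0 ≤ Ψ s) {T : ℕ} {C : ℝ}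
    (hΨB : ∀ t s, t ≤ T → Inv t s → |Ψ s| ≤ C) (hrB : ∀ t s, t ≤ T → Inv t s → |r s| ≤ C)
    {η κ : ℝ} (hη : 0 < η)
    (hdesc : ∀ t s, t < T → Inv t s → ∫ z, Ψ (step z s) ∂D ≤ Ψ s - 2 * η * (r s - κ)) :
    ∫ z, ∑ t ∈ Finset.range T, r (iterates step s₀ z t) ∂(Measure.pi fun _ : Fin T => D)
      ≤ T * κ + Ψ s₀ / (2 * η) := by
  have hX := fun t => measurable_iterates hstep s₀ (T := T) t
  have hΨi : ∀ t, t ≤ T → Integrable (fun z : Fin T → Ω => Ψ (iterates step s₀ z t))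
      (Measure.pi fun _ : Fin T => D) := fun t ht =>
    integrable_of_abs_le _ (hΨm.comp (hX t)) fun z => hΨB t _ ht (iterates_invariant h0 hI z t ht)
  have hri : ∀ t, t ≤ T → Integrable (fun z : Fin T → Ω => r (iterates step s₀ z t))
      (Measure.pi fun _ : Fin T => D) := fun t ht =>
    integrable_of_abs_le _ (hrm.comp (hX t)) fun z => hrB t _ ht (iterates_invariant h0 hI z t ht)
  have hone : ∀ t, t < T →
      ∫ z, Ψ (iterates step s₀ z (t + 1)) ∂(Measure.pi fun _ : Fin T => D)
        ≤ ∫ z, Ψ (iterates step s₀ z t) ∂(Measure.pi fun _ : Fin T => D)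
          - 2 * η * (∫ z, r (iterates step s₀ z t) ∂(Measure.pi fun _ : Fin T => D) - κ) := by
    intro t ht
    -- Resampling the example of step `t` preserves the law of the sequence and the state at time
    -- `t`. So the expected potential after the step is an average over a fresh example with the
    -- state held fixed, to which `hdesc` applies.
    have hmp := measurePreserving_update D (⟨t, ht⟩ : Fin T)
    have hi := hmp.integrable_comp_of_integrable (hΨi (t + 1) ht)
    have e1 : ∫ z, Ψ (iterates step s₀ z (t + 1)) ∂(Measure.pi fun _ : Fin T => D)
        = ∫ z, ∫ w, Ψ (step w (iterates step s₀ z t)) ∂D ∂(Measure.pi fun _ : Fin T => D) := by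
      have h1 := integral_map (μ := (Measure.pi fun _ : Fin T => D).prod D)
        hmp.measurable.aemeasurable
        (f := fun z => Ψ (iterates step s₀ z (t + 1)))
        ((hΨm.comp (hX (t + 1))).aestronglyMeasurable)
      rw [hmp.map_eq] at h1
      rw [h1]
      refine (integral_prod _ hi).trans ?_
      refine integral_congr_ae (Filter.Eventually.of_forall fun z => ?_)
      refine integral_congr_ae (Filter.Eventually.of_forall fun w => ?_)
      simp only [Function.comp, iterates, ht, dite_true, Function.update_self]
      rw [iterates_update _ _ _ _ _ _ le_rfl]
    have hi2 : Integrable (fun z : Fin T → Ω => ∫ w, Ψ (step w (iterates step s₀ z t)) ∂D)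
        (Measure.pi fun _ : Fin T => D) := by
      refine (hi.integral_prod_left).congr (Filter.Eventually.of_forall fun z => ?_)
      refine integral_congr_ae (Filter.Eventually.of_forall fun w => ?_)
      simp only [Function.comp, iterates, ht, dite_true, Function.update_self]
      rw [iterates_update _ _ _ _ _ _ le_rfl]
    rw [e1]
    have hr' : Integrable (fun z : Fin T → Ω => r (iterates step s₀ z t) - κ)
        (Measure.pi fun _ : Fin T => D) := (hri t ht.le).sub (integrable_const κ)
    have hr2 : Integrable (fun z : Fin T → Ω => 2 * η * (r (iterates step s₀ z t) - κ))
        (Measure.pi fun _ : Fin T => D) := hr'.const_mul _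
    calc _ ≤ ∫ z, (Ψ (iterates step s₀ z t) - 2 * η * (r (iterates step s₀ z t) - κ))
          ∂(Measure.pi fun _ : Fin T => D) :=
          integral_mono hi2 ((hΨi t ht.le).sub hr2) fun z =>
            hdesc t _ ht (iterates_invariant h0 hI z t ht.le)
      _ = _ := by
          rw [integral_sub (hΨi t ht.le) hr2, integral_const_mul,
            integral_sub (hri t ht.le) (integrable_const κ)]
          simp
  -- Telescoping of the expected potential; its final value is nonnegative and is dropped.
  have hsum : ∀ n, n ≤ T →
      2 * η * (∑ t ∈ Finset.range n,
          ∫ z, r (iterates step s₀ z t) ∂(Measure.pi fun _ : Fin T => D) - n * κ)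
        + ∫ z, Ψ (iterates step s₀ z n) ∂(Measure.pi fun _ : Fin T => D) ≤ Ψ s₀ := by
    intro n hn
    induction n with
    | zero => simp [iterates]
    | succ n ih =>
      have h1 := ih (by omega)
      have h2 := hone n (by omega)
      rw [Finset.sum_range_succ]
      push_cast
      linarith
  have hT := hsum T le_rfl
  have hpos : 0 ≤ ∫ z, Ψ (iterates step s₀ z T) ∂(Measure.pi fun _ : Fin T => D) :=
    integral_nonneg fun z => hΨ0 _
  rw [integral_finsetSum _ fun t ht => hri t (Finset.mem_range.mp ht).le]
  have h3 : ∑ t ∈ Finset.range T,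
      ∫ z, r (iterates step s₀ z t) ∂(Measure.pi fun _ : Fin T => D) - T * κ
      ≤ Ψ s₀ / (2 * η) := by
    rw [le_div_iff₀ (by positivity)]; linarith
  linarith

end Online

/-! ### Averages over resampled training sets -/

section Resample

variable {Ω : Type*}

/-- The mean of `f` over `T` uniform draws with replacement from `Z`. -/
def resampleMean {T N : ℕ} (f : (Fin T → Ω) → ℝ) (Z : Fin N → Ω) : ℝ :=
  (∑ s : Fin T → Fin N, f fun j => Z (s j)) / (N : ℝ) ^ T

lemma measurable_resampleMean [MeasurableSpace Ω] {T N : ℕ} {f : (Fin T → Ω) → ℝ} (hf : Measurable f) :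
    Measurable (resampleMean (N := N) f) := by
  unfold resampleMean
  refine (Finset.measurable_sum _ fun s _ => ?_).div_const _
  exact hf.comp (measurable_pi_lambda _ fun j => measurable_pi_apply _)

lemma card_fun_real (T N : ℕ) : ((Finset.univ : Finset (Fin T → Fin N)).card : ℝ) = (N : ℝ) ^ T := by
  simp

lemma abs_resampleMean_le {T N : ℕ} (hN : 0 < N) {f : (Fin T → Ω) → ℝ} {C : ℝ}
    (hC : ∀ z, |f z| ≤ C) (Z : Fin N → Ω) : |resampleMean f Z| ≤ C := by
  unfold resampleMean
  have hN' : (0 : ℝ) < (N : ℝ) ^ T := by positivity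
  rw [abs_div, abs_of_pos hN', div_le_iff₀ hN']
  refine (Finset.abs_sum_le_sum_abs _ _).trans ?_
  refine (Finset.sum_le_card_nsmul _ _ C fun s _ => hC _).trans (le_of_eq ?_)
  rw [nsmul_eq_mul, card_fun_real, mul_comm]

/-- An injective draw sequence reads off independent examples, so its mean is that of fresh data.
The others form a fraction at most `T ^ 2 / N`, and each exceeds the fresh mean by at most `2 * B`.
Centring at `r₀` matters: only the oscillation of `f` is paid, not its size. -/
lemma integral_resampleMean_le [MeasurableSpace Ω] (D : Measure Ω) [IsProbabilityMeasure D] {T N : ℕ} (hN : 0 < N)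
    {f : (Fin T → Ω) → ℝ} (hf : Measurable f) {r₀ B K : ℝ} (hB : ∀ z, |f z - r₀| ≤ B)
    (hK : ∫ z, f z ∂(Measure.pi fun _ : Fin T => D) ≤ K) :
    ∫ Z, resampleMean f Z ∂(Measure.pi fun _ : Fin N => D) ≤ K + 2 * B * (T ^ 2 / N) := by
  classical
  have hN' : (0 : ℝ) < (N : ℝ) ^ T := by positivity
  have hbd : ∀ z, |f z| ≤ B + |r₀| := fun z => by
    have := abs_add_le (f z - r₀) r₀
    rw [sub_add_cancel] at this
    linarith [hB z]
  have hB0 : 0 ≤ B := by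
    obtain ⟨Z⟩ : Nonempty (Fin T → Ω) := (Measure.pi fun _ : Fin T => D).nonempty_of_neZero
    exact (abs_nonneg _).trans (hB Z)
  have hfi : Integrable f (Measure.pi fun _ : Fin T => D) := integrable_of_abs_le _ hf hbd
  have hm : ∀ s : Fin T → Fin N, Measurable fun Z : Fin N → Ω => f fun j => Z (s j) := fun s =>
    hf.comp (measurable_pi_lambda _ fun j => measurable_pi_apply _)
  have hi : ∀ s : Fin T → Fin N, Integrable (fun Z : Fin N → Ω => f fun j => Z (s j))
      (Measure.pi fun _ : Fin N => D) := fun s => integrable_of_abs_le _ (hm s) fun _ => hbd _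
  have hlow : r₀ - B ≤ ∫ z, f z ∂(Measure.pi fun _ : Fin T => D) := by
    have := integral_mono (μ := Measure.pi fun _ : Fin T => D) (integrable_const (r₀ - B)) hfi
      (fun z => by have := (abs_le.mp (hB z)).1; show r₀ - B ≤ f z; linarith)
    simpa using this
  have hterm : ∀ s : Fin T → Fin N, ∫ Z, f (fun j => Z (s j)) ∂(Measure.pi fun _ : Fin N => D)
      ≤ K + if ¬ Function.Injective s then 2 * B else 0 := by
    intro s
    by_cases hs : Function.Injective s
    · have hmp := measurePreserving_comp_injective D hs
      have h1 := integral_map (μ := Measure.pi fun _ : Fin N => D) hmp.measurable.aemeasurable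
        (f := f) hf.aestronglyMeasurable
      rw [hmp.map_eq] at h1
      rw [← h1]
      simpa [hs] using hK
    · have := integral_mono (μ := Measure.pi fun _ : Fin N => D) (hi s) (integrable_const (r₀ + B))
        (fun z => by have := (abs_le.mp (hB fun j => z (s j))).2; show f _ ≤ r₀ + B; linarith)
      simp only [hs, not_false_eq_true, if_true]
      have h2 : ∫ z : Fin N → Ω, r₀ + B ∂(Measure.pi fun _ : Fin N => D) = r₀ + B := by simp
      rw [h2] at this
      linarith
  have hcard := card_not_injective_le T N hN
  unfold resampleMean
  rw [integral_div, integral_finsetSum _ fun s _ => hi s, div_le_iff₀ hN']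
  refine (Finset.sum_le_sum fun s _ => hterm s).trans ?_
  rw [Finset.sum_add_distrib, Finset.sum_const, nsmul_eq_mul, card_fun_real, ← Finset.sum_filter,
    Finset.sum_const, nsmul_eq_mul]
  have := mul_le_mul_of_nonneg_right hcard (by positivity : 0 ≤ 2 * B)
  calc _ ≤ (N : ℝ) ^ T * K + (T : ℝ) ^ 2 / N * (N : ℝ) ^ T * (2 * B) := by
        refine add_le_add le_rfl ?_
        convert this using 3
    _ = _ := by ring

/-- Replacing one training example alters only the draw sequences that contain it, a fraction at
most `T / N`, each by at most `2 * B`. McDiarmid's inequality applies with differences `2 * B * T /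
N`, which decay like `1 / N` for fixed `T`. -/
lemma resampleMean_tail [MeasurableSpace Ω] (D : Measure Ω) [IsProbabilityMeasure D] {T N : ℕ} (hN : 0 < N)
    {f : (Fin T → Ω) → ℝ} (hf : Measurable f) {r₀ B s : ℝ} (hB : ∀ z, |f z - r₀| ≤ B)
    (hs : 0 ≤ s) :
    (Measure.pi fun _ : Fin N => D).real
      {Z | ∫ Z', resampleMean f Z' ∂(Measure.pi fun _ : Fin N => D) + s ≤ resampleMean f Z}
      ≤ Real.exp (-s ^ 2 / (2 * (N * (2 * B * (T / N)) ^ 2))) := by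
  classical
  have hN' : (0 : ℝ) < (N : ℝ) ^ T := by positivity
  have hbd : ∀ z, |f z| ≤ B + |r₀| := fun z => by
    have := abs_add_le (f z - r₀) r₀
    rw [sub_add_cancel] at this
    linarith [hB z]
  have hB0 : 0 ≤ B := by
    obtain ⟨Z⟩ : Nonempty (Fin T → Ω) := (Measure.pi fun _ : Fin T => D).nonempty_of_neZero
    exact (abs_nonneg _).trans (hB Z)
  refine mcdiarmid D (by positivity) (measurable_resampleMean hf)
    (fun Z => abs_resampleMean_le hN hbd Z) (fun Z j z => ?_) hs
  unfold resampleMean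
  rw [← sub_div, ← Finset.sum_sub_distrib, abs_div, abs_of_pos hN', div_le_iff₀ hN']
  refine (Finset.abs_sum_le_sum_abs _ _).trans ?_
  have hterm : ∀ σ : Fin T → Fin N,
      |(f fun i => Function.update Z j z (σ i)) - f fun i => Z (σ i)|
        ≤ if ∃ t, σ t = j then 2 * B else 0 := by
    intro σ
    split_ifs with h
    · have h1 := abs_le.mp (hB fun i => Function.update Z j z (σ i))
      have h2 := abs_le.mp (hB fun i => Z (σ i))
      rw [abs_le]; constructor <;> linarith [h1.1, h1.2, h2.1, h2.2]
    · push Not at h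
      have : (fun i => Function.update Z j z (σ i)) = fun i => Z (σ i) := by
        ext i; rw [Function.update_of_ne (h i)]
      rw [this]; simp
  refine (Finset.sum_le_sum fun σ _ => hterm σ).trans ?_
  rw [← Finset.sum_filter, Finset.sum_const, nsmul_eq_mul]
  have := mul_le_mul_of_nonneg_right (card_hit_le T N j) (by positivity : 0 ≤ 2 * B)
  calc _ ≤ (T : ℝ) / N * (N : ℝ) ^ T * (2 * B) := by convert this using 3
    _ = _ := by ring

end Resample

end

end SAMGen

namespace SAMGen

noncomputable section

/-! ### Generalization of stochastic SAM for a fixed initialization -/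

section Fixed

variable {m d k : ℕ} {Y : Type*}

lemma norm_learner_le (θ : InitSpace m d k) (W : Weights m d) {x : Input d} (hx : ‖x‖ = 1) :
    ‖learner θ W x‖ ≤ ‖learner θ 0 0‖ + ∑ i, ‖outWeight θ i‖ * ‖W i‖ := by
  have h := norm_learner_sub_le θ W 0 hx
  have e : learner θ 0 x = learner θ 0 0 := by simp [learner]
  simp only [e, Pi.zero_apply, sub_zero] at h
  have := norm_add_le (learner θ W x - learner θ 0 0) (learner θ 0 0)
  rw [sub_add_cancel] at this
  linarith

lemma norm_linNet_le (θ : InitSpace m d k) (V : Weights m d) {x : Input d} (hx : ‖x‖ = 1) :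
    ‖linNet θ V x‖ ≤ ∑ i, ‖V i‖ * ‖outWeight θ i‖ := by
  unfold linNet
  refine (norm_sum_le _ _).trans (Finset.sum_le_sum fun i _ => ?_)
  rw [norm_smul]
  refine mul_le_mul_of_nonneg_right ?_ (norm_nonneg _)
  split_ifs
  · have := abs_real_inner_le_norm (V i) x
    rwa [hx, mul_one] at this
  · simp

lemma measurable_linNet (θ : InitSpace m d k) (V : Weights m d) : Measurable (linNet θ V) := by
  unfold linNet preact
  refine Finset.measurable_sum _ fun i _ => Measurable.smul_const ?_ _
  refine Measurable.ite ?_ (by fun_prop) measurable_const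
  exact measurableSet_le measurable_const (by fun_prop)

lemma measurable_nearZero (θ : InitSpace m d k) (τ : ℝ) (i : Fin m) :
    Measurable (nearZero θ τ i) := by
  unfold nearZero preact
  refine Measurable.ite ?_ measurable_const measurable_const
  exact measurableSet_le (by fun_prop) measurable_const

lemma nearZero_le_one (θ : InitSpace m d k) (τ : ℝ) (i : Fin m) (x : Input d) :
    nearZero θ τ i x ≤ 1 := by
  unfold nearZero; split_ifs <;> norm_num

lemma measurable_learner_comp {α : Type*} [MeasurableSpace α] (θ : InitSpace m d k)
    {W : α → Weights m d} {x : α → Input d} (hW : Measurable W) (hx : Measurable x) :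
    Measurable fun a => learner θ (W a) (x a) :=
  Measurable.comp (g := fun q : Weights m d × Input d => learner θ q.1 q.2)
    (f := fun a => (W a, x a)) (measurable_learner θ) (hW.prodMk hx)

lemma measurable_learner_apply (θ : InitSpace m d k) (W : Weights m d) :
    Measurable (learner θ W) :=
  measurable_learner_comp θ measurable_const measurable_id

lemma GoodLoss.abs_sub_le {L : Output k → Y → ℝ} (hL : GoodLoss L) (u v : Output k) (y : Y) :
    |L u y - L v y| ≤ ‖u - v‖ := by
  have := (hL.lipschitz y).norm_sub_le u v
  rwa [NNReal.coe_one, one_mul, Real.norm_eq_abs] at this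

/-- Replace an input that is not normalized by a unit vector. -/
def normalizeInput (z : Input d × Y) : Input d × Y :=
  if ‖z.1‖ = 1 then z else (EuclideanSpace.single 0 1, z.2)

lemma norm_normalizeInput (z : Input d × Y) : ‖(normalizeInput z).1‖ = 1 := by
  unfold normalizeInput; split_ifs with h
  · exact h
  · simp

/-- Inputs have norm one only almost surely, whereas the invariants of the iteration are required
for every sequence of examples. The step with normalized inputs has sure bounds and agrees with SAM
on normalized data. -/
lemma samIterate_eq_iterates (L : Output k → Y → ℝ) (η ρ : ℝ) (θ : InitSpace m d k) {T : ℕ}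
    {z : Fin T → Input d × Y} (hz : ∀ j, normalizeInput (z j) = z j) (t : ℕ) :
    samIterate L η ρ θ z t
      = iterates (fun z V => samStep L η ρ θ (normalizeInput z) V) 0 z t := by
  induction t with
  | zero => rfl
  | succ t ih =>
    simp only [samIterate, iterates]
    split_ifs with h
    · rw [ih, hz]
    · exact ih

variable [MeasurableSpace Y]

lemma integrable_loss {D : Measure (Input d × Y)} [IsProbabilityMeasure D]
    (hD : NormalizedInputs D) {L : Output k → Y → ℝ} (hL : GoodLoss L)
    (hm : Measurable (Function.uncurry L)) (hi : Integrable (fun z : Input d × Y => L 0 z.2) D)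
    {F : Input d → Output k} (hF : Measurable F) {C : ℝ} (hC : ∀ x, ‖x‖ = 1 → ‖F x‖ ≤ C) :
    Integrable (fun z : Input d × Y => L (F z.1) z.2) D := by
  have hmeas : Measurable fun z : Input d × Y => L (F z.1) z.2 :=
    hm.comp ((hF.comp measurable_fst).prodMk measurable_snd)
  refine Integrable.mono' (hi.add (integrable_const C)) hmeas.aestronglyMeasurable ?_
  filter_upwards [hD] with z hz
  have h := hL.abs_sub_le (F z.1) 0 z.2
  rw [sub_zero] at h
  have h1 := (abs_le.mp h).2
  rw [Real.norm_eq_abs, abs_of_nonneg (hL.nonneg _ _), Pi.add_apply]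
  linarith [hC _ hz.1]

lemma integrable_loss_learner {D : Measure (Input d × Y)} [IsProbabilityMeasure D]
    (hD : NormalizedInputs D) {L : Output k → Y → ℝ} (hL : GoodLoss L)
    (hm : Measurable (Function.uncurry L)) (hi : Integrable (fun z : Input d × Y => L 0 z.2) D)
    (θ : InitSpace m d k) (W : Weights m d) :
    Integrable (fun z : Input d × Y => L (learner θ W z.1) z.2) D :=
  integrable_loss hD hL hm hi (measurable_learner_apply θ W) fun _ hx => norm_learner_le θ W hx

lemma abs_risk_sub_le {D : Measure (Input d × Y)} [IsProbabilityMeasure D]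
    (hD : NormalizedInputs D) {L : Output k → Y → ℝ} (hL : GoodLoss L)
    (hm : Measurable (Function.uncurry L)) (hi : Integrable (fun z : Input d × Y => L 0 z.2) D)
    (θ : InitSpace m d k) (W W' : Weights m d) :
    |risk D L (learner θ W) - risk D L (learner θ W')|
      ≤ ∑ i, ‖outWeight θ i‖ * ‖W i - W' i‖ := by
  unfold risk
  rw [← integral_sub (integrable_loss_learner hD hL hm hi θ W)
    (integrable_loss_learner hD hL hm hi θ W'), ← Real.norm_eq_abs]
  have := norm_integral_le_of_norm_le_const (μ := D)
    (f := fun z : Input d × Y => L (learner θ W z.1) z.2 - L (learner θ W' z.1) z.2)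
    (C := ∑ i, ‖outWeight θ i‖ * ‖W i - W' i‖) (by
      filter_upwards [hD] with z hz
      rw [Real.norm_eq_abs]
      exact (hL.abs_sub_le _ _ _).trans (norm_learner_sub_le θ W W' hz.1))
  simpa using this

lemma measurable_risk_learner {D : Measure (Input d × Y)} [IsProbabilityMeasure D]
    {L : Output k → Y → ℝ} (hm : Measurable (Function.uncurry L)) (θ : InitSpace m d k) :
    Measurable fun V : Weights m d => risk D L (learner θ (initW θ + V)) := by
  unfold risk
  have h : Measurable fun q : Weights m d × (Input d × Y) =>
      L (learner θ (initW θ + q.1) q.2.1) q.2.2 := by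
    have h1 : Measurable fun q : Weights m d × (Input d × Y) =>
        learner θ (initW θ + q.1) q.2.1 :=
      measurable_learner_comp θ (measurable_fst.const_add (initW θ))
        (measurable_fst.comp measurable_snd)
    exact Measurable.comp (g := Function.uncurry L)
      (f := fun q : Weights m d × (Input d × Y) => (learner θ (initW θ + q.1) q.2.1, q.2.2)) hm
      (h1.prodMk (measurable_snd.comp measurable_snd))
  exact h.stronglyMeasurable.integral_prod_right.measurable

lemma measurable_normalizeInput : Measurable (normalizeInput (d := d) (Y := Y)) := by
  unfold normalizeInput
  refine Measurable.ite ?_ measurable_id (measurable_const.prodMk measurable_snd)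
  exact measurableSet_eq_fun (by fun_prop) measurable_const

lemma normalizeInput_ae {D : Measure (Input d × Y)} (hD : NormalizedInputs D) :
    ∀ᵐ z ∂D, normalizeInput z = z := by
  filter_upwards [hD] with z hz
  simp [normalizeInput, hz.1]

/-- The average risk of the iterates driven by the examples `z`. -/
def pathRisk (D : Measure (Input d × Y)) (L : Output k → Y → ℝ) (η ρ : ℝ)
    (θ : InitSpace m d k) {T : ℕ} (z : Fin T → Input d × Y) : ℝ :=
  (∑ t ∈ Finset.range T, risk D L (learner θ (initW θ +
    iterates (fun z V => samStep L η ρ θ (normalizeInput z) V) 0 z t))) / (T : ℝ)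

lemma samAverageRisk_ae_eq {D : Measure (Input d × Y)} [IsProbabilityMeasure D]
    (hD : NormalizedInputs D) (L : Output k → Y → ℝ) (η ρ : ℝ) (T : ℕ) (θ : InitSpace m d k)
    (N : ℕ) : ∀ᵐ Z ∂(Measure.pi fun _ : Fin N => D),
      samAverageRisk D L η ρ T θ Z = resampleMean (pathRisk D L η ρ θ (T := T)) Z := by
  have h : ∀ᵐ Z ∂(Measure.pi fun _ : Fin N => D), ∀ j, normalizeInput (Z j) = Z j := by
    rw [ae_all_iff]
    intro j
    exact (measurePreserving_eval (fun _ : Fin N => D) j).quasiMeasurePreserving.ae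
      (normalizeInput_ae hD)
  filter_upwards [h] with Z hZ
  unfold samAverageRisk resampleMean pathRisk
  refine congrArg (· / (N : ℝ) ^ T) (Finset.sum_congr rfl fun s _ => ?_)
  refine congrArg (· / (T : ℝ)) (Finset.sum_congr rfl fun t _ => ?_)
  rw [samIterate_eq_iterates L η ρ θ (z := fun j => Z (s j)) (fun j => hZ _)]

lemma samStep_expected_dist_le {D : Measure (Input d × Y)} [IsProbabilityMeasure D]
    (hD : NormalizedInputs D) {L : Output k → Y → ℝ} (hL : GoodLoss L)
    (hm : Measurable (Function.uncurry L)) (hi : Integrable (fun z : Input d × Y => L 0 z.2) D)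
    (θ : InitSpace m d k) {η ρ α τ τs : ℝ} (hη : 0 ≤ η) (hρ : 0 ≤ ρ) (hα0 : 0 ≤ α)
    (hα : ∀ i, ‖outWeight θ i‖ ≤ α) {V Vs : Weights m d} (hV : ∀ i, ‖V i‖ + ρ * α ≤ τ)
    (hVs : ∀ i, ‖Vs i‖ ≤ τs)
    (hint : Integrable (fun z => ∑ i, ‖samStep L η ρ θ (normalizeInput z) V i - Vs i‖ ^ 2) D) :
    ∫ z, ∑ i, ‖samStep L η ρ θ (normalizeInput z) V i - Vs i‖ ^ 2 ∂D
      ≤ ∑ i, ‖V i - Vs i‖ ^ 2 - 2 * η * (risk D L (learner θ (initW θ + V))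
        - (risk D L (fun x => learner θ (initW θ) x + linNet θ Vs x)
          + 2 * (m * ρ * α ^ 2) + α * (2 * τ + τs) * ∫ z, ∑ i, nearZero θ τ i z.1 ∂D
          + η * (m * α ^ 2) / 2)) := by
  have h1 := integrable_loss_learner hD hL hm hi θ (initW θ + V)
  have h2 : Integrable (fun z : Input d × Y =>
      L (learner θ (initW θ) z.1 + linNet θ Vs z.1) z.2) D :=
    integrable_loss hD hL hm hi (F := fun x => learner θ (initW θ) x + linNet θ Vs x)
      ((measurable_learner_apply θ _).add (measurable_linNet θ Vs)) fun x hx =>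
      (norm_add_le _ _).trans (add_le_add (norm_learner_le θ _ hx) (norm_linNet_le θ Vs hx))
  have h3 : Integrable (fun z : Input d × Y => ∑ i, nearZero θ τ i z.1) D := by
    refine integrable_finsetSum _ fun i _ => ?_
    refine integrable_of_abs_le D ((measurable_nearZero θ τ i).comp measurable_fst) (C := 1) ?_
    intro z
    rw [abs_of_nonneg (nearZero_nonneg θ τ i z.1)]
    exact nearZero_le_one θ τ i z.1
  have h4 : Integrable (fun z : Input d × Y =>
      2 * (m * ρ * α ^ 2) + α * (2 * τ + τs) * ∑ i, nearZero θ τ i z.1) D :=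
    (integrable_const _).add (h3.const_mul _)
  have h12 : Integrable (fun z : Input d × Y => L (learner θ (initW θ + V) z.1) z.2
      - L (learner θ (initW θ) z.1 + linNet θ Vs z.1) z.2) D := h1.sub h2
  have h124 : Integrable (fun z : Input d × Y => L (learner θ (initW θ + V) z.1) z.2
      - L (learner θ (initW θ) z.1 + linNet θ Vs z.1) z.2
      - (2 * (m * ρ * α ^ 2) + α * (2 * τ + τs) * ∑ i, nearZero θ τ i z.1)) D := h12.sub h4
  have h5 : Integrable (fun z : Input d × Y => 2 * η * (L (learner θ (initW θ + V) z.1) z.2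
      - L (learner θ (initW θ) z.1 + linNet θ Vs z.1) z.2
      - (2 * (m * ρ * α ^ 2) + α * (2 * τ + τs) * ∑ i, nearZero θ τ i z.1))) D := h124.const_mul _
  have h6 : Integrable (fun z : Input d × Y => ∑ i, ‖V i - Vs i‖ ^ 2
      - 2 * η * (L (learner θ (initW θ + V) z.1) z.2
      - L (learner θ (initW θ) z.1 + linNet θ Vs z.1) z.2
      - (2 * (m * ρ * α ^ 2) + α * (2 * τ + τs) * ∑ i, nearZero θ τ i z.1))) D :=
    (integrable_const _).sub h5
  have hle : ∫ z, ∑ i, ‖samStep L η ρ θ (normalizeInput z) V i - Vs i‖ ^ 2 ∂D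
      ≤ ∫ z, (∑ i, ‖V i - Vs i‖ ^ 2 - 2 * η * (L (learner θ (initW θ + V) z.1) z.2
      - L (learner θ (initW θ) z.1 + linNet θ Vs z.1) z.2
      - (2 * (m * ρ * α ^ 2) + α * (2 * τ + τs) * ∑ i, nearZero θ τ i z.1))
      + η ^ 2 * (m * α ^ 2)) ∂D := by
    refine integral_mono_ae hint (h6.add (integrable_const _)) ?_
    filter_upwards [hD, normalizeInput_ae hD] with z hz hz'
    simp only [hz']
    exact samStep_dist_le hL θ hz.1 hη hρ hα0 hα hV hVs
  refine hle.trans (le_of_eq ?_)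
  have e3 : ∫ z : Input d × Y, α * (2 * τ + τs) * ∑ i, nearZero θ τ i z.1 ∂D
      = α * (2 * τ + τs) * ∫ z : Input d × Y, ∑ i, nearZero θ τ i z.1 ∂D := integral_const_mul _ _
  rw [integral_add h6 (integrable_const _), integral_sub (integrable_const _) h5,
    integral_const_mul, integral_sub h12 h4, integral_sub h1 h2,
    integral_add (integrable_const _) (h3.const_mul _), e3]
  simp only [integral_const, probReal_univ, one_smul, risk]
  ring

lemma measurable_sqDist (Vs : Weights m d) :
    Measurable fun V : Weights m d => ∑ i, ‖V i - Vs i‖ ^ 2 := by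
  have : Continuous fun V : Weights m d => ∑ i, ‖V i - Vs i‖ ^ 2 := by fun_prop
  exact this.measurable

lemma measurable_normalizedStep {L : Output k → Y → ℝ} (hL : GoodLoss L)
    (hm : Measurable (Function.uncurry L)) (η ρ : ℝ) (θ : InitSpace m d k) :
    Measurable fun q : (Input d × Y) × Weights m d => samStep L η ρ θ (normalizeInput q.1) q.2 :=
  Measurable.comp (g := fun q : (Input d × Y) × Weights m d => samStep L η ρ θ q.1 q.2)
    (f := fun q : (Input d × Y) × Weights m d => (normalizeInput q.1, q.2))
    (measurable_samStep hL hm η ρ θ)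
    ((measurable_normalizeInput.comp measurable_fst).prodMk measurable_snd)

omit [MeasurableSpace Y] in
lemma norm_iterates_le {L : Output k → Y → ℝ} (hL : GoodLoss L)
    (θ : InitSpace m d k) {η ρ α : ℝ} (hη : 0 ≤ η)
    (hα : ∀ i, ‖outWeight θ i‖ ≤ α) {T : ℕ} (z : Fin T → Input d × Y) (t : ℕ) (ht : t ≤ T)
    (i : Fin m) :
    ‖iterates (fun z V => samStep L η ρ θ (normalizeInput z) V) 0 z t i‖ ≤ t * (η * α) := by
  have h := iterates_invariant (step := fun z V => samStep L η ρ θ (normalizeInput z) V)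
    (s₀ := (0 : Weights m d))
    (Inv := fun t V => ∀ i, ‖V i‖ ≤ t * (η * α)) (by simp) (by
      intro t V z hV i
      have h1 := norm_samStep_sub_le (ρ := ρ) hL θ (norm_normalizeInput z) hη hα V i
      push_cast
      linarith [hV i]) z t ht
  exact h i

lemma measurable_pathRisk {D : Measure (Input d × Y)} [IsProbabilityMeasure D]
    {L : Output k → Y → ℝ} (hL : GoodLoss L) (hm : Measurable (Function.uncurry L)) (η ρ : ℝ)
    (θ : InitSpace m d k) (T : ℕ) : Measurable (pathRisk D L η ρ θ (T := T)) := by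
  unfold pathRisk
  refine (Finset.measurable_sum _ fun t _ => ?_).div_const _
  exact Measurable.comp (g := fun V : Weights m d => risk D L (learner θ (initW θ + V)))
    (measurable_risk_learner hm θ) (measurable_iterates (measurable_normalizedStep hL hm η ρ θ) 0 t)

lemma abs_risk_learner_sub_le {D : Measure (Input d × Y)} [IsProbabilityMeasure D]
    (hD : NormalizedInputs D) {L : Output k → Y → ℝ} (hL : GoodLoss L)
    (hm : Measurable (Function.uncurry L)) (hi : Integrable (fun z : Input d × Y => L 0 z.2) D)
    (θ : InitSpace m d k) {α : ℝ} (hα0 : 0 ≤ α)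
    (hα : ∀ i, ‖outWeight θ i‖ ≤ α) {V : Weights m d} {C : ℝ} (hV : ∀ i, ‖V i‖ ≤ C) :
    |risk D L (learner θ (initW θ + V)) - risk D L (learner θ (initW θ))| ≤ m * (α * C) := by
  refine (abs_risk_sub_le hD hL hm hi θ _ _).trans ?_
  refine (Finset.sum_le_card_nsmul _ _ (α * C) fun i _ => ?_).trans (by simp)
  rw [Pi.add_apply, add_sub_cancel_left]
  exact mul_le_mul (hα i) (hV i) (norm_nonneg _) hα0

/-- For a fixed initialization, in expectation over fresh examples the average risk of the
iterates is close to that of any comparator of the linearized network. -/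
lemma integral_pathRisk_le {D : Measure (Input d × Y)} [IsProbabilityMeasure D]
    (hD : NormalizedInputs D) {L : Output k → Y → ℝ} (hL : GoodLoss L)
    (hm : Measurable (Function.uncurry L)) (hi : Integrable (fun z : Input d × Y => L 0 z.2) D)
    (θ : InitSpace m d k) {η ρ α τs : ℝ} (hη : 0 < η) (hρ : 0 ≤ ρ) (hα0 : 0 ≤ α)
    (hα : ∀ i, ‖outWeight θ i‖ ≤ α) {Vs : Weights m d} (hVs : ∀ i, ‖Vs i‖ ≤ τs)
    {T : ℕ} (hT : 0 < T) :
    ∫ z, pathRisk D L η ρ θ z ∂(Measure.pi fun _ : Fin T => D)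
      ≤ risk D L (fun x => learner θ (initW θ) x + linNet θ Vs x)
          + 2 * (m * ρ * α ^ 2) + α * (2 * ((η * T + ρ) * α) + τs)
            * ∫ z, ∑ i, nearZero θ ((η * T + ρ) * α) i z.1 ∂D
          + η * (m * α ^ 2) / 2 + (∑ i, ‖Vs i‖ ^ 2) / (2 * η * T) := by
  obtain ⟨κ, hκ⟩ : ∃ κ, κ = risk D L (fun x => learner θ (initW θ) x + linNet θ Vs x)
          + 2 * (m * ρ * α ^ 2) + α * (2 * ((η * T + ρ) * α) + τs)
            * ∫ z, ∑ i, nearZero θ ((η * T + ρ) * α) i z.1 ∂D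
          + η * (m * α ^ 2) / 2 := ⟨_, rfl⟩
  rw [← hκ]
  have hT' : (0 : ℝ) < T := by exact_mod_cast hT
  have hηα : 0 ≤ η * α := by positivity
  have hstep := measurable_normalizedStep hL hm η ρ θ
  have htle : ∀ t : ℕ, t ≤ T → (t : ℝ) * (η * α) ≤ T * (η * α) := fun t ht =>
    mul_le_mul_of_nonneg_right (by exact_mod_cast ht) hηα
  have hΨbd : ∀ V : Weights m d, (∀ i, ‖V i‖ ≤ T * (η * α)) →
      |∑ i, ‖V i - Vs i‖ ^ 2| ≤ ∑ i, (T * (η * α) + ‖Vs i‖) ^ 2 := by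
    intro V hV
    rw [abs_of_nonneg (by positivity)]
    refine Finset.sum_le_sum fun i _ => ?_
    exact pow_le_pow_left₀ (norm_nonneg _) ((norm_sub_le _ _).trans (add_le_add (hV i) le_rfl)) 2
  -- The potential is the squared distance to the comparator. A step moves each neuron by at most `η
  -- * α`, so all iterates, including their SAM perturbations, stay within `(η * T + ρ) * α`; this
  -- is the radius at which gates are compared.
  have key := integral_sum_iterates_le D (step := fun z V => samStep L η ρ θ (normalizeInput z) V)
    hstep (s₀ := (0 : Weights m d)) (Inv := fun t V => ∀ i, ‖V i‖ ≤ t * (η * α)) (by simp) (by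
      intro t V z hV i
      have h1 := norm_samStep_sub_le (ρ := ρ) hL θ (norm_normalizeInput z) hη.le hα V i
      push_cast
      linarith [hV i])
    (Ψ := fun V => ∑ i, ‖V i - Vs i‖ ^ 2)
    (r := fun V => risk D L (learner θ (initW θ + V))) (measurable_sqDist Vs)
    (measurable_risk_learner hm θ) (fun V => by positivity) (T := T)
    (C := max (∑ i, (T * (η * α) + ‖Vs i‖) ^ 2)
      (|risk D L (learner θ (initW θ))| + m * (α * (T * (η * α)))))
    (fun t V ht hV => (hΨbd V fun i => (hV i).trans (htle t ht)).trans (le_max_left _ _))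
    (fun t V ht hV => by
      refine le_trans ?_ (le_max_right _ _)
      have h1 := abs_risk_learner_sub_le hD hL hm hi θ hα0 hα
        (fun i => (hV i).trans (htle t ht))
      have h2 := abs_add_le (risk D L (learner θ (initW θ + V)) - risk D L (learner θ (initW θ)))
        (risk D L (learner θ (initW θ)))
      rw [sub_add_cancel] at h2
      linarith) (κ := κ) hη (by
      intro t V ht hV
      rw [hκ]
      refine samStep_expected_dist_le hD hL hm hi θ hη.le hρ hα0 hα (fun i => ?_) hVs ?_
      · have := (hV i).trans (htle t ht.le)
        calc ‖V i‖ + ρ * α ≤ T * (η * α) + ρ * α := by linarith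
          _ = _ := by ring
      · refine integrable_of_abs_le D ?_ (C := ∑ i, (T * (η * α) + ‖Vs i‖) ^ 2) fun z =>
          hΨbd _ fun i => ?_
        · exact Measurable.comp (g := fun V : Weights m d => ∑ i, ‖V i - Vs i‖ ^ 2)
            (f := fun z => samStep L η ρ θ (normalizeInput z) V) (measurable_sqDist Vs)
            (hstep.comp (measurable_id.prodMk measurable_const))
        · have h1 := norm_samStep_sub_le (ρ := ρ) hL θ (norm_normalizeInput z) hη.le hα V i
          have h2 := htle (t + 1) ht
          push_cast at h2
          linarith [hV i])
  unfold pathRisk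
  rw [integral_div, div_le_iff₀ hT']
  refine key.trans (le_of_eq ?_)
  simp only [Pi.zero_apply, zero_sub, norm_neg]
  field_simp

/-- For a fixed initialization, the average risk of stochastic SAM in expectation and in
probability over the training set. -/
lemma samAverageRisk_bounds {D : Measure (Input d × Y)} [IsProbabilityMeasure D]
    (hD : NormalizedInputs D) {L : Output k → Y → ℝ} (hL : GoodLoss L)
    (hm : Measurable (Function.uncurry L)) (hi : Integrable (fun z : Input d × Y => L 0 z.2) D)
    (θ : InitSpace m d k) {η ρ α : ℝ} (hη : 0 ≤ η) (hα0 : 0 ≤ α)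
    (hα : ∀ i, ‖outWeight θ i‖ ≤ α) {T N : ℕ} (hT : 0 < T) (hN : 0 < N) {K B s : ℝ} (hs : 0 ≤ s)
    (hB : m * (α * (T * (η * α))) ≤ B)
    (hK : ∫ z, pathRisk D L η ρ θ z ∂(Measure.pi fun _ : Fin T => D) ≤ K) :
    ∫ Z, samAverageRisk D L η ρ T θ Z ∂(Measure.pi fun _ : Fin N => D)
        ≤ K + 2 * B * (T ^ 2 / N) ∧
      (Measure.pi fun _ : Fin N => D) {Z | K + 2 * B * (T ^ 2 / N) + s
        < samAverageRisk D L η ρ T θ Z}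
        ≤ ENNReal.ofReal (Real.exp (-s ^ 2 / (2 * (N * (2 * B * (T / N)) ^ 2)))) := by
  have hT' : (0 : ℝ) < T := by exact_mod_cast hT
  have hf := measurable_pathRisk (D := D) hL hm η ρ θ T
  have hηα : 0 ≤ η * α := by positivity
  -- The reference value is the risk at initialization, which may be arbitrarily large; the iterates
  -- move away from it by at most `B`.
  have hbd : ∀ z : Fin T → Input d × Y,
      |pathRisk D L η ρ θ z - risk D L (learner θ (initW θ))| ≤ B := by
    intro z
    have e : pathRisk D L η ρ θ z - risk D L (learner θ (initW θ))
        = (∑ t ∈ Finset.range T, (risk D L (learner θ (initW θ +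
          iterates (fun z V => samStep L η ρ θ (normalizeInput z) V) 0 z t))
          - risk D L (learner θ (initW θ)))) / (T : ℝ) := by
      rw [Finset.sum_sub_distrib, Finset.sum_const, Finset.card_range, nsmul_eq_mul, sub_div,
        mul_div_cancel_left₀ _ hT'.ne']
      rfl
    rw [e, abs_div, abs_of_pos hT', div_le_iff₀ hT']
    refine (Finset.abs_sum_le_sum_abs _ _).trans ?_
    refine (Finset.sum_le_card_nsmul _ _ B fun t ht => ?_).trans (by simp [mul_comm])
    have ht' := (Finset.mem_range.mp ht).le
    refine (abs_risk_learner_sub_le hD hL hm hi θ hα0 hα (C := T * (η * α))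
      fun i => ?_).trans hB
    exact (norm_iterates_le hL θ hη hα z t ht' i).trans
      (mul_le_mul_of_nonneg_right (by exact_mod_cast ht') hηα)
  have hE := integral_resampleMean_le D hN hf hbd hK
  have hae := samAverageRisk_ae_eq hD L η ρ T θ N
  refine ⟨(integral_congr_ae hae).trans_le hE, ?_⟩
  have htail := resampleMean_tail D hN hf hbd hs
  have h1 : (Measure.pi fun _ : Fin N => D) {Z | K + 2 * B * (T ^ 2 / N) + s
        < samAverageRisk D L η ρ T θ Z} ≤ (Measure.pi fun _ : Fin N => D)
      {Z | ∫ Z', resampleMean (pathRisk D L η ρ θ (T := T)) Z' ∂(Measure.pi fun _ : Fin N => D) + s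
        ≤ resampleMean (pathRisk D L η ρ θ (T := T)) Z} := by
    refine measure_mono_ae ?_
    filter_upwards [hae] with Z hZ h
    change K + 2 * B * (T ^ 2 / N) + s < samAverageRisk D L η ρ T θ Z at h
    rw [hZ] at h
    show _ + s ≤ _
    linarith
  refine h1.trans ?_
  rw [← ofReal_measureReal]
  exact ENNReal.ofReal_le_ofReal htail

end Fixed

end

end SAMGen

namespace SAMGen

noncomputable section

/-! ### The initialization in terms of independent standardized neurons -/

section Neurons

/-- Law of the standardized first-layer weight and bias of a neuron. -/
def hiddenLaw (d : ℕ) : Measure (Input d × ℝ) :=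
  (stdGaussian (Input d)).prod (gaussianReal 0 1)

instance (d : ℕ) : IsProbabilityMeasure (hiddenLaw d) := by
  unfold hiddenLaw; infer_instance

/-- Law of the standardized output weights of a neuron. -/
def outLaw (k : ℕ) : Measure (Fin k → ℝ) := Measure.pi fun _ => gaussianReal 0 1

instance (k : ℕ) : IsProbabilityMeasure (outLaw k) := by
  unfold outLaw; infer_instance

/-- First-layer weight, bias and output weights of a neuron. -/
abbrev Neuron (d k : ℕ) := (Input d × ℝ) × (Fin k → ℝ)

def neuronLaw (d k : ℕ) : Measure (Neuron d k) := (hiddenLaw d).prod (outLaw k)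

instance (d k : ℕ) : IsProbabilityMeasure (neuronLaw d k) := by
  unfold neuronLaw; infer_instance

variable {m d k : ℕ}

/-- The standardized neurons of an initialization. -/
def neurons (εa : ℝ) (θ : InitSpace m d k) : Fin m → Neuron d k :=
  fun i => ((√m • initW θ i, √m * initB θ i), fun r => εa⁻¹ * initA θ r i)

/-- Used to regroup the output weights, which are indexed by output first, into one vector per
neuron. -/
lemma measurePreserving_swap_pi {ι κ X : Type*} [Fintype ι] [Fintype κ] [MeasurableSpace X]
    (μ : Measure X) [IsProbabilityMeasure μ] :
    MeasurePreserving (fun (f : ι → κ → X) (j : κ) (i : ι) => f i j)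
      (Measure.pi fun _ : ι => Measure.pi fun _ : κ => μ)
      (Measure.pi fun _ : κ => Measure.pi fun _ : ι => μ) := by
  have h1 : MeasurePreserving (MeasurableEquiv.curry ι κ X).symm
      (Measure.pi fun _ : ι => Measure.pi fun _ : κ => μ) (Measure.pi fun _ : ι × κ => μ) := by
    refine ⟨(MeasurableEquiv.curry ι κ X).symm.measurable, ?_⟩
    have := Measure.infinitePi_map_curry_symm (fun (_ : ι) (_ : κ) => μ)
    simpa only [Measure.infinitePi_eq_pi] using this
  have h2 : MeasurePreserving (fun (Z : ι × κ → X) (j : κ × ι) => Z j.swap)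
      (Measure.pi fun _ : ι × κ => μ) (Measure.pi fun _ : κ × ι => μ) :=
    measurePreserving_comp_injective μ Prod.swap_injective
  have h3 : MeasurePreserving (MeasurableEquiv.curry κ ι X)
      (Measure.pi fun _ : κ × ι => μ) (Measure.pi fun _ : κ => Measure.pi fun _ : ι => μ) := by
    refine ⟨(MeasurableEquiv.curry κ ι X).measurable, ?_⟩
    have := Measure.infinitePi_map_curry (fun (_ : κ) (_ : ι) => μ)
    simpa only [Measure.infinitePi_eq_pi] using this
  exact h3.comp (h2.comp h1)

lemma measurePreserving_const_mul_gaussian {c : ℝ} {v : ℝ≥0} (h : c ^ 2 * v = 1) :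
    MeasurePreserving (fun u : ℝ => c * u) (gaussianReal 0 v) (gaussianReal 0 1) := by
  refine ⟨by fun_prop, ?_⟩
  rw [gaussianReal_map_const_mul, mul_zero]
  congr 1
  ext
  simpa using h

/-- Rescaling by `√m` and `εa⁻¹` turns the initialization into independent copies of one neuron
whose law does not involve `m` or `εa`. Every concentration bound below is for such a product over
neurons. -/
lemma measurePreserving_neurons {εa : ℝ} (hεa : 0 < εa) (hm : 0 < m) :
    MeasurePreserving (neurons (m := m) (d := d) (k := k) εa) (initMeasure m d k εa)
      (Measure.pi fun _ => neuronLaw d k) := by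
  have hm' : (0 : ℝ) < m := by exact_mod_cast hm
  have hs : MeasurePreserving (fun u : ℝ => √m * u) (gaussianReal 0 (1 / (m : ℝ≥0)))
      (gaussianReal 0 1) := by
    refine measurePreserving_const_mul_gaussian ?_
    rw [Real.sq_sqrt hm'.le]; push_cast; field_simp
  have ha : MeasurePreserving (fun u : ℝ => εa⁻¹ * u) (gaussianReal 0 (εa.toNNReal ^ 2))
      (gaussianReal 0 1) := by
    refine measurePreserving_const_mul_gaussian ?_
    push_cast
    rw [Real.coe_toNNReal _ hεa.le]; field_simp
  have hstd : MeasurePreserving (WithLp.toLp 2) (Measure.pi fun _ : Fin (d + 1) => gaussianReal 0 1)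
      (stdGaussian (Input d)) := ⟨WithLp.measurable_toLp 2 _, map_pi_eq_stdGaussian⟩
  have hW : MeasurePreserving
      (fun (w : Fin m → Fin (d + 1) → ℝ) (i : Fin m) =>
        (WithLp.toLp 2 fun l => √m * w i l : Input d))
      (Measure.pi fun _ => Measure.pi fun _ => gaussianReal 0 (1 / (m : ℝ≥0)))
      (Measure.pi fun _ => stdGaussian (Input d)) :=
    measurePreserving_pi _ _ fun i => hstd.comp (measurePreserving_pi _ _ fun l => hs)
  have hb : MeasurePreserving (fun (b : Fin m → ℝ) (i : Fin m) => √m * b i)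
      (Measure.pi fun _ => gaussianReal 0 (1 / (m : ℝ≥0)))
      (Measure.pi fun _ => gaussianReal 0 1) := measurePreserving_pi _ _ fun i => hs
  have hA : MeasurePreserving (fun (a : Fin k → Fin m → ℝ) (r : Fin k) (i : Fin m) => εa⁻¹ * a r i)
      (Measure.pi fun _ => Measure.pi fun _ => gaussianReal 0 (εa.toNNReal ^ 2))
      (Measure.pi fun _ => Measure.pi fun _ => gaussianReal 0 1) :=
    measurePreserving_pi _ _ fun r => measurePreserving_pi _ _ fun i => ha
  have hA' : MeasurePreserving (fun (a : Fin k → Fin m → ℝ) (i : Fin m) (r : Fin k) => εa⁻¹ * a r i)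
      (Measure.pi fun _ => Measure.pi fun _ => gaussianReal 0 (εa.toNNReal ^ 2))
      (Measure.pi fun _ => outLaw k) := (measurePreserving_swap_pi (gaussianReal 0 1)).comp hA
  have h1 := hW.prod (hb.prod hA')
  have hassoc := (measurePreserving_prodAssoc (Measure.pi fun _ : Fin m => stdGaussian (Input d))
    (Measure.pi fun _ : Fin m => gaussianReal 0 1) (Measure.pi fun _ : Fin m => outLaw k)).symm
  have hz1 := (measurePreserving_arrowProdEquivProdArrow (Input d) ℝ (Fin m)
    (fun _ => stdGaussian (Input d)) (fun _ => gaussianReal 0 1)).symm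
  have hz2 := (measurePreserving_arrowProdEquivProdArrow (Input d × ℝ) (Fin k → ℝ) (Fin m)
    (fun _ => hiddenLaw d) (fun _ => outLaw k)).symm
  have h2 := hz2.comp ((hz1.prod (MeasurePreserving.id _)).comp (hassoc.comp h1))
  exact h2

lemma gaussian_map_inner (w : Input d) {v : ℝ≥0} (hv : (v : ℝ) = ‖w‖ ^ 2) :
    (stdGaussian (Input d)).map (fun y => inner ℝ w y) = gaussianReal 0 v := by
  have h := IsGaussian.map_eq_gaussianReal (μ := stdGaussian (Input d)) (innerSL ℝ w)
  rw [integral_strongDual_stdGaussian, variance_dual_stdGaussian, innerSL_apply_norm, ← hv,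
    Real.toNNReal_coe] at h
  exact h

/-- Joint law of the projections of a hidden neuron to an input and to a target direction. -/
lemma map_hiddenLaw {x w : Input d} (hx : ‖x‖ = 1) (hw : ‖w‖ = 1) {v : ℝ≥0}
    (hv : (v : ℝ) = 1 - inner ℝ w x ^ 2) :
    (hiddenLaw d).map (fun q => (q.2, inner ℝ x q.1, inner ℝ (w - inner ℝ w x • x) q.1))
      = projLaw v := by
  have hnorm : (v : ℝ) = ‖w - inner ℝ w x • x‖ ^ 2 := by
    rw [hv, norm_sub_sq_real, hw, norm_smul, hx, real_inner_smul_right, Real.norm_eq_abs, mul_one,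
      sq_abs]
    ring
  have hpair : (stdGaussian (Input d)).map
      (fun y => (inner ℝ x y, inner ℝ (w - inner ℝ w x • x) y))
      = (gaussianReal 0 1).prod (gaussianReal 0 v) := by
    have hlaw : HasGaussianLaw (fun y : Input d => (inner ℝ x y, inner ℝ (w - inner ℝ w x • x) y))
        (stdGaussian (Input d)) := by
      have h0 : HasGaussianLaw (id : Input d → Input d) (stdGaussian (Input d)) :=
        ⟨by rw [Measure.map_id]; infer_instance⟩
      exact h0.map_of_measurable
        ((innerSL ℝ x).prod (innerSL ℝ (w - inner ℝ w x • x))) (by fun_prop)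
    -- The remainder `w - ⟨w, x⟩ x` is orthogonal to `x`, and jointly Gaussian uncorrelated
    -- variables are independent.
    have hcov : cov[fun y => inner ℝ x y, fun y => inner ℝ (w - inner ℝ w x • x) y;
        stdGaussian (Input d)] = 0 := by
      rw [← covarianceBilin_apply_eq_cov IsGaussian.memLp_two_id, covarianceBilin_stdGaussian,
        innerSL_apply_apply, inner_sub_right, real_inner_smul_right, real_inner_self_eq_norm_sq, hx,
        real_inner_comm]
      ring
    have hind := hlaw.indepFun_of_covariance_eq_zero hcov
    rw [(indepFun_iff_map_prod_eq_prod_map_map (by fun_prop) (by fun_prop)).mp hind,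
      gaussian_map_inner x (v := 1) (by simp [hx]), gaussian_map_inner _ hnorm]
  have e : (fun q : Input d × ℝ => (q.2, inner ℝ x q.1, inner ℝ (w - inner ℝ w x • x) q.1))
      = (Prod.map id fun y : Input d => (inner ℝ x y, inner ℝ (w - inner ℝ w x • x) y))
        ∘ Prod.swap := rfl
  rw [hiddenLaw, e, ← Measure.map_map (by fun_prop) measurable_swap, Measure.prod_swap,
    ← Measure.map_prod_map _ _ measurable_id (by fun_prop), Measure.map_id, hpair]
  rfl

end Neurons

end

end SAMGen

namespace SAMGen

noncomputable section

/-! ### Estimates for Gaussian variables -/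

section GaussianEstimates

/-- The density is at most `1 / 2` and the interval has length `2 * δ`. -/
lemma gaussian_interval_le (a : ℝ) {δ : ℝ} (hδ : 0 ≤ δ) :
    (gaussianReal 0 1).real {u | |a + u| ≤ δ} ≤ δ := by
  have hset : {u : ℝ | |a + u| ≤ δ} = Set.Icc (-δ - a) (δ - a) := by
    ext u
    simp only [Set.mem_ofPred_eq, Set.mem_Icc, abs_le]
    constructor <;> rintro ⟨h1, h2⟩ <;> constructor <;> linarith
  rw [hset, measureReal_def, gaussianReal_apply_eq_integral 0 one_ne_zero,
    ENNReal.toReal_ofReal (integral_nonneg fun u => gaussianPDFReal_nonneg _ _ _)]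
  have hpdf : ∀ u, ‖gaussianPDFReal 0 1 u‖ ≤ 1 / 2 := by
    intro u
    rw [Real.norm_of_nonneg (gaussianPDFReal_nonneg _ _ _), gaussianPDFReal]
    have h1 : (2 : ℝ) ≤ √(2 * Real.pi * (1 : ℝ≥0)) := by
      apply Real.le_sqrt_of_sq_le
      have := Real.pi_gt_three
      norm_num; linarith
    have h2 : (√(2 * Real.pi * (1 : ℝ≥0)))⁻¹ ≤ 1 / 2 := by
      rw [one_div]; exact inv_anti₀ (by norm_num) h1
    have h3 : Real.exp (-(u - 0) ^ 2 / (2 * (1 : ℝ≥0))) ≤ 1 := by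
      apply Real.exp_le_one_iff.mpr
      have := sq_nonneg (u - 0)
      simp only [NNReal.coe_one]; linarith
    have h4 := (Real.exp_pos (-(u - 0) ^ 2 / (2 * (1 : ℝ≥0)))).le
    calc _ ≤ 1 / 2 * 1 := mul_le_mul h2 h3 h4 (by norm_num)
      _ = _ := by norm_num
  have h := norm_setIntegral_le_of_norm_le_const (μ := volume)
    (s := Set.Icc (-δ - a) (δ - a)) (f := gaussianPDFReal 0 1) (C := 1 / 2)
    measure_Icc_lt_top (fun u _ => hpdf u)
  refine ((le_abs_self _).trans h).trans ?_
  rw [Measure.real, Real.volume_Icc, ENNReal.toReal_ofReal (by linarith)]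
  linarith

/-- The exact value is `(1 - 2 * t) ^ (-1 / 2)`, and `(1 - 2 * t) * exp (4 * t) ≥ 1` in the given
range. -/
lemma integral_exp_mul_sq_gaussian {t : ℝ} (h0 : 0 ≤ t) (ht : t ≤ 1 / 4) :
    ∫⁻ u, ENNReal.ofReal (Real.exp (t * u ^ 2)) ∂(gaussianReal 0 1)
      ≤ ENNReal.ofReal (Real.exp (2 * t)) := by
  rw [gaussianReal_of_var_ne_zero _ one_ne_zero,
    lintegral_withDensity_eq_lintegral_mul _ (measurable_gaussianPDF 0 1) (by fun_prop)]
  have e : ∀ u : ℝ, (gaussianPDF 0 1 * fun u => ENNReal.ofReal (Real.exp (t * u ^ 2))) u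
      = ENNReal.ofReal ((√(2 * Real.pi))⁻¹ * Real.exp (-(1 / 2 - t) * u ^ 2)) := by
    intro u
    rw [Pi.mul_apply, gaussianPDF, ← ENNReal.ofReal_mul (gaussianPDFReal_nonneg _ _ _),
      gaussianPDFReal, mul_assoc, ← Real.exp_add]
    congr 2
    · simp
    · congr 1; simp; ring
  simp_rw [e]
  have hb : 0 < 1 / 2 - t := by linarith
  rw [← ofReal_integral_eq_lintegral_ofReal ((integrable_exp_neg_mul_sq hb).const_mul _)
    (Filter.Eventually.of_forall fun u => by positivity), integral_const_mul, integral_gaussian]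
  apply ENNReal.ofReal_le_ofReal
  have hpi := Real.pi_pos
  have h1 : (√(2 * Real.pi))⁻¹ * √(Real.pi / (1 / 2 - t)) = √((1 - 2 * t)⁻¹) := by
    rw [← Real.sqrt_inv, ← Real.sqrt_mul (by positivity)]
    congr 1
    field_simp
  rw [h1]
  apply Real.sqrt_le_iff.mpr ⟨(Real.exp_pos _).le, ?_⟩
  rw [← Real.exp_nat_mul]
  have h2 : Real.exp (-(4 * t)) ≤ 1 - 2 * t := by
    have h3 := Real.quadratic_le_exp_of_nonneg (x := 4 * t) (by linarith)
    rw [Real.exp_neg]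
    apply inv_le_of_inv_le₀ (by linarith)
    refine le_trans ?_ h3
    rw [inv_eq_one_div, div_le_iff₀ (by linarith)]
    nlinarith [mul_nonneg h0 h0, mul_nonneg (mul_nonneg h0 h0) h0, mul_nonneg h0 hb.le, mul_nonneg (mul_nonneg h0 h0) (by linarith : 0 ≤ 1/4 - t)]
  calc (1 - 2 * t)⁻¹ ≤ (Real.exp (-(4 * t)))⁻¹ := inv_anti₀ (Real.exp_pos _) h2
    _ = _ := by rw [← Real.exp_neg]; congr 1; push_cast; ring

lemma lintegral_exp_linear_outLaw {k : ℕ} (g : Fin k → ℝ) :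
    ∫⁻ ξ, ENNReal.ofReal (Real.exp (∑ r, g r * ξ r)) ∂(outLaw k)
      = ENNReal.ofReal (Real.exp ((∑ r, g r ^ 2) / 2)) := by
  have hint : Integrable (fun ξ : Fin k → ℝ => ∏ r, Real.exp (g r * ξ r)) (outLaw k) :=
    Integrable.fintype_prod (f := fun r u => Real.exp (g r * u)) fun r =>
      integrable_exp_mul_gaussianReal (g r)
  simp_rw [Real.exp_sum]
  rw [← ofReal_integral_eq_lintegral_ofReal hint (Filter.Eventually.of_forall fun ξ =>
    Finset.prod_nonneg fun r _ => (Real.exp_pos _).le)]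
  congr 1
  rw [outLaw, integral_fintype_prod_eq_prod (f := fun r u => Real.exp (g r * u)), Finset.sum_div,
    Real.exp_sum]
  refine Finset.prod_congr rfl fun r _ => ?_
  have := congrFun (mgf_id_gaussianReal (μ := 0) (v := 1)) (g r)
  simpa [mgf] using this

/-- Truncation to `[-Λ, Λ]`. -/
def clip (Λ u : ℝ) : ℝ := max (-Λ) (min u Λ)

lemma measurable_clip (Λ : ℝ) : Measurable (clip Λ) := by unfold clip; fun_prop

lemma abs_clip_le {Λ : ℝ} (hΛ : 0 ≤ Λ) (u : ℝ) : |clip Λ u| ≤ Λ := by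
  unfold clip
  rw [abs_le]
  exact ⟨le_max_left _ _, max_le (by linarith) (min_le_right _ _)⟩

lemma clip_of_abs_le {Λ u : ℝ} (h : |u| ≤ Λ) : clip Λ u = u := by
  obtain ⟨h1, h2⟩ := abs_le.mp h
  unfold clip
  rw [min_eq_left h2, max_eq_right h1]

lemma measurable_sign : Measurable Real.sign := by
  unfold Real.sign
  refine Measurable.ite measurableSet_Iio measurable_const ?_
  exact Measurable.ite measurableSet_Ioi measurable_const measurable_const

lemma abs_sign_le_one (u : ℝ) : |Real.sign u| ≤ 1 := by
  rcases Real.sign_apply_eq u with h | h | h <;> rw [h] <;> norm_num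

lemma clip_mul_sign {Λ : ℝ} (hΛ : 0 ≤ Λ) (u : ℝ) : clip Λ u * Real.sign u = min |u| Λ := by
  unfold clip
  rcases lt_trichotomy u 0 with h | h | h
  · rw [Real.sign_of_neg h, abs_of_neg h, min_eq_left (by linarith : u ≤ Λ)]
    rw [mul_neg_one, ← min_neg_neg, neg_neg, min_comm]
  · simp [h, hΛ]
  · rw [Real.sign_of_pos h, abs_of_pos h, mul_one]
    exact max_eq_right (le_min (by linarith) (by linarith))

/-- The mean of a truncated absolute Gaussian. -/
def clipMean (Λ : ℝ) : ℝ := ∫ u, min |u| Λ ∂(gaussianReal 0 1)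

/-- With probability at least one half `|u|` exceeds `1 / 2`. -/
lemma clipMean_ge {Λ : ℝ} (hΛ : 1 ≤ Λ) : 1 / 4 ≤ clipMean Λ := by
  have hm : MeasurableSet {u : ℝ | |0 + u| ≤ 1 / 2} :=
    measurableSet_le (by fun_prop) measurable_const
  have h := gaussian_interval_le 0 (δ := 1 / 2) (by norm_num)
  have hc : (1 / 2 : ℝ) ≤ (gaussianReal 0 1).real {u : ℝ | |0 + u| ≤ 1 / 2}ᶜ := by
    rw [probReal_compl_eq_one_sub hm]; linarith
  have hi : Integrable (fun u : ℝ => min |u| Λ) (gaussianReal 0 1) := by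
    refine integrable_of_abs_le _ (by fun_prop) (C := Λ) fun u => ?_
    rw [abs_of_nonneg (le_min (abs_nonneg _) (by linarith))]
    exact min_le_right _ _
  have h2 : ∫ u, Set.indicator {u : ℝ | |0 + u| ≤ 1 / 2}ᶜ (fun _ => (1 / 2 : ℝ)) u
      ∂(gaussianReal 0 1) ≤ clipMean Λ := by
    refine integral_mono ((integrable_const _).indicator hm.compl) hi fun u => ?_
    by_cases hu : u ∈ {u : ℝ | |0 + u| ≤ 1 / 2}ᶜ
    · rw [Set.indicator_of_mem hu]
      simp only [Set.mem_compl_iff, Set.mem_ofPred_eq, not_le, zero_add] at hu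
      exact le_min hu.le (by linarith)
    · rw [Set.indicator_of_notMem hu]
      exact le_min (abs_nonneg _) (by linarith)
  rw [integral_indicator hm.compl, setIntegral_const, smul_eq_mul] at h2
  linarith

/-- For distinct indices, flipping the sign of the coordinate `r'` preserves the law and negates the
integrand. This orthogonality lets one set of neurons serve all outputs at once. Clipping makes the
terms bounded, as the concentration inequality requires, and changes nothing on the event that all
output weights are at most `Λ`. -/
lemma integral_clip_mul_sign {k : ℕ} {Λ : ℝ} (hΛ : 0 ≤ Λ) (r r' : Fin k) :
    ∫ ξ, clip Λ (ξ r) * Real.sign (ξ r') ∂(outLaw k) = if r' = r then clipMean Λ else 0 := by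
  split_ifs with h
  · subst h
    simp_rw [clip_mul_sign hΛ]
    have := integral_comp_eval (μ := fun _ : Fin k => gaussianReal 0 1) (i := r')
      (f := fun u => min |u| Λ)
      (Measurable.aestronglyMeasurable (by fun_prop))
    exact this
  · have hmp : MeasurePreserving
        (fun (ξ : Fin k → ℝ) (i : Fin k) => (if i = r' then fun u : ℝ => -u else id) (ξ i))
        (outLaw k) (outLaw k) := by
      refine measurePreserving_pi _ _ fun i => ?_
      split_ifs
      · exact ⟨measurable_neg, by rw [gaussianReal_map_neg, neg_zero]⟩
      · exact MeasurePreserving.id _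
    have hmeas : Measurable fun ξ : Fin k → ℝ => clip Λ (ξ r) * Real.sign (ξ r') :=
      ((measurable_clip Λ).comp (measurable_pi_apply r)).mul
        (measurable_sign.comp (measurable_pi_apply r'))
    have h1 := integral_map (μ := outLaw k) hmp.measurable.aemeasurable
      (f := fun ξ : Fin k → ℝ => clip Λ (ξ r) * Real.sign (ξ r')) hmeas.aestronglyMeasurable
    rw [hmp.map_eq] at h1
    have h' : ¬ r = r' := fun e => h e.symm
    simp only [h', if_false, if_true, id, Real.sign_neg, mul_neg, integral_neg] at h1
    linarith

end GaussianEstimates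

/-! ### Sums over independent copies -/

section Copies

variable {Ω : Type*} [MeasurableSpace Ω]

lemma lintegral_pi_prod {m : ℕ} (μ : Measure Ω) [IsProbabilityMeasure μ] {f : Ω → ℝ≥0∞}
    (hf : Measurable f) :
    ∫⁻ n, ∏ i, f (n i) ∂(Measure.pi fun _ : Fin m => μ) = (∫⁻ u, f u ∂μ) ^ m := by
  have hind : iIndepFun (fun (i : Fin m) (n : Fin m → Ω) => f (n i))
      (Measure.pi fun _ : Fin m => μ) :=
    iIndepFun_pi (X := fun _ => f) fun i => hf.aemeasurable
  have h := lintegral_prod_eq_prod_lintegral_of_indepFun Finset.univ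
    (fun (i : Fin m) (n : Fin m → Ω) => f (n i)) hind
    (fun i => hf.comp (measurable_pi_apply i))
  rw [h]
  have : ∀ i : Fin m, ∫⁻ n, f (n i) ∂(Measure.pi fun _ : Fin m => μ) = ∫⁻ u, f u ∂μ := by
    intro i
    exact (measurePreserving_eval (fun _ : Fin m => μ) i).lintegral_comp hf
  simp [this]

/-- The centred sum `X` has second moment at most `m * M ^ 2`, and `2 * (M * √m) * |X| ≤ X ^ 2 + M ^
2 * m` converts this into a first moment. -/
lemma integral_abs_mean_sub_le {m : ℕ} (hm : 0 < m) (μ : Measure Ω) [IsProbabilityMeasure μ]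
    {f : Ω → ℝ} (hf : Measurable f) {M : ℝ} (hM : 0 < M) (hfM : ∀ u, |f u| ≤ M) :
    ∫ n, |(∑ i, f (n i)) / m - ∫ u, f u ∂μ| ∂(Measure.pi fun _ : Fin m => μ) ≤ M / √m := by
  have hm' : (0 : ℝ) < m := by exact_mod_cast hm
  have hLp : MemLp f 2 μ := MemLp.of_bound hf.aestronglyMeasurable M
    (Filter.Eventually.of_forall fun u => by rw [Real.norm_eq_abs]; exact hfM u)
  have hfi : Integrable f μ := integrable_of_abs_le μ hf hfM
  have hvar := variance_sum_pi (μ := fun _ : Fin m => μ) (X := fun _ => f) fun _ => hLp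
  have hS : Measurable fun n : Fin m → Ω => ∑ i, f (n i) :=
    Finset.measurable_sum _ fun i _ => hf.comp (measurable_pi_apply i)
  have e0 : (∑ i : Fin m, fun n : Fin m → Ω => f (n i)) = fun n => ∑ i, f (n i) := by
    ext n; simp
  have hmean : ∫ n, ∑ i, f (n i) ∂(Measure.pi fun _ : Fin m => μ) = m * ∫ u, f u ∂μ := by
    rw [integral_finsetSum]
    · have : ∀ i : Fin m, ∫ n, f (n i) ∂(Measure.pi fun _ : Fin m => μ) = ∫ u, f u ∂μ := fun i =>
        integral_comp_eval (μ := fun _ : Fin m => μ) hf.aestronglyMeasurable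
      simp [this]
    · intro i _
      exact integrable_of_abs_le _ (hf.comp (measurable_pi_apply i)) fun n => hfM _
  rw [e0, variance_eq_integral hS.aemeasurable, hmean] at hvar
  have hv1 : Var[f; μ] ≤ M ^ 2 := by
    refine (variance_le_expectation_sq hf.aestronglyMeasurable).trans ?_
    have : ∫ u, (f ^ 2) u ∂μ ≤ ∫ _, M ^ 2 ∂μ := by
      refine integral_mono_of_nonneg (Filter.Eventually.of_forall fun u => sq_nonneg _)
        (integrable_const _) (Filter.Eventually.of_forall fun u => ?_)
      exact sq_le_sq' (by linarith [(abs_le.mp (hfM u)).1]) (abs_le.mp (hfM u)).2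
    simpa using this
  have hv2 : ∫ n, (∑ i, f (n i) - m * ∫ u, f u ∂μ) ^ 2 ∂(Measure.pi fun _ : Fin m => μ)
      ≤ m * M ^ 2 := by
    rw [hvar, Finset.sum_const, Finset.card_univ, Fintype.card_fin, nsmul_eq_mul]
    exact mul_le_mul_of_nonneg_left hv1 hm'.le
  have hsq : (√(m : ℝ)) ^ 2 = m := Real.sq_sqrt hm'.le
  have hsp : 0 < √(m : ℝ) := Real.sqrt_pos.mpr hm'
  have hSb : ∀ n : Fin m → Ω, |∑ i, f (n i)| ≤ m * M := fun n =>
    (Finset.abs_sum_le_sum_abs _ _).trans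
      ((Finset.sum_le_card_nsmul _ _ M fun i _ => hfM _).trans (by simp))
  have hint2 : Integrable (fun n : Fin m → Ω => (∑ i, f (n i) - m * ∫ u, f u ∂μ) ^ 2)
      (Measure.pi fun _ : Fin m => μ) := by
    refine integrable_of_abs_le _ ((hS.sub_const _).pow_const 2)
      (C := (m * M + |m * ∫ u, f u ∂μ|) ^ 2) fun n => ?_
    rw [abs_pow]
    exact pow_le_pow_left₀ (abs_nonneg _) ((abs_sub _ _).trans (add_le_add (hSb n) le_rfl)) 2
  have hpt : ∀ n : Fin m → Ω, |(∑ i, f (n i)) / m - ∫ u, f u ∂μ|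
      ≤ (2 * M * m * √m)⁻¹ * (∑ i, f (n i) - m * ∫ u, f u ∂μ) ^ 2 + M / (2 * √m) := by
    intro n
    have e : (∑ i, f (n i)) / m - ∫ u, f u ∂μ = (∑ i, f (n i) - m * ∫ u, f u ∂μ) / m := by
      field_simp
    rw [e, abs_div, abs_of_pos hm']
    generalize ∑ i, f (n i) - m * ∫ u, f u ∂μ = X
    have h1 : 0 ≤ (|X| - M * √m) ^ 2 := sq_nonneg _
    have h2 : 2 * (M * √m) * |X| ≤ X ^ 2 + M ^ 2 * m := by
      rw [← sq_abs X]
      have e3 : (M * √m) ^ 2 = M ^ 2 * m := by rw [mul_pow, hsq]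
      nlinarith
    have e4 : (2 * M * m * √m)⁻¹ * X ^ 2 + M / (2 * √m)
        = (X ^ 2 + M ^ 2 * m) / (2 * M * m * √m) := by field_simp
    rw [e4, div_le_div_iff₀ hm' (by positivity)]
    have := mul_le_mul_of_nonneg_right h2 hm'.le
    linarith
  have hint : Integrable (fun n : Fin m → Ω =>
      (2 * M * m * √m)⁻¹ * (∑ i, f (n i) - m * ∫ u, f u ∂μ) ^ 2 + M / (2 * √m))
      (Measure.pi fun _ : Fin m => μ) := (hint2.const_mul _).add (integrable_const _)
  refine (integral_mono_of_nonneg (Filter.Eventually.of_forall fun n => abs_nonneg _) hint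
    (Filter.Eventually.of_forall hpt)).trans ?_
  rw [integral_add (hint2.const_mul _) (integrable_const _), integral_const_mul]
  simp only [integral_const, probReal_univ, one_smul]
  have h5 := mul_le_mul_of_nonneg_left hv2 (by positivity : 0 ≤ (2 * M * m * √m)⁻¹)
  refine (add_le_add h5 le_rfl).trans (le_of_eq ?_)
  field_simp
  norm_num

/-- Concentration of empirical means in `L¹`. -/
lemma empirical_mean_tail {m : ℕ} (hm : 0 < m) (μ : Measure Ω) [IsProbabilityMeasure μ]
    {X : Type*} [MeasurableSpace X] (D : Measure X) [IsProbabilityMeasure D]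
    {U : X → Ω → ℝ} (hU : Measurable (Function.uncurry U)) {M : ℝ} (hM : 0 < M)
    (hUM : ∀ x u, |U x u| ≤ M) {s : ℝ} (hs : 0 ≤ s) :
    (Measure.pi fun _ : Fin m => μ).real
      {n | M / √m + s ≤ ∫ x, |(∑ i, U x (n i)) / m - ∫ u, U x u ∂μ| ∂D}
      ≤ Real.exp (-(m * s ^ 2) / (8 * M ^ 2)) := by
  have hm' : (0 : ℝ) < m := by exact_mod_cast hm
  have hmean : Measurable fun x => ∫ u, U x u ∂μ :=
    hU.stronglyMeasurable.integral_prod_right.measurable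
  have hjoint : Measurable fun q : (Fin m → Ω) × X =>
      |(∑ i, U q.2 (q.1 i)) / m - ∫ u, U q.2 u ∂μ| := by
    refine (Measurable.sub (Measurable.div_const (Finset.measurable_sum _ fun i _ => ?_) _)
      (hmean.comp measurable_snd)).abs
    exact hU.comp (f := fun q : (Fin m → Ω) × X => (q.2, q.1 i))
      (measurable_snd.prodMk ((measurable_pi_apply i).comp measurable_fst))
  have hmeanb : ∀ x, |∫ u, U x u ∂μ| ≤ M := fun x => by
    have := norm_integral_le_of_norm_le_const (μ := μ) (f := U x) (C := M)
      (Filter.Eventually.of_forall fun u => by rw [Real.norm_eq_abs]; exact hUM x u)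
    simpa using this
  have hb : ∀ (n : Fin m → Ω) x, |(∑ i, U x (n i)) / m - ∫ u, U x u ∂μ| ≤ 2 * M := by
    intro n x
    have h1 : |(∑ i : Fin m, U x (n i)) / m| ≤ M := by
      rw [abs_div, abs_of_pos hm', div_le_iff₀ hm']
      refine (Finset.abs_sum_le_sum_abs _ _).trans ?_
      exact (Finset.sum_le_card_nsmul _ _ M fun i _ => hUM _ _).trans (by simp [mul_comm])
    have := (abs_sub ((∑ i : Fin m, U x (n i)) / m) (∫ u, U x u ∂μ))
    linarith [hmeanb x]
  obtain ⟨f, hfdef⟩ : ∃ f : (Fin m → Ω) → ℝ,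
      f = fun n => ∫ x, |(∑ i, U x (n i)) / m - ∫ u, U x u ∂μ| ∂D := ⟨_, rfl⟩
  have hfm : Measurable f := by
    rw [hfdef]; exact hjoint.stronglyMeasurable.integral_prod_right.measurable
  have hxm : ∀ n : Fin m → Ω, Measurable fun x =>
      |(∑ i, U x (n i)) / m - ∫ u, U x u ∂μ| := fun n =>
    hjoint.comp (f := fun x => (n, x)) (measurable_const.prodMk measurable_id)
  have hxi : ∀ n : Fin m → Ω, Integrable (fun x =>
      |(∑ i, U x (n i)) / m - ∫ u, U x u ∂μ|) D := fun n =>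
    integrable_of_abs_le D (hxm n) (C := 2 * M) fun x => by rw [abs_abs]; exact hb n x
  have hfB : ∀ n, |f n| ≤ 2 * M := by
    intro n
    have := norm_integral_le_of_norm_le_const (μ := D)
      (f := fun x => |(∑ i, U x (n i)) / m - ∫ u, U x u ∂μ|) (C := 2 * M)
      (Filter.Eventually.of_forall fun x => by
        rw [Real.norm_eq_abs, abs_abs]; exact hb n x)
    rw [hfdef]
    simpa using this
  have hmeanf : ∫ n, f n ∂(Measure.pi fun _ : Fin m => μ) ≤ M / √m := by
    rw [hfdef]
    have hsw := integral_integral_swap (μ := Measure.pi fun _ : Fin m => μ) (ν := D)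
      (f := fun n x => |(∑ i, U x (n i)) / m - ∫ u, U x u ∂μ|)
      (integrable_of_abs_le _ hjoint (C := 2 * M) fun q =>
        (abs_abs _).le.trans (hb q.1 q.2))
    rw [hsw]
    have : ∫ x, ∫ n, |(∑ i, U x (n i)) / m - ∫ u, U x u ∂μ| ∂(Measure.pi fun _ : Fin m => μ) ∂D
        ≤ ∫ _, M / √m ∂D := by
      refine integral_mono_of_nonneg (Filter.Eventually.of_forall fun x =>
        integral_nonneg fun n => abs_nonneg _) (integrable_const _)
        (Filter.Eventually.of_forall fun x => ?_)
      exact integral_abs_mean_sub_le hm μ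
        (hU.comp (f := fun u => (x, u)) (measurable_const.prodMk measurable_id)) hM (hUM x)
    simpa using this
  -- The deviation is averaged over `D` before concentration is applied, so no union bound or
  -- covering over inputs is needed; replacing one neuron changes the average by at most `2 * M /
  -- m`.
  have hdiff : ∀ n j u, |f (Function.update n j u) - f n| ≤ 2 * M / m := by
    intro n j u
    rw [hfdef]
    simp only
    rw [← integral_sub (hxi _) (hxi _), ← Real.norm_eq_abs]
    have := norm_integral_le_of_norm_le_const (μ := D)
      (f := fun x => |(∑ i, U x (Function.update n j u i)) / m - ∫ u, U x u ∂μ|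
        - |(∑ i, U x (n i)) / m - ∫ u, U x u ∂μ|) (C := 2 * M / m)
      (Filter.Eventually.of_forall fun x => by
        rw [Real.norm_eq_abs]
        refine (abs_abs_sub_abs_le _ _).trans ?_
        rw [sub_sub_sub_cancel_right, ← sub_div, abs_div, abs_of_pos hm']
        refine div_le_div_of_nonneg_right ?_ hm'.le
        rw [← Finset.sum_sub_distrib, Finset.sum_eq_single j]
        · rw [Function.update_self]
          have := abs_sub (U x u) (U x (n j))
          linarith [hUM x u, hUM x (n j)]
        · intro i _ hi
          rw [Function.update_of_ne hi, sub_self]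
        · simp)
    simpa using this
  have hmc := mcdiarmid μ (by positivity) hfm hfB hdiff hs
  have hexp : -s ^ 2 / (2 * (m * (2 * M / m) ^ 2)) = -(m * s ^ 2) / (8 * M ^ 2) := by
    field_simp
    ring
  rw [hexp] at hmc
  refine le_trans (measureReal_mono ?_) hmc
  intro n hn
  rw [hfdef] at hmeanf ⊢
  simp only [Set.mem_ofPred_eq] at hn ⊢
  linarith

end Copies

end

end SAMGen

namespace SAMGen

noncomputable section

/-! ### High-probability events of the initialization -/

section Events

variable {m d k : ℕ}

/-- Pre-activation of a standardized neuron. -/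
def neuronAct (ν : Neuron d k) (x : Input d) : ℝ := inner ℝ ν.1.1 x + ν.1.2

lemma measurable_neuronAct :
    Measurable fun q : Neuron d k × Input d => neuronAct q.1 q.2 := by
  have : Continuous fun q : Neuron d k × Input d => neuronAct q.1 q.2 := by
    unfold neuronAct; fun_prop
  exact this.measurable

lemma measurable_neuronAct_comp {α : Type*} [MeasurableSpace α] {ν : α → Neuron d k}
    {x : α → Input d} (hν : Measurable ν) (hx : Measurable x) :
    Measurable fun a => neuronAct (ν a) (x a) :=
  measurable_neuronAct.comp (f := fun a => (ν a, x a)) (hν.prodMk hx)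

/-- Conditionally on the hidden weight, the Gaussian bias alone gives anti-concentration, so no
property of the input is needed. -/
lemma neuronLaw_nearZero_le (x : Input d) {δ : ℝ} (hδ : 0 ≤ δ) :
    (neuronLaw d k).real {ν | |neuronAct ν x| ≤ δ} ≤ δ := by
  have hS : MeasurableSet {q : Input d × ℝ | |inner ℝ q.1 x + q.2| ≤ δ} :=
    measurableSet_le (Continuous.measurable (by fun_prop)) measurable_const
  have hset : {ν : Neuron d k | |neuronAct ν x| ≤ δ}
      = {q : Input d × ℝ | |inner ℝ q.1 x + q.2| ≤ δ} ×ˢ Set.univ := by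
    ext ν; simp [neuronAct]
  rw [measureReal_def, hset, neuronLaw, Measure.prod_prod, measure_univ, mul_one, hiddenLaw,
    Measure.prod_apply hS]
  refine ENNReal.toReal_le_of_le_ofReal hδ ?_
  refine (lintegral_mono (g := fun _ => ENNReal.ofReal δ) fun y => ?_).trans (by simp)
  rw [← ENNReal.ofReal_toReal (measure_ne_top _ _)]
  exact ENNReal.ofReal_le_ofReal (gaussian_interval_le (inner ℝ y x) hδ)

/-- The `D`-probability of being nearly inactive is a function of the neuron with values in `[0,
1]`; by Fubini its mean is at most `δ`, and Hoeffding's inequality handles the sum over neurons. -/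
lemma nearZero_tail {Y : Type*} [MeasurableSpace Y] (D : Measure (Input d × Y))
    [IsProbabilityMeasure D] {δ s : ℝ} (hδ : 0 ≤ δ) (hs : 0 ≤ s) :
    (Measure.pi fun _ : Fin m => neuronLaw d k).real
      {n | m * (δ + s) ≤ ∑ i, ∫ z, (if |neuronAct (n i) z.1| ≤ δ then (1 : ℝ) else 0) ∂D}
      ≤ Real.exp (-(m * s ^ 2) / 2) := by
  have hj : Measurable fun q : Neuron d k × (Input d × Y) =>
      if |neuronAct q.1 q.2.1| ≤ δ then (1 : ℝ) else 0 := by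
    refine Measurable.ite (measurableSet_le ?_ measurable_const) measurable_const measurable_const
    exact (measurable_neuronAct_comp measurable_fst (measurable_fst.comp measurable_snd)).abs
  have hb : ∀ (ν : Neuron d k) (x : Input d),
      |(if |neuronAct ν x| ≤ δ then (1 : ℝ) else 0)| ≤ 1 := by
    intro ν x; split_ifs <;> norm_num
  have hg : Measurable fun ν : Neuron d k =>
      ∫ z, (if |neuronAct ν z.1| ≤ δ then (1 : ℝ) else 0) ∂D :=
    hj.stronglyMeasurable.integral_prod_right.measurable
  have hgb : ∀ ν : Neuron d k,
      |∫ z, (if |neuronAct ν z.1| ≤ δ then (1 : ℝ) else 0) ∂D| ≤ 1 := by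
    intro ν
    have := norm_integral_le_of_norm_le_const (μ := D)
      (f := fun z : Input d × Y => if |neuronAct ν z.1| ≤ δ then (1 : ℝ) else 0) (C := 1)
      (Filter.Eventually.of_forall fun z => hb ν z.1)
    simpa using this
  have hmean : ∫ ν, ∫ z, (if |neuronAct ν z.1| ≤ δ then (1 : ℝ) else 0) ∂D ∂(neuronLaw d k)
      ≤ δ := by
    have hsw := integral_integral_swap (μ := neuronLaw d k) (ν := D)
      (f := fun ν z => if |neuronAct ν z.1| ≤ δ then (1 : ℝ) else 0)
      (integrable_of_abs_le _ hj (C := 1) fun q => hb q.1 q.2.1)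
    rw [hsw]
    have : ∫ z, ∫ ν, (if |neuronAct ν z.1| ≤ δ then (1 : ℝ) else 0) ∂(neuronLaw d k) ∂D
        ≤ ∫ _, δ ∂D := by
      refine integral_mono_of_nonneg (Filter.Eventually.of_forall fun z =>
        integral_nonneg fun ν => by dsimp; split_ifs <;> norm_num) (integrable_const _)
        (Filter.Eventually.of_forall fun z => ?_)
      have hS : MeasurableSet {ν : Neuron d k | |neuronAct ν z.1| ≤ δ} :=
        measurableSet_le (measurable_neuronAct_comp measurable_id measurable_const).abs
          measurable_const
      have e : (fun ν : Neuron d k => if |neuronAct ν z.1| ≤ δ then (1 : ℝ) else 0)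
          = Set.indicator {ν : Neuron d k | |neuronAct ν z.1| ≤ δ} 1 := by
        ext ν; simp [Set.indicator]
      simp only [e]
      rw [integral_indicator_one hS]
      exact neuronLaw_nearZero_le z.1 hδ
    simpa using this
  have h := hoeffding_pi (m := m) (neuronLaw d k) hg one_pos hgb hs
  have e : -(m * s ^ 2) / (2 * (1 : ℝ) ^ 2) = -(m * s ^ 2) / 2 := by norm_num
  rw [e] at h
  refine le_trans (measureReal_mono ?_) h
  intro n hn
  simp only [Set.mem_ofPred_eq] at hn ⊢
  have := mul_le_mul_of_nonneg_left hmean (Nat.cast_nonneg m : (0 : ℝ) ≤ m)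
  linarith

lemma outWeights_tail {Λ : ℝ} (hΛ : 0 ≤ Λ) :
    (Measure.pi fun _ : Fin m => neuronLaw d k) {n | ∃ i r, Λ < |(n i).2 r|}
      ≤ ENNReal.ofReal (m * k * (2 * Real.exp (-Λ ^ 2 / 2))) := by
  have hset : {n : Fin m → Neuron d k | ∃ i r, Λ < |(n i).2 r|}
      = ⋃ i, ⋃ r, {n | Λ < |(n i).2 r|} := by
    ext n; simp
  have hmu : MeasurableSet {u : ℝ | Λ < |u|} := measurableSet_lt measurable_const (by fun_prop)
  have hone : ∀ (i : Fin m) (r : Fin k),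
      (Measure.pi fun _ : Fin m => neuronLaw d k) {n | Λ < |(n i).2 r|}
        ≤ ENNReal.ofReal (2 * Real.exp (-Λ ^ 2 / 2)) := by
    intro i r
    have h1 : MeasurePreserving (fun n : Fin m → Neuron d k => (n i).2 r)
        (Measure.pi fun _ : Fin m => neuronLaw d k) (gaussianReal 0 1) :=
      (measurePreserving_eval (fun _ : Fin k => gaussianReal 0 1) r).comp
        ((measurePreserving_snd (μ := hiddenLaw d) (ν := outLaw k)).comp
          (measurePreserving_eval (fun _ : Fin m => neuronLaw d k) i))
    have h2 := h1.measure_preimage hmu.nullMeasurableSet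
    change (Measure.pi fun _ : Fin m => neuronLaw d k)
      ((fun n : Fin m → Neuron d k => (n i).2 r) ⁻¹' {u : ℝ | Λ < |u|}) ≤ _
    rw [h2, ← ENNReal.ofReal_toReal (measure_ne_top _ _)]
    exact ENNReal.ofReal_le_ofReal (gaussian_abs_tail Λ hΛ)
  rw [hset]
  refine (measure_iUnion_fintype_le _ _).trans ?_
  refine (Finset.sum_le_sum fun i _ => (measure_iUnion_fintype_le _ _).trans
    (Finset.sum_le_sum fun r _ => hone i r)).trans ?_
  rw [Finset.sum_const, Finset.sum_const, Finset.card_univ, Finset.card_univ, Fintype.card_fin,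
    Fintype.card_fin, nsmul_eq_mul, nsmul_eq_mul, mul_assoc (m : ℝ),
    ENNReal.ofReal_mul (p := (m : ℝ)) (by positivity),
    ENNReal.ofReal_mul (p := (k : ℝ)) (by positivity),
    ENNReal.ofReal_natCast, ENNReal.ofReal_natCast]

/-- Given the hidden part, the exponent is a centred Gaussian in the output weights with variance at
most `c ^ 2 * (max act 0) ^ 2`, where `act` is the pre-activation. The square is at most twice the
sum of the squares of the projection and of the bias, so half the variance splits into two
independent quadratic exponents, each contributing `exp (2 * c ^ 2)`. -/
lemma lintegral_exp_neuron {x : Input d} (hx : ‖x‖ = 1) {g : Output k} (hg : ‖g‖ ≤ 1) {c : ℝ}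
    (hc : c ^ 2 ≤ 1 / 4) :
    ∫⁻ ν, ENNReal.ofReal (Real.exp (c * (max (neuronAct ν x) 0 * ∑ r, g r * ν.2 r)))
      ∂(neuronLaw d k) ≤ ENNReal.ofReal (Real.exp (4 * c ^ 2)) := by
  have hmeas : Measurable fun ν : Neuron d k =>
      ENNReal.ofReal (Real.exp (c * (max (neuronAct ν x) 0 * ∑ r, g r * ν.2 r))) := by
    have h1 : Measurable fun ν : Neuron d k => neuronAct ν x :=
      measurable_neuronAct_comp measurable_id measurable_const
    fun_prop
  have hg2 : ∑ r, g r ^ 2 ≤ 1 := by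
    rw [← EuclideanSpace.real_norm_sq_eq]
    exact pow_le_one₀ (norm_nonneg _) hg
  rw [neuronLaw, lintegral_prod _ hmeas.aemeasurable]
  have hin : ∀ q : Input d × ℝ,
      ∫⁻ ξ, ENNReal.ofReal (Real.exp (c * (max (neuronAct (q, ξ) x) 0 * ∑ r, g r * ξ r)))
        ∂(outLaw k) ≤ ENNReal.ofReal (Real.exp (c ^ 2 * (inner ℝ x q.1) ^ 2))
          * ENNReal.ofReal (Real.exp (c ^ 2 * q.2 ^ 2)) := by
    intro q
    have e : ∀ ξ : Fin k → ℝ, c * (max (neuronAct (q, ξ) x) 0 * ∑ r, g r * ξ r)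
        = ∑ r, (c * max (inner ℝ q.1 x + q.2) 0 * g r) * ξ r := by
      intro ξ
      rw [Finset.mul_sum, Finset.mul_sum]
      refine Finset.sum_congr rfl fun r _ => ?_
      simp only [neuronAct]; ring
    simp_rw [e]
    rw [lintegral_exp_linear_outLaw, ← ENNReal.ofReal_mul (Real.exp_pos _).le, ← Real.exp_add]
    refine ENNReal.ofReal_le_ofReal (Real.exp_le_exp.mpr ?_)
    rw [real_inner_comm q.1 x]
    simp_rw [mul_pow]
    rw [← Finset.mul_sum]
    have h1 : (max (inner ℝ q.1 x + q.2) 0) ^ 2 ≤ 2 * ((inner ℝ q.1 x) ^ 2 + q.2 ^ 2) := by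
      have h2 : (max (inner ℝ q.1 x + q.2) 0) ^ 2 ≤ (inner ℝ q.1 x + q.2) ^ 2 := by
        rcases le_total 0 (inner ℝ q.1 x + q.2) with h | h
        · rw [max_eq_left h]
        · rw [max_eq_right h]; simpa using sq_nonneg (inner ℝ q.1 x + q.2)
      nlinarith [sq_nonneg (inner ℝ q.1 x - q.2)]
    have h3 : c ^ 2 * (max (inner ℝ q.1 x + q.2) 0) ^ 2 * ∑ r, g r ^ 2
        ≤ c ^ 2 * (2 * ((inner ℝ q.1 x) ^ 2 + q.2 ^ 2)) * 1 := by
      refine mul_le_mul (mul_le_mul_of_nonneg_left h1 (sq_nonneg c)) hg2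
        (Finset.sum_nonneg fun r _ => sq_nonneg _) (by positivity)
    linarith
  refine (lintegral_mono hin).trans ?_
  have hA : AEMeasurable (fun y : Input d => ENNReal.ofReal (Real.exp (c ^ 2 * (inner ℝ x y) ^ 2)))
      (stdGaussian (Input d)) :=
    (Measurable.ennreal_ofReal (Continuous.measurable (by fun_prop))).aemeasurable
  have hB : AEMeasurable (fun u : ℝ => ENNReal.ofReal (Real.exp (c ^ 2 * u ^ 2)))
      (gaussianReal 0 1) := by fun_prop
  rw [hiddenLaw, lintegral_prod_mul hA hB]
  have h1 := integral_exp_mul_sq_gaussian (sq_nonneg c) hc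
  have h2 : ∫⁻ y, ENNReal.ofReal (Real.exp (c ^ 2 * (inner ℝ x y) ^ 2)) ∂(stdGaussian (Input d))
      = ∫⁻ u, ENNReal.ofReal (Real.exp (c ^ 2 * u ^ 2)) ∂(gaussianReal 0 1) := by
    rw [← gaussian_map_inner x (v := 1) (by simp [hx]),
      lintegral_map (f := fun u : ℝ => ENNReal.ofReal (Real.exp (c ^ 2 * u ^ 2)))
        (by fun_prop) (by fun_prop)]
  rw [h2]
  refine (mul_le_mul' h1 h1).trans (le_of_eq ?_)
  rw [← ENNReal.ofReal_mul (Real.exp_pos _).le, ← Real.exp_add]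
  congr 2; ring

/-- The standardized output of the initial network. -/
def initOutput (n : Fin m → Neuron d k) (x : Input d) : Output k :=
  (√m)⁻¹ • ∑ i, max (neuronAct (n i) x) 0 • (WithLp.toLp 2 (n i).2 : Output k)

lemma measurable_initOutput :
    Measurable fun q : (Fin m → Neuron d k) × Input d => initOutput q.1 q.2 := by
  have : Continuous fun q : (Fin m → Neuron d k) × Input d => initOutput q.1 q.2 := by
    unfold initOutput neuronAct; fun_prop
  exact this.measurable

lemma measurable_initOutput_comp {α : Type*} [MeasurableSpace α] {n : α → Fin m → Neuron d k}
    {x : α → Input d} (hn : Measurable n) (hx : Measurable x) :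
    Measurable fun a => initOutput (n a) (x a) :=
  measurable_initOutput.comp (f := fun a => (n a, x a)) (hn.prodMk hx)

lemma exists_norm_initOutput_le (n : Fin m → Neuron d k) :
    ∃ C, ∀ x, ‖x‖ = 1 → ‖initOutput n x‖ ≤ C := by
  refine ⟨(√m)⁻¹ * ∑ i, (‖(n i).1.1‖ + |(n i).1.2|) * ‖(WithLp.toLp 2 (n i).2 : Output k)‖,
    fun x hx => ?_⟩
  unfold initOutput
  rw [norm_smul, Real.norm_of_nonneg (by positivity)]
  refine mul_le_mul_of_nonneg_left ?_ (by positivity)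
  refine (norm_sum_le _ _).trans (Finset.sum_le_sum fun i _ => ?_)
  rw [norm_smul]
  refine mul_le_mul_of_nonneg_right ?_ (norm_nonneg _)
  have h1 := abs_real_inner_le_norm (n i).1.1 x
  rw [hx, mul_one] at h1
  rw [Real.norm_of_nonneg (le_max_right _ _)]
  refine max_le ?_ (by positivity)
  unfold neuronAct
  exact add_le_add ((le_abs_self _).trans h1) (le_abs_self _)

/-- The neurons are independent and each enters with `c = 1 / (2 * √m)`, so the product of `m`
factors `exp (4 * c ^ 2)` is exactly `e`. -/
lemma lintegral_exp_initOutput (hm : 0 < m) {x : Input d} (hx : ‖x‖ = 1) {g : Output k}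
    (hg : ‖g‖ ≤ 1) :
    ∫⁻ n, ENNReal.ofReal (Real.exp (inner ℝ g (initOutput n x) / 2))
      ∂(Measure.pi fun _ : Fin m => neuronLaw d k) ≤ ENNReal.ofReal (Real.exp 1) := by
  have hm' : (1 : ℝ) ≤ m := by exact_mod_cast hm
  have hsq : (√(m : ℝ)) ^ 2 = m := Real.sq_sqrt (by positivity)
  have hc : ((2 * √(m : ℝ))⁻¹) ^ 2 = 1 / (4 * m) := by
    rw [inv_pow, mul_pow, hsq]; norm_num
  have hc' : ((2 * √(m : ℝ))⁻¹) ^ 2 ≤ 1 / 4 := by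
    rw [hc, div_le_div_iff₀ (by positivity) (by norm_num)]; linarith
  have e : ∀ n : Fin m → Neuron d k,
      ENNReal.ofReal (Real.exp (inner ℝ g (initOutput n x) / 2))
        = ∏ i, ENNReal.ofReal (Real.exp
          ((2 * √(m : ℝ))⁻¹ * (max (neuronAct (n i) x) 0 * ∑ r, g r * (n i).2 r))) := by
    intro n
    rw [← ENNReal.ofReal_prod_of_nonneg fun i _ => (Real.exp_pos _).le, ← Real.exp_sum]
    congr 2
    unfold initOutput
    rw [real_inner_smul_right, inner_sum, mul_div_right_comm, Finset.mul_sum]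
    refine Finset.sum_congr rfl fun i _ => ?_
    rw [real_inner_smul_right]
    have : inner ℝ g (WithLp.toLp 2 (n i).2 : Output k) = ∑ r, g r * (n i).2 r := by
      simp [PiLp.inner_apply, mul_comm]
    rw [this, mul_inv]; ring
  have hmeas : Measurable fun ν : Neuron d k => ENNReal.ofReal (Real.exp
      ((2 * √(m : ℝ))⁻¹ * (max (neuronAct ν x) 0 * ∑ r, g r * ν.2 r))) := by
    have h1 : Measurable fun ν : Neuron d k => neuronAct ν x :=
      measurable_neuronAct_comp measurable_id measurable_const
    fun_prop
  simp_rw [e]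
  rw [lintegral_pi_prod (neuronLaw d k) hmeas]
  refine (pow_le_pow_left' (lintegral_exp_neuron hx hg hc') m).trans (le_of_eq ?_)
  rw [← ENNReal.ofReal_pow (Real.exp_pos _).le, ← Real.exp_nat_mul, hc]
  congr 2
  field_simp

/-- Jensen's inequality moves the exponential inside the average over `D`, Fubini reduces to a fixed
input, and Markov's inequality concludes. The bound does not involve `k` because `g` has norm at
most one; this is what makes the linear term of the loss expansion cheap. -/
lemma initOutput_inner_tail (hm : 0 < m) {Y : Type*} [MeasurableSpace Y]
    {D : Measure (Input d × Y)} [IsProbabilityMeasure D] (hD : NormalizedInputs D)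
    {g : Input d × Y → Output k} (hg : Measurable g) (hg1 : ∀ z, ‖g z‖ ≤ 1) (t : ℝ) :
    (Measure.pi fun _ : Fin m => neuronLaw d k)
      {n | t ≤ ∫ z, inner ℝ (g z) (initOutput n z.1) ∂D}
      ≤ ENNReal.ofReal (Real.exp (1 - t / 2)) := by
  have hz : ∀ n : Fin m → Neuron d k, Measurable fun z : Input d × Y =>
      inner ℝ (g z) (initOutput n z.1) := fun n =>
    hg.inner (measurable_initOutput_comp measurable_const measurable_fst)
  have hj : Measurable fun q : (Fin m → Neuron d k) × (Input d × Y) =>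
      ENNReal.ofReal (Real.exp (inner ℝ (g q.2) (initOutput q.1 q.2.1) / 2)) := by
    have : Measurable fun q : (Fin m → Neuron d k) × (Input d × Y) =>
        inner ℝ (g q.2) (initOutput q.1 q.2.1) :=
      (hg.comp measurable_snd).inner
        (measurable_initOutput_comp measurable_fst (measurable_fst.comp measurable_snd))
    fun_prop
  have hjensen : ∀ n : Fin m → Neuron d k,
      ENNReal.ofReal (Real.exp ((∫ z, inner ℝ (g z) (initOutput n z.1) ∂D) / 2))
        ≤ ∫⁻ z, ENNReal.ofReal (Real.exp (inner ℝ (g z) (initOutput n z.1) / 2)) ∂D := by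
    intro n
    obtain ⟨C, hC⟩ := exists_norm_initOutput_le n
    have hb : ∀ᵐ z ∂D, |inner ℝ (g z) (initOutput n z.1) / 2| ≤ C := by
      filter_upwards [hD] with z hz
      have h1 := abs_real_inner_le_norm (g z) (initOutput n z.1)
      have h2 := hC _ hz.1
      rw [abs_div, abs_two]
      nlinarith [norm_nonneg (g z), norm_nonneg (initOutput n z.1), hg1 z]
    have hi : Integrable (fun z => inner ℝ (g z) (initOutput n z.1) / 2) D :=
      Integrable.of_bound ((hz n).div_const _).aestronglyMeasurable C hb
    have hei : Integrable (fun z => Real.exp (inner ℝ (g z) (initOutput n z.1) / 2)) D := by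
      refine Integrable.of_bound ((hz n).div_const _).exp.aestronglyMeasurable (Real.exp C) ?_
      filter_upwards [hb] with z hz
      rw [Real.norm_of_nonneg (Real.exp_pos _).le]
      exact Real.exp_le_exp.mpr ((le_abs_self _).trans hz)
    have h := convexOn_exp.map_integral_le Real.continuous_exp.continuousOn isClosed_univ
      (Filter.Eventually.of_forall fun z => Set.mem_univ _) hi hei
    rw [← ofReal_integral_eq_lintegral_ofReal hei
      (Filter.Eventually.of_forall fun z => (Real.exp_pos _).le), ← integral_div]
    exact ENNReal.ofReal_le_ofReal h
  have hE : ∫⁻ n, ∫⁻ z, ENNReal.ofReal (Real.exp (inner ℝ (g z) (initOutput n z.1) / 2)) ∂D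
      ∂(Measure.pi fun _ : Fin m => neuronLaw d k) ≤ ENNReal.ofReal (Real.exp 1) := by
    rw [lintegral_lintegral_swap hj.aemeasurable]
    refine (lintegral_mono_ae (g := fun _ => ENNReal.ofReal (Real.exp 1)) ?_).trans (by simp)
    filter_upwards [hD] with z hz
    exact lintegral_exp_initOutput hm hz.1 (hg1 z)
  have hmk := meas_ge_le_lintegral_div (μ := Measure.pi fun _ : Fin m => neuronLaw d k)
    (f := fun n => ∫⁻ z, ENNReal.ofReal (Real.exp (inner ℝ (g z) (initOutput n z.1) / 2)) ∂D)
    hj.lintegral_prod_right'.aemeasurable (ε := ENNReal.ofReal (Real.exp (t / 2)))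
    (by simp [Real.exp_pos]) ENNReal.ofReal_ne_top
  refine (measure_mono ?_).trans (hmk.trans ?_)
  · intro n hn
    simp only [Set.mem_ofPred_eq] at hn ⊢
    refine le_trans (ENNReal.ofReal_le_ofReal (Real.exp_le_exp.mpr ?_)) (hjensen n)
    linarith
  · refine (ENNReal.div_le_div_right hE _).trans (le_of_eq ?_)
    rw [← ENNReal.ofReal_div_of_pos (Real.exp_pos _), ← Real.exp_sub]

/-- Beyond `s` one has `t ^ 2 ≤ 32 * exp (|t| / 4)` and `|t| / 4 ≤ |t| / 2 - s / 4`. So an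
exponential moment at rate `1 / 2` controls the excess of a square with an exponentially small
factor. -/
lemma sq_le_add_exp {s : ℝ} (t : ℝ) (hs : 0 ≤ s) :
    t ^ 2 ≤ s ^ 2 + 32 * Real.exp (-(s / 4)) * Real.exp (|t| / 2) := by
  rw [← sq_abs t, mul_assoc, ← Real.exp_add]
  have hu : 0 ≤ |t| := abs_nonneg t
  rcases le_or_gt |t| s with h | h
  · have h1 : |t| ^ 2 ≤ s ^ 2 := pow_le_pow_left₀ hu h 2
    have := Real.exp_pos (-(s / 4) + |t| / 2)
    linarith
  · have h1 := Real.quadratic_le_exp_of_nonneg (x := |t| / 4) (by positivity)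
    have h2 : Real.exp (|t| / 4) ≤ Real.exp (-(s / 4) + |t| / 2) :=
      Real.exp_le_exp.mpr (by linarith)
    nlinarith [sq_nonneg s]

lemma measurable_initOutput_coord {α : Type*} [MeasurableSpace α] {n : α → Fin m → Neuron d k}
    {x : α → Input d} (hn : Measurable n) (hx : Measurable x) (r : Fin k) :
    Measurable fun a => initOutput (n a) (x a) r :=
  Measurable.comp (g := fun u : Output k => u r) (f := fun a => initOutput (n a) (x a))
    (Continuous.measurable (by fun_prop)) (measurable_initOutput_comp hn hx)

lemma lintegral_exp_abs_initOutput (hm : 0 < m) {x : Input d} (hx : ‖x‖ = 1) (r : Fin k) :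
    ∫⁻ n, ENNReal.ofReal (Real.exp (|initOutput n x r| / 2))
      ∂(Measure.pi fun _ : Fin m => neuronLaw d k) ≤ ENNReal.ofReal (2 * Real.exp 1) := by
  have hpm : ∀ c : ℝ, |c| = 1 → ∫⁻ n, ENNReal.ofReal (Real.exp (c * initOutput n x r / 2))
      ∂(Measure.pi fun _ : Fin m => neuronLaw d k) ≤ ENNReal.ofReal (Real.exp 1) := by
    intro c hc
    have h := lintegral_exp_initOutput (m := m) hm hx (g := EuclideanSpace.single r c)
      (by simp [hc])
    simpa [EuclideanSpace.inner_single_left] using h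
  have h1 := hpm 1 (by norm_num)
  have h2 := hpm (-1) (by norm_num)
  have hmz : Measurable fun n : Fin m → Neuron d k =>
      ENNReal.ofReal (Real.exp (1 * initOutput n x r / 2)) := by
    have : Measurable fun n : Fin m → Neuron d k => initOutput n x r :=
      measurable_initOutput_coord measurable_id measurable_const r
    exact ((this.const_mul 1).div_const 2).exp.ennreal_ofReal
  calc _ ≤ ∫⁻ n, (ENNReal.ofReal (Real.exp (1 * initOutput n x r / 2))
        + ENNReal.ofReal (Real.exp (-1 * initOutput n x r / 2)))
        ∂(Measure.pi fun _ : Fin m => neuronLaw d k) := by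
        refine lintegral_mono fun n => ?_
        rcases abs_cases (initOutput n x r) with ⟨h, _⟩ | ⟨h, _⟩
        · rw [h, one_mul]; exact le_self_add
        · rw [h, neg_one_mul]; exact le_add_self
    _ ≤ _ := by
        rw [lintegral_add_left hmz, two_mul,
          ENNReal.ofReal_add (Real.exp_pos _).le (Real.exp_pos _).le]
        exact add_le_add h1 h2

/-- Apply `sq_le_add_exp` to each output coordinate and Markov's inequality to the averaged
exponential moment, of expectation at most `2 * e * k`. The constant `180` is such that `32 * 2 * e
≤ 180`. -/
lemma initOutput_sq_tail (hm : 0 < m) (hk : 0 < k) {Y : Type*} [MeasurableSpace Y]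
    {D : Measure (Input d × Y)} [IsProbabilityMeasure D] (hD : NormalizedInputs D)
    {s : ℝ} (hs : 0 ≤ s) :
    (Measure.pi fun _ : Fin m => neuronLaw d k)
      {n | k * (s ^ 2 + 180) ≤ ∫ z, ‖initOutput n z.1‖ ^ 2 ∂D}
      ≤ ENNReal.ofReal (Real.exp (-(s / 4))) := by
  have hk' : (0 : ℝ) < k := by exact_mod_cast hk
  have hj : Measurable fun q : (Fin m → Neuron d k) × (Input d × Y) =>
      ∑ r, ENNReal.ofReal (Real.exp (|initOutput q.1 q.2.1 r| / 2)) :=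
    Finset.measurable_sum _ fun r _ =>
      (((measurable_initOutput_coord measurable_fst
        (measurable_fst.comp measurable_snd) r).abs.div_const 2).exp).ennreal_ofReal
  have hE : ∫⁻ n, ∫⁻ z, ∑ r, ENNReal.ofReal (Real.exp (|initOutput n z.1 r| / 2)) ∂D
      ∂(Measure.pi fun _ : Fin m => neuronLaw d k) ≤ ENNReal.ofReal (k * (2 * Real.exp 1)) := by
    rw [lintegral_lintegral_swap hj.aemeasurable]
    refine (lintegral_mono_ae (g := fun _ => ENNReal.ofReal (k * (2 * Real.exp 1))) ?_).trans
      (by simp)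
    filter_upwards [hD] with z hz
    rw [lintegral_finsetSum]
    · refine (Finset.sum_le_sum fun r _ => lintegral_exp_abs_initOutput hm hz.1 r).trans ?_
      rw [Finset.sum_const, Finset.card_univ, Fintype.card_fin, nsmul_eq_mul,
        ENNReal.ofReal_mul (p := (k : ℝ)) hk'.le, ENNReal.ofReal_natCast]
    · intro r _
      exact (((measurable_initOutput_coord measurable_id measurable_const
        r).abs.div_const 2).exp).ennreal_ofReal
  obtain ⟨Φ, hΦ⟩ : ∃ Φ : (Fin m → Neuron d k) → ℝ≥0∞, Φ = fun n =>
      ∫⁻ z, ∑ r, ENNReal.ofReal (Real.exp (|initOutput n z.1 r| / 2)) ∂D := ⟨_, rfl⟩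
  have hΦm : Measurable Φ := by rw [hΦ]; exact hj.lintegral_prod_right'
  have hlev : 0 < k * 180 * Real.exp (s / 4) / 32 := by positivity
  have hmk := meas_ge_le_lintegral_div (μ := Measure.pi fun _ : Fin m => neuronLaw d k)
    hΦm.aemeasurable (ε := ENNReal.ofReal (k * 180 * Real.exp (s / 4) / 32))
    (by simpa using hlev) ENNReal.ofReal_ne_top
  have hbound : ∀ n : Fin m → Neuron d k, ENNReal.ofReal (∫ z, ‖initOutput n z.1‖ ^ 2 ∂D)
      ≤ ENNReal.ofReal (k * s ^ 2) + ENNReal.ofReal (32 * Real.exp (-(s / 4))) * Φ n := by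
    intro n
    have hmn : Measurable fun z : Input d × Y => ‖initOutput n z.1‖ ^ 2 :=
      ((measurable_initOutput_comp measurable_const measurable_fst).norm).pow_const 2
    have hmr : Measurable fun z : Input d × Y =>
        ∑ r, ENNReal.ofReal (Real.exp (|initOutput n z.1 r| / 2)) :=
      Finset.measurable_sum _ fun r _ =>
        (((measurable_initOutput_coord measurable_const measurable_fst
          r).abs.div_const 2).exp).ennreal_ofReal
    rw [integral_eq_lintegral_of_nonneg_ae (Filter.Eventually.of_forall fun z => sq_nonneg _)
      hmn.aestronglyMeasurable]
    refine ENNReal.ofReal_toReal_le.trans ?_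
    rw [hΦ, ← lintegral_const_mul _ hmr]
    have e0 : ENNReal.ofReal (k * s ^ 2) = ∫⁻ _ : Input d × Y, ENNReal.ofReal (k * s ^ 2) ∂D := by
      simp
    rw [e0, ← lintegral_add_left measurable_const]
    refine lintegral_mono fun z => ?_
    have hsum : ‖initOutput n z.1‖ ^ 2 ≤ k * s ^ 2
        + 32 * Real.exp (-(s / 4)) * ∑ r, Real.exp (|initOutput n z.1 r| / 2) := by
      rw [EuclideanSpace.real_norm_sq_eq]
      refine (Finset.sum_le_sum fun r _ => sq_le_add_exp (initOutput n z.1 r) hs).trans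
        (le_of_eq ?_)
      rw [Finset.sum_add_distrib, ← Finset.mul_sum, Finset.sum_const, Finset.card_univ,
        Fintype.card_fin, nsmul_eq_mul]
    refine (ENNReal.ofReal_le_ofReal hsum).trans (le_of_eq ?_)
    rw [ENNReal.ofReal_add (by positivity) (by positivity),
      ENNReal.ofReal_mul (p := 32 * Real.exp (-(s / 4))) (by positivity),
      ENNReal.ofReal_sum_of_nonneg fun r _ => (Real.exp_pos _).le]
  refine (measure_mono ?_).trans (hmk.trans ?_)
  · intro n hn
    simp only [Set.mem_ofPred_eq] at hn ⊢
    by_contra hlt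
    push Not at hlt
    have h1 := (ENNReal.ofReal_le_ofReal hn).trans (hbound n)
    have hfin : Φ n ≠ ⊤ := (hlt.trans ENNReal.ofReal_lt_top).ne
    rw [← ENNReal.ofReal_toReal hfin, ← ENNReal.ofReal_mul (by positivity),
      ← ENNReal.ofReal_add (by positivity) (by positivity),
      ENNReal.ofReal_le_ofReal_iff (by positivity)] at h1
    have h2 : (Φ n).toReal < k * 180 * Real.exp (s / 4) / 32 := by
      rw [← ENNReal.ofReal_toReal hfin] at hlt
      exact (ENNReal.ofReal_lt_ofReal_iff hlev).mp hlt
    have h3 := mul_lt_mul_of_pos_left h2 (by positivity : 0 < 32 * Real.exp (-(s / 4)))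
    have h4 : 32 * Real.exp (-(s / 4)) * (k * 180 * Real.exp (s / 4) / 32) = k * 180 := by
      rw [Real.exp_neg]; field_simp
    linarith
  · rw [hΦ]
    refine (ENNReal.div_le_div_right hE _).trans ?_
    rw [← ENNReal.ofReal_div_of_pos hlev]
    refine ENNReal.ofReal_le_ofReal ?_
    rw [div_le_iff₀ hlev, Real.exp_neg]
    have he : Real.exp 1 < 2.7182818286 := Real.exp_one_lt_d9
    have : (Real.exp (s / 4))⁻¹ * (k * 180 * Real.exp (s / 4) / 32) = k * 180 / 32 := by
      field_simp
    rw [this]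
    nlinarith

end Events

end

end SAMGen

namespace SAMGen

noncomputable section

/-! ### The comparator weights -/

section Comparator

variable {m d k q : ℕ}

/-- Gated value of a feature of a hidden neuron. -/
def gatedFeature (h : ℝ → ℝ → ℝ) (w x : Input d) (u : Input d × ℝ) : ℝ :=
  if 0 ≤ inner ℝ u.1 x + u.2 then h (inner ℝ w u.1) u.2 else 0

lemma measurable_gatedFeature {h : ℝ → ℝ → ℝ} (hh : Measurable (Function.uncurry h))
    (w : Input d) :
    Measurable fun v : Input d × (Input d × ℝ) => gatedFeature h w v.1 v.2 := by
  unfold gatedFeature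
  refine Measurable.ite ?_ ?_ measurable_const
  · exact measurableSet_le measurable_const (Continuous.measurable (by fun_prop))
  · exact hh.comp (f := fun v : Input d × (Input d × ℝ) => (inner ℝ w v.2.1, v.2.2))
      (Continuous.measurable (by fun_prop))

lemma abs_gatedFeature_le {h : ℝ → ℝ → ℝ} {H : ℝ} (hH : ∀ u b, |h u b| ≤ H)
    (w x : Input d) (u : Input d × ℝ) : |gatedFeature h w x u| ≤ H := by
  unfold gatedFeature
  split_ifs
  · exact hH _ _
  · simpa using (abs_nonneg _).trans (hH 0 0)

/-- Decomposing `w` along `x` and its orthogonal complement reduces the integral over hidden neurons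
to the law of three independent real Gaussians. -/
lemma integral_gatedFeature {h : ℝ → ℝ → ℝ} (hh : Measurable (Function.uncurry h))
    {w x : Input d} (hw : ‖w‖ = 1) (hx : ‖x‖ = 1) {v : ℝ≥0} (hv : (v : ℝ) = 1 - inner ℝ w x ^ 2) :
    ∫ u, gatedFeature h w x u ∂(hiddenLaw d)
      = ∫ y, (if 0 ≤ y.2.1 + y.1 then h (inner ℝ w x * y.2.1 + y.2.2) y.1 else 0)
        ∂(projLaw v) := by
  have hmeas : Measurable fun y : ℝ × ℝ × ℝ =>
      if 0 ≤ y.2.1 + y.1 then h (inner ℝ w x * y.2.1 + y.2.2) y.1 else 0 := by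
    refine Measurable.ite (measurableSet_le measurable_const (by fun_prop)) ?_ measurable_const
    exact hh.comp (f := fun y : ℝ × ℝ × ℝ => (inner ℝ w x * y.2.1 + y.2.2, y.1)) (by fun_prop)
  rw [← map_hiddenLaw hx hw hv, integral_map (Continuous.measurable (by fun_prop)).aemeasurable
    hmeas.aestronglyMeasurable]
  refine integral_congr_ae (Filter.Eventually.of_forall fun u => ?_)
  simp only [gatedFeature]
  have e : inner ℝ w x * inner ℝ x u.1 + inner ℝ (w - inner ℝ w x • x) u.1 = inner ℝ w u.1 := by
    rw [inner_sub_left, real_inner_smul_left]; ring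
  rw [e, real_inner_comm u.1 x]

lemma integral_feature_sq_le {h : ℝ → ℝ → ℝ} (hh : Measurable (Function.uncurry h)) {H c : ℝ}
    (hH : ∀ u b, |h u b| ≤ H) (hsq : ∀ b, ∫ u, h u b ^ 2 ∂(gaussianReal 0 1) ≤ c)
    {w : Input d} (hw : ‖w‖ = 1) :
    ∫ u, h (inner ℝ w u.1) u.2 ^ 2 ∂(hiddenLaw d) ≤ c := by
  have hm2 : Measurable fun u : Input d × ℝ => h (inner ℝ w u.1) u.2 ^ 2 :=
    (hh.comp (f := fun u : Input d × ℝ => (inner ℝ w u.1, u.2))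
      (Continuous.measurable (by fun_prop))).pow_const 2
  have hi : Integrable (fun u : Input d × ℝ => h (inner ℝ w u.1) u.2 ^ 2) (hiddenLaw d) :=
    integrable_of_abs_le _ hm2 (C := H ^ 2) fun u => by
      rw [abs_pow]; exact pow_le_pow_left₀ (abs_nonneg _) (hH _ _) 2
  rw [hiddenLaw] at hi ⊢
  rw [integral_prod_symm _ hi]
  have : ∫ b, ∫ y, h (inner ℝ w y) b ^ 2 ∂(stdGaussian (Input d)) ∂(gaussianReal 0 1)
      ≤ ∫ _, c ∂(gaussianReal 0 1) := by
    refine integral_mono_of_nonneg (Filter.Eventually.of_forall fun b =>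
      integral_nonneg fun y => sq_nonneg _) (integrable_const _)
      (Filter.Eventually.of_forall fun b => ?_)
    have hmb : Measurable fun u : ℝ => h u b ^ 2 :=
      (hh.comp (f := fun u : ℝ => (u, b)) (by fun_prop)).pow_const 2
    have e := integral_map (μ := stdGaussian (Input d)) (φ := fun y => inner ℝ w y)
      (f := fun u : ℝ => h u b ^ 2) (by fun_prop) hmb.aestronglyMeasurable
    rw [gaussian_map_inner w (v := 1) (by simp [hw])] at e
    simp only
    rw [← e]
    exact hsq b
  simpa using this

/-- Direction in which the comparator moves a neuron. -/
def comparatorDir (h : Fin q → ℝ → ℝ → ℝ) (w₁ w₂ : Fin q → Input d) (a : Fin k → Fin q → ℝ)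
    (ν : Neuron d k) : Input d :=
  ∑ r, Real.sign (ν.2 r) • ∑ j, (a r j * h j (inner ℝ (w₁ j) ν.1.1) ν.1.2) • w₂ j

lemma norm_comparatorDir_le {h : Fin q → ℝ → ℝ → ℝ} {w₁ w₂ : Fin q → Input d}
    {a : Fin k → Fin q → ℝ} (hw₂ : ∀ j, ‖w₂ j‖ = 1) (ha : ∀ r j, |a r j| ≤ 1) (ν : Neuron d k) :
    ‖comparatorDir h w₁ w₂ a ν‖ ≤ k * ∑ j, |h j (inner ℝ (w₁ j) ν.1.1) ν.1.2| := by
  unfold comparatorDir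
  refine (norm_sum_le _ _).trans ?_
  refine (Finset.sum_le_card_nsmul _ _ (∑ j, |h j (inner ℝ (w₁ j) ν.1.1) ν.1.2|)
    fun r _ => ?_).trans (by simp)
  rw [norm_smul, Real.norm_eq_abs]
  refine (mul_le_of_le_one_left (norm_nonneg _) (abs_sign_le_one _)).trans ?_
  refine (norm_sum_le _ _).trans (Finset.sum_le_sum fun j _ => ?_)
  rw [norm_smul, hw₂, mul_one, Real.norm_eq_abs, abs_mul]
  exact mul_le_of_le_one_left (abs_nonneg _) (ha r j)

lemma norm_comparatorDir_le_const {h : Fin q → ℝ → ℝ → ℝ} {w₁ w₂ : Fin q → Input d}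
    {a : Fin k → Fin q → ℝ} (hw₂ : ∀ j, ‖w₂ j‖ = 1) (ha : ∀ r j, |a r j| ≤ 1) {H : ℝ}
    (hH : ∀ j u b, |h j u b| ≤ H) (ν : Neuron d k) :
    ‖comparatorDir h w₁ w₂ a ν‖ ≤ k * (q * H) := by
  refine (norm_comparatorDir_le hw₂ ha ν).trans (mul_le_mul_of_nonneg_left ?_ (by positivity))
  exact (Finset.sum_le_card_nsmul _ _ H fun j _ => hH j _ _).trans (by simp)

lemma norm_comparatorDir_sq_le {h : Fin q → ℝ → ℝ → ℝ} {w₁ w₂ : Fin q → Input d}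
    {a : Fin k → Fin q → ℝ} (hw₂ : ∀ j, ‖w₂ j‖ = 1) (ha : ∀ r j, |a r j| ≤ 1) (ν : Neuron d k) :
    ‖comparatorDir h w₁ w₂ a ν‖ ^ 2
      ≤ k ^ 2 * (q * ∑ j, h j (inner ℝ (w₁ j) ν.1.1) ν.1.2 ^ 2) := by
  refine (pow_le_pow_left₀ (norm_nonneg _) (norm_comparatorDir_le hw₂ ha ν) 2).trans ?_
  rw [mul_pow]
  refine mul_le_mul_of_nonneg_left ?_ (by positivity)
  have := sq_sum_le_card_mul_sum_sq (s := (Finset.univ : Finset (Fin q)))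
    (f := fun j => |h j (inner ℝ (w₁ j) ν.1.1) ν.1.2|)
  simpa using this

/-- Contribution of a neuron to the `r`-th output of the comparator. -/
def comparatorTerm (Λ : ℝ) (h : Fin q → ℝ → ℝ → ℝ) (w₁ w₂ : Fin q → Input d)
    (a : Fin k → Fin q → ℝ) (r : Fin k) (x : Input d) (ν : Neuron d k) : ℝ :=
  (clipMean Λ)⁻¹ * clip Λ (ν.2 r) *
    if 0 ≤ neuronAct ν x then inner ℝ (comparatorDir h w₁ w₂ a ν) x else 0

lemma comparatorTerm_eq_sum (Λ : ℝ) (h : Fin q → ℝ → ℝ → ℝ) (w₁ w₂ : Fin q → Input d)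
    (a : Fin k → Fin q → ℝ) (r : Fin k) (x : Input d) (ν : Neuron d k) :
    comparatorTerm Λ h w₁ w₂ a r x ν = ∑ r', ∑ j, ((clipMean Λ)⁻¹ * (a r' j * inner ℝ (w₂ j) x)) *
      (gatedFeature (h j) (w₁ j) x ν.1 * (clip Λ (ν.2 r) * Real.sign (ν.2 r'))) := by
  unfold comparatorTerm gatedFeature neuronAct comparatorDir
  split_ifs with hc
  · simp_rw [sum_inner, real_inner_smul_left, sum_inner, real_inner_smul_left]
    rw [Finset.mul_sum]
    refine Finset.sum_congr rfl fun r' _ => ?_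
    rw [Finset.mul_sum, Finset.mul_sum]
    refine Finset.sum_congr rfl fun j _ => ?_
    ring
  · simp

lemma measurable_comparatorTerm (Λ : ℝ) {h : Fin q → ℝ → ℝ → ℝ}
    (hh : ∀ j, Measurable (Function.uncurry (h j))) (w₁ w₂ : Fin q → Input d)
    (a : Fin k → Fin q → ℝ) (r : Fin k) :
    Measurable fun v : Input d × Neuron d k => comparatorTerm Λ h w₁ w₂ a r v.1 v.2 := by
  simp_rw [comparatorTerm_eq_sum]
  refine Finset.measurable_sum _ fun r' _ => Finset.measurable_sum _ fun j _ => ?_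
  refine Measurable.mul ?_ (Measurable.mul ?_ ?_)
  · exact Continuous.measurable (by fun_prop)
  · exact (measurable_gatedFeature (hh j) (w₁ j)).comp
      (f := fun v : Input d × Neuron d k => (v.1, v.2.1)) (by fun_prop)
  · have h1 : ∀ r : Fin k, Measurable fun v : Input d × Neuron d k => v.2.2 r := fun r => by
      fun_prop
    exact ((measurable_clip Λ).comp (h1 r)).mul (measurable_sign.comp (h1 r'))

lemma abs_comparatorTerm_le {Λ : ℝ} (hΛ : 1 ≤ Λ) {h : Fin q → ℝ → ℝ → ℝ} {w₁ w₂ : Fin q → Input d}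
    {a : Fin k → Fin q → ℝ} (hw₂ : ∀ j, ‖w₂ j‖ = 1) (ha : ∀ r j, |a r j| ≤ 1) {H : ℝ}
    (hH : ∀ j u b, |h j u b| ≤ H) (r : Fin k) {x : Input d} (hx : ‖x‖ = 1) (ν : Neuron d k) :
    |comparatorTerm Λ h w₁ w₂ a r x ν| ≤ 4 * Λ * (k * (q * H)) := by
  have hc := clipMean_ge hΛ
  unfold comparatorTerm
  rw [abs_mul, abs_mul, abs_inv, abs_of_pos (by linarith : 0 < clipMean Λ)]
  have h1 : (clipMean Λ)⁻¹ ≤ 4 := by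
    rw [inv_le_comm₀ (by linarith) (by norm_num)]; linarith
  have h2 := abs_clip_le (by linarith : 0 ≤ Λ) (ν.2 r)
  have h3 : |if 0 ≤ neuronAct ν x then inner ℝ (comparatorDir h w₁ w₂ a ν) x else 0|
      ≤ k * (q * H) := by
    have h4 := norm_comparatorDir_le_const (w₁ := w₁) hw₂ ha hH ν
    split_ifs
    · have := abs_real_inner_le_norm (comparatorDir h w₁ w₂ a ν) x
      rw [hx, mul_one] at this
      exact this.trans h4
    · simpa using (norm_nonneg _).trans h4
  exact mul_le_mul (mul_le_mul h1 h2 (abs_nonneg _) (by norm_num)) h3 (abs_nonneg _)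
    (by linarith)

/-- Hidden part and output weights are independent, so every summand factors. The sum over `r'`
collapses to `r` by `integral_clip_mul_sign`, and the normalization by `clipMean Λ` cancels. -/
lemma integral_comparatorTerm {Λ : ℝ} (hΛ : 1 ≤ Λ) {h : Fin q → ℝ → ℝ → ℝ}
    (hh : ∀ j, Measurable (Function.uncurry (h j))) {H : ℝ} (hH : ∀ j u b, |h j u b| ≤ H)
    (w₁ w₂ : Fin q → Input d) (a : Fin k → Fin q → ℝ) (r : Fin k) (x : Input d) :
    ∫ ν, comparatorTerm Λ h w₁ w₂ a r x ν ∂(neuronLaw d k)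
      = ∑ j, a r j * (∫ u, gatedFeature (h j) (w₁ j) x u ∂(hiddenLaw d)) * inner ℝ (w₂ j) x := by
  have hc := clipMean_ge hΛ
  have hG : ∀ j, Measurable fun u : Input d × ℝ => gatedFeature (h j) (w₁ j) x u := fun j =>
    (measurable_gatedFeature (hh j) (w₁ j)).comp (f := fun u : Input d × ℝ => (x, u))
      (measurable_const.prodMk measurable_id)
  have hS : ∀ r' : Fin k, Measurable fun ξ : Fin k → ℝ => clip Λ (ξ r) * Real.sign (ξ r') :=
    fun r' => ((measurable_clip Λ).comp (measurable_pi_apply r)).mul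
      (measurable_sign.comp (measurable_pi_apply r'))
  have hi : ∀ r' j, Integrable (fun ν : Neuron d k =>
      ((clipMean Λ)⁻¹ * (a r' j * inner ℝ (w₂ j) x)) *
      (gatedFeature (h j) (w₁ j) x ν.1 * (clip Λ (ν.2 r) * Real.sign (ν.2 r'))))
      (neuronLaw d k) := by
    intro r' j
    refine Integrable.const_mul ?_ _
    refine integrable_of_abs_le _ (((hG j).comp measurable_fst).mul
      ((hS r').comp measurable_snd)) (C := H * (Λ * 1)) fun ν => ?_
    rw [abs_mul, abs_mul]
    have h1 := abs_gatedFeature_le (hH j) (w₁ j) x ν.1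
    have h2 := abs_clip_le (by linarith : 0 ≤ Λ) (ν.2 r)
    exact mul_le_mul h1 (mul_le_mul h2 (abs_sign_le_one _) (abs_nonneg _) (by linarith))
      (by positivity) ((abs_nonneg _).trans h1)
  simp_rw [comparatorTerm_eq_sum]
  rw [integral_finsetSum _ fun r' _ => integrable_finsetSum _ fun j _ => hi r' j,
    Finset.sum_eq_single r]
  · rw [integral_finsetSum _ fun j _ => hi r j]
    refine Finset.sum_congr rfl fun j _ => ?_
    rw [integral_const_mul, neuronLaw,
      integral_prod_mul (fun u => gatedFeature (h j) (w₁ j) x u)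
        (fun ξ : Fin k → ℝ => clip Λ (ξ r) * Real.sign (ξ r)),
      integral_clip_mul_sign (by linarith), if_pos rfl]
    have : clipMean Λ ≠ 0 := by linarith
    field_simp
  · intro r' _ hr'
    rw [integral_finsetSum _ fun j _ => hi r' j]
    refine Finset.sum_eq_zero fun j _ => ?_
    rw [integral_const_mul, neuronLaw,
      integral_prod_mul (fun u => gatedFeature (h j) (w₁ j) x u)
        (fun ξ : Fin k → ℝ => clip Λ (ξ r) * Real.sign (ξ r')),
      integral_clip_mul_sign (by linarith), if_neg hr', mul_zero, mul_zero]
  · simp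

/-- Features represent the activation functions up to `δ`. -/
structure IsFeature (φ : ℝ → ℝ) (h : ℝ → ℝ → ℝ) (H cs δ : ℝ) : Prop where
  measurable : Measurable (Function.uncurry h)
  bound : ∀ u b, |h u b| ≤ H
  sq_le : ∀ b, ∫ u, h u b ^ 2 ∂(gaussianReal 0 1) ≤ cs ^ 2
  repr : ∀ (x : ℝ) (v : ℝ≥0), |x| ≤ 1 → (v : ℝ) = 1 - x ^ 2 →
    |∫ y, (if 0 ≤ y.2.1 + y.1 then h (x * y.2.1 + y.2.2) y.1 else 0) ∂(projLaw v) - φ x| ≤ δ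

lemma abs_integral_comparatorTerm_sub_le {Λ : ℝ} (hΛ : 1 ≤ Λ) {φ : Fin q → ℝ → ℝ}
    {h : Fin q → ℝ → ℝ → ℝ} {H cs δ : ℝ} (hf : ∀ j, IsFeature (φ j) (h j) H cs δ)
    {w₁ w₂ : Fin q → Input d} (hw₁ : ∀ j, ‖w₁ j‖ = 1) (hw₂ : ∀ j, ‖w₂ j‖ = 1)
    {a : Fin k → Fin q → ℝ} (ha : ∀ r j, |a r j| ≤ 1) (r : Fin k) {x : Input d} (hx : ‖x‖ = 1) :
    |∫ ν, comparatorTerm Λ h w₁ w₂ a r x ν ∂(neuronLaw d k) - targetNet φ w₁ w₂ a x r|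
      ≤ q * δ := by
  rw [integral_comparatorTerm hΛ (fun j => (hf j).measurable) (fun j => (hf j).bound)]
  simp only [targetNet]
  rw [← Finset.sum_sub_distrib]
  refine (Finset.abs_sum_le_sum_abs _ _).trans ?_
  refine (Finset.sum_le_card_nsmul _ _ δ fun j _ => ?_).trans (by simp)
  have hin : |inner ℝ (w₁ j) x| ≤ 1 := by
    have := abs_real_inner_le_norm (w₁ j) x
    rwa [hw₁, hx, mul_one] at this
  have hin2 : |inner ℝ (w₂ j) x| ≤ 1 := by
    have := abs_real_inner_le_norm (w₂ j) x
    rwa [hw₂, hx, mul_one] at this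
  have hsq : inner ℝ (w₁ j) x ^ 2 ≤ 1 := by
    rw [← sq_abs]; exact pow_le_one₀ (abs_nonneg _) hin
  have hv : ((1 - inner ℝ (w₁ j) x ^ 2).toNNReal : ℝ) = 1 - inner ℝ (w₁ j) x ^ 2 :=
    Real.coe_toNNReal _ (by linarith)
  have hr := (hf j).repr (inner ℝ (w₁ j) x) _ hin hv
  rw [← integral_gatedFeature (hf j).measurable (hw₁ j) hx hv] at hr
  rw [← sub_mul, ← mul_sub, abs_mul, abs_mul]
  have hδ := (abs_nonneg _).trans hr
  calc _ ≤ 1 * δ * 1 := mul_le_mul (mul_le_mul (ha r j) hr (abs_nonneg _) zero_le_one) hin2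
        (abs_nonneg _) (by linarith)
    _ = δ := by ring

/-- The squared norm of the comparator concentrates near its mean, which is governed by `cs`. The
larger bound `H` on single features only enters the probability of failure, hence the required
width. -/
lemma featureSum_tail {φ : Fin q → ℝ → ℝ} {h : Fin q → ℝ → ℝ → ℝ} {H cs δ : ℝ}
    (hf : ∀ j, IsFeature (φ j) (h j) H cs δ) {w₁ : Fin q → Input d} (hw₁ : ∀ j, ‖w₁ j‖ = 1) :
    (Measure.pi fun _ : Fin m => neuronLaw d k).real
      {n | m * (q * cs ^ 2 + 1)
        ≤ ∑ i, ∑ j, h j (inner ℝ (w₁ j) (n i).1.1) (n i).1.2 ^ 2}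
      ≤ Real.exp (-m / (2 * (q * H ^ 2 + 1) ^ 2)) := by
  have hm2 : ∀ j, Measurable fun ν : Neuron d k => h j (inner ℝ (w₁ j) ν.1.1) ν.1.2 ^ 2 := fun j =>
    ((hf j).measurable.comp (f := fun ν : Neuron d k => (inner ℝ (w₁ j) ν.1.1, ν.1.2))
      (Continuous.measurable (by fun_prop))).pow_const 2
  have hb : ∀ j (ν : Neuron d k), |h j (inner ℝ (w₁ j) ν.1.1) ν.1.2 ^ 2| ≤ H ^ 2 := fun j ν => by
    rw [abs_pow]; exact pow_le_pow_left₀ (abs_nonneg _) ((hf j).bound _ _) 2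
  have hbound : ∀ ν : Neuron d k, |∑ j, h j (inner ℝ (w₁ j) ν.1.1) ν.1.2 ^ 2| ≤ q * H ^ 2 + 1 := by
    intro ν
    refine (Finset.abs_sum_le_sum_abs _ _).trans ?_
    refine (Finset.sum_le_card_nsmul _ _ (H ^ 2) fun j _ => hb j ν).trans ?_
    simp
  have hmean : ∫ ν, ∑ j, h j (inner ℝ (w₁ j) ν.1.1) ν.1.2 ^ 2 ∂(neuronLaw d k) ≤ q * cs ^ 2 := by
    rw [integral_finsetSum _ fun j _ => integrable_of_abs_le _ (hm2 j) (hb j)]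
    refine (Finset.sum_le_card_nsmul _ _ (cs ^ 2) fun j _ => ?_).trans (by simp)
    have e : ∫ ν : Neuron d k, h j (inner ℝ (w₁ j) ν.1.1) ν.1.2 ^ 2 ∂(neuronLaw d k)
        = ∫ u, h j (inner ℝ (w₁ j) u.1) u.2 ^ 2 ∂(hiddenLaw d) := by
      rw [neuronLaw, integral_fun_fst (fun u : Input d × ℝ => h j (inner ℝ (w₁ j) u.1) u.2 ^ 2)]
      simp
    rw [e]
    exact integral_feature_sq_le (hf j).measurable (hf j).bound (hf j).sq_le (hw₁ j)
  have ht := hoeffding_pi (m := m) (neuronLaw d k)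
    (Finset.measurable_sum Finset.univ fun j _ => hm2 j)
    (by positivity : 0 < q * H ^ 2 + 1) hbound zero_le_one
  have e : -(m * (1 : ℝ) ^ 2) / (2 * (q * H ^ 2 + 1) ^ 2) = -m / (2 * (q * H ^ 2 + 1) ^ 2) := by
    ring
  rw [e] at ht
  refine le_trans (measureReal_mono ?_) ht
  intro n hn
  simp only [Set.mem_ofPred_eq] at hn ⊢
  have := mul_le_mul_of_nonneg_left hmean (Nat.cast_nonneg m : (0 : ℝ) ≤ m)
  linarith

end Comparator

end

end SAMGen

namespace SAMGen

noncomputable section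

/-! ### The network at initialization in terms of its standardized neurons -/

section Link

variable {m d k q : ℕ}

lemma preact_eq (εa : ℝ) (θ : InitSpace m d k) (i : Fin m) (x : Input d) :
    neuronAct (neurons εa θ i) x = √m * preact θ i x := by
  simp only [neuronAct, neurons, preact, real_inner_smul_left]
  ring

lemma outWeight_eq {εa : ℝ} (hεa : 0 < εa) (θ : InitSpace m d k) (i : Fin m) :
    outWeight θ i = εa • (WithLp.toLp 2 (neurons εa θ i).2 : Output k) := by
  ext r
  simp only [outWeight, neurons, PiLp.smul_apply, smul_eq_mul]
  field_simp

lemma learner_initW_eq (hm : 0 < m) {εa : ℝ} (hεa : 0 < εa) (θ : InitSpace m d k) (x : Input d) :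
    learner θ (initW θ) x = εa • initOutput (neurons εa θ) x := by
  have hm' : (0 : ℝ) < √m := Real.sqrt_pos.mpr (by exact_mod_cast hm)
  rw [learner_eq_sum, initOutput, Finset.smul_sum, Finset.smul_sum]
  refine Finset.sum_congr rfl fun i _ => ?_
  have e : max (neuronAct (neurons εa θ i) x) 0
      = √m * max (inner ℝ (initW θ i) x + initB θ i) 0 := by
    rw [preact_eq, preact, mul_max_of_nonneg _ _ hm'.le, mul_zero]
  rw [outWeight_eq hεa, e, smul_smul, smul_smul, smul_smul]
  congr 1
  field_simp

lemma nearZero_eq (hm : 0 < m) (εa τ : ℝ) (θ : InitSpace m d k) (i : Fin m) (x : Input d) :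
    nearZero θ τ i x = if |neuronAct (neurons εa θ i) x| ≤ √m * τ then 1 else 0 := by
  have hm' : (0 : ℝ) < √m := Real.sqrt_pos.mpr (by exact_mod_cast hm)
  have e : |neuronAct (neurons εa θ i) x| ≤ √m * τ ↔ |preact θ i x| ≤ τ := by
    rw [preact_eq, abs_mul, abs_of_pos hm', mul_le_mul_iff_right₀ hm']
  simp only [e]
  rfl

lemma norm_le_sum_abs (v : Output k) : ‖v‖ ≤ ∑ r, |v r| := by
  rw [EuclideanSpace.norm_eq]
  apply Real.sqrt_le_iff.mpr ⟨Finset.sum_nonneg fun r _ => abs_nonneg _, ?_⟩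
  simp_rw [Real.norm_eq_abs]
  exact Finset.sum_sq_le_sq_sum_of_nonneg fun r _ => abs_nonneg _

lemma norm_outWeight_le {εa Λ : ℝ} (hεa : 0 < εa) (θ : InitSpace m d k) (i : Fin m)
    (h : ∀ r, |(neurons εa θ i).2 r| ≤ Λ) : ‖outWeight θ i‖ ≤ εa * Λ * √k := by
  rcases Nat.eq_zero_or_pos k with hk | hk
  · subst hk
    simp [EuclideanSpace.norm_eq]
  have hΛ : 0 ≤ Λ := (abs_nonneg _).trans (h ⟨0, hk⟩)
  rw [outWeight_eq hεa, norm_smul, Real.norm_of_nonneg hεa.le, mul_assoc]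
  refine mul_le_mul_of_nonneg_left ?_ hεa.le
  rw [EuclideanSpace.norm_eq]
  apply Real.sqrt_le_iff.mpr ⟨by positivity, ?_⟩
  rw [mul_pow, Real.sq_sqrt (by positivity)]
  refine (Finset.sum_le_card_nsmul _ _ (Λ ^ 2) fun r _ => ?_).trans (by simp [mul_comm])
  rw [Real.norm_eq_abs]
  exact pow_le_pow_left₀ (abs_nonneg _) (h r) 2

/-- Weights whose linearized network imitates the target network. -/
def comparator (εa Λ : ℝ) (h : Fin q → ℝ → ℝ → ℝ) (w₁ w₂ : Fin q → Input d)
    (a : Fin k → Fin q → ℝ) (θ : InitSpace m d k) : Weights m d :=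
  fun i => (clipMean Λ * εa * m)⁻¹ • comparatorDir h w₁ w₂ a (neurons εa θ i)

/-- The scale `εa` of the output weights cancels against the comparator, gates are invariant under
positive scaling of the pre-activation, and clipping is invisible for output weights bounded by `Λ`.
-/
lemma linNet_comparator (hm : 0 < m) {εa Λ : ℝ} (hεa : 0 < εa) (hΛ : 1 ≤ Λ)
    (h : Fin q → ℝ → ℝ → ℝ) (w₁ w₂ : Fin q → Input d) (a : Fin k → Fin q → ℝ)
    (θ : InitSpace m d k) (hθ : ∀ i r, |(neurons εa θ i).2 r| ≤ Λ) (x : Input d) (r : Fin k) :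
    linNet θ (comparator εa Λ h w₁ w₂ a θ) x r
      = (∑ i, comparatorTerm Λ h w₁ w₂ a r x (neurons εa θ i)) / m := by
  have hm0 : (0 : ℝ) < m := by exact_mod_cast hm
  have hm' : (0 : ℝ) < √m := Real.sqrt_pos.mpr hm0
  have hc := clipMean_ge hΛ
  rw [linNet, WithLp.ofLp_sum, Finset.sum_apply, Finset.sum_div]
  refine Finset.sum_congr rfl fun i _ => ?_
  have hiff : 0 ≤ preact θ i x ↔ 0 ≤ neuronAct (neurons εa θ i) x := by
    rw [preact_eq]; exact (mul_nonneg_iff_of_pos_left hm').symm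
  rw [outWeight_eq hεa]
  unfold comparatorTerm comparator
  simp only [PiLp.smul_apply, smul_eq_mul, hiff, clip_of_abs_le (hθ i r)]
  split_ifs
  · rw [real_inner_smul_left]
    field_simp
  · simp

lemma norm_comparator_le {p : ℕ} (hq : q ≤ p) {εa Λ : ℝ} (hεa : 0 < εa) (hΛ : 1 ≤ Λ)
    {h : Fin q → ℝ → ℝ → ℝ} {w₁ w₂ : Fin q → Input d} {a : Fin k → Fin q → ℝ}
    (hw₂ : ∀ j, ‖w₂ j‖ = 1) (ha : ∀ r j, |a r j| ≤ 1) {H : ℝ} (hH0 : 0 ≤ H)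
    (hH : ∀ j u b, |h j u b| ≤ H) (θ : InitSpace m d k) (i : Fin m) :
    ‖comparator εa Λ h w₁ w₂ a θ i‖ ≤ 4 * (k * (p * H)) / (εa * m) := by
  have hc := clipMean_ge hΛ
  have hm0 : (0 : ℝ) < m := by exact_mod_cast i.pos
  have hq' : (q : ℝ) ≤ p := by exact_mod_cast hq
  unfold comparator
  rw [norm_smul, Real.norm_of_nonneg (by positivity)]
  have h1 : ‖comparatorDir h w₁ w₂ a (neurons εa θ i)‖ ≤ k * (p * H) :=
    (norm_comparatorDir_le_const hw₂ ha hH _).trans (by gcongr)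
  have h2 : (clipMean Λ * εa * m)⁻¹ ≤ 4 / (εa * m) := by
    rw [inv_eq_one_div, div_le_div_iff₀ (by positivity) (by positivity)]
    nlinarith [mul_pos hεa hm0]
  calc _ ≤ 4 / (εa * m) * (k * (p * H)) := mul_le_mul h2 h1 (norm_nonneg _) (by positivity)
    _ = _ := by ring

lemma sum_norm_comparator_sq_le {p : ℕ} (hq : q ≤ p) (hm : 0 < m) {εa Λ : ℝ} (hεa : 0 < εa)
    (hΛ : 1 ≤ Λ) {h : Fin q → ℝ → ℝ → ℝ} {w₁ w₂ : Fin q → Input d} {a : Fin k → Fin q → ℝ}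
    (hw₂ : ∀ j, ‖w₂ j‖ = 1) (ha : ∀ r j, |a r j| ≤ 1) (θ : InitSpace m d k) {cs : ℝ}
    (hθ : ∑ i, ∑ j, h j (inner ℝ (w₁ j) (neurons εa θ i).1.1) (neurons εa θ i).1.2 ^ 2
      ≤ m * (q * cs ^ 2 + 1)) :
    ∑ i, ‖comparator εa Λ h w₁ w₂ a θ i‖ ^ 2
      ≤ 16 * k ^ 2 * p * (p * cs ^ 2 + 1) / (εa ^ 2 * m) := by
  have hc := clipMean_ge hΛ
  have hm0 : (0 : ℝ) < m := by exact_mod_cast hm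
  have hq' : (q : ℝ) ≤ p := by exact_mod_cast hq
  have h2 : (clipMean Λ * εa * m)⁻¹ ≤ 4 / (εa * m) := by
    rw [inv_eq_one_div, div_le_div_iff₀ (by positivity) (by positivity)]
    nlinarith [mul_pos hεa hm0]
  have hterm : ∀ i, ‖comparator εa Λ h w₁ w₂ a θ i‖ ^ 2 ≤ (4 / (εa * m)) ^ 2 * (k ^ 2 * (q *
      ∑ j, h j (inner ℝ (w₁ j) (neurons εa θ i).1.1) (neurons εa θ i).1.2 ^ 2)) := by
    intro i
    unfold comparator
    rw [norm_smul, Real.norm_of_nonneg (by positivity), mul_pow]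
    exact mul_le_mul (pow_le_pow_left₀ (by positivity) h2 2)
      (norm_comparatorDir_sq_le hw₂ ha _) (by positivity) (by positivity)
  refine (Finset.sum_le_sum fun i _ => hterm i).trans ?_
  rw [← Finset.mul_sum, ← Finset.mul_sum, ← Finset.mul_sum]
  calc _ ≤ (4 / (εa * m)) ^ 2 * (k ^ 2 * (p * (m * (p * cs ^ 2 + 1)))) := by
        have : q * ∑ i, ∑ j, h j (inner ℝ (w₁ j) (neurons εa θ i).1.1) (neurons εa θ i).1.2 ^ 2
            ≤ p * (m * (p * cs ^ 2 + 1)) := by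
          refine mul_le_mul hq' (hθ.trans ?_) (by positivity) (by positivity)
          gcongr
        gcongr
    _ = _ := by field_simp; ring

lemma continuous_targetNet {φ : Fin q → ℝ → ℝ} (hφ : ∀ j, InfSmooth (φ j))
    (w₁ w₂ : Fin q → Input d) (a : Fin k → Fin q → ℝ) : Continuous (targetNet φ w₁ w₂ a) := by
  have hc : ∀ j, Continuous (φ j) := fun j => (hφ j).1.continuous
  unfold targetNet
  fun_prop

lemma exists_norm_targetNet_le {φ : Fin q → ℝ → ℝ} (hφ : ∀ j, InfSmooth (φ j))
    (w₁ w₂ : Fin q → Input d) (a : Fin k → Fin q → ℝ) :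
    ∃ C, ∀ x, ‖x‖ = 1 → ‖targetNet φ w₁ w₂ a x‖ ≤ C := by
  obtain ⟨C, hC⟩ := (isCompact_sphere (0 : Input d) 1).exists_bound_of_continuousOn
    (continuous_targetNet hφ w₁ w₂ a).continuousOn
  exact ⟨C, fun x hx => hC x (by simpa using hx)⟩

/-- Risk of the linearized network at the comparator. -/
lemma risk_comparator_le {Y : Type*} [MeasurableSpace Y] {D : Measure (Input d × Y)}
    [IsProbabilityMeasure D] (hD : NormalizedInputs D) {L : Output k → Y → ℝ} (hL : GoodLoss L)
    (hLm : Measurable (Function.uncurry L)) (hLi : Integrable (fun z : Input d × Y => L 0 z.2) D)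
    (hm : 0 < m) {εa Λ : ℝ} (hεa : 0 < εa) (hΛ : 1 ≤ Λ) {φ : Fin q → ℝ → ℝ}
    (hφ : ∀ j, InfSmooth (φ j)) {h : Fin q → ℝ → ℝ → ℝ} {H cs δ : ℝ}
    (hf : ∀ j, IsFeature (φ j) (h j) H cs δ)
    {w₁ w₂ : Fin q → Input d} (hw₁ : ∀ j, ‖w₁ j‖ = 1) (hw₂ : ∀ j, ‖w₂ j‖ = 1)
    {a : Fin k → Fin q → ℝ} (ha : ∀ r j, |a r j| ≤ 1) (θ : InitSpace m d k)
    (hθ : ∀ i r, |(neurons εa θ i).2 r| ≤ Λ) {t e₁ e₂ : ℝ}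
    (ht : ∫ z, inner ℝ (gradient (fun u => L u z.2) (targetNet φ w₁ w₂ a z.1))
      (initOutput (neurons εa θ) z.1) ∂D ≤ t)
    (he₁ : ∫ z, ‖initOutput (neurons εa θ) z.1‖ ^ 2 ∂D ≤ e₁)
    (he₂ : ∀ r : Fin k, ∫ z, |(∑ i, comparatorTerm Λ h w₁ w₂ a r (normalizeInput z).1
        (neurons εa θ i)) / m - ∫ ν, comparatorTerm Λ h w₁ w₂ a r (normalizeInput z).1 ν
          ∂(neuronLaw d k)| ∂D ≤ e₂) :
    risk D L (fun x => learner θ (initW θ) x + linNet θ (comparator εa Λ h w₁ w₂ a θ) x)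
      ≤ risk D L (targetNet φ w₁ w₂ a) + εa * t + εa ^ 2 * e₁ / 2 + k * (e₂ + q * δ) := by
  obtain ⟨CF, hCF⟩ := exists_norm_targetNet_le hφ w₁ w₂ a
  obtain ⟨CN, hCN⟩ := exists_norm_initOutput_le (neurons εa θ)
  have hFm : Measurable (targetNet φ w₁ w₂ a) := (continuous_targetNet hφ w₁ w₂ a).measurable
  have hNm : Measurable fun z : Input d × Y => initOutput (neurons εa θ) z.1 :=
    measurable_initOutput_comp measurable_const measurable_fst
  have hgm : Measurable fun z : Input d × Y =>
      gradient (fun u => L u z.2) (targetNet φ w₁ w₂ a z.1) :=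
    Measurable.comp (g := fun y : Output k × Y => gradient (fun u => L u y.2) y.1)
      (f := fun z : Input d × Y => (targetNet φ w₁ w₂ a z.1, z.2)) (measurable_gradient hL hLm)
      ((hFm.comp measurable_fst).prodMk measurable_snd)
  have i0 : Integrable (fun z : Input d × Y => L (learner θ (initW θ) z.1
      + linNet θ (comparator εa Λ h w₁ w₂ a θ) z.1) z.2) D :=
    integrable_loss hD hL hLm hLi
      (F := fun x => learner θ (initW θ) x + linNet θ (comparator εa Λ h w₁ w₂ a θ) x)
      ((measurable_learner_apply θ _).add (measurable_linNet θ _)) fun x hx =>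
      (norm_add_le _ _).trans (add_le_add (norm_learner_le θ _ hx) (norm_linNet_le θ _ hx))
  have i1 : Integrable (fun z : Input d × Y => L (targetNet φ w₁ w₂ a z.1) z.2) D :=
    integrable_loss hD hL hLm hLi hFm hCF
  have i2 : Integrable (fun z : Input d × Y =>
      inner ℝ (gradient (fun u => L u z.2) (targetNet φ w₁ w₂ a z.1))
        (initOutput (neurons εa θ) z.1)) D := by
    refine Integrable.of_bound (hgm.inner hNm).aestronglyMeasurable CN ?_
    filter_upwards [hD] with z hz
    rw [Real.norm_eq_abs]
    refine (abs_real_inner_le_norm _ _).trans ?_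
    exact (mul_le_of_le_one_left (norm_nonneg _)
      (norm_gradient_le_one (hL.lipschitz z.2) _)).trans (hCN _ hz.1)
  have i3 : Integrable (fun z : Input d × Y => ‖initOutput (neurons εa θ) z.1‖ ^ 2) D := by
    refine Integrable.of_bound (hNm.norm.pow_const 2).aestronglyMeasurable (CN ^ 2) ?_
    filter_upwards [hD] with z hz
    rw [Real.norm_of_nonneg (sq_nonneg _)]
    exact pow_le_pow_left₀ (norm_nonneg _) (hCN _ hz.1) 2
  have hUm := fun r => measurable_comparatorTerm Λ (fun j => (hf j).measurable) w₁ w₂ a r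
  have hxm : Measurable fun z : Input d × Y => (normalizeInput z).1 :=
    measurable_fst.comp measurable_normalizeInput
  have i4 : ∀ r : Fin k, Integrable (fun z : Input d × Y =>
      |(∑ i, comparatorTerm Λ h w₁ w₂ a r (normalizeInput z).1
        (neurons εa θ i)) / m - ∫ ν, comparatorTerm Λ h w₁ w₂ a r (normalizeInput z).1 ν
          ∂(neuronLaw d k)|) D := by
    intro r
    have hb : ∀ (z : Input d × Y) (ν : Neuron d k),
        |comparatorTerm Λ h w₁ w₂ a r (normalizeInput z).1 ν| ≤ 4 * Λ * (k * (q * H)) := fun z ν =>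
      abs_comparatorTerm_le hΛ hw₂ ha (fun j => (hf j).bound) r (norm_normalizeInput z) ν
    have hmean : Measurable fun x : Input d =>
        ∫ ν, comparatorTerm Λ h w₁ w₂ a r x ν ∂(neuronLaw d k) :=
      (hUm r).stronglyMeasurable.integral_prod_right.measurable
    have hI1 : Integrable (fun z : Input d × Y =>
        (∑ i, comparatorTerm Λ h w₁ w₂ a r (normalizeInput z).1 (neurons εa θ i)) / m) D := by
      refine (integrable_finsetSum _ fun i _ => ?_).div_const _
      exact integrable_of_abs_le _ ((hUm r).comp
        (f := fun z : Input d × Y => ((normalizeInput z).1, neurons εa θ i))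
        (hxm.prodMk measurable_const)) fun z => hb z _
    have hI2 : Integrable (fun z : Input d × Y =>
        ∫ ν, comparatorTerm Λ h w₁ w₂ a r (normalizeInput z).1 ν ∂(neuronLaw d k)) D := by
      refine integrable_of_abs_le _ (hmean.comp hxm) (C := 4 * Λ * (k * (q * H))) fun z => ?_
      have := norm_integral_le_of_norm_le_const (μ := neuronLaw d k)
        (f := fun ν => comparatorTerm Λ h w₁ w₂ a r (normalizeInput z).1 ν)
        (Filter.Eventually.of_forall fun ν => hb z ν)
      simpa using this
    exact (hI1.sub hI2).abs
  have i5 : Integrable (fun z : Input d × Y => ∑ r,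
      |(∑ i, comparatorTerm Λ h w₁ w₂ a r (normalizeInput z).1
        (neurons εa θ i)) / m - ∫ ν, comparatorTerm Λ h w₁ w₂ a r (normalizeInput z).1 ν
          ∂(neuronLaw d k)|) D := integrable_finsetSum _ fun r _ => i4 r
  have hpt : ∀ᵐ z ∂D, L (learner θ (initW θ) z.1
      + linNet θ (comparator εa Λ h w₁ w₂ a θ) z.1) z.2 ≤ L (targetNet φ w₁ w₂ a z.1) z.2
      + εa * inner ℝ (gradient (fun u => L u z.2) (targetNet φ w₁ w₂ a z.1))
        (initOutput (neurons εa θ) z.1)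
      + εa ^ 2 / 2 * ‖initOutput (neurons εa θ) z.1‖ ^ 2
      + (∑ r, |(∑ i, comparatorTerm Λ h w₁ w₂ a r (normalizeInput z).1
        (neurons εa θ i)) / m - ∫ ν, comparatorTerm Λ h w₁ w₂ a r (normalizeInput z).1 ν
          ∂(neuronLaw d k)| + k * (q * δ)) := by
    filter_upwards [hD, normalizeInput_ae hD] with z hz hz'
    rw [hz', learner_initW_eq hm hεa]
    -- The Lipschitz bound is spent on the approximation error only. The initial output is added to
    -- the target and expanded to second order in `h2`, since its pairing with the gradient is small
    -- on average although its norm is not.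
    have h1 := hL.abs_sub_le (εa • initOutput (neurons εa θ) z.1
      + linNet θ (comparator εa Λ h w₁ w₂ a θ) z.1)
      (targetNet φ w₁ w₂ a z.1 + εa • initOutput (neurons εa θ) z.1) z.2
    have h2 := le_of_lipschitz_gradient (hL.differentiable z.2) (hL.smooth z.2)
      (targetNet φ w₁ w₂ a z.1) (εa • initOutput (neurons εa θ) z.1)
    rw [real_inner_smul_right, norm_smul, Real.norm_of_nonneg hεa.le, mul_pow] at h2
    have h3 : ‖εa • initOutput (neurons εa θ) z.1
        + linNet θ (comparator εa Λ h w₁ w₂ a θ) z.1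
        - (targetNet φ w₁ w₂ a z.1 + εa • initOutput (neurons εa θ) z.1)‖
        ≤ ∑ r, |(∑ i, comparatorTerm Λ h w₁ w₂ a r z.1 (neurons εa θ i)) / m
          - ∫ ν, comparatorTerm Λ h w₁ w₂ a r z.1 ν ∂(neuronLaw d k)| + k * (q * δ) := by
      have e : εa • initOutput (neurons εa θ) z.1
        + linNet θ (comparator εa Λ h w₁ w₂ a θ) z.1
        - (targetNet φ w₁ w₂ a z.1 + εa • initOutput (neurons εa θ) z.1)
        = linNet θ (comparator εa Λ h w₁ w₂ a θ) z.1 - targetNet φ w₁ w₂ a z.1 := by abel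
      rw [e]
      refine (norm_le_sum_abs _).trans ?_
      have hk : (k : ℝ) * (q * δ) = ∑ _r : Fin k, (q : ℝ) * δ := by simp
      rw [hk, ← Finset.sum_add_distrib]
      refine Finset.sum_le_sum fun r _ => ?_
      rw [PiLp.sub_apply, linNet_comparator hm hεa hΛ h w₁ w₂ a θ hθ]
      refine (abs_sub_le _ (∫ ν, comparatorTerm Λ h w₁ w₂ a r z.1 ν ∂(neuronLaw d k)) _).trans ?_
      exact add_le_add le_rfl (abs_integral_comparatorTerm_sub_le hΛ hf hw₁ hw₂ ha r hz.1)
    have h4 := (abs_le.mp h1).2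
    linarith
  have j2 := i2.const_mul εa
  have j3 := i3.const_mul (εa ^ 2 / 2)
  have j5 := i5.add (integrable_const (k * (q * δ)))
  have hint := integral_mono_ae i0 (((i1.add j2).add j3).add j5) hpt
  unfold risk
  refine hint.trans ?_
  have e := integral_add' (μ := D) ((i1.add j2).add j3) j5
  have e' := integral_add' (μ := D) (i1.add j2) j3
  have e'' := integral_add' (μ := D) i1 j2
  have e3 := integral_add' (μ := D) i5 (integrable_const (k * (q * δ)))
  rw [e, e', e'', e3, integral_const_mul, integral_const_mul, integral_finsetSum _ fun r _ => i4 r]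
  simp only [integral_const, probReal_univ, one_smul]
  have s1 := mul_le_mul_of_nonneg_left ht hεa.le
  have s2 := mul_le_mul_of_nonneg_left he₁ (by positivity : 0 ≤ εa ^ 2 / 2)
  have s3 : ∑ r, ∫ z, |(∑ i, comparatorTerm Λ h w₁ w₂ a r (normalizeInput z).1
        (neurons εa θ i)) / m - ∫ ν, comparatorTerm Λ h w₁ w₂ a r (normalizeInput z).1 ν
          ∂(neuronLaw d k)| ∂D ≤ k * e₂ :=
    (Finset.sum_le_card_nsmul _ _ e₂ fun r _ => he₂ r).trans (by simp)
  linarith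

end Link

end

end SAMGen

namespace SAMGen

noncomputable section

/-! ### Probability of a good initialization -/

section GoodInit

variable {m d k q : ℕ} {Y : Type*} [MeasurableSpace Y]

/-- The properties of an initialization that the analysis of SAM uses: bounds on the output
weights and on the number of nearly inactive neurons, and a good comparator. -/
structure GoodInit (D : Measure (Input d × Y)) (L : Output k → Y → ℝ) (θ : InitSpace m d k)
    (α τ S τs Q R : ℝ) : Prop where
  outWeight_le : ∀ i, ‖outWeight θ i‖ ≤ α
  nearZero_le : ∫ z, ∑ i, nearZero θ τ i z.1 ∂D ≤ S
  exists_comparator : ∃ Vs : Weights m d, (∀ i, ‖Vs i‖ ≤ τs) ∧ ∑ i, ‖Vs i‖ ^ 2 ≤ Q ∧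
    risk D L (fun x => learner θ (initW θ) x + linNet θ Vs x) ≤ R

lemma measure_le_of_real_le {Ω : Type*} [MeasurableSpace Ω] {μ : Measure Ω} [IsFiniteMeasure μ]
    {s : Set Ω} {c : ℝ} (h : μ.real s ≤ c) : μ s ≤ ENNReal.ofReal c := by
  rw [← ofReal_measureReal]; exact ENNReal.ofReal_le_ofReal h

/-- A union bound, in the standardized neurons, over six events: a large output weight, too many
nearly inactive neurons, a large comparator, a poor empirical mean in some output coordinate, a
large linear term and a large quadratic term in the expansion of the loss. The target is fixed in
advance, so no uniformity over the concept class is needed. -/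
lemma initMeasure_not_goodInit_le {D : Measure (Input d × Y)}
    [IsProbabilityMeasure D] (hD : NormalizedInputs D) {L : Output k → Y → ℝ} (hL : GoodLoss L)
    (hLm : Measurable (Function.uncurry L)) (hLi : Integrable (fun z : Input d × Y => L 0 z.2) D)
    (hm : 0 < m) (hk : 0 < k) {p : ℕ} (hp : 0 < p) (hq : q ≤ p) {εa Λ : ℝ} (hεa : 0 < εa)
    (hΛ : 1 ≤ Λ) {φ : Fin q → ℝ → ℝ} (hφ : ∀ j, InfSmooth (φ j)) {h : Fin q → ℝ → ℝ → ℝ}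
    {H cs δ : ℝ} (hH : 0 < H) (hf : ∀ j, IsFeature (φ j) (h j) H cs δ)
    {w₁ w₂ : Fin q → Input d} (hw₁ : ∀ j, ‖w₁ j‖ = 1) (hw₂ : ∀ j, ‖w₂ j‖ = 1)
    {a : Fin k → Fin q → ℝ} (ha : ∀ r j, |a r j| ≤ 1) {τ s₁ s₂ s t : ℝ} (hτ : 0 ≤ τ)
    (hs₁ : 0 ≤ s₁) (hs₂ : 0 ≤ s₂) (hs : 0 ≤ s) :
    initMeasure m d k εa {θ | ¬ GoodInit D L θ (εa * Λ * √k) τ (m * (√m * τ + s₁))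
      (4 * (k * (p * H)) / (εa * m)) (16 * k ^ 2 * p * (p * cs ^ 2 + 1) / (εa ^ 2 * m))
      (risk D L (targetNet φ w₁ w₂ a) + εa * t + εa ^ 2 * (k * (s ^ 2 + 180)) / 2
        + k * (4 * Λ * (k * (p * H)) / √m + s₂ + q * δ))}
      ≤ ENNReal.ofReal (m * k * (2 * Real.exp (-Λ ^ 2 / 2)))
        + ENNReal.ofReal (Real.exp (-(m * s₁ ^ 2) / 2))
        + ENNReal.ofReal (Real.exp (-m / (2 * (q * H ^ 2 + 1) ^ 2)))
        + ENNReal.ofReal (k * Real.exp (-(m * s₂ ^ 2) / (8 * (4 * Λ * (k * (p * H))) ^ 2)))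
        + ENNReal.ofReal (Real.exp (1 - t / 2)) + ENNReal.ofReal (Real.exp (-(s / 4))) := by
  have hM : 0 < 4 * Λ * (k * (p * H)) := by positivity
  have hq' : (q : ℝ) ≤ p := by exact_mod_cast hq
  have hFm : Measurable (targetNet φ w₁ w₂ a) := (continuous_targetNet hφ w₁ w₂ a).measurable
  have hgm : Measurable fun z : Input d × Y =>
      gradient (fun u => L u z.2) (targetNet φ w₁ w₂ a z.1) :=
    Measurable.comp (g := fun y : Output k × Y => gradient (fun u => L u y.2) y.1)
      (f := fun z : Input d × Y => (targetNet φ w₁ w₂ a z.1, z.2)) (measurable_gradient hL hLm)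
      ((hFm.comp measurable_fst).prodMk measurable_snd)
  have b1 := outWeights_tail (m := m) (d := d) (k := k) (by linarith : 0 ≤ Λ)
  have b2 := measure_le_of_real_le (nearZero_tail (m := m) (k := k) D
    (by positivity : 0 ≤ √(m : ℝ) * τ) hs₁)
  have b3 := measure_le_of_real_le (featureSum_tail (m := m) (k := k) hf hw₁)
  have b4 : ∀ r : Fin k, _ := fun r => measure_le_of_real_le (empirical_mean_tail hm
    (neuronLaw d k) D (U := fun z ν => comparatorTerm Λ h w₁ w₂ a r (normalizeInput z).1 ν)
    (Measurable.comp (g := fun v : Input d × Neuron d k => comparatorTerm Λ h w₁ w₂ a r v.1 v.2)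
      (f := fun v : (Input d × Y) × Neuron d k => ((normalizeInput v.1).1, v.2))
      (measurable_comparatorTerm Λ (fun j => (hf j).measurable) w₁ w₂ a r)
      (((measurable_fst.comp measurable_normalizeInput).comp measurable_fst).prodMk
        measurable_snd)) hM
    (fun z ν => (abs_comparatorTerm_le hΛ hw₂ ha (fun j => (hf j).bound) r
      (norm_normalizeInput z) ν).trans (by gcongr)) hs₂)
  have b5 := initOutput_inner_tail hm hD hgm
    (fun z => norm_gradient_le_one (hL.lipschitz z.2) _) t
  have b6 := initOutput_sq_tail (m := m) hm hk hD hs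
  obtain ⟨A1, hA1⟩ : ∃ A, A = {n : Fin m → Neuron d k | ∃ i r, Λ < |(n i).2 r|} := ⟨_, rfl⟩
  obtain ⟨A2, hA2⟩ : ∃ A, A = {n : Fin m → Neuron d k | m * (√m * τ + s₁) ≤
    ∑ i, ∫ z, (if |neuronAct (n i) z.1| ≤ √m * τ then (1 : ℝ) else 0) ∂D} := ⟨_, rfl⟩
  obtain ⟨A3, hA3⟩ : ∃ A, A = {n : Fin m → Neuron d k | m * (q * cs ^ 2 + 1)
    ≤ ∑ i, ∑ j, h j (inner ℝ (w₁ j) (n i).1.1) (n i).1.2 ^ 2} := ⟨_, rfl⟩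
  obtain ⟨A4, hA4⟩ : ∃ A : Fin k → Set (Fin m → Neuron d k), A = fun r =>
    {n : Fin m → Neuron d k | 4 * Λ * (k * (p * H)) / √m + s₂ ≤
      ∫ z, |(∑ i, comparatorTerm Λ h w₁ w₂ a r (normalizeInput z).1 (n i)) / m
        - ∫ ν, comparatorTerm Λ h w₁ w₂ a r (normalizeInput z).1 ν ∂(neuronLaw d k)| ∂D} :=
    ⟨_, rfl⟩
  obtain ⟨A5, hA5⟩ : ∃ A, A = {n : Fin m → Neuron d k | t ≤
    ∫ z, inner ℝ (gradient (fun u => L u z.2) (targetNet φ w₁ w₂ a z.1))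
      (initOutput n z.1) ∂D} := ⟨_, rfl⟩
  obtain ⟨A6, hA6⟩ : ∃ A, A = {n : Fin m → Neuron d k | k * (s ^ 2 + 180) ≤
    ∫ z, ‖initOutput n z.1‖ ^ 2 ∂D} := ⟨_, rfl⟩
  rw [← hA1] at b1
  rw [← hA2] at b2
  rw [← hA3] at b3
  have b4' : ∀ r, (Measure.pi fun _ : Fin m => neuronLaw d k) (A4 r) ≤ ENNReal.ofReal
      (Real.exp (-(m * s₂ ^ 2) / (8 * (4 * Λ * (k * (p * H))) ^ 2))) := by
    intro r; rw [hA4]; exact b4 r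
  rw [← hA5] at b5
  rw [← hA6] at b6
  have b4'' : (Measure.pi fun _ : Fin m => neuronLaw d k) (⋃ r, A4 r) ≤ ENNReal.ofReal
      (k * Real.exp (-(m * s₂ ^ 2) / (8 * (4 * Λ * (k * (p * H))) ^ 2))) := by
    refine (measure_iUnion_fintype_le _ _).trans ?_
    refine (Finset.sum_le_sum fun r _ => b4' r).trans ?_
    rw [Finset.sum_const, Finset.card_univ, Fintype.card_fin, nsmul_eq_mul,
      ENNReal.ofReal_mul (p := (k : ℝ)) (by positivity), ENNReal.ofReal_natCast]
  have hmp := measurePreserving_neurons (m := m) (d := d) (k := k) hεa hm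
  have hsub : {θ : InitSpace m d k | ¬ GoodInit D L θ (εa * Λ * √k) τ (m * (√m * τ + s₁))
      (4 * (k * (p * H)) / (εa * m)) (16 * k ^ 2 * p * (p * cs ^ 2 + 1) / (εa ^ 2 * m))
      (risk D L (targetNet φ w₁ w₂ a) + εa * t + εa ^ 2 * (k * (s ^ 2 + 180)) / 2
        + k * (4 * Λ * (k * (p * H)) / √m + s₂ + q * δ))}
      ⊆ neurons εa ⁻¹' (A1 ∪ A2 ∪ A3 ∪ (⋃ r, A4 r) ∪ A5 ∪ A6) := by
    intro θ hθ
    by_contra hn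
    apply hθ
    simp only [Set.mem_preimage, Set.mem_union, Set.mem_iUnion, not_or, not_exists] at hn
    obtain ⟨⟨⟨⟨⟨n1, n2⟩, n3⟩, n4⟩, n5⟩, n6⟩ := hn
    rw [hA1] at n1
    rw [hA2] at n2
    rw [hA3] at n3
    rw [hA4] at n4
    rw [hA5] at n5
    rw [hA6] at n6
    simp only [Set.mem_ofPred_eq, not_exists, not_lt] at n1
    simp only [Set.mem_ofPred_eq, not_le] at n2 n3 n4 n5 n6
    refine ⟨fun i => norm_outWeight_le hεa θ i (n1 i), ?_,
      comparator εa Λ h w₁ w₂ a θ, ?_, ?_, ?_⟩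
    · rw [integral_finsetSum]
      · simp_rw [nearZero_eq hm εa]
        exact n2.le
      · intro i _
        refine integrable_of_abs_le D ((measurable_nearZero θ τ i).comp measurable_fst) (C := 1) ?_
        intro z
        exact (abs_of_nonneg (nearZero_nonneg θ τ i z.1)).le.trans (nearZero_le_one θ τ i z.1)
    · exact fun i => norm_comparator_le hq hεa hΛ hw₂ ha hH.le (fun j => (hf j).bound) θ i
    · exact sum_norm_comparator_sq_le hq hm hεa hΛ hw₂ ha θ n3.le
    · exact risk_comparator_le hD hL hLm hLi hm hεa hΛ hφ hf hw₁ hw₂ ha θ n1 n5.le n6.le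
        fun r => (n4 r).le
  -- The transfer inequality holds for arbitrary sets, so measurability of the bad events is never
  -- needed.
  refine (measure_mono hsub).trans ((Measure.le_map_apply hmp.measurable.aemeasurable _).trans ?_)
  rw [hmp.map_eq]
  refine (measure_union_le _ _).trans (add_le_add ?_ b6)
  refine (measure_union_le _ _).trans (add_le_add ?_ b5)
  refine (measure_union_le _ _).trans (add_le_add ?_ b4'')
  refine (measure_union_le _ _).trans (add_le_add ?_ b3)
  exact (measure_union_le _ _).trans (add_le_add b1 b2)

end GoodInit

end

end SAMGen

namespace SAMGen

noncomputable section

/-! ### Stochastic SAM from a good initialization -/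

section FromGoodInit

variable {m d k : ℕ} {Y : Type*} [MeasurableSpace Y]

lemma sam_bounds_of_goodInit {D : Measure (Input d × Y)} [IsProbabilityMeasure D]
    (hD : NormalizedInputs D) {L : Output k → Y → ℝ} (hL : GoodLoss L)
    (hm : Measurable (Function.uncurry L)) (hi : Integrable (fun z : Input d × Y => L 0 z.2) D)
    {θ : InitSpace m d k} {η ρ α S τs Q R s B goal : ℝ} {T N : ℕ} (hη : 0 < η) (hρ : 0 ≤ ρ)
    (hα : 0 ≤ α) (hτs : 0 ≤ τs) (hT : 0 < T) (hN : 0 < N) (hs : 0 ≤ s)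
    (hθ : GoodInit D L θ α ((η * T + ρ) * α) S τs Q R) (hB : m * (α * (T * (η * α))) ≤ B)
    (hgoal : R + 2 * (m * ρ * α ^ 2) + α * (2 * ((η * T + ρ) * α) + τs) * S
      + η * (m * α ^ 2) / 2 + Q / (2 * η * T) + 2 * B * (T ^ 2 / N) + s ≤ goal) :
    ∫ Z, samAverageRisk D L η ρ T θ Z ∂(Measure.pi fun _ : Fin N => D) ≤ goal ∧
      (Measure.pi fun _ : Fin N => D) {Z | ¬ samAverageRisk D L η ρ T θ Z ≤ goal}
        ≤ ENNReal.ofReal (Real.exp (-s ^ 2 / (2 * (N * (2 * B * (T / N)) ^ 2)))) := by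
  obtain ⟨Vs, hVs, hQ, hR⟩ := hθ.exists_comparator
  have hT' : (0 : ℝ) < T := by exact_mod_cast hT
  have h1 := integral_pathRisk_le hD hL hm hi θ hη hρ hα hθ.outWeight_le hVs hT
  have h2 : α * (2 * ((η * T + ρ) * α) + τs)
      * ∫ z, ∑ i, nearZero θ ((η * T + ρ) * α) i z.1 ∂D
      ≤ α * (2 * ((η * T + ρ) * α) + τs) * S :=
    mul_le_mul_of_nonneg_left hθ.nearZero_le (by positivity)
  have h3 : (∑ i, ‖Vs i‖ ^ 2) / (2 * η * T) ≤ Q / (2 * η * T) :=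
    div_le_div_of_nonneg_right hQ (by positivity)
  have hK : ∫ z, pathRisk D L η ρ θ z ∂(Measure.pi fun _ : Fin T => D)
      ≤ R + 2 * (m * ρ * α ^ 2) + α * (2 * ((η * T + ρ) * α) + τs) * S
        + η * (m * α ^ 2) / 2 + Q / (2 * η * T) := by linarith
  obtain ⟨h4, h5⟩ := samAverageRisk_bounds hD hL hm hi θ hη.le hα hθ.outWeight_le hT hN hs hB hK
  refine ⟨by linarith, (measure_mono fun Z hZ => ?_).trans h5⟩
  simp only [Set.mem_ofPred_eq, not_le] at hZ ⊢
  linarith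

end FromGoodInit

/-! ### Choice of the parameters -/

section Parameters

/-- The parameters of the main theorem: `l` is `log m`, and `W` bounds all the quantities that do
not grow with `m`, up to logarithms. -/
structure ParamBounds (c ε k p cs cn m l y W : ℝ) : Prop where
  c_pos : 0 < c
  ε_pos : 0 < ε
  k_ge : 1 ≤ k
  p_ge : 1 ≤ p
  cs_ge : 1 ≤ cs
  cn_nonneg : 0 ≤ cn
  prod_le : p * k * cs * ε ≤ 1
  l_ge : 40 * (c + 10) ≤ l
  c_le : c + 2000 ≤ W
  l_le : l ≤ W
  ε_inv_le : 1 / ε ≤ W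
  H_le : 1024 * cn + 1 ≤ W
  cl_le : (c + 5) * l ≤ W
  y_ge : W ^ 60 ≤ y
  m_eq : m = y ^ 4

variable {c ε k p cs cn m l y W : ℝ}

namespace ParamBounds

lemma W_ge (h : ParamBounds c ε k p cs cn m l y W) : 2000 ≤ W := by
  linarith [h.c_pos, h.c_le]

lemma l_ge_one (h : ParamBounds c ε k p cs cn m l y W) : 400 ≤ l := by
  linarith [h.c_pos, h.l_ge]

lemma y_pos (h : ParamBounds c ε k p cs cn m l y W) : 0 < y :=
  lt_of_lt_of_le (pow_pos (by linarith [h.W_ge]) 60) h.y_ge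

lemma m_pos (h : ParamBounds c ε k p cs cn m l y W) : 0 < m := by
  rw [h.m_eq]; exact pow_pos h.y_pos 4

lemma k_ε_le (h : ParamBounds c ε k p cs cn m l y W) : k * ε ≤ 1 := by
  have h1 := h.prod_le
  have hε := h.ε_pos
  have h2 : 1 * k * 1 * ε ≤ p * k * cs * ε := by
    have := h.k_ge; have := h.p_ge; have := h.cs_ge
    gcongr
  linarith

lemma pk_ε_le (h : ParamBounds c ε k p cs cn m l y W) : p * k * ε ≤ 1 := by
  have h1 := h.prod_le
  have hε := h.ε_pos
  have h2 : p * k * 1 * ε ≤ p * k * cs * ε := by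
    have := h.k_ge; have := h.p_ge; have := h.cs_ge
    gcongr
  linarith

lemma cs_ε_le (h : ParamBounds c ε k p cs cn m l y W) : cs * ε ≤ 1 := by
  have h1 := h.prod_le
  have hε := h.ε_pos
  have h2 : 1 * 1 * cs * ε ≤ p * k * cs * ε := by
    have := h.k_ge; have := h.p_ge; have := h.cs_ge
    gcongr
  linarith

lemma p_ε_le (h : ParamBounds c ε k p cs cn m l y W) : p * ε ≤ 1 := by
  have h1 := h.pk_ε_le
  have hε := h.ε_pos
  have h2 : p * 1 * ε ≤ p * k * ε := by
    have := h.k_ge; have := h.p_ge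
    gcongr
  linarith

lemma ε_le_one (h : ParamBounds c ε k p cs cn m l y W) : ε ≤ 1 := by
  have := h.k_ε_le; have := h.ε_pos; have := h.k_ge
  nlinarith

lemma le_W (h : ParamBounds c ε k p cs cn m l y W) {u : ℝ} (hu : u * ε ≤ 1) : u ≤ W := by
  refine le_trans ?_ h.ε_inv_le
  rwa [le_div_iff₀ h.ε_pos]

lemma one_le_Wε (h : ParamBounds c ε k p cs cn m l y W) : 1 ≤ W * ε := by
  have := h.ε_inv_le
  rwa [div_le_iff₀ h.ε_pos] at this

/-- A quantity below `W ^ 2 / y` is negligible. -/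
lemma small (h : ParamBounds c ε k p cs cn m l y W) {u : ℝ} (hu : u * W ^ 2 ≤ 1) :
    u ≤ ε / 100 := by
  have hW := h.W_ge
  have h1 := h.one_le_Wε
  have hε := h.ε_pos
  rcases le_or_gt u 0 with hu0 | hu0
  · exact hu0.trans (by positivity)
  have h2 : u * W ≤ ε := by
    have : u * W * (W * ε) ≤ 1 * ε := by nlinarith
    have h3 : u * W * 1 ≤ u * W * (W * ε) := mul_le_mul_of_nonneg_left h1 (by positivity)
    linarith
  have h4 : u * 100 ≤ u * W := mul_le_mul_of_nonneg_left (by linarith) hu0.le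
  linarith

/-- The power `l ^ 4` in `εa` pays for the tail level of order `l ^ 2` of the linear term. -/
lemma outputError (h : ParamBounds c ε k p cs cn m l y W) :
    ε / l ^ 4 * (2 * (c + 3) * l ^ 2) ≤ ε / 20 := by
  have hl := h.l_ge_one
  have hl0 : 0 < l := by linarith
  have hε := h.ε_pos
  have e : ε / l ^ 4 * (2 * (c + 3) * l ^ 2) = ε * (2 * (c + 3)) / l ^ 2 := by field_simp
  rw [e, div_le_div_iff₀ (by positivity) (by norm_num)]
  have : 2 * (c + 3) * 20 ≤ l ^ 2 := by nlinarith [h.l_ge, h.c_pos]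
  nlinarith

/-- The quadratic term grows like `k`; one factor `ε` of `εa ^ 2` absorbs it through `k * ε ≤ 1`,
and `l ^ 8` dominates the tail level. -/
lemma outputSqError (h : ParamBounds c ε k p cs cn m l y W) :
    (ε / l ^ 4) ^ 2 * (k * ((4 * (c + 2) * l ^ 2) ^ 2 + 180)) / 2 ≤ ε / 20 := by
  have hl := h.l_ge_one
  have hl0 : 0 < l := by linarith
  have hε := h.ε_pos
  have hk := h.k_ε_le
  have hc := h.c_pos
  have hcl : 40 * (c + 2) ≤ l := by linarith [h.l_ge]
  have h1 : (4 * (c + 2) * l ^ 2) ^ 2 + 180 ≤ l ^ 8 / 10 := by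
    have h2 : 4 * (c + 2) * l ^ 2 ≤ l ^ 3 / 10 := by
      have := mul_le_mul_of_nonneg_right hcl (by positivity : 0 ≤ l ^ 2)
      nlinarith
    have h3 : (4 * (c + 2) * l ^ 2) ^ 2 ≤ (l ^ 3 / 10) ^ 2 := pow_le_pow_left₀ (by positivity) h2 2
    have h4 : (400 : ℝ) ^ 2 ≤ l ^ 2 := pow_le_pow_left₀ (by norm_num) hl 2
    have h5 : (400 : ℝ) ^ 6 ≤ l ^ 6 := pow_le_pow_left₀ (by norm_num) hl 6
    have h6 : l ^ 8 = l ^ 2 * l ^ 6 := by ring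
    have h7 : (l ^ 3 / 10) ^ 2 = l ^ 6 / 100 := by ring
    rw [h6]; rw [h7] at h3
    nlinarith
  have e : (ε / l ^ 4) ^ 2 * (k * ((4 * (c + 2) * l ^ 2) ^ 2 + 180)) / 2
      = ε * (k * ε) * ((4 * (c + 2) * l ^ 2) ^ 2 + 180) / (2 * l ^ 8) := by field_simp
  rw [e, div_le_div_iff₀ (by positivity) (by norm_num)]
  have hkp : 0 ≤ k * ε := by have := h.k_ge; positivity
  have : ε * (k * ε) * ((4 * (c + 2) * l ^ 2) ^ 2 + 180) ≤ ε * 1 * (l ^ 8 / 10) := by gcongr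
  linarith

lemma k_le (h : ParamBounds c ε k p cs cn m l y W) : k ≤ W := h.le_W h.k_ε_le

lemma p_le (h : ParamBounds c ε k p cs cn m l y W) : p ≤ W := h.le_W h.p_ε_le

lemma cs_le (h : ParamBounds c ε k p cs cn m l y W) : cs ≤ W := h.le_W h.cs_ε_le

lemma termBound_le (h : ParamBounds c ε k p cs cn m l y W) :
    4 * ((c + 5) * l) * (k * (p * (1024 * cn + 1))) ≤ W ^ 5 := by
  have hW := h.W_ge
  have hc := h.c_pos
  have hl := h.l_ge_one
  have hk := h.k_ge
  have hp := h.p_ge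
  have hcn := h.cn_nonneg
  calc _ ≤ W * W * (W * (W * W)) := by
        refine mul_le_mul (mul_le_mul (by linarith) h.cl_le (by positivity) (by linarith))
          (mul_le_mul h.k_le (mul_le_mul h.p_le h.H_le (by positivity) (by linarith))
            (by positivity) (by linarith)) (by positivity) (by positivity)
    _ = _ := by ring

lemma pow_div_y_le (h : ParamBounds c ε k p cs cn m l y W) {n : ℕ} (hn : n ≤ 60) :
    W ^ n / y ≤ 1 / W ^ (60 - n) := by
  have hW := h.W_ge
  have hy := h.y_pos
  rw [div_le_div_iff₀ hy (by positivity), one_mul, ← pow_add, Nat.add_sub_cancel' hn]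
  exact h.y_ge

lemma small_of_pow (h : ParamBounds c ε k p cs cn m l y W) {u : ℝ} (hu : u ≤ W ^ 58 / y) :
    u ≤ ε / 100 := by
  have hW := h.W_ge
  have h1 := hu.trans (h.pow_div_y_le (by norm_num))
  norm_num at h1
  apply h.small
  have h2 := mul_le_mul_of_nonneg_right h1 (by positivity : 0 ≤ W ^ 2)
  rwa [inv_mul_cancel₀ (by positivity)] at h2

lemma one_le_y (h : ParamBounds c ε k p cs cn m l y W) : 1 ≤ y :=
  (one_le_pow₀ (by linarith [h.W_ge])).trans h.y_ge

lemma approxError (h : ParamBounds c ε k p cs cn m l y W) {q : ℝ} (hq : q ≤ p) :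
    k * (4 * ((c + 5) * l) * (k * (p * (1024 * cn + 1))) / y ^ 2 + 1 / y + q * (ε ^ 2 / 1000))
      ≤ ε / 20 := by
  have hW := h.W_ge
  have hy := h.y_pos
  have hk := h.k_ge
  have hε := h.ε_pos
  have h1 : k * (4 * ((c + 5) * l) * (k * (p * (1024 * cn + 1))) / y ^ 2) ≤ ε / 100 := by
    apply h.small_of_pow
    calc _ ≤ W * (W ^ 5 / y ^ 2) := by
          refine mul_le_mul h.k_le (div_le_div_of_nonneg_right h.termBound_le (by positivity)) ?_
            (by linarith)
          have := h.c_pos; have := h.l_ge_one; have := h.p_ge; have := h.cn_nonneg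
          positivity
      _ ≤ W * (W ^ 5 / y) := by
          have : y ≤ y ^ 2 := by nlinarith [h.one_le_y]
          gcongr
      _ = W ^ 6 / y := by ring
      _ ≤ W ^ 58 / y := by
          have : W ^ 6 ≤ W ^ 58 := pow_le_pow_right₀ (by linarith) (by norm_num)
          gcongr
  have h2 : k * (1 / y) ≤ ε / 100 := by
    apply h.small_of_pow
    have h3 : k ≤ W ^ 58 := h.k_le.trans (le_self_pow₀ (by linarith) (by norm_num))
    rw [mul_one_div]
    gcongr
  have h4 : k * (q * (ε ^ 2 / 1000)) ≤ ε / 1000 := by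
    have h5 : k * (q * (ε ^ 2 / 1000)) ≤ k * (p * (ε ^ 2 / 1000)) := by gcongr
    have h6 : k * (p * (ε ^ 2 / 1000)) = p * k * ε * ε / 1000 := by ring
    have h7 := mul_le_mul_of_nonneg_right h.pk_ε_le hε.le
    linarith
  linarith

lemma alpha_sq (h : ParamBounds c ε k p cs cn m l y W) :
    (ε / l ^ 4 * ((c + 5) * l) * √k) ^ 2 = ε ^ 2 * k * (c + 5) ^ 2 / l ^ 6 := by
  have hl := h.l_ge_one
  have hl0 : l ≠ 0 := by linarith
  have hk := h.k_ge
  rw [mul_pow, Real.sq_sqrt (by linarith)]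
  field_simp

lemma c_sq_le (h : ParamBounds c ε k p cs cn m l y W) : (c + 5) ^ 2 ≤ l ^ 6 / 20 := by
  have hl := h.l_ge_one
  have hc := h.c_pos
  have h1 : (c + 5) ^ 2 ≤ l ^ 2 := pow_le_pow_left₀ (by linarith) (by linarith [h.l_ge]) 2
  have h2 : (400 : ℝ) ^ 4 ≤ l ^ 4 := pow_le_pow_left₀ (by norm_num) hl 4
  have h3 : l ^ 6 = l ^ 4 * l ^ 2 := by ring
  rw [h3]
  nlinarith [sq_nonneg l]

/-- The squared gradient norm is at most `m * α ^ 2`, of order `ε ^ 2 * k * m` up to logarithms.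
This fixes the scale `1 / (ε * k * m)` of the learning rate. -/
lemma stepError (h : ParamBounds c ε k p cs cn m l y W) :
    1 / (ε * k * m) * (m * (ε / l ^ 4 * ((c + 5) * l) * √k) ^ 2) / 2 ≤ ε / 20 := by
  have hl := h.l_ge_one
  have hk := h.k_ge
  have hε := h.ε_pos
  have hm := h.m_pos
  have hl0 : 0 < l := by linarith
  rw [h.alpha_sq]
  have e : 1 / (ε * k * m) * (m * (ε ^ 2 * k * (c + 5) ^ 2 / l ^ 6)) / 2
      = ε * (c + 5) ^ 2 / (2 * l ^ 6) := by field_simp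
  rw [e, div_le_div_iff₀ (by positivity) (by norm_num)]
  have := mul_le_mul_of_nonneg_left h.c_sq_le hε.le
  nlinarith [pow_pos hl0 6]

/-- With this `ρ` the shift of the output is of order `1 / (ε * m ^ 2)` up to logarithms, far below
what the bound needs. -/
lemma perturbError (h : ParamBounds c ε k p cs cn m l y W) :
    2 * (m * (1 / (ε ^ 3 * k * m ^ 3)) * (ε / l ^ 4 * ((c + 5) * l) * √k) ^ 2) ≤ ε / 20 := by
  have hl := h.l_ge_one
  have hk := h.k_ge
  have hε := h.ε_pos
  have hm := h.m_pos
  have hl0 : 0 < l := by linarith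
  have hW := h.W_ge
  have hy := h.y_pos
  rw [h.alpha_sq]
  have e : 2 * (m * (1 / (ε ^ 3 * k * m ^ 3)) * (ε ^ 2 * k * (c + 5) ^ 2 / l ^ 6))
      = (c + 5) ^ 2 / l ^ 6 * 2 * (1 / ε) / m ^ 2 := by field_simp
  rw [e]
  have h1 : (c + 5) ^ 2 / l ^ 6 * 2 ≤ 1 := by
    rw [div_mul_eq_mul_div, div_le_one (by positivity)]
    have := h.c_sq_le
    have := pow_pos hl0 6
    linarith
  have h2 : (c + 5) ^ 2 / l ^ 6 * 2 * (1 / ε) / m ^ 2 ≤ 1 * W / y := by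
    have h3 : y ≤ m ^ 2 := by
      rw [h.m_eq, ← pow_mul]; exact le_self_pow₀ h.one_le_y (by norm_num)
    have := h.ε_inv_le
    gcongr
  have h4 : 1 * W / y ≤ W ^ 58 / y := by
    rw [one_mul]
    have : W ≤ W ^ 58 := le_self_pow₀ (by linarith) (by norm_num)
    gcongr
  have := h.small_of_pow (h2.trans h4)
  linarith

/-- The factor `l ^ 9` in the number of steps comes from here: `εa ^ (-2)` produces `l ^ 8`, and one
more `l ≥ 400` beats the constant `320`. -/
lemma regretError (h : ParamBounds c ε k p cs cn m l y W) {T : ℝ}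
    (hT : l ^ 9 * (cs ^ 2 * k ^ 3 * p ^ 2 / ε ^ 2) ≤ T) :
    16 * k ^ 2 * p * (p * cs ^ 2 + 1) / ((ε / l ^ 4) ^ 2 * m) / (2 * (1 / (ε * k * m)) * T)
      ≤ ε / 20 := by
  have hl := h.l_ge_one
  have hk := h.k_ge
  have hp := h.p_ge
  have hcs := h.cs_ge
  have hε := h.ε_pos
  have hm := h.m_pos
  have hl0 : 0 < l := by linarith
  have hT0 : 0 < T := lt_of_lt_of_le (by positivity) hT
  have h1 : p * cs ^ 2 + 1 ≤ 2 * (p * cs ^ 2) := by nlinarith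
  have e : 16 * k ^ 2 * p * (p * cs ^ 2 + 1) / ((ε / l ^ 4) ^ 2 * m) / (2 * (1 / (ε * k * m)) * T)
      = 8 * k ^ 3 * p * (p * cs ^ 2 + 1) * l ^ 8 / (ε * T) := by field_simp; ring
  rw [e, div_le_div_iff₀ (by positivity) (by norm_num)]
  have h2 : l ^ 9 * (cs ^ 2 * k ^ 3 * p ^ 2) ≤ ε ^ 2 * T := by
    have := mul_le_mul_of_nonneg_left hT (by positivity : 0 ≤ ε ^ 2)
    have e2 : ε ^ 2 * (l ^ 9 * (cs ^ 2 * k ^ 3 * p ^ 2 / ε ^ 2))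
        = l ^ 9 * (cs ^ 2 * k ^ 3 * p ^ 2) := by field_simp
    linarith
  have h3 : 8 * k ^ 3 * p * (p * cs ^ 2 + 1) * l ^ 8 * 20
      ≤ 8 * k ^ 3 * p * (2 * (p * cs ^ 2)) * l ^ 8 * 20 := by gcongr
  have h4 : 8 * k ^ 3 * p * (2 * (p * cs ^ 2)) * l ^ 8 * 20
      = 320 * l ^ 8 * (cs ^ 2 * k ^ 3 * p ^ 2) := by ring
  have h5 : 320 * l ^ 8 * (cs ^ 2 * k ^ 3 * p ^ 2) ≤ l ^ 9 * (cs ^ 2 * k ^ 3 * p ^ 2) := by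
    refine mul_le_mul_of_nonneg_right ?_ (by positivity)
    have : l ^ 9 = l * l ^ 8 := by ring
    rw [this]
    exact mul_le_mul_of_nonneg_right (by linarith) (by positivity)
  calc _ ≤ ε ^ 2 * T := by linarith
    _ = ε * (ε * T) := by ring

lemma steps_le (h : ParamBounds c ε k p cs cn m l y W) :
    l ^ 9 * (cs ^ 2 * k ^ 3 * p ^ 2 / ε ^ 2) ≤ W ^ 18 := by
  have hl := h.l_ge_one
  have hk := h.k_ge
  have hp := h.p_ge
  have hcs := h.cs_ge
  have hε := h.ε_pos
  have hW := h.W_ge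
  have e : cs ^ 2 * k ^ 3 * p ^ 2 / ε ^ 2 = cs ^ 2 * k ^ 3 * p ^ 2 * (1 / ε) ^ 2 := by
    field_simp
  rw [e]
  have := h.l_le; have := h.cs_le; have := h.k_le; have := h.p_le; have := h.ε_inv_le
  calc _ ≤ W ^ 9 * (W ^ 2 * W ^ 3 * W ^ 2 * W ^ 2) := by gcongr
    _ = _ := by ring

/-- The cost of freezing the gates. Displacements are of order `1 / m`, so each affected neuron
costs order `1 / m` up to powers of `W`. At most `m * W ^ 24 / y` neurons are affected, because `y ^
2 = √m` times the displacement is below the slack scale `1 / y = m ^ (-1 / 4)` up to powers of `W`.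
The product is `W ^ 50 / y`, which is small since `y ≥ W ^ 60`. -/
lemma gateError (h : ParamBounds c ε k p cs cn m l y W) {T : ℝ} (hT0 : 0 ≤ T)
    (hT : T ≤ W ^ 19) :
    ε / l ^ 4 * ((c + 5) * l) * √k
      * (2 * ((1 / (ε * k * m) * T + 1 / (ε ^ 3 * k * m ^ 3)) * (ε / l ^ 4 * ((c + 5) * l) * √k))
        + 4 * (k * (p * (1024 * cn + 1))) / (ε / l ^ 4 * m))
      * (m * (y ^ 2 * ((1 / (ε * k * m) * T + 1 / (ε ^ 3 * k * m ^ 3))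
        * (ε / l ^ 4 * ((c + 5) * l) * √k)) + 1 / y)) ≤ ε / 20 := by
  have hl := h.l_ge_one
  have hk := h.k_ge
  have hp := h.p_ge
  have hc := h.c_pos
  have hε := h.ε_pos
  have hm := h.m_pos
  have hl0 : 0 < l := by linarith
  have hW := h.W_ge
  have hW0 : 0 < W := by linarith
  have hy := h.y_pos
  have hy1 := h.one_le_y
  have hcn := h.cn_nonneg
  have hl1 : 1 ≤ l ^ 4 := one_le_pow₀ (by linarith)
  have hm1 : 1 ≤ m := by rw [h.m_eq]; exact one_le_pow₀ hy1
  obtain ⟨α, hα⟩ : ∃ α, α = ε / l ^ 4 * ((c + 5) * l) * √k := ⟨_, rfl⟩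
  obtain ⟨τ, hτ⟩ : ∃ τ, τ = (1 / (ε * k * m) * T + 1 / (ε ^ 3 * k * m ^ 3)) * α := ⟨_, rfl⟩
  rw [← hα, ← hτ]
  have hα0 : 0 ≤ α := by rw [hα]; positivity
  have hτ0 : 0 ≤ τ := by rw [hτ]; positivity
  have hα1 : α ≤ W ^ 2 := by
    have h1 : ε / l ^ 4 ≤ 1 := by
      rw [div_le_one (by positivity)]; exact h.ε_le_one.trans hl1
    have h2 : √k ≤ W := by
      refine le_trans ?_ h.k_le
      rw [Real.sqrt_le_left (by linarith)]; nlinarith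
    calc α ≤ 1 * W * W := by
          rw [hα]
          have := h.cl_le
          gcongr
      _ = W ^ 2 := by ring
  have hη : 1 / (ε * k * m) ≤ W / m := by
    have e : 1 / (ε * k * m) = 1 / ε * (1 / k) / m := by field_simp
    have h1 : 1 / k ≤ 1 := by rw [div_le_one (by linarith)]; exact hk
    rw [e]
    have := h.ε_inv_le
    calc _ ≤ W * 1 / m := by gcongr
      _ = _ := by ring
  have hρ : 1 / (ε ^ 3 * k * m ^ 3) ≤ W ^ 3 / m := by
    have e : 1 / (ε ^ 3 * k * m ^ 3) = (1 / ε) ^ 3 * (1 / k) / m ^ 3 := by field_simp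
    have h1 : 1 / k ≤ 1 := by rw [div_le_one (by linarith)]; exact hk
    have h2 : m ≤ m ^ 3 := le_self_pow₀ hm1 (by norm_num)
    rw [e]
    have := h.ε_inv_le
    calc _ ≤ W ^ 3 * 1 / m := by gcongr
      _ = _ := by ring
  have hτ1 : τ ≤ W ^ 23 / m := by
    have h1 : 1 / (ε * k * m) * T + 1 / (ε ^ 3 * k * m ^ 3) ≤ W ^ 21 / m := by
      have h2 : 1 / (ε * k * m) * T ≤ W / m * W ^ 19 :=
        mul_le_mul hη hT hT0 (by positivity)
      have h3 : W / m * W ^ 19 + W ^ 3 / m = (W ^ 20 + W ^ 3) / m := by ring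
      have h4 : W ^ 20 + W ^ 3 ≤ W ^ 21 := by
        have h5 : W ^ 3 ≤ W ^ 20 := pow_le_pow_right₀ (by linarith) (by norm_num)
        have h6 : W ^ 21 = W * W ^ 20 := by ring
        have := pow_pos hW0 20
        nlinarith
      have h7 : (W ^ 20 + W ^ 3) / m ≤ W ^ 21 / m := by gcongr
      linarith
    rw [hτ]
    calc _ ≤ W ^ 21 / m * W ^ 2 := mul_le_mul h1 hα1 hα0 (by positivity)
      _ = _ := by ring
  have hτs : 4 * (k * (p * (1024 * cn + 1))) / (ε / l ^ 4 * m) ≤ W ^ 9 / m := by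
    have e : 4 * (k * (p * (1024 * cn + 1))) / (ε / l ^ 4 * m)
        = 4 * (k * (p * (1024 * cn + 1))) * l ^ 4 * (1 / ε) / m := by field_simp
    rw [e]
    have := h.k_le; have := h.p_le; have := h.H_le; have := h.l_le; have := h.ε_inv_le
    have h4 : (4 : ℝ) ≤ W := by linarith
    calc _ ≤ W * (W * (W * W)) * W ^ 4 * W / m := by gcongr
      _ = _ := by ring
  have hsum : 2 * τ + 4 * (k * (p * (1024 * cn + 1))) / (ε / l ^ 4 * m) ≤ W ^ 24 / m := by
    have h1 : 2 * (W ^ 23 / m) + W ^ 9 / m = (2 * W ^ 23 + W ^ 9) / m := by ring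
    have h2 : 2 * W ^ 23 + W ^ 9 ≤ W ^ 24 := by
      have h5 : W ^ 9 ≤ W ^ 23 := pow_le_pow_right₀ (by linarith) (by norm_num)
      have h6 : W ^ 24 = W * W ^ 23 := by ring
      have := pow_pos hW0 23
      nlinarith
    have h7 : (2 * W ^ 23 + W ^ 9) / m ≤ W ^ 24 / m := by gcongr
    linarith
  have hS : y ^ 2 * τ + 1 / y ≤ W ^ 24 / y := by
    have h1 : y ^ 2 * τ ≤ W ^ 23 / y := by
      have h2 : y ^ 2 * τ ≤ y ^ 2 * (W ^ 23 / m) := by gcongr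
      have h3 : y ^ 2 * (W ^ 23 / m) = W ^ 23 / y ^ 2 := by rw [h.m_eq]; field_simp
      have h4 : y ≤ y ^ 2 := le_self_pow₀ hy1 (by norm_num)
      have h5 : W ^ 23 / y ^ 2 ≤ W ^ 23 / y := by gcongr
      linarith
    have h6 : W ^ 23 / y + 1 / y = (W ^ 23 + 1) / y := by ring
    have h7 : W ^ 23 + 1 ≤ W ^ 24 := by
      have h8 : (1 : ℝ) ≤ W ^ 23 := one_le_pow₀ (by linarith)
      have h9 : W ^ 24 = W * W ^ 23 := by ring
      nlinarith
    have h10 : (W ^ 23 + 1) / y ≤ W ^ 24 / y := by gcongr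
    linarith
  have hτs0 : 0 ≤ 4 * (k * (p * (1024 * cn + 1))) / (ε / l ^ 4 * m) := by positivity
  have hfin : α * (2 * τ + 4 * (k * (p * (1024 * cn + 1))) / (ε / l ^ 4 * m))
      * (m * (y ^ 2 * τ + 1 / y)) ≤ W ^ 58 / y := by
    calc _ ≤ W ^ 2 * (W ^ 24 / m) * (m * (W ^ 24 / y)) := by
          refine mul_le_mul (mul_le_mul hα1 hsum (by positivity) (by positivity))
            (mul_le_mul_of_nonneg_left hS hm.le) (by positivity) (by positivity)
      _ = W ^ 50 / y := by field_simp
      _ ≤ W ^ 58 / y := by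
          have : W ^ 50 ≤ W ^ 58 := pow_le_pow_right₀ (by linarith) (by norm_num)
          gcongr
  have := h.small_of_pow hfin
  linarith

end ParamBounds

end Parameters

end

end SAMGen

namespace SAMGen

noncomputable section

/-! ### Failure probabilities and the size of the training set -/

section Parameters

variable {c ε k p cs cn m l y W : ℝ}

namespace ParamBounds

lemma cl_sq_le (h : ParamBounds c ε k p cs cn m l y W) : (c + 3) * l ^ 2 ≤ W ^ 3 := by
  have := h.l_le; have := h.c_le; have := h.c_pos; have := h.l_ge_one
  have h3 : c + 3 ≤ W := by linarith
  have h4 : 0 ≤ W := by linarith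
  calc _ ≤ W * W ^ 2 := by gcongr
    _ = _ := by ring

lemma W_le_m (h : ParamBounds c ε k p cs cn m l y W) : W ≤ m := by
  have hW := h.W_ge
  calc W ≤ W ^ 60 := le_self_pow₀ (by linarith) (by norm_num)
    _ ≤ y := h.y_ge
    _ ≤ y ^ 4 := le_self_pow₀ h.one_le_y (by norm_num)
    _ = m := h.m_eq.symm

lemma outWeights_fail (h : ParamBounds c ε k p cs cn m l y W) (hl : Real.exp l = m) :
    m * k * (2 * Real.exp (-((c + 5) * l) ^ 2 / 2)) ≤ Real.exp (-((c + 2) * l ^ 2)) := by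
  have hl1 := h.l_ge_one
  have hc := h.c_pos
  have hk : k ≤ Real.exp l := by rw [hl]; exact h.k_le.trans h.W_le_m
  have h2 : (2 : ℝ) ≤ Real.exp 1 := by have := Real.add_one_le_exp (1 : ℝ); linarith
  calc _ ≤ Real.exp l * Real.exp l * (Real.exp 1 * Real.exp (-((c + 5) * l) ^ 2 / 2)) := by
        rw [← hl]; gcongr
    _ = Real.exp (l + l + (1 + -((c + 5) * l) ^ 2 / 2)) := by
        rw [Real.exp_add, Real.exp_add, Real.exp_add]
    _ ≤ _ := by
        apply Real.exp_le_exp.mpr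
        have h3 : l + l + 1 ≤ 3 * l ^ 2 := by nlinarith
        have h4 : (c + 5) * l ^ 2 ≤ (c + 5) ^ 2 * l ^ 2 / 2 := by
          have h5 : c + 5 ≤ (c + 5) ^ 2 / 2 := by nlinarith
          linarith [mul_le_mul_of_nonneg_right h5 (sq_nonneg l)]
        nlinarith

lemma nearZero_fail (h : ParamBounds c ε k p cs cn m l y W) :
    Real.exp (-(m * (1 / y) ^ 2) / 2) ≤ Real.exp (-((c + 2) * l ^ 2)) := by
  apply Real.exp_le_exp.mpr
  have hy := h.y_pos
  have hW := h.W_ge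
  have e : m * (1 / y) ^ 2 = y ^ 2 := by rw [h.m_eq]; field_simp
  rw [e]
  have h1 := h.cl_sq_le
  have h2 : W ^ 3 ≤ y := le_trans (pow_le_pow_right₀ (by linarith) (by norm_num)) h.y_ge
  have h3 : (2000 : ℝ) ≤ y := by
    have : W ≤ W ^ 60 := le_self_pow₀ (by linarith) (by norm_num)
    linarith [h.y_ge]
  nlinarith [sq_nonneg l]

lemma feature_fail (h : ParamBounds c ε k p cs cn m l y W) {q : ℝ} (hq0 : 0 ≤ q) (hq : q ≤ p) :
    Real.exp (-m / (2 * (q * (1024 * cn + 1) ^ 2 + 1) ^ 2)) ≤ Real.exp (-((c + 2) * l ^ 2)) := by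
  apply Real.exp_le_exp.mpr
  have hy := h.y_pos
  have hW := h.W_ge
  have hcn := h.cn_nonneg
  have h1 := h.cl_sq_le
  have h2 : q * (1024 * cn + 1) ^ 2 + 1 ≤ W ^ 4 := by
    have h3 : q * (1024 * cn + 1) ^ 2 ≤ W * W ^ 2 := by
      have := h.H_le; have := hq.trans h.p_le
      gcongr
    have h4 : (1 : ℝ) ≤ W ^ 3 := one_le_pow₀ (by linarith)
    have h5 : W ^ 4 = W * W ^ 3 := by ring
    nlinarith
  have h6 : 2 * (q * (1024 * cn + 1) ^ 2 + 1) ^ 2 ≤ W ^ 9 := by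
    calc _ ≤ 2 * (W ^ 4) ^ 2 := by gcongr
      _ = 2 * W ^ 8 := by ring
      _ ≤ W * W ^ 8 := by gcongr; linarith
      _ = _ := by ring
  have h7 : W ^ 3 ≤ m / (2 * (q * (1024 * cn + 1) ^ 2 + 1) ^ 2) := by
    rw [le_div_iff₀ (by positivity)]
    calc _ ≤ W ^ 3 * W ^ 9 := by gcongr
      _ = W ^ 12 := by ring
      _ ≤ W ^ 60 := pow_le_pow_right₀ (by linarith) (by norm_num)
      _ ≤ y := h.y_ge
      _ ≤ y ^ 4 := le_self_pow₀ h.one_le_y (by norm_num)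
      _ = m := h.m_eq.symm
  rw [neg_div]
  nlinarith [sq_nonneg l]

/-- With `s₂ = 1 / y` the exponent has numerator `m / y ^ 2 = y ^ 2`, far above the polynomial bound
on the terms; the union over the `k` outputs costs at most `exp (l ^ 2)`. -/
lemma approx_fail (h : ParamBounds c ε k p cs cn m l y W) (hl : Real.exp l = m) :
    k * Real.exp (-(m * (1 / y) ^ 2) / (8 * (4 * ((c + 5) * l) * (k * (p * (1024 * cn + 1)))) ^ 2))
      ≤ Real.exp (-((c + 2) * l ^ 2)) := by
  have hy := h.y_pos
  have hW := h.W_ge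
  have hl1 := h.l_ge_one
  have hcn := h.cn_nonneg
  have hc := h.c_pos
  have hk := h.k_ge
  have hp := h.p_ge
  have hk' : k ≤ Real.exp (l ^ 2) := by
    refine (h.k_le.trans h.W_le_m).trans ?_
    rw [← hl]
    exact Real.exp_le_exp.mpr (by nlinarith)
  have e : m * (1 / y) ^ 2 = y ^ 2 := by rw [h.m_eq]; field_simp
  rw [e]
  have hM0 : 0 < 4 * ((c + 5) * l) * (k * (p * (1024 * cn + 1))) := by
    have : 0 < l := by linarith
    positivity
  have h1 : W ^ 3 ≤ y ^ 2 / (8 * (4 * ((c + 5) * l) * (k * (p * (1024 * cn + 1)))) ^ 2) := by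
    rw [le_div_iff₀ (by positivity)]
    have := h.termBound_le
    calc _ ≤ W ^ 3 * (W * (W ^ 5) ^ 2) := by
          gcongr
          linarith
      _ = W ^ 14 := by ring
      _ ≤ W ^ 60 := pow_le_pow_right₀ (by linarith) (by norm_num)
      _ ≤ y := h.y_ge
      _ ≤ y ^ 2 := le_self_pow₀ h.one_le_y (by norm_num)
  calc _ ≤ Real.exp (l ^ 2) * Real.exp (-((c + 3) * l ^ 2)) := by
        refine mul_le_mul hk' (Real.exp_le_exp.mpr ?_) (Real.exp_pos _).le (Real.exp_pos _).le
        rw [neg_div]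
        linarith [h.cl_sq_le]
    _ = _ := by rw [← Real.exp_add]; congr 1; ring

lemma inner_fail (h : ParamBounds c ε k p cs cn m l y W) :
    Real.exp (1 - 2 * (c + 3) * l ^ 2 / 2) ≤ Real.exp (-((c + 2) * l ^ 2)) := by
  apply Real.exp_le_exp.mpr
  have hl1 := h.l_ge_one
  nlinarith

lemma six_exp_le (h : ParamBounds c ε k p cs cn m l y W) :
    6 * Real.exp (-((c + 2) * l ^ 2)) ≤ Real.exp (-c * l ^ 2) := by
  have hl1 := h.l_ge_one
  have h1 : 6 ≤ Real.exp (2 * l ^ 2) := by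
    have := Real.add_one_le_exp (2 * l ^ 2)
    nlinarith
  calc _ ≤ Real.exp (2 * l ^ 2) * Real.exp (-((c + 2) * l ^ 2)) := by gcongr
    _ = _ := by rw [← Real.exp_add]; congr 1; ring

/-- With this learning rate `m * η * α ^ 2 ≤ 1`, so the risk moves by at most one per step. This
allows `B = T` in the resampling bounds, with no dependence on the width. -/
lemma range_le (h : ParamBounds c ε k p cs cn m l y W) {T : ℝ} (hT : 0 ≤ T) :
    m * (ε / l ^ 4 * ((c + 5) * l) * √k
      * (T * (1 / (ε * k * m) * (ε / l ^ 4 * ((c + 5) * l) * √k)))) ≤ T := by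
  have hl := h.l_ge_one
  have hk := h.k_ge
  have hε := h.ε_pos
  have hm := h.m_pos
  have hl0 : 0 < l := by linarith
  have e : m * (ε / l ^ 4 * ((c + 5) * l) * √k
      * (T * (1 / (ε * k * m) * (ε / l ^ 4 * ((c + 5) * l) * √k))))
      = m * T * (1 / (ε * k * m)) * (ε / l ^ 4 * ((c + 5) * l) * √k) ^ 2 := by ring
  rw [e, h.alpha_sq]
  have e2 : m * T * (1 / (ε * k * m)) * (ε ^ 2 * k * (c + 5) ^ 2 / l ^ 6)
      = T * (ε * ((c + 5) ^ 2 / l ^ 6)) := by field_simp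
  rw [e2]
  refine mul_le_of_le_one_right hT ?_
  have h1 : (c + 5) ^ 2 / l ^ 6 ≤ 1 := by
    rw [div_le_one (by positivity)]
    have := h.c_sq_le
    have := pow_pos hl0 6
    linarith
  calc _ ≤ 1 * 1 := mul_le_mul h.ε_le_one h1 (by positivity) zero_le_one
    _ = 1 := by ring

/-- Both claims reduce to `N ≥ 3200 * (c + 1) * l ^ 2 * T ^ 4 / ε ^ 2`. Since `k` and `p` are at
most `1 / ε`, the number of steps is at most `2 * l ^ 9 * cs ^ 2 * (1 / ε) ^ 7`. Its fourth power
gives `cs ^ 8 * (1 / ε) ^ 30`, the exponent `38` of `l` and the constant `51200 = 16 * 3200`; in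
this way `k` and `p` disappear from the sample size. -/
lemma samples (h : ParamBounds c ε k p cs cn m l y W) {T N : ℝ} (hT1 : 1 ≤ T)
    (hT : T ≤ 2 * (l ^ 9 * (cs ^ 2 * k ^ 3 * p ^ 2 / ε ^ 2)))
    (hN : 51200 * (c + 1) * l ^ 38 * (cs ^ 8 * (1 / ε) ^ 30) ≤ N) :
    2 * T * (T ^ 2 / N) ≤ ε / 20 ∧
      Real.exp (-(ε / 20) ^ 2 / (2 * (N * (2 * T * (T / N)) ^ 2))) ≤ Real.exp (-c * l ^ 2) := by
  have hl := h.l_ge_one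
  have hk := h.k_ge
  have hp := h.p_ge
  have hcs := h.cs_ge
  have hε := h.ε_pos
  have hc := h.c_pos
  have hl0 : 0 < l := by linarith
  have hT' : T ^ 4 * ((c + 1) * l ^ 2 / ε ^ 2) ≤ N / 3200 := by
    have h1 : T ≤ 2 * (l ^ 9 * (cs ^ 2 * (1 / ε) ^ 7)) := by
      refine hT.trans ?_
      have hk1 : k ≤ 1 / ε := by rw [le_div_iff₀ hε]; exact h.k_ε_le
      have hp1 : p ≤ 1 / ε := by rw [le_div_iff₀ hε]; exact h.p_ε_le
      have e : cs ^ 2 * k ^ 3 * p ^ 2 / ε ^ 2 = cs ^ 2 * (k ^ 3 * p ^ 2 * (1 / ε) ^ 2) := by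
        field_simp
      rw [e]
      have : k ^ 3 * p ^ 2 * (1 / ε) ^ 2 ≤ (1 / ε) ^ 3 * (1 / ε) ^ 2 * (1 / ε) ^ 2 := by gcongr
      have e2 : (1 / ε) ^ 3 * (1 / ε) ^ 2 * (1 / ε) ^ 2 = (1 / ε) ^ 7 := by ring
      rw [e2] at this
      gcongr
    calc _ ≤ (2 * (l ^ 9 * (cs ^ 2 * (1 / ε) ^ 7))) ^ 4 * ((c + 1) * l ^ 2 / ε ^ 2) := by gcongr
      _ = 51200 * (c + 1) * l ^ 38 * (cs ^ 8 * (1 / ε) ^ 30) / 3200 := by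
          field_simp; norm_num
      _ ≤ _ := by gcongr
  have hN0 : 0 < N := by
    have : 0 < T ^ 4 * ((c + 1) * l ^ 2 / ε ^ 2) := by positivity
    linarith
  constructor
  · have e : 2 * T * (T ^ 2 / N) = 2 * T ^ 3 / N := by ring
    rw [e, div_le_div_iff₀ hN0 (by norm_num)]
    have h1 : T ^ 3 ≤ T ^ 4 := pow_le_pow_right₀ hT1 (by norm_num)
    have h2 : 1 ≤ (c + 1) * l ^ 2 := by nlinarith
    have h3 : T ^ 4 * ((c + 1) * l ^ 2) ≤ N / 3200 * ε ^ 2 := by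
      have := mul_le_mul_of_nonneg_right hT' (by positivity : 0 ≤ ε ^ 2)
      have e3 : T ^ 4 * ((c + 1) * l ^ 2 / ε ^ 2) * ε ^ 2 = T ^ 4 * ((c + 1) * l ^ 2) := by
        field_simp
      linarith
    have h4 : T ^ 4 * 1 ≤ T ^ 4 * ((c + 1) * l ^ 2) := by gcongr
    have h5 : ε ^ 2 ≤ ε := by nlinarith [h.ε_le_one]
    have h6 : N / 3200 * ε ^ 2 ≤ N / 3200 * ε := by gcongr
    nlinarith
  · apply Real.exp_le_exp.mpr
    have e : -(ε / 20) ^ 2 / (2 * (N * (2 * T * (T / N)) ^ 2)) = -(ε ^ 2 * N / (3200 * T ^ 4)) := by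
      field_simp; norm_num
    rw [e, neg_mul, neg_le_neg_iff, le_div_iff₀ (by positivity)]
    have h3 : T ^ 4 * ((c + 1) * l ^ 2) ≤ N / 3200 * ε ^ 2 := by
      have := mul_le_mul_of_nonneg_right hT' (by positivity : 0 ≤ ε ^ 2)
      have e3 : T ^ 4 * ((c + 1) * l ^ 2 / ε ^ 2) * ε ^ 2 = T ^ 4 * ((c + 1) * l ^ 2) := by
        field_simp
      linarith
    have : 0 ≤ T ^ 4 * l ^ 2 := by positivity
    nlinarith

end ParamBounds

lemma exists_width_threshold {c : ℝ} (hc : 0 < c) : ∃ M : ℝ, 1 ≤ M ∧ ∀ x : ℝ, M ≤ x →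
    40 * (c + 10) ≤ Real.log x ∧ ((c + 2000) * Real.log x) ^ 480 ≤ x := by
  have h1 : ∀ᶠ x : ℝ in Filter.atTop, 40 * (c + 10) ≤ Real.log x :=
    Real.tendsto_log_atTop.eventually_ge_atTop _
  have h2 : ∀ᶠ x : ℝ in Filter.atTop, ((c + 2000) * Real.log x) ^ 480 ≤ x := by
    have ho := (Real.isLittleO_pow_log_id_atTop (n := 480)).def
      (c := ((c + 2000) ^ 480)⁻¹) (by positivity)
    filter_upwards [ho, Filter.eventually_ge_atTop 1] with x hx hx1
    rw [mul_pow]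
    have hl : 0 ≤ Real.log x := Real.log_nonneg hx1
    rw [Real.norm_of_nonneg (by positivity), id, Real.norm_of_nonneg (by linarith)] at hx
    calc _ ≤ (c + 2000) ^ 480 * (((c + 2000) ^ 480)⁻¹ * x) := by gcongr
      _ = x := by
        rw [← mul_assoc, mul_inv_cancel₀ (by positivity), one_mul]
  obtain ⟨M, hM⟩ := Filter.eventually_atTop.mp (h1.and h2)
  exact ⟨max M 1, le_max_right _ _, fun x hx => hM x ((le_max_left _ _).trans hx)⟩

end Parameters

end

end SAMGen

namespace SAMGen

noncomputable section

/-! ### The main theorem -/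

lemma exists_features {q : ℕ} {Cstar ε cs cn : ℝ} (hC : 1024 ≤ Cstar) (hε : 0 < ε)
    (hε1 : ε < 1) (hcs : 1 ≤ cs) (hcsε : cs * ε ≤ 1) (hcn : 0 ≤ cn) {φ : Fin q → ℝ → ℝ}
    (hφ : ∀ j, InfSmooth (φ j)) (hs : ∀ j, sampleComplexity Cstar (φ j) 1 ≤ ENNReal.ofReal cs)
    (hn : ∀ j, networkComplexity Cstar ε (φ j) 1 ≤ ENNReal.ofReal cn) :
    ∃ h : Fin q → ℝ → ℝ → ℝ, ∀ j, IsFeature (φ j) (h j) (1024 * cn + 1) cs (ε ^ 2 / 1000) := by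
  have hcsε' : cs ≤ 1 / ε := by rwa [le_div_iff₀ hε]
  choose h hm hb hq hr using fun j =>
    exists_representation hC hε hε1 hcs hcsε' hcn (hφ j) (hs j) (hn j)
  exact ⟨h, fun j => ⟨hm j, fun u b => (hb j u b).trans (by linarith), hq j, hr j⟩⟩

/-- The infimum need not be attained, so a near-minimizer is used. The network with `q = 0` terms
shows that the class is nonempty. -/
lemma exists_risk_le_OPT_add {d k p : ℕ} {Y : Type*} [MeasurableSpace Y]
    (D : Measure (Input d × Y)) (L : Output k → Y → ℝ) (Cstar ε cs cn : ℝ)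
    {δ : ℝ} (hδ : 0 < δ) :
    ∃ F ∈ conceptClass d k p Cstar ε cs cn, risk D L F ≤ OPT D L p Cstar ε cs cn + δ := by
  have hne : (risk D L '' conceptClass d k p Cstar ε cs cn).Nonempty := by
    refine Set.Nonempty.image _ ⟨targetNet (q := 0) Fin.elim0 Fin.elim0 Fin.elim0
      (fun _ => Fin.elim0), 0, Nat.zero_le _, Fin.elim0, Fin.elim0, Fin.elim0,
      fun _ => Fin.elim0, ?_, ?_, ?_, ?_, ?_, ?_, rfl⟩
    · exact fun i => i.elim0
    · exact fun i => i.elim0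
    · exact fun i => i.elim0
    · exact fun i => i.elim0
    · exact fun i => i.elim0
    · exact fun _ i => i.elim0
  obtain ⟨_, ⟨F, hF, rfl⟩, hlt⟩ := exists_lt_of_csInf_lt hne
    (show sInf (risk D L '' conceptClass d k p Cstar ε cs cn) < OPT D L p Cstar ε cs cn + δ by
      unfold OPT; linarith)
  exact ⟨F, hF, hlt.le⟩

/-- `W` is the product of a logarithmic and a polynomial factor, each with 480th power at most `m`.
Multiplying the two bounds and taking a square root gives `W ^ 240 ≤ m`, that is `W ^ 60 ≤ y` for
the fourth root `y` of `m`. -/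
lemma paramBounds_of_width {c ε k p cs cn m : ℝ} (hc : 0 < c) (hk : 1 ≤ k) (hp : 1 ≤ p)
    (hcs : 1 ≤ cs) (hcn : 0 ≤ cn) (hε : 0 < ε) (hprod : p * k * cs * ε ≤ 1)
    (hm : (1 + cn + 1 / ε) ^ 480 ≤ m) (hl : 40 * (c + 10) ≤ Real.log m)
    (hlm : ((c + 2000) * Real.log m) ^ 480 ≤ m) :
    ParamBounds c ε k p cs cn m (Real.log m) (√√m)
      ((c + 2000) * Real.log m * (1 + cn + 1 / ε)) := by
  have hε' : 0 < 1 / ε := by positivity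
  obtain ⟨X, hX⟩ : ∃ X, X = 1 + cn + 1 / ε := ⟨_, rfl⟩
  obtain ⟨l, hldef⟩ : ∃ l, l = Real.log m := ⟨_, rfl⟩
  rw [← hX] at hm ⊢
  rw [← hldef] at hl hlm ⊢
  have hm0 : 0 ≤ m := le_trans (Even.pow_nonneg (by decide) X) hm
  have hpow : ((c + 2000) * l * X) ^ 240 ≤ m := by
    refine le_of_sq_le_sq ?_ hm0
    calc (((c + 2000) * l * X) ^ 240) ^ 2 = ((c + 2000) * l) ^ 480 * X ^ 480 := by
          rw [← pow_mul, mul_pow]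
      _ ≤ m * m := mul_le_mul hlm hm (Even.pow_nonneg (by decide) X) hm0
      _ = m ^ 2 := (sq m).symm
  clear hm hlm
  have hy : ((c + 2000) * l * X) ^ 60 ≤ √√m := by
    refine Real.le_sqrt_of_sq_le (Real.le_sqrt_of_sq_le ?_)
    rwa [← pow_mul, ← pow_mul]
  clear hpow
  refine ⟨hc, hε, hk, hp, hcs, hcn, hprod, hl, ?_, ?_, ?_, ?_, ?_, hy, ?_⟩
  all_goals clear hy
  all_goals
    have hX1 : 1 ≤ X := by linarith
    have hl1 : 1 ≤ l := by linarith
    have hlX : 1 ≤ l * X := by nlinarith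
    have hcX : 1 ≤ (c + 2000) * X := by nlinarith
    have hcl : 1 ≤ (c + 2000) * l := by nlinarith
  · rw [mul_assoc]; exact le_mul_of_one_le_right (by linarith) hlX
  · calc l = l * 1 := (mul_one l).symm
      _ ≤ l * ((c + 2000) * X) := by gcongr
      _ = _ := by ring
  · calc 1 / ε ≤ X := by linarith
      _ = 1 * X := (one_mul X).symm
      _ ≤ _ := by gcongr
  · calc 1024 * cn + 1 ≤ 2000 * 1 * X := by linarith
      _ ≤ _ := by gcongr; linarith
  · calc (c + 5) * l = (c + 5) * l * 1 := (mul_one _).symm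
      _ ≤ _ := by gcongr; linarith
  · rw [show (√√m) ^ 4 = ((√√m) ^ 2) ^ 2 by ring, Real.sq_sqrt (Real.sqrt_nonneg m),
      Real.sq_sqrt hm0]

/-- A target nearly attaining `OPT` is chosen before the initialization is drawn; a single good
event for that target yields both claims about the training set. -/
lemma initMeasure_not_sam_bound_le {Cstar c ε cs cn W : ℝ} {k p m : ℕ} (hC : 1024 ≤ Cstar)
    (hε1 : ε < 1) (h : ParamBounds c ε k p cs cn m (Real.log m) (√√(m : ℝ)) W) {T N : ℕ}
    (hT : Real.log m ^ 9 * (cs ^ 2 * k ^ 3 * p ^ 2 / ε ^ 2) ≤ T) (hT1 : 1 ≤ (T : ℝ))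
    (hT2 : T ≤ 2 * (Real.log m ^ 9 * (cs ^ 2 * k ^ 3 * p ^ 2 / ε ^ 2)))
    (hN : 51200 * (c + 1) * Real.log m ^ 38 * (cs ^ 8 * (1 / ε) ^ 30) ≤ N) (hN0 : 0 < N)
    {d : ℕ} {Y : Type*} [MeasurableSpace Y] (D : Measure (Input d × Y)) [IsProbabilityMeasure D]
    {L : Output k → Y → ℝ} (hD : NormalizedInputs D) (hL : GoodLoss L)
    (hLm : Measurable (Function.uncurry L)) (hLi : Integrable (fun z : Input d × Y => L 0 z.2) D) :
    initMeasure m d k (ε / Real.log m ^ 4)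
      {θ | ¬ ((Measure.pi fun _ : Fin N => D)
              {Z | ¬ samAverageRisk D L (1 / (ε * k * m)) (1 / (ε ^ 3 * k * m ^ 3)) T θ Z
                ≤ OPT D L p Cstar ε cs cn + ε}
              ≤ ENNReal.ofReal (Real.exp (-c * Real.log m ^ 2)) ∧
            ∫ Z, samAverageRisk D L (1 / (ε * k * m)) (1 / (ε ^ 3 * k * m ^ 3)) T θ Z
                ∂(Measure.pi fun _ : Fin N => D)
              ≤ OPT D L p Cstar ε cs cn + ε)}
      ≤ ENNReal.ofReal (Real.exp (-c * Real.log m ^ 2)) := by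
  have hε := h.ε_pos
  have hc := h.c_pos
  have hcn := h.cn_nonneg
  have hm0 : (0 : ℝ) < m := h.m_pos
  have hk0 : (0 : ℝ) < k := by linarith [h.k_ge]
  have hl1 := h.l_ge_one
  have hy := h.y_pos
  have hW := h.W_ge
  have hexp : Real.exp (Real.log m) = m := Real.exp_log hm0
  have hsqrt : √(m : ℝ) = √√(m : ℝ) ^ 2 := (Real.sq_sqrt (Real.sqrt_nonneg _)).symm
  obtain ⟨_, ⟨q, hq, φ, w₁, w₂, a, hφ, hs, hn, hw₁, hw₂, ha, rfl⟩, hrisk⟩ :=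
    exists_risk_le_OPT_add (p := p) D L Cstar ε cs cn (δ := ε / 20) (by positivity)
  obtain ⟨f, hf⟩ := exists_features hC hε hε1 h.cs_ge h.cs_ε_le hcn hφ hs hn
  have hq' : (q : ℝ) ≤ p := by exact_mod_cast hq
  obtain ⟨hsamp, hconc⟩ := h.samples hT1 hT2 hN
  have hTW : (T : ℝ) ≤ W ^ 19 := by
    have h1 := h.steps_le
    have h2 : W ^ 19 = W * W ^ 18 := by ring
    have h3 : 0 < W ^ 18 := by positivity
    rw [h2]; nlinarith
  set l := Real.log m with hl
  set y := √√(m : ℝ) with hydef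
  set α := ε / l ^ 4 * ((c + 5) * l) * √(k : ℝ) with hα
  set η := 1 / (ε * k * m) with hη
  set ρ := 1 / (ε ^ 3 * k * m ^ 3) with hρ
  have hl0 : 0 < l := by linarith
  have hα0 : 0 ≤ α := by positivity
  have hη0 : 0 < η := by positivity
  have hρ0 : 0 ≤ ρ := by positivity
  have hΛ : 1 ≤ (c + 5) * l := by nlinarith
  have key := initMeasure_not_goodInit_le hD hL hLm hLi (by exact_mod_cast hm0)
    (by exact_mod_cast hk0) (by exact_mod_cast (by linarith [h.p_ge] : (0 : ℝ) < p)) hq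
    (εa := ε / l ^ 4) (by positivity) hΛ hφ (by positivity) hf hw₁ hw₂ ha
    (τ := (η * T + ρ) * α) (s₁ := 1 / y) (s₂ := 1 / y) (s := 4 * (c + 2) * l ^ 2)
    (t := 2 * (c + 3) * l ^ 2) (by positivity) (by positivity) (by positivity) (by positivity)
  refine (measure_mono ?_).trans (key.trans ?_)
  · intro θ hθ hgood
    refine hθ ?_
    obtain ⟨h1, h2⟩ := sam_bounds_of_goodInit (N := N) (T := T) (s := ε / 20) (B := T)
      (goal := OPT D L p Cstar ε cs cn + ε) hD hL hLm hLi hη0 hρ0 hα0 (by positivity)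
      (by exact_mod_cast hT1) hN0 (by positivity) hgood
      (h.range_le (by positivity)) (by
        -- Ten errors of at most `ε / 20` each: seven from the lemmas below, one from the
        -- near-minimizer, one from repeated draws and one from the deviation `s`.
        rw [hsqrt]
        have e1 := h.outputError
        have e2 := h.outputSqError
        have e3 := h.approxError hq'
        have e4 := h.perturbError
        have e5 := h.gateError (T := T) (by positivity) hTW
        have e6 := h.stepError
        have e7 := h.regretError hT
        linarith)
    exact ⟨h2.trans (ENNReal.ofReal_le_ofReal hconc), h1⟩
  -- The tail levels were chosen so that each of the six failure probabilities is at most `exp (-((c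
  -- + 2) * l ^ 2))`; the surplus `2 * l ^ 2` absorbs the factor six.
  · have e6 : Real.exp (-(4 * (c + 2) * l ^ 2 / 4)) = Real.exp (-((c + 2) * l ^ 2)) := by
      congr 1; ring
    rw [← ENNReal.ofReal_add (by positivity) (by positivity),
      ← ENNReal.ofReal_add (by positivity) (by positivity),
      ← ENNReal.ofReal_add (by positivity) (by positivity),
      ← ENNReal.ofReal_add (by positivity) (by positivity),
      ← ENNReal.ofReal_add (by positivity) (by positivity)]
    refine ENNReal.ofReal_le_ofReal ?_
    linarith [h.outWeights_fail hexp, h.nearZero_fail, h.feature_fail (Nat.cast_nonneg q) hq',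
      h.approx_fail hexp, h.inner_fail, h.six_exp_le]

lemma tildeTheta_of_le {A m n : ℕ} {v u : ℝ} (hA : 2 ≤ A) (hn : n ≤ A) (hl : 1 ≤ Real.log m)
    (hu : 0 ≤ u) (h₁ : u / Real.log m ^ n ≤ v) (h₂ : v ≤ 2 * (Real.log m ^ n * u)) :
    TildeTheta A m v u := by
  have hA' : (2 : ℝ) ≤ A := by exact_mod_cast hA
  have hpow : Real.log m ^ n ≤ Real.log m ^ A := pow_le_pow_right₀ hl hn
  have hn0 : 0 < Real.log m ^ n := by positivity
  constructor
  · refine le_trans ?_ h₁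
    have : Real.log m ^ n ≤ A * Real.log m ^ A := by nlinarith
    gcongr
  · refine h₂.trans ?_
    rw [← mul_assoc]
    gcongr

end

end SAMGen

theorem mainTheorem3 :
    ∃ C₀ : ℝ, 0 < C₀ ∧ ∀ Cstar : ℝ, C₀ ≤ Cstar → ∀ c : ℝ, 0 < c →
    ∃ (PM PN : MvPolynomial (Fin 2) ℝ) (A : ℕ),
    ∀ (k p : ℕ) (cs cn ε : ℝ), 1 ≤ k → 1 ≤ p → 1 ≤ cs → 0 ≤ cn →
      0 < ε → ε < 1 / (p * k * cs) →
    ∀ m : ℕ, MvPolynomial.eval ![cn, 1 / ε] PM ≤ (m : ℝ) →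
    ∃ (εa η ρ : ℝ) (T : ℕ),
      0 < εa ∧ εa ≤ 1 ∧ 0 < η ∧ 0 < ρ ∧ 0 < T ∧
      TildeTheta A m εa ε ∧
      TildeTheta A m η (1 / (ε * k * m)) ∧
      TildeTheta A m ρ (1 / (ε ^ 3 * k * m ^ 3)) ∧
      TildeTheta A m T (cs ^ 2 * k ^ 3 * p ^ 2 / ε ^ 2) ∧
      ∀ N : ℕ, A * Real.log m ^ A * MvPolynomial.eval ![cs, 1 / ε] PN ≤ (N : ℝ) → 0 < N →
      ∀ (d : ℕ) (Y : Type*) [MeasurableSpace Y]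
        (D : MeasureTheory.Measure (Input d × Y)) [MeasureTheory.IsProbabilityMeasure D]
        (L : Output k → Y → ℝ),
        NormalizedInputs D → GoodLoss L → Measurable (Function.uncurry L) →
        MeasureTheory.Integrable (fun z : Input d × Y => L 0 z.2) D →
        initMeasure m d k εa
          {θ | ¬ ((MeasureTheory.Measure.pi fun _ : Fin N => D)
                    {Z | ¬ samAverageRisk D L η ρ T θ Z ≤ OPT D L p Cstar ε cs cn + ε}
                  ≤ ENNReal.ofReal (Real.exp (-c * Real.log m ^ 2)) ∧
                ∫ Z, samAverageRisk D L η ρ T θ Z ∂(MeasureTheory.Measure.pi fun _ : Fin N => D)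
                  ≤ OPT D L p Cstar ε cs cn + ε)}
          ≤ ENNReal.ofReal (Real.exp (-c * Real.log m ^ 2)) := by
  refine ⟨1024, by norm_num, fun Cstar hC c hc => ?_⟩
  obtain ⟨M, hM1, hM⟩ := exists_width_threshold hc
  -- The exponent `480` is what `paramBounds_of_width` consumes, and the factor `M` ensures the
  -- logarithmic conditions on the width. The second polynomial and the constant `A` come from the
  -- sample size in `ParamBounds.samples`.
  refine ⟨MvPolynomial.C M * (1 + MvPolynomial.X 0 + MvPolynomial.X 1) ^ 480,
    MvPolynomial.X 0 ^ 8 * MvPolynomial.X 1 ^ 30, ⌈51200 * (c + 1)⌉₊ + 38, ?_⟩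
  intro k p cs cn ε hk hp hcs hcn hε hε' m hm
  have hk' : (1 : ℝ) ≤ k := by exact_mod_cast hk
  have hp' : (1 : ℝ) ≤ p := by exact_mod_cast hp
  have hprod : p * k * cs * ε ≤ 1 := by
    rw [lt_div_iff₀ (by positivity)] at hε'
    linarith
  have hε1 : ε < 1 := by
    refine hε'.trans_le ?_
    rw [div_le_one (by positivity)]
    exact one_le_mul_of_one_le_of_one_le (one_le_mul_of_one_le_of_one_le hp' hk') hcs
  have hX : 1 ≤ 1 + cn + 1 / ε := by
    have : 0 < 1 / ε := by positivity
    linarith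
  have hM0 : 0 ≤ M := zero_le_one.trans hM1
  simp only [map_mul, map_pow, map_add, map_one, MvPolynomial.eval_C, MvPolynomial.eval_X,
    Matrix.cons_val_zero, Matrix.cons_val_one] at hm
  have hmM : M ≤ m := (le_mul_of_one_le_right hM0 (one_le_pow₀ hX)).trans hm
  have hmX : (1 + cn + 1 / ε) ^ 480 ≤ m :=
    (le_mul_of_one_le_left (pow_nonneg (zero_le_one.trans hX) _) hM1).trans hm
  have hP : ParamBounds c ε k p cs cn m (Real.log m) (√√(m : ℝ)) _ :=
    paramBounds_of_width hc hk' hp' hcs hcn hε hprod hmX (hM m hmM).1 (hM m hmM).2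
  clear hm hmX hM
  have hm0 := hP.m_pos
  have hl1 : 1 ≤ Real.log m := by linarith [hP.l_ge_one]
  have hu1 : 1 ≤ cs ^ 2 * k ^ 3 * p ^ 2 / ε ^ 2 := by
    rw [one_le_div (by positivity)]
    calc ε ^ 2 ≤ 1 ^ 2 * 1 ^ 3 * 1 ^ 2 := by nlinarith
      _ ≤ _ := by gcongr
  have hTl : 1 ≤ Real.log m ^ 9 * (cs ^ 2 * k ^ 3 * p ^ 2 / ε ^ 2) :=
    one_le_mul_of_one_le_of_one_le (one_le_pow₀ hl1) hu1
  obtain ⟨T, hTdef⟩ : ∃ T, T = ⌈Real.log m ^ 9 * (cs ^ 2 * k ^ 3 * p ^ 2 / ε ^ 2)⌉₊ := ⟨_, rfl⟩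
  have hT : Real.log m ^ 9 * (cs ^ 2 * k ^ 3 * p ^ 2 / ε ^ 2) ≤ T := by
    rw [hTdef]; exact Nat.le_ceil _
  have hT2 : T ≤ 2 * (Real.log m ^ 9 * (cs ^ 2 * k ^ 3 * p ^ 2 / ε ^ 2)) := by
    have := Nat.ceil_lt_add_one (le_trans zero_le_one hTl)
    rw [← hTdef] at this
    linarith
  have hT1 : 1 ≤ (T : ℝ) := hTl.trans hT
  have hA : 2 ≤ ⌈51200 * (c + 1)⌉₊ + 38 := by omega
  refine ⟨ε / Real.log m ^ 4, 1 / (ε * k * m), 1 / (ε ^ 3 * k * m ^ 3), T, by positivity, ?_,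
    by positivity, by positivity, by exact_mod_cast hT1,
    tildeTheta_of_le (n := 4) hA (by omega) hl1 hε.le le_rfl ?_,
    tildeTheta_of_le (n := 0) hA (by omega) hl1 (by positivity) (by simp) ?_,
    tildeTheta_of_le (n := 0) hA (by omega) hl1 (by positivity) (by simp) ?_,
    tildeTheta_of_le (n := 9) hA (by omega) hl1 (by positivity) ?_ hT2, ?_⟩
  · rw [div_le_one (by positivity)]
    exact hε1.le.trans (one_le_pow₀ hl1)
  · have h1 : 1 ≤ Real.log m ^ 4 := one_le_pow₀ hl1
    have h2 : ε / Real.log m ^ 4 ≤ ε := div_le_self hε.le h1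
    nlinarith
  · have : 0 < 1 / (ε * k * m) := by positivity
    linarith
  · have : 0 < 1 / (ε ^ 3 * k * m ^ 3) := by positivity
    linarith
  · have h1 : 1 ≤ Real.log m ^ 9 := one_le_pow₀ hl1
    refine (div_le_self (by positivity) h1).trans (le_trans ?_ hT)
    exact le_mul_of_one_le_left (by positivity) h1
  · intro N hN hN0 d Y _ D _ L hD hL hLm hLi
    refine initMeasure_not_sam_bound_le hC hε1 hP hT hT1 hT2 ?_ hN0 D hD hL hLm hLi
    simp only [map_mul, map_pow, MvPolynomial.eval_X, Matrix.cons_val_zero,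
      Matrix.cons_val_one] at hN
    refine le_trans ?_ hN
    have h1 : 51200 * (c + 1) ≤ ((⌈51200 * (c + 1)⌉₊ + 38 : ℕ) : ℝ) := by
      push_cast
      linarith [Nat.le_ceil (51200 * (c + 1))]
    have h2 : Real.log m ^ 38 ≤ Real.log m ^ (⌈51200 * (c + 1)⌉₊ + 38) :=
      pow_le_pow_right₀ hl1 (by omega)
    gcongr
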